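/- **Setting.** Let $P\ge 1$, let $c_1,\dots,c_P\in\mathbb C\setminus\{0\}$, let $z_1,\dots,z_P$ be points of the open upper half-plane whose real parts increase strictly with $p$, and let $$u_0(x)=\sum_{p=1}^P\frac{c_p}{x-z_p}+\mathrm{c.c.},\qquad u_0\in L^1(\mathbb R),$$ be a positive rational Klaus–Shaw potential: $u_0>0$ on $\mathbb R$, and there is $x_{\mathrm c}\in\mathbb R$, the unique real critical point of $u_0$, such that $u_0$ is strictly monotone on $(-\infty,x_{\mathrm c})$ and on $(x_{\mathrm c},\infty)$. The bulk is $\mathcal B=\{\lambda:-\sup u_0<\lambda<-\inf u_0\}$; for $\lambda\in\mathcal B$ let $x_-(\lambda)<x_+(\lambda)$ be the two real roots of $u_0(x)=-\lambda$. Put $$h(x;\lambda)=\lambda x+f(x),\qquad f(x)=\sum_{p=1}^P c_p\Big(\mathrm{Log}(i(x-z_p))+\tfrac{\pi i}{2}\Big)+\mathrm{c.c.},$$ with the principal branch of $\mathrm{Log}$, so that $f'=u_0$, where "c.c." denotes the complex conjugate for real $x$, continued analytically to complex $x$. The function $f$ is analytic off vertical branch cuts that run from the points $z_p$ upwards and from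 the points $z_p^*$ downwards, and $h'=\lambda+u_0$ is a rational function. For $\epsilon>0$ and $\lambda<0$ let $\mathbf A(\lambda)$ be the $P\times P$ matrix with entries $$A_{mp}(\lambda)=\int_{C_m}\frac{e^{-ih(z;\lambda)/\epsilon}}{z-z_p}\,dz .$$ Here, if $ic_m/\epsilon$ is not a negative integer, $C_m$ is a contour in the domain of analyticity of $f$ from $i\infty$ to the left of all the cuts to $i\infty$ to the right of the cut of $z_m$ and (if $m<P$) to the left of the cut of $z_{m+1}$; if $ic_m/\epsilon$ is a negative integer, $C_m$ starts in the same way and ends at $z_m$. The eigenvalues are the numbers $\lambda<0$ with $\det\mathbf A(\lambda)=0$. For an eigenvalue $\lambda$ let $\boldsymbol\phi(\lambda)$ be the nullvector of $\mathbf A(\lambda)$ with $\sum_p\phi_p(\lambda)=\lambda$, and let $$\Phi(x;\lambda)=-\frac i\epsilon e^{ih(x;\lambda)/\epsilon}\int_{-\infty}^x e^{-ih(z;\lambda)/\epsilon}\sum_{p=1}^P\frac{\phi_p(\lambda)}{z-z_p}\,dz\qquad(x\in\mathbb R)$$ (improper integral). Given $\Lambda\in\mathcal B$, let $\lambda_\epsilon$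 be the eigenvalue closest to $\Lambda$ (the larger one if two are equidistant), and let $$\Phi_\epsilon(x)=\Phi(x;\lambda_\epsilon),\qquad I_\epsilon(x)=\frac{\epsilon}{2\pi\lambda_\epsilon}|\Phi_\epsilon(x)|^2 .$$ **Proposition.** Let $\Lambda\in\mathcal B$ be such that the complex (nonreal) critical points of $h(\cdot;\Lambda)$, i.e. the nonreal zeros of $h'(\cdot;\Lambda)$, are simple, and set $L=1+\max\{|x_+(\Lambda)|,|x_-(\Lambda)|\}$. For all sufficiently small $\epsilon>0$ the objects above are well defined: $\lambda_\epsilon$ exists, $\boldsymbol\phi(\lambda_\epsilon)$ exists and is unique, and the improper integral converges for every $x\in\mathbb R$. Moreover: 1. There is a constant $K_0$ such that, for all sufficiently small $\epsilon>0$, $$\left|I_\epsilon(x)-\frac{\epsilon}{2\pi\lambda_\epsilon x^2}\right|\le\frac{K_0\,\epsilon}{|x|^3}\qquad\text{for all real $x$ with }|x|\ge L .$$ 2. There is a constant $K_1$ such that, for all sufficiently small $\epsilon>0$, $|I_\epsilon(x)|\le K_1$ for all real $x$ with $|x|\le L$. 3. For every real $x\ne x_\pm(\Lambda)$, $$\lim_{\epsilon\downarrow0}I_\epsilon(x)=-\frac{\chi_{(x_-(\Lambda),x_+(\Lambda))}(x)}{x_+(\Lambda)-x_-(\Lambda)},$$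 where $\chi_{(a,b)}$ is the characteristic function of $(a,b)$. The constants $K_0,K_1$ and the thresholds for $\epsilon$ in 1 and 2 depend only on $u_0$ and $\Lambda$, not on $x$ or $\epsilon$. -/

import Mathlib

open MeasureTheory Filter Topology

noncomputable section

namespace BO

variable {P : ℕ}

/-- The rational function `∑ₚ cₚ / (w - zₚ) + c.c.` of a complex variable `w`, the complex
conjugate being taken for real `w` and then continued analytically (Schwarz reflection). -/
def uC (c z : Fin P → ℂ) (w : ℂ) : ℂ :=
  ∑ p, (c p / (w - z p) + star (c p) / (w - star (z p)))

/-- The real potential `u₀(x) = ∑ₚ cₚ / (x - zₚ) + c.c.`, for real `x`. -/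
def u₀ (c z : Fin P → ℂ) (x : ℝ) : ℝ := (uC c z (x : ℂ)).re

/-- `uC` is real on the real axis, so that it is the analytic continuation of `u₀`. -/
theorem uC_ofReal (c z : Fin P → ℂ) (x : ℝ) : uC c z (x : ℂ) = (u₀ c z x : ℂ) := by
  have h : (starRingEnd ℂ) (uC c z (x : ℂ)) = uC c z (x : ℂ) := by
    unfold uC
    rw [map_sum]
    refine Finset.sum_congr rfl fun p _ => ?_
    simp [add_comm]
  exact (Complex.conj_eq_iff_re.mp h).symm

/-- Admissible data of a rational potential: nonzero coefficients `cₚ`, poles `zₚ` in the open upper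
half-plane whose real parts increase strictly with `p`, and `u₀ ∈ L¹(ℝ)`. -/
structure IsRationalPotential (c z : Fin P → ℂ) : Prop where
  coeff_ne_zero : ∀ p, c p ≠ 0
  pole_im_pos : ∀ p, 0 < (z p).im
  pole_re_strictMono : StrictMono fun p => (z p).re
  integrable : Integrable (u₀ c z)

/-- Positive rational Klaus-Shaw potential: `u₀ > 0` is strictly monotone on each side of a point
`x_c` (increasing, then decreasing, as `u₀ > 0` vanishes at infinity), and `x_c` is its only real
critical point. -/
structure IsPositiveKlausShaw (c z : Fin P → ℂ) : Prop extends IsRationalPotential c z where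
  pos : ∀ x, 0 < u₀ c z x
  lobe : ∃ xc : ℝ, StrictMonoOn (u₀ c z) (Set.Iio xc) ∧ StrictAntiOn (u₀ c z) (Set.Ioi xc) ∧
    ∀ x, deriv (u₀ c z) x = 0 ↔ x = xc

/-- The bulk: the set of `lam` with `-sup u₀ < lam < -inf u₀`. -/
def bulk (c z : Fin P → ℂ) : Set ℝ :=
  {lam | -(⨆ x, u₀ c z x) < lam ∧ lam < -(⨅ x, u₀ c z x)}

/-- The smaller real root of `u₀ = -lam` (for a Klaus-Shaw potential and `lam` in the bulk there are
exactly two real roots). -/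
def xMinus (c z : Fin P → ℂ) (lam : ℝ) : ℝ := sInf {x | u₀ c z x = -lam}

/-- The larger real root of `u₀ = -lam`. -/
def xPlus (c z : Fin P → ℂ) (lam : ℝ) : ℝ := sSup {x | u₀ c z x = -lam}

/-- `f(w) = ∑ₚ cₚ (Log (i (w - zₚ)) + π i / 2) + c.c.`, the antiderivative of the potential that
vanishes at `-∞`; principal branch of the logarithm, hence vertical branch cuts from the `zₚ` upwards
and from their conjugates downwards. -/
def f (c z : Fin P → ℂ) (w : ℂ) : ℂ :=
  ∑ p, (c p * (Complex.log (Complex.I * (w - z p)) + Real.pi * Complex.I / 2) +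
    star (c p) * (Complex.log (-Complex.I * (w - star (z p))) - Real.pi * Complex.I / 2))

/-- `h(w; lam) = lam w + f(w)`. -/
def h (c z : Fin P → ℂ) (lam : ℝ) (w : ℂ) : ℂ := lam * w + f c z w

/-- `h'(w; lam) = lam + u₀(w)`, a rational function of `w ∈ ℂ`. -/
def hDeriv (c z : Fin P → ℂ) (lam : ℝ) (w : ℂ) : ℂ := lam + uC c z w

/-- The complex (nonreal) critical points of `h(·; lam)`, i.e. the nonreal zeros of the rational
function `h'(·; lam)`, are simple. The poles are excluded because `uC` takes a junk value there. -/
def SimpleComplexCriticalPoints (c z : Fin P → ℂ) (lam : ℝ) : Prop :=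
  ∀ w : ℂ, w.im ≠ 0 → (∀ p, w ≠ z p ∧ w ≠ star (z p)) → hDeriv c z lam w = 0 →
    deriv (hDeriv c z lam) w ≠ 0

/-- `e^{-i h(w; lam) / ε}`. -/
def expFactor (c z : Fin P → ℂ) (ε lam : ℝ) (w : ℂ) : ℂ :=
  Complex.exp (-Complex.I * h c z lam w / ε)

/-- An abscissa to the left of all poles. -/
def leftAbscissa [NeZero P] (z : Fin P → ℂ) : ℝ := (z 0).re - 1

/-- An abscissa to the right of `zₘ` and to the left of the next pole, if there is one. -/
def gapAbscissa (z : Fin P → ℂ) (m : Fin P) : ℝ :=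
  if hm : (m : ℕ) + 1 < P then ((z m).re + (z ⟨m + 1, hm⟩).re) / 2 else (z m).re + 1

/-- Integral over the path from `i∞` straight down to the real axis along `Re w = a`, and then along
the real axis to `b`. -/
def integralDownTo (g : ℂ → ℂ) (a b : ℝ) : ℂ :=
  -(Complex.I * ∫ y in Set.Ioi (0 : ℝ), g (a + y * Complex.I)) + ∫ x in a..b, g (x : ℂ)

/-- Integral over the contour `Uₘ`, which comes from `i∞` to the left of all branch cuts and returns
to `i∞` between the branch cuts of `zₘ` and of the next pole. -/
def integralU [NeZero P] (z : Fin P → ℂ) (m : Fin P) (g : ℂ → ℂ) : ℂ :=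
  integralDownTo g (leftAbscissa z) (gapAbscissa z m) +
    Complex.I * ∫ y in Set.Ioi (0 : ℝ), g (gapAbscissa z m + y * Complex.I)

/-- Integral over the contour `ℓ₀(zₘ)`, which comes from `i∞` to the left of all branch cuts and ends
at `zₘ`, approached from below. -/
def integralEll [NeZero P] (z : Fin P → ℂ) (m : Fin P) (g : ℂ → ℂ) : ℂ :=
  integralDownTo g (leftAbscissa z) (z m).re +
    Complex.I * ∫ y in (0 : ℝ)..(z m).im, g ((z m).re + y * Complex.I)

open scoped Classical in
/-- Integral over `Cₘ`, for `lam < 0`: `ℓ₀(zₘ)` if `i cₘ / ε` is a negative integer, otherwise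
`Uₘ`. -/
def integralC [NeZero P] (c z : Fin P → ℂ) (ε : ℝ) (m : Fin P) (g : ℂ → ℂ) : ℂ :=
  if ∃ n : ℕ, 0 < n ∧ Complex.I * c m / ε = -(n : ℂ) then integralEll z m g else integralU z m g

/-- `A_{mp}(lam) = ∫_{Cₘ} e^{-i h(w; lam) / ε} / (w - zₚ) dw`, for `lam < 0`. -/
def A [NeZero P] (c z : Fin P → ℂ) (ε lam : ℝ) : Matrix (Fin P) (Fin P) ℂ :=
  Matrix.of fun m p => integralC c z ε m fun w => expFactor c z ε lam w / (w - z p)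

/-- The Evans function `D(lam) = det A(lam)`, for `lam < 0`. -/
def evans [NeZero P] (c z : Fin P → ℂ) (ε lam : ℝ) : ℂ := (A c z ε lam).det

/-- The (negative) eigenvalues: the zeros of the Evans function. -/
def IsEigenvalue [NeZero P] (c z : Fin P → ℂ) (ε lam : ℝ) : Prop :=
  lam < 0 ∧ evans c z ε lam = 0

/-- `lam` is the eigenvalue closest to `Lam`, the larger one if two are equidistant. -/
def IsNearestEigenvalue [NeZero P] (c z : Fin P → ℂ) (ε Lam lam : ℝ) : Prop :=
  IsEigenvalue c z ε lam ∧ ∀ μ, IsEigenvalue c z ε μ →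
    |lam - Lam| ≤ |μ - Lam| ∧ (|μ - Lam| = |lam - Lam| → μ ≤ lam)

/-- `φ` is a nullvector of `A(lam)` normalized by `∑ₚ φₚ = lam`. -/
def IsNormalizedNullvector [NeZero P] (c z : Fin P → ℂ) (ε lam : ℝ) (φ : Fin P → ℂ) : Prop :=
  Matrix.mulVec (A c z ε lam) φ = 0 ∧ ∑ p, φ p = lam

/-- The eigenvalue `λ_ε` closest to `Lam`. -/
def lamEps [NeZero P] (c z : Fin P → ℂ) (Lam ε : ℝ) : ℝ :=
  Classical.epsilon (IsNearestEigenvalue c z ε Lam)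

/-- The normalized nullvector at an eigenvalue `lam`. -/
def phi [NeZero P] (c z : Fin P → ℂ) (ε lam : ℝ) : Fin P → ℂ :=
  Classical.epsilon (IsNormalizedNullvector c z ε lam)

/-- `∫_{-R}^x e^{-i h(y; lam) / ε} ∑ₚ φₚ(lam) / (y - zₚ) dy`. -/
def truncatedIntegral [NeZero P] (c z : Fin P → ℂ) (ε lam x R : ℝ) : ℂ :=
  ∫ y in (-R)..x, expFactor c z ε lam (y : ℂ) * ∑ p, phi c z ε lam p / ((y : ℂ) - z p)

/-- The normalized eigenfunction
`Φ(x; lam) = -(i/ε) e^{i h(x; lam) / ε} ∫_{-∞}^x e^{-i h(y; lam) / ε} ∑ₚ φₚ(lam) / (y - zₚ) dy`,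
with a (conditionally convergent) improper integral. -/
def Phi [NeZero P] (c z : Fin P → ℂ) (ε lam x : ℝ) : ℂ :=
  -(Complex.I / ε) * Complex.exp (Complex.I * h c z lam (x : ℂ) / ε) *
    limUnder atTop (truncatedIntegral c z ε lam x)

/-- `I_ε(x) = ε / (2 π λ_ε) |Φ(x; λ_ε)|²`. -/
def IEps [NeZero P] (c z : Fin P → ℂ) (Lam ε x : ℝ) : ℝ :=
  ε / (2 * Real.pi * lamEps c z Lam ε) * ‖Phi c z ε (lamEps c z Lam ε) x‖ ^ 2

/-- `I₀ = -χ_{(x₋, x₊)} / (x₊ - x₋)`. -/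
def IZero (c z : Fin P → ℂ) (Lam x : ℝ) : ℝ :=
  -(Set.indicator (Set.Ioo (xMinus c z Lam) (xPlus c z Lam)) (fun _ => (1 : ℝ)) x) /
    (xPlus c z Lam - xMinus c z Lam)

/-- `L = 1 + max {|x₊|, |x₋|}`. -/
def L (c z : Fin P → ℂ) (Lam : ℝ) : ℝ := 1 + max |xPlus c z Lam| |xMinus c z Lam|

end BO

end

open MeasureTheory Filter Topology

/-! ### Holomorphic functions with decay in the upper half-plane: Cauchy's theorem, Cauchy's
formula, point bounds. -/

namespace BO

/-! On the real line the function of interest solves `-i ε Φ' = (λ + u₀) Φ - ∑ φ_p / (x - z_p)`. The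
equations `A φ = 0` say that integration from `i∞` gives the same solution in every gap between the
cuts. This makes the solution single-valued off the poles `z_m`; these are regular singular points,
at which it can have at most a pole, and that is excluded as well. Hence a nullvector gives a
solution that is holomorphic in the upper half-plane and `O(1/|w|)`
(`exists_hardySolution_of_integralC`). Apart from analyticity in `λ`, the contours play no further
role.

Two identities then carry the proof, where the source may have an additional term `-ρ / (w -
z_q^*)`. The energy identity `HardySolution.energy` is `Im λ ∫ |Φ|² = 2 π Re (ρ^* Φ(z_q))`. For `ρ =
0` and real `λ`, Wu's identity `HardySolution.norm_identity` is `λ ε ∫ |Φ|² = -2 π |∑ φ_p|²`. The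
former excludes nonreal zeros of the determinant. The latter shows that a nullvector is determined
by its sum, and with the sum `λ` it says that `I_ε` has total integral `-1`.

Existence of eigenvalues close to `Λ` (`eventually_exists_eigenvalue`) is by contradiction. If there
are none within `δ`, then the problem with `ρ = 1` has a solution depending analytically on `λ`, and
the two half-planes control `Φ(z_q)` up to the real axis. The energy identity at `Λ + i ε` then
bounds `∫ |Φ|²` independently of `ε`. At a zero of `h'` the differential equation leaves only small
terms, so the source is small at the `P - 1` critical points in the upper half-plane and at the two
turning points. A source has `P + 1` simple poles and is determined by these `P + 1` values, so `ρ`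
would be small as well.

The same interpolation bounds the normalized nullvectors (`exists_sum_norm_le`): the sum `λ` and the
values of the source at the `P - 1` upper critical points determine `φ`. Simplicity of these points
is used for the count and for solving the equation for `Φ` on small circles around them.

The last step is real analysis. Let `S` be the source and `k = λ + u₀`. The modulus of `Φ - S / k`
changes only by the integral of `|(S / k)'|`. Across windows of width of order `√ε` at the turning
points the equation is integrated directly, and `|Φ| = O(ε^(-1/2))` results. At a fixed distance
from the turning points `Φ` is bounded outside of them, and between them its modulus is constant up
to `O(1)`. So `ε |Φ|²` tends to zero outside and becomes constant inside; the total integral fixes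
this constant by dominated convergence (`tendsto_one_div_of_integral_eq_one`). At infinity `Φ` is
compared with `S / k`, and the normalization makes `S / k` equal to `1 / x` up to `O(x⁻²)`. -/

/-- An integral of holomorphic functions with an integrable majorant is holomorphic. -/
theorem differentiableAt_integral_of_norm_le {α : Type*} [MeasurableSpace α] {μ : Measure α}
    {k : ℂ → α → ℂ} {w₀ : ℂ} {r : ℝ} (hr : 0 < r) {B : α → ℝ}
    (hmeas : ∀ w ∈ Metric.ball w₀ r, AEStronglyMeasurable (k w) μ) (hB : Integrable B μ)
    (hdiff : ∀ᵐ s ∂μ, DifferentiableOn ℂ (fun w => k w s) (Metric.ball w₀ r))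
    (hbound : ∀ᵐ s ∂μ, ∀ w ∈ Metric.ball w₀ r, ‖k w s‖ ≤ B s) :
    DifferentiableAt ℂ (fun w => ∫ s, k w s ∂μ) w₀ := by
  have hsub : ∀ w ∈ Metric.ball w₀ (r / 2), Metric.closedBall w (r / 4) ⊆ Metric.ball w₀ r := by
    intro w hw
    refine Metric.closedBall_subset_ball' ?_
    have := Metric.mem_ball.mp hw
    linarith
  have hw0 : w₀ ∈ Metric.ball w₀ r := Metric.mem_ball_self hr
  refine (hasDerivAt_integral_of_dominated_loc_of_deriv_le (s := Metric.ball w₀ (r / 2))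
    (F' := fun w s => deriv (fun w => k w s) w) (bound := fun s => B s / (r / 4))
    (Metric.ball_mem_nhds _ (by linarith)) ?_ ?_ ?_ ?_ (hB.div_const _) ?_).2.differentiableAt
  · filter_upwards [Metric.ball_mem_nhds w₀ hr] with w hw using hmeas w hw
  · refine hB.mono' (hmeas w₀ hw0) ?_
    filter_upwards [hbound] with s hs using hs w₀ hw0
  -- Measurability of the derivative in `s` is not assumed. It is a limit of the measurable
  -- difference quotients along `t n → 0`.
  · set t : ℕ → ℂ := fun n => ((r / 2 / ((n : ℝ) + 1) : ℝ) : ℂ) with ht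
    have ht0 : Tendsto t atTop (𝓝 0) := by
      have : Tendsto (fun n : ℕ => r / 2 / ((n : ℝ) + 1)) atTop (𝓝 0) :=
        tendsto_const_nhds.div_atTop (tendsto_natCast_atTop_atTop.atTop_add tendsto_const_nhds)
      have := (Complex.continuous_ofReal.tendsto 0).comp this
      rwa [Complex.ofReal_zero] at this
    have htpos : ∀ n : ℕ, 0 < r / 2 / ((n : ℝ) + 1) := fun n => div_pos (half_pos hr) (Nat.cast_add_one_pos n)
    have htb : ∀ n, w₀ + t n ∈ Metric.ball w₀ r := by
      intro n
      rw [Metric.mem_ball, dist_eq_norm, add_sub_cancel_left, ht, Complex.norm_real,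
        Real.norm_of_nonneg (htpos n).le]
      rw [div_lt_iff₀ (by positivity)]
      nlinarith [Nat.cast_nonneg (α := ℝ) n]
    refine aestronglyMeasurable_of_tendsto_ae atTop
      (f := fun n s => (t n)⁻¹ • (k (w₀ + t n) s - k w₀ s)) ?_ ?_
    · intro n
      exact ((hmeas _ (htb n)).sub (hmeas _ hw0)).const_smul (t n)⁻¹
    · filter_upwards [hdiff] with s hs
      have h1 : HasDerivAt (fun w => k w s) (deriv (fun w => k w s) w₀) w₀ :=
        (hs.differentiableAt (Metric.isOpen_ball.mem_nhds hw0)).hasDerivAt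
      have h2 := hasDerivAt_iff_tendsto_slope_zero.mp h1
      refine h2.comp (tendsto_nhdsWithin_iff.mpr ⟨ht0, Eventually.of_forall fun n => ?_⟩)
      simp only [ht, Set.mem_compl_iff, Set.mem_singleton_iff, Complex.ofReal_eq_zero]
      exact (htpos n).ne'
  · filter_upwards [hbound, hdiff] with s hs hd w hw
    refine Complex.norm_deriv_le_of_forall_mem_sphere_norm_le (by linarith) ?_ ?_
    · exact (hd.mono (hsub w hw)).diffContOnCl_ball subset_rfl
    · intro v hv
      exact hs v (hsub w hw (Metric.sphere_subset_closedBall hv))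
  · filter_upwards [hdiff] with s hs w hw
    refine (hs.differentiableAt (Metric.isOpen_ball.mem_nhds ?_)).hasDerivAt
    exact hsub w hw (Metric.mem_closedBall_self (by linarith))

/-- Functions on the closed upper half-plane that are holomorphic inside and `O(|w|⁻ᵏ)`. -/
structure UpperDecay (k : ℕ) (Φ : ℂ → ℂ) : Prop where
  cont : ContinuousOn Φ {w | 0 ≤ w.im}
  diff : DifferentiableOn ℂ Φ {w | 0 < w.im}
  decay : ∃ C : ℝ, 0 ≤ C ∧ ∀ w : ℂ, 0 ≤ w.im → ‖Φ w‖ ≤ C / (1 + ‖w‖) ^ k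

/-- Continuity bounds the function on the compact half-disc, so only large `‖w‖` matters. -/
theorem UpperDecay.of_large {k : ℕ} {Φ : ℂ → ℂ} (hc : ContinuousOn Φ {w | 0 ≤ w.im})
    (hd : DifferentiableOn ℂ Φ {w | 0 < w.im}) {C R : ℝ}
    (h : ∀ w : ℂ, 0 ≤ w.im → R ≤ ‖w‖ → ‖Φ w‖ ≤ C / ‖w‖ ^ k) : UpperDecay k Φ := by
  refine ⟨hc, hd, ?_⟩
  have hK : IsCompact (Metric.closedBall (0 : ℂ) (max R 1) ∩ {w | 0 ≤ w.im}) :=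
    (isCompact_closedBall _ _).inter_right (isClosed_le continuous_const Complex.continuous_im)
  obtain ⟨M, hM⟩ := hK.exists_bound_of_continuousOn (hc.mono Set.inter_subset_right)
  refine ⟨|C| * 2 ^ k + |M| * (1 + max R 1) ^ k, by positivity, fun w hw => ?_⟩
  rw [le_div_iff₀ (by positivity)]
  rcases le_or_gt ‖w‖ (max R 1) with h1 | h1
  · have h2 := hM w ⟨by simpa using h1, hw⟩
    calc ‖Φ w‖ * (1 + ‖w‖) ^ k ≤ |M| * (1 + max R 1) ^ k := by
          gcongr
          exact h2.trans (le_abs_self M)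
      _ ≤ _ := le_add_of_nonneg_left (by positivity)
  · have h1' : R ≤ ‖w‖ ∧ 1 ≤ ‖w‖ := ⟨(le_max_left _ _).trans h1.le, (le_max_right _ _).trans h1.le⟩
    have hpos : 0 < ‖w‖ := by linarith
    calc ‖Φ w‖ * (1 + ‖w‖) ^ k ≤ (|C| / ‖w‖ ^ k) * (2 * ‖w‖) ^ k := by
          gcongr
          · exact (h w hw h1'.1).trans (by gcongr; exact le_abs_self C)
          · linarith
      _ = |C| * 2 ^ k := by rw [mul_pow]; field_simp
      _ ≤ _ := le_add_of_nonneg_right (by positivity)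

theorem UpperDecay.mul {k l : ℕ} {Φ Ψ : ℂ → ℂ} (h1 : UpperDecay k Φ) (h2 : UpperDecay l Ψ) :
    UpperDecay (k + l) (fun w => Φ w * Ψ w) := by
  refine ⟨h1.cont.mul h2.cont, h1.diff.mul h2.diff, ?_⟩
  obtain ⟨C, hC, hc⟩ := h1.decay
  obtain ⟨D, hD, hd⟩ := h2.decay
  refine ⟨C * D, by positivity, fun w hw => ?_⟩
  rw [norm_mul, pow_add, ← div_mul_div_comm]
  exact mul_le_mul (hc w hw) (hd w hw) (norm_nonneg _) (by positivity)

theorem UpperDecay.add {k : ℕ} {Φ Ψ : ℂ → ℂ} (h1 : UpperDecay k Φ) (h2 : UpperDecay k Ψ) :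
    UpperDecay k (fun w => Φ w + Ψ w) := by
  refine ⟨h1.cont.add h2.cont, h1.diff.add h2.diff, ?_⟩
  obtain ⟨C, hC, hc⟩ := h1.decay
  obtain ⟨D, hD, hd⟩ := h2.decay
  refine ⟨C + D, by positivity, fun w hw => ?_⟩
  rw [add_div]
  exact (norm_add_le _ _).trans (add_le_add (hc w hw) (hd w hw))

theorem UpperDecay.const_mul {k : ℕ} {Φ : ℂ → ℂ} (h1 : UpperDecay k Φ) (a : ℂ) :
    UpperDecay k (fun w => a * Φ w) := by
  refine ⟨continuousOn_const.mul h1.cont, h1.diff.const_mul a, ?_⟩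
  obtain ⟨C, hC, hc⟩ := h1.decay
  refine ⟨‖a‖ * C, by positivity, fun w hw => ?_⟩
  rw [norm_mul, mul_div_assoc]
  gcongr
  exact hc w hw

theorem UpperDecay.sum {k : ℕ} {ι : Type*} (s : Finset ι) {Φ : ι → ℂ → ℂ}
    (h : ∀ i, UpperDecay k (Φ i)) : UpperDecay k (fun w => ∑ i ∈ s, Φ i w) := by
  classical
  induction s using Finset.induction_on with
  | empty =>
    simp only [Finset.sum_empty]
    exact ⟨continuousOn_const, differentiableOn_const _, 0, le_rfl, fun w _ => by simp⟩
  | insert a s ha ih =>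
    simp only [Finset.sum_insert ha]
    exact (h a).add ih

theorem upperDecay_inv_sub {a : ℂ} (ha : a.im < 0) : UpperDecay 1 (fun w => 1 / (w - a)) := by
  have hne : ∀ w : ℂ, 0 ≤ w.im → w - a ≠ 0 := by
    intro w hw h
    have := congrArg Complex.im h
    simp at this
    linarith
  refine UpperDecay.of_large (C := 2) (R := 2 * ‖a‖ + 1) ?_ ?_ ?_
  · exact continuousOn_const.div (continuousOn_id.sub continuousOn_const) fun w hw => hne w hw
  · exact (differentiableOn_const _).div (differentiableOn_id.sub (differentiableOn_const _))
      fun w hw => hne w (le_of_lt hw)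
  · intro w hw hR
    have h1 : ‖w‖ - ‖a‖ ≤ ‖w - a‖ := norm_sub_norm_le w a
    have h0 := norm_nonneg a
    rw [norm_div, norm_one, pow_one, div_le_div_iff₀ (by linarith) (by linarith)]
    linarith

theorem UpperDecay.continuous_ofReal {k : ℕ} {Φ : ℂ → ℂ} (h : UpperDecay k Φ) :
    Continuous (fun x : ℝ => Φ x) := by
  refine h.cont.comp_continuous Complex.continuous_ofReal fun x => ?_
  simp

theorem one_add_sq_le (x : ℝ) : 1 + x ^ 2 ≤ (1 + ‖(x : ℂ)‖) ^ 2 := by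
  rw [Complex.norm_real, Real.norm_eq_abs]
  nlinarith [abs_nonneg x, sq_abs x]

theorem UpperDecay.integrable {Φ : ℂ → ℂ} (h : UpperDecay 2 Φ) :
    Integrable (fun x : ℝ => Φ x) := by
  obtain ⟨C, hC, hc⟩ := h.decay
  refine (integrable_inv_one_add_sq.const_mul C).mono'
    h.continuous_ofReal.aestronglyMeasurable (Eventually.of_forall fun x => ?_)
  refine (hc x (by simp)).trans ?_
  rw [div_eq_mul_inv]
  gcongr
  exact one_add_sq_le x

/-- Cauchy's theorem on the box over `[-T, T]` of height `T`: the other three sides have length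
`O(T)` and the function is `O(T⁻²)` on them. -/
theorem UpperDecay.integral_eq_zero {Φ : ℂ → ℂ} (h : UpperDecay 2 Φ) : ∫ x : ℝ, Φ x = 0 := by
  obtain ⟨C, hC, hc⟩ := h.decay
  have hlim : Tendsto (fun T : ℝ => ∫ x in (-T)..T, Φ x) atTop (𝓝 (∫ x : ℝ, Φ x)) :=
    intervalIntegral_tendsto_integral h.integrable tendsto_neg_atTop_atBot tendsto_id
  refine tendsto_nhds_unique hlim ?_
  have hbd : ∀ T : ℝ, 0 < T → ‖∫ x in (-T)..T, Φ x‖ ≤ 4 * C / T := by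
    intro T hT
    have hrect := Complex.integral_boundary_rect_eq_zero_of_continuousOn_of_differentiableOn Φ
      (-T : ℂ) (T + T * Complex.I) ?_ ?_
    · simp at hrect
      have e1 : ∫ x in (-T)..T, Φ x = (∫ x in (-T)..T, Φ (x + T * Complex.I)) -
          Complex.I * (∫ y in (0:ℝ)..T, Φ (T + y * Complex.I)) +
          Complex.I * (∫ y in (0:ℝ)..T, Φ (-T + y * Complex.I)) := by
        linear_combination hrect
      have key : ∀ w : ℂ, 0 ≤ w.im → T ≤ ‖w‖ → ‖Φ w‖ ≤ C / T ^ 2 := by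
        intro w hw hTw
        refine (hc w hw).trans ?_
        gcongr
        linarith
      have i1 : ‖∫ x in (-T)..T, Φ (x + T * Complex.I)‖ ≤ C / T ^ 2 * |T - (-T)| := by
        refine intervalIntegral.norm_integral_le_of_norm_le_const fun x _ => key _ ?_ ?_
        · simp [hT.le]
        · refine le_trans ?_ (Complex.abs_im_le_norm _)
          simp [le_abs_self]
      have i2 : ‖∫ y in (0:ℝ)..T, Φ (T + y * Complex.I)‖ ≤ C / T ^ 2 * |T - 0| := by
        refine intervalIntegral.norm_integral_le_of_norm_le_const fun y hy => key _ ?_ ?_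
        · rw [Set.uIoc_of_le hT.le] at hy
          simp [hy.1.le]
        · refine le_trans ?_ (Complex.abs_re_le_norm _)
          simp [le_abs_self]
      have i3 : ‖∫ y in (0:ℝ)..T, Φ (-T + y * Complex.I)‖ ≤ C / T ^ 2 * |T - 0| := by
        refine intervalIntegral.norm_integral_le_of_norm_le_const fun y hy => key _ ?_ ?_
        · rw [Set.uIoc_of_le hT.le] at hy
          simp [hy.1.le]
        · refine le_trans ?_ (Complex.abs_re_le_norm _)
          simp [le_abs_self]
      rw [e1]
      calc _ ≤ ‖∫ x in (-T)..T, Φ (x + T * Complex.I)‖ +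
            ‖∫ y in (0:ℝ)..T, Φ (T + y * Complex.I)‖ +
            ‖∫ y in (0:ℝ)..T, Φ (-T + y * Complex.I)‖ := by
            refine (norm_add_le _ _).trans (add_le_add ((norm_sub_le _ _).trans ?_) ?_) <;> simp
        _ ≤ C / T ^ 2 * |T - (-T)| + C / T ^ 2 * |T - 0| + C / T ^ 2 * |T - 0| := by gcongr
        _ = 4 * C / T := by
          rw [sub_neg_eq_add, sub_zero, abs_of_pos hT, abs_of_pos (by linarith)]
          field_simp; ring
    · refine h.cont.mono fun w hw => ?_
      have := hw.2
      simp [Set.uIcc_of_le hT.le] at this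
      exact this.1
    · refine h.diff.mono fun w hw => ?_
      have := hw.2
      simp [hT.le] at this
      exact this.1
  refine squeeze_zero_norm' ?_ (tendsto_const_nhds.div_atTop tendsto_id : Tendsto (fun T : ℝ => 4 * C / T) atTop (𝓝 0))
  filter_upwards [eventually_gt_atTop 0] with T hT using hbd T hT

theorem integral_inv_normSq_sub {w : ℂ} (hw : 0 < w.im) :
    Integrable (fun x : ℝ => (‖(x : ℂ) - w‖ ^ 2)⁻¹) ∧
      ∫ x : ℝ, (‖(x : ℂ) - w‖ ^ 2)⁻¹ = Real.pi / w.im := by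
  have e : (fun x : ℝ => (‖(x : ℂ) - w‖ ^ 2)⁻¹) =
      fun x : ℝ => (w.im ^ 2)⁻¹ * (fun t : ℝ => (fun s : ℝ => (1 + s ^ 2)⁻¹) (t * w.im⁻¹)) (x - w.re) := by
    funext x
    have : ‖(x : ℂ) - w‖ ^ 2 = (x - w.re) ^ 2 + w.im ^ 2 := by
      rw [← Complex.normSq_eq_norm_sq, Complex.normSq_apply]; simp; ring
    rw [this]
    simp only
    rw [← mul_inv]
    congr 1
    field_simp
    ring
  have hi : Integrable (fun t : ℝ => (fun s : ℝ => (1 + s ^ 2)⁻¹) (t * w.im⁻¹)) :=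
    integrable_inv_one_add_sq.comp_mul_right' (inv_ne_zero hw.ne')
  constructor
  · rw [e]
    exact (hi.comp_sub_right w.re).const_mul _
  · rw [e, integral_const_mul, integral_sub_right_eq_self (fun t : ℝ => (fun s : ℝ => (1 + s ^ 2)⁻¹) (t * w.im⁻¹)),
      Measure.integral_comp_mul_right (fun s : ℝ => (1 + s ^ 2)⁻¹), integral_univ_inv_one_add_sq]
    rw [inv_inv, abs_of_pos hw, smul_eq_mul]
    field_simp

/-- Cauchy's formula for the upper half-plane. -/
theorem UpperDecay.cauchy {Φ : ℂ → ℂ} (h : UpperDecay 1 Φ) {w : ℂ} (hw : 0 < w.im) :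
    ∫ x : ℝ, Φ x / (x - w) = 2 * Real.pi * Complex.I * Φ w := by
  have hbar : (star w).im < 0 := by simp [hw]
  -- Subtracting a multiple of `1 / (ζ - star w)` makes the function vanish at `w`. Its quotient by
  -- `ζ - w` then has second order decay and integral zero; what was subtracted contributes a
  -- multiple of the Poisson kernel.
  have hψ := h.add ((upperDecay_inv_sub hbar).const_mul (-(Φ w * (w - star w))))
  set ψ : ℂ → ℂ := fun ζ => Φ ζ + -(Φ w * (w - star w)) * (1 / (ζ - star w)) with hψdef
  have hopen : IsOpen {w : ℂ | 0 < w.im} := isOpen_lt continuous_const Complex.continuous_im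
  have hnhds : {w : ℂ | 0 < w.im} ∈ 𝓝 w := hopen.mem_nhds hw
  have hne : w - star w ≠ 0 := by
    intro h0
    have := congrArg Complex.im h0
    simp at this
    linarith
  have hψw : ψ w = 0 := by
    simp only [hψdef]; field_simp; ring
  obtain ⟨C, hC, hc⟩ := hψ.decay
  have hK : UpperDecay 2 (dslope ψ w) := by
    refine UpperDecay.of_large (C := 2 * C) (R := 2 * ‖w‖ + 1) ?_ ?_ ?_
    · have hn' : {w : ℂ | 0 ≤ w.im} ∈ 𝓝 w := mem_of_superset hnhds fun v (hv : 0 < v.im) => hv.le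
      rw [continuousOn_dslope hn']
      exact ⟨hψ.cont, hψ.diff.differentiableAt hnhds⟩
    · exact (Complex.differentiableOn_dslope hnhds).mpr hψ.diff
    · intro v hv hR
      have h0 := norm_nonneg w
      have hvw : v ≠ w := by
        rintro rfl; linarith
      have h1 : ‖v‖ / 2 ≤ ‖v - w‖ := by
        have := norm_sub_norm_le v w
        linarith
      rw [dslope_of_ne _ hvw, slope_def_field, hψw, sub_zero, norm_div]
      have h2 := hc v hv
      have hv0 : 0 < ‖v‖ := by linarith
      calc ‖ψ v‖ / ‖v - w‖ ≤ (C / (1 + ‖v‖) ^ 1) / (‖v‖ / 2) := by gcongr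
        _ ≤ (C / ‖v‖) / (‖v‖ / 2) := by rw [pow_one]; gcongr; linarith
        _ = 2 * C / ‖v‖ ^ 2 := by field_simp
  have hz := hK.integral_eq_zero
  have hxne : ∀ x : ℝ, (x : ℂ) ≠ w := by
    rintro x rfl
    simp at hw
  have hxbar : ∀ x : ℝ, (x : ℂ) - star w ≠ 0 := by
    intro x h0
    have := congrArg Complex.im h0
    simp at this
    linarith
  have he : ∀ x : ℝ, Φ x / (x - w) =
      dslope ψ w x + Φ w * (w - star w) * (((‖(x : ℂ) - w‖ ^ 2)⁻¹ : ℝ) : ℂ) := by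
    intro x
    have hx : (x : ℂ) - w ≠ 0 := sub_ne_zero.mpr (hxne x)
    rw [dslope_of_ne _ (hxne x), slope_def_field, hψw, sub_zero]
    have hn : (((‖(x : ℂ) - w‖ ^ 2)⁻¹ : ℝ) : ℂ) = (((x : ℂ) - w) * (x - star w))⁻¹ := by
      have : (((‖(x : ℂ) - w‖ ^ 2) : ℝ) : ℂ) = ((x : ℂ) - w) * (x - star w) := by
        rw [← Complex.normSq_eq_norm_sq, ← Complex.mul_conj]; simp
      rw [Complex.ofReal_inv, this]
    rw [hn]
    simp only [hψdef]
    have := hxbar x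
    field_simp
    ring
  simp_rw [he]
  rw [integral_add (f := fun x : ℝ => dslope ψ w x)
    (g := fun x : ℝ => Φ w * (w - star w) * (((‖(x : ℂ) - w‖ ^ 2)⁻¹ : ℝ) : ℂ)) hK.integrable
    ((integral_inv_normSq_sub hw).1.ofReal.const_mul _), hz, zero_add,
    integral_const_mul, integral_complex_ofReal, (integral_inv_normSq_sub hw).2]
  have : w - star w = 2 * w.im * Complex.I := by
    apply Complex.ext <;> simp; ring
  rw [this]
  have hw' : (w.im : ℂ) ≠ 0 := by exact_mod_cast hw.ne'
  push_cast
  field_simp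

theorem UpperDecay.integrable_normSq {Φ : ℂ → ℂ} (h : UpperDecay 1 Φ) :
    Integrable (fun x : ℝ => ‖Φ x‖ ^ 2) := by
  obtain ⟨C, hC, hc⟩ := h.decay
  refine (integrable_inv_one_add_sq.const_mul (C ^ 2)).mono'
    (h.continuous_ofReal.norm.pow 2).aestronglyMeasurable (Eventually.of_forall fun x => ?_)
  rw [Real.norm_of_nonneg (by positivity)]
  have h1 := hc x (by simp)
  rw [pow_one] at h1
  calc ‖Φ x‖ ^ 2 ≤ (C / (1 + ‖(x : ℂ)‖)) ^ 2 := by gcongr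
    _ = C ^ 2 * ((1 + ‖(x : ℂ)‖) ^ 2)⁻¹ := by rw [div_pow, div_eq_mul_inv]
    _ ≤ _ := by gcongr; exact one_add_sq_le x

/-- The pointwise bound on Hardy functions. -/
theorem UpperDecay.normSq_le {Φ : ℂ → ℂ} (h : UpperDecay 1 Φ) {w : ℂ} (hw : 0 < w.im) :
    4 * Real.pi * w.im * ‖Φ w‖ ^ 2 ≤ ∫ x : ℝ, ‖Φ x‖ ^ 2 := by
  have hN : 0 ≤ ∫ x : ℝ, ‖Φ x‖ ^ 2 := integral_nonneg fun x => by positivity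
  rcases eq_or_ne (Φ w) 0 with h0 | h0
  · simpa [h0] using hN
  have hpos : 0 < ‖Φ w‖ := norm_pos_iff.mpr h0
  -- The weight in Young's inequality `a b ≤ t a² / 2 + b² / (2 t)`, chosen so that the Poisson term
  -- is exactly half of the left side.
  set t : ℝ := 1 / (2 * w.im * ‖Φ w‖) with ht
  have htpos : 0 < t := by positivity
  have h1 : 2 * Real.pi * ‖Φ w‖ ≤ ∫ x : ℝ, (t / 2 * ‖Φ x‖ ^ 2 + 1 / (2 * t) * (‖(x : ℂ) - w‖ ^ 2)⁻¹) := by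
    have e : ‖∫ x : ℝ, Φ x / (x - w)‖ = 2 * Real.pi * ‖Φ w‖ := by
      rw [h.cauchy hw]; simp [abs_of_pos Real.pi_pos]
    rw [← e]
    refine norm_integral_le_of_norm_le ((h.integrable_normSq.const_mul _).add
      ((integral_inv_normSq_sub hw).1.const_mul _)) (Eventually.of_forall fun x => ?_)
    rw [norm_div]
    have e2 : (‖(x : ℂ) - w‖ ^ 2)⁻¹ = (‖(x : ℂ) - w‖⁻¹) ^ 2 := by rw [inv_pow]
    rw [e2, div_eq_mul_inv]
    set a := ‖Φ x‖
    set b := ‖(x : ℂ) - w‖⁻¹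
    have : t / 2 * a ^ 2 + 1 / (2 * t) * b ^ 2 - a * b = (t * a - b) ^ 2 / (2 * t) := by
      field_simp; ring
    have h3 : 0 ≤ (t * a - b) ^ 2 / (2 * t) := by positivity
    linarith
  rw [integral_add (h.integrable_normSq.const_mul _) ((integral_inv_normSq_sub hw).1.const_mul _),
    integral_const_mul, integral_const_mul, (integral_inv_normSq_sub hw).2, ht] at h1
  set N := ∫ x : ℝ, ‖Φ x‖ ^ 2
  have e3 : 1 / (2 * w.im * ‖Φ w‖) / 2 * N + 1 / (2 * (1 / (2 * w.im * ‖Φ w‖))) * (Real.pi / w.im)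
      = N / (4 * w.im * ‖Φ w‖) + Real.pi * ‖Φ w‖ := by field_simp; ring
  rw [e3] at h1
  have h4 : Real.pi * ‖Φ w‖ ≤ N / (4 * w.im * ‖Φ w‖) := by linarith
  rw [le_div_iff₀ (by positivity)] at h4
  nlinarith

/-- Cauchy's estimate on the disc of radius `w.im / 2`, where imaginary parts stay above `w.im / 2`,
combined with the point bound. -/
theorem UpperDecay.normSq_deriv_le {Φ : ℂ → ℂ} (h : UpperDecay 1 Φ) {w : ℂ} (hw : 0 < w.im) :
    ‖deriv Φ w‖ ^ 2 ≤ 2 / (Real.pi * w.im ^ 3) * ∫ x : ℝ, ‖Φ x‖ ^ 2 := by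
  set N := ∫ x : ℝ, ‖Φ x‖ ^ 2 with hNdef
  have hN : 0 ≤ N := integral_nonneg fun x => by positivity
  have him : ∀ v ∈ Metric.closedBall w (w.im / 2), w.im / 2 ≤ v.im := by
    intro v hv
    have h1 := (Complex.abs_im_le_norm (v - w)).trans (mem_closedBall_iff_norm.mp hv)
    rw [Complex.sub_im, abs_le] at h1
    linarith [h1.1]
  have hd : ‖deriv Φ w‖ ≤ Real.sqrt (N / (2 * Real.pi * w.im)) / (w.im / 2) := by
    refine Complex.norm_deriv_le_of_forall_mem_sphere_norm_le (by linarith) ?_ ?_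
    · refine (h.diff.mono fun v hv => ?_).diffContOnCl_ball (U := Metric.closedBall w (w.im / 2))
        subset_rfl
      have := him v hv
      show 0 < v.im
      linarith
    · intro v hv
      have h1 := him v (Metric.sphere_subset_closedBall hv)
      have h2 := h.normSq_le (w := v) (by linarith)
      refine Real.le_sqrt_of_sq_le ?_
      rw [le_div_iff₀ (by positivity)]
      refine le_trans ?_ h2
      have : 2 * Real.pi * w.im ≤ 4 * Real.pi * v.im := by nlinarith [Real.pi_pos]
      nlinarith [sq_nonneg ‖Φ v‖]
  calc ‖deriv Φ w‖ ^ 2 ≤ (Real.sqrt (N / (2 * Real.pi * w.im)) / (w.im / 2)) ^ 2 := by gcongr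
    _ = 2 / (Real.pi * w.im ^ 3) * N := by
      rw [div_pow, Real.sq_sqrt (by positivity)]
      field_simp

end BO

/-! ### The differential equation in the Hardy space, residues at the poles, and the energy
identity. -/

namespace BO

variable {P : ℕ}

/-- `∑ₚ φₚ / (w - zₚ) - ρ / (w - z_q^*)`. -/
noncomputable def source (z φ : Fin P → ℂ) (ρ : ℂ) (q : Fin P) (w : ℂ) : ℂ :=
  ∑ p, φ p / (w - z p) - ρ / (w - star (z q))

/-- Solutions `Φ` in the Hardy space of `-i ε Φ' = h' Φ - source`. -/
structure HardySolution (c z : Fin P → ℂ) (ε : ℝ) (lam : ℂ) (φ : Fin P → ℂ) (ρ : ℂ) (q : Fin P)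
    (η : ℝ) (Φ : ℂ → ℂ) : Prop where
  eta_pos : 0 < η
  diff : DifferentiableOn ℂ Φ {w | -η < w.im}
  decay : UpperDecay 1 Φ
  ode : ∀ w : ℂ, -η < w.im → (∀ p, w ≠ z p) →
    -Complex.I * ε * deriv Φ w = (lam + uC c z w) * Φ w - source z φ ρ q w

theorem tendsto_sub_mul_sum_div {ι : Type*} [Fintype ι] {z : ι → ℂ} (hz : Function.Injective z)
    (a : ι → ℂ) (p : ι) :
    Tendsto (fun w => (w - z p) * ∑ j, a j / (w - z j)) (𝓝[≠] z p) (𝓝 (a p)) := by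
  classical
  have h : ∀ j, Tendsto (fun w => (w - z p) * (a j / (w - z j))) (𝓝[≠] z p)
      (𝓝 (if j = p then a p else 0)) := by
    intro j
    by_cases hj : j = p
    · subst hj
      rw [if_pos rfl]
      refine tendsto_const_nhds.congr' ?_
      filter_upwards [self_mem_nhdsWithin] with w hw
      have : w - z j ≠ 0 := sub_ne_zero.mpr hw
      field_simp
    · rw [if_neg hj]
      have hne : z p - z j ≠ 0 := sub_ne_zero.mpr fun h => hj (hz h).symm
      have : ContinuousAt (fun w => (w - z p) * (a j / (w - z j))) (z p) := by
        fun_prop (disch := exact hne)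
      have h2 := this.tendsto
      simp only [sub_self, zero_mul] at h2
      exact h2.mono_left nhdsWithin_le_nhds
  simp_rw [Finset.mul_sum]
  have := tendsto_finsetSum Finset.univ fun j _ => h j
  simpa using this

theorem IsRationalPotential.injective {c z : Fin P → ℂ} (hu : IsRationalPotential c z) :
    Function.Injective z := fun _ _ h => hu.pole_re_strictMono.injective (congrArg Complex.re h)

theorem sub_star_ne_zero {v w : ℂ} (hw : -v.im < w.im) : w - star v ≠ 0 := by
  intro h
  have := congrArg Complex.im h
  simp at this
  linarith

theorem tendsto_sub_mul_uC {c z : Fin P → ℂ} (hu : IsRationalPotential c z) (p : Fin P) :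
    Tendsto (fun w => (w - z p) * uC c z w) (𝓝[≠] z p) (𝓝 (c p)) := by
  have h1 := tendsto_sub_mul_sum_div hu.injective c p
  have h2 : ContinuousAt (fun w => (w - z p) * ∑ j, star (c j) / (w - star (z j))) (z p) := by
    have : ∀ j, z p - star (z j) ≠ 0 := fun j => sub_star_ne_zero
      (by linarith [hu.pole_im_pos j, hu.pole_im_pos p])
    refine ContinuousAt.mul (by fun_prop) ?_
    refine tendsto_finsetSum _ fun j _ => ?_
    have : ContinuousAt (fun w => star (c j) / (w - star (z j))) (z p) := by
      fun_prop (disch := exact this j)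
    exact this
  have h3 := h1.add (h2.tendsto.mono_left nhdsWithin_le_nhds)
  simp only [sub_self, zero_mul, add_zero] at h3
  refine h3.congr fun w => ?_
  rw [uC, Finset.sum_add_distrib, mul_add]

theorem tendsto_sub_mul_source {z : Fin P → ℂ} (hz : Function.Injective z)
    (him : ∀ p, 0 < (z p).im) (φ : Fin P → ℂ) (ρ : ℂ) (q p : Fin P) :
    Tendsto (fun w => (w - z p) * source z φ ρ q w) (𝓝[≠] z p) (𝓝 (φ p)) := by
  have h1 := tendsto_sub_mul_sum_div hz φ p
  have h2 : ContinuousAt (fun w => (w - z p) * (ρ / (w - star (z q)))) (z p) := by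
    have : z p - star (z q) ≠ 0 := sub_star_ne_zero (by linarith [him q, him p])
    fun_prop (disch := exact this)
  have h3 := h1.sub (h2.tendsto.mono_left nhdsWithin_le_nhds)
  simp only [sub_self, zero_mul, sub_zero] at h3
  refine h3.congr fun w => ?_
  rw [source, mul_sub]

variable {c z : Fin P → ℂ} {ε : ℝ} {lam : ℂ} {φ : Fin P → ℂ} {ρ : ℂ} {q : Fin P} {η : ℝ}
  {Φ : ℂ → ℂ}

theorem isOpen_neg_lt_im (η : ℝ) : IsOpen {w : ℂ | -η < w.im} :=
  isOpen_lt continuous_const Complex.continuous_im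

theorem HardySolution.differentiableAt (hs : HardySolution c z ε lam φ ρ q η Φ) {w : ℂ}
    (hw : 0 ≤ w.im) : DifferentiableAt ℂ Φ w :=
  hs.diff.differentiableAt ((isOpen_neg_lt_im η).mem_nhds
    (show -η < w.im by linarith [hs.eta_pos]))

/-- Since `Φ` is holomorphic at `z p`, the residues on the two sides of the equation must agree
there. So `φ` can be read off from `Φ`, and bounds on `Φ` become bounds on `φ`. -/
theorem HardySolution.coeff_mul_eq (hu : IsRationalPotential c z)
    (hs : HardySolution c z ε lam φ ρ q η Φ) (p : Fin P) : c p * Φ (z p) = φ p := by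
  have hp := hu.pole_im_pos p
  have hnhds : {w : ℂ | -η < w.im} ∈ 𝓝 (z p) :=
    (isOpen_neg_lt_im η).mem_nhds (show -η < (z p).im by linarith [hs.eta_pos])
  have hne : ∀ᶠ w in 𝓝[≠] z p, ∀ j, w ≠ z j := by
    rw [eventually_all]
    intro j
    by_cases hj : j = p
    · subst hj; exact self_mem_nhdsWithin
    · exact nhdsWithin_le_nhds (isOpen_ne.mem_nhds fun h => hj (hu.injective h).symm)
  have hd : ContinuousAt (deriv Φ) (z p) :=
    ((hs.diff.deriv (isOpen_neg_lt_im η)).differentiableAt hnhds).continuousAt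
  have hΦ : ContinuousAt Φ (z p) := (hs.diff.differentiableAt hnhds).continuousAt
  have hsub : Tendsto (fun w => w - z p) (𝓝[≠] z p) (𝓝 0) := by
    have : ContinuousAt (fun w => w - z p) (z p) := by fun_prop
    have := this.tendsto
    rw [sub_self] at this
    exact this.mono_left nhdsWithin_le_nhds
  have h1 : Tendsto (fun w => (w - z p) * (-Complex.I * ε * deriv Φ w)) (𝓝[≠] z p) (𝓝 0) := by
    have := hsub.mul ((hd.tendsto.mono_left nhdsWithin_le_nhds).const_mul (-Complex.I * ε))
    simpa using this
  have h2 : Tendsto (fun w => (w - z p) * ((lam + uC c z w) * Φ w - source z φ ρ q w)) (𝓝[≠] z p)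
      (𝓝 (c p * Φ (z p) - φ p)) := by
    have h3 := (((hsub.mul_const lam).add (tendsto_sub_mul_uC hu p)).mul
      (hΦ.tendsto.mono_left nhdsWithin_le_nhds)).sub
      (tendsto_sub_mul_source hu.injective hu.pole_im_pos φ ρ q p)
    rw [zero_mul, zero_add] at h3
    refine h3.congr fun w => ?_
    ring
  have h4 := h1.congr' (f₂ := fun w => (w - z p) * ((lam + uC c z w) * Φ w - source z φ ρ q w)) (by
    filter_upwards [hne, nhdsWithin_le_nhds hnhds] with w hw hw2
    rw [hs.ode w hw2 hw])
  exact sub_eq_zero.mp (tendsto_nhds_unique h2 h4)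

theorem HardySolution.hasDerivAt (hu : IsRationalPotential c z) (hε : 0 < ε)
    (hs : HardySolution c z ε lam φ ρ q η Φ) (x : ℝ) :
    HasDerivAt (fun x : ℝ => Φ x)
      (Complex.I / ε * ((lam + u₀ c z x) * Φ x - source z φ ρ q x)) x := by
  have h1 : HasDerivAt Φ (deriv Φ x) (x : ℂ) := (hs.differentiableAt (by simp)).hasDerivAt
  have h2 := hs.ode x (by simpa using hs.eta_pos) (fun p h => by
    have := hu.pole_im_pos p
    rw [← h] at this
    simp at this)
  rw [← uC_ofReal, ← h2]
  have hε' : (ε : ℂ) ≠ 0 := by exact_mod_cast hε.ne'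
  convert h1.comp_ofReal using 1
  field_simp
  rw [Complex.I_sq]; ring

/-- Schwarz reflection of `∑ₚ φₚ / (w - zₚ)`. -/
noncomputable def sourceStar (z φ : Fin P → ℂ) (w : ℂ) : ℂ := ∑ p, star (φ p) * (1 / (w - star (z p)))

theorem upperDecay_sourceStar (hz : ∀ p, 0 < (z p).im) (φ : Fin P → ℂ) :
    UpperDecay 1 (sourceStar z φ) :=
  UpperDecay.sum _ fun p => (upperDecay_inv_sub (by simpa using hz p)).const_mul _

theorem star_source_ofReal (z φ : Fin P → ℂ) (ρ : ℂ) (q : Fin P) (x : ℝ) :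
    star (source z φ ρ q x) = sourceStar z φ x - star ρ / (x - z q) := by
  simp [source, sourceStar, div_eq_mul_inv]

theorem UpperDecay.integrable_div_sub {Φ : ℂ → ℂ} (h : UpperDecay 1 Φ) {w : ℂ} (hw : 0 < w.im) :
    Integrable (fun x : ℝ => Φ x / (x - w)) := by
  have hne : ∀ x : ℝ, (x : ℂ) - w ≠ 0 := by
    intro x h0
    have := congrArg Complex.im h0
    simp at this
    linarith
  refine (h.integrable_normSq.add (integral_inv_normSq_sub hw).1).mono'
    (h.continuous_ofReal.div (by fun_prop) hne).aestronglyMeasurable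
    (Eventually.of_forall fun x => ?_)
  rw [norm_div, div_eq_mul_inv, Pi.add_apply, ← inv_pow]
  nlinarith [sq_nonneg (‖Φ x‖ - ‖(x : ℂ) - w‖⁻¹), sq_nonneg (‖Φ x‖ + ‖(x : ℂ) - w‖⁻¹)]

/-- On the real line the conjugate of the source extends holomorphically to the upper half-plane
except for the pole of the `ρ` term, which is reflected to `z q`. The holomorphic part integrates to
zero and Cauchy's formula evaluates the rest. -/
theorem integral_starSource_mul (hz : ∀ p, 0 < (z p).im) (h : UpperDecay 1 Φ) :
    Integrable (fun x : ℝ => star (source z φ ρ q x) * Φ x) ∧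
    ∫ x : ℝ, star (source z φ ρ q x) * Φ x = -(2 * Real.pi * Complex.I * (star ρ * Φ (z q))) := by
  have h1 := (upperDecay_sourceStar hz φ).mul h
  have h2 := (h.integrable_div_sub (hz q)).const_mul (star ρ)
  have e : ∀ x : ℝ, star (source z φ ρ q x) * Φ x =
      sourceStar z φ x * Φ x - star ρ * (Φ x / (x - z q)) := by
    intro x
    rw [star_source_ofReal]; ring
  simp_rw [e]
  refine ⟨h1.integrable.sub h2, ?_⟩
  rw [integral_sub h1.integrable h2, h1.integral_eq_zero, integral_const_mul, h.cauchy (hz q)]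
  ring

theorem UpperDecay.tendsto_ofReal_atTop (h : UpperDecay 1 Φ) :
    Tendsto (fun x : ℝ => Φ x) atTop (𝓝 0) := by
  obtain ⟨C, hC, hc⟩ := h.decay
  refine squeeze_zero_norm' (a := fun x : ℝ => C / x) ?_ (tendsto_const_nhds.div_atTop tendsto_id)
  filter_upwards [eventually_gt_atTop 0] with x hx
  refine (hc x (by simp)).trans ?_
  rw [pow_one, Complex.norm_real, Real.norm_of_nonneg hx.le]
  gcongr
  linarith

theorem UpperDecay.tendsto_ofReal_atBot (h : UpperDecay 1 Φ) :
    Tendsto (fun x : ℝ => Φ x) atBot (𝓝 0) := by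
  obtain ⟨C, hC, hc⟩ := h.decay
  refine squeeze_zero_norm' (a := fun x : ℝ => C / |x|) ?_
    (tendsto_const_nhds.div_atTop tendsto_abs_atBot_atTop)
  filter_upwards [eventually_lt_atBot 0] with x hx
  refine (hc x (by simp)).trans ?_
  rw [pow_one, Complex.norm_real, Real.norm_eq_abs]
  have := abs_pos.mpr hx.ne
  gcongr
  linarith

/-- The energy identity. -/
theorem HardySolution.energy (hu : IsRationalPotential c z) (hε : 0 < ε)
    (hs : HardySolution c z ε lam φ ρ q η Φ) :
    lam.im * ∫ x : ℝ, ‖Φ x‖ ^ 2 = 2 * Real.pi * (star ρ * Φ (z q)).re := by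
  obtain ⟨hi, he⟩ := integral_starSource_mul (φ := φ) (ρ := ρ) (q := q) hu.pole_im_pos hs.decay
  have hε' : (ε : ℂ) ≠ 0 := by exact_mod_cast hε.ne'
  -- The real part of `lam + u₀` only rotates the phase, so only `lam.im` and the source remain. The
  -- integral of this derivative vanishes because `Φ` tends to zero at both ends.
  have hd : ∀ x : ℝ, HasDerivAt (fun x : ℝ => ‖Φ x‖ ^ 2)
      (2 / ε * (-(lam.im * ‖Φ x‖ ^ 2) - (star (source z φ ρ q x) * Φ x).im)) x := by
    intro x
    have h1 := hs.hasDerivAt hu hε x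
    have h2 := h1.norm_sq
    convert h2 using 1
    set T := source z φ ρ q x
    rw [Complex.inner, ← Complex.normSq_eq_norm_sq, Complex.normSq_apply]
    simp [Complex.mul_re, Complex.mul_im]
    field_simp
    ring
  have hint : Integrable (fun x : ℝ =>
      2 / ε * (-(lam.im * ‖Φ x‖ ^ 2) - (star (source z φ ρ q x) * Φ x).im)) :=
    (((hs.decay.integrable_normSq.const_mul _).neg).sub hi.im).const_mul _
  have h0 := integral_of_hasDerivAt_of_tendsto hd hint (m := 0) (n := 0)
    (by simpa using hs.decay.tendsto_ofReal_atBot.norm.pow 2)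
    (by simpa using hs.decay.tendsto_ofReal_atTop.norm.pow 2)
  rw [integral_const_mul, integral_sub (f := fun x : ℝ => -(lam.im * ‖Φ x‖ ^ 2))
    (g := fun x : ℝ => (star (source z φ ρ q x) * Φ x).im)
    (hs.decay.integrable_normSq.const_mul _).neg hi.im, integral_neg, integral_const_mul] at h0
  have h3 : ∫ x : ℝ, (star (source z φ ρ q x) * Φ x).im =
      (∫ x : ℝ, star (source z φ ρ q x) * Φ x).im := by
    have := integral_im hi
    simpa using this
  rw [h3, he] at h0
  have h4 : (2 / ε) ≠ 0 := by positivity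
  have h5 : -(lam.im * ∫ x : ℝ, ‖Φ x‖ ^ 2) -
      (-(2 * Real.pi * Complex.I * (star ρ * Φ (z q)))).im = 0 := by
    simpa [h4] using h0
  have h6 : (-(2 * Real.pi * Complex.I * (star ρ * Φ (z q)))).im =
      -(2 * Real.pi * (star ρ * Φ (z q)).re) := by
    set s := star ρ * Φ (z q)
    simp
  rw [h6] at h5
  linarith

/-- The residue relation turns the point bound at `z p` into a bound of the coefficient; in
particular a solution of zero norm has no source coefficients. -/
theorem HardySolution.normSq_coeff_le (hu : IsRationalPotential c z)
    (hs : HardySolution c z ε lam φ ρ q η Φ) (p : Fin P) :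
    ‖φ p‖ ^ 2 ≤ ‖c p‖ ^ 2 / (4 * Real.pi * (z p).im) * ∫ x : ℝ, ‖Φ x‖ ^ 2 := by
  have hp := hu.pole_im_pos p
  have := hs.decay.normSq_le hp
  rw [← hs.coeff_mul_eq hu p, norm_mul, mul_pow, div_mul_eq_mul_div, le_div_iff₀ (by positivity)]
  nlinarith [sq_nonneg ‖c p‖]

theorem HardySolution.eq_zero_of_integral_eq_zero (hu : IsRationalPotential c z)
    (hs : HardySolution c z ε lam φ ρ q η Φ) (h : ∫ x : ℝ, ‖Φ x‖ ^ 2 = 0) : φ = 0 := by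
  funext p
  have := hs.normSq_coeff_le hu p
  rw [h, mul_zero] at this
  have h1 : ‖φ p‖ ^ 2 = 0 := le_antisymm this (by positivity)
  simpa using h1

/-- This is the reason why eigenvalues are real: for `ρ = 0` the energy identity leaves no norm. -/
theorem HardySolution.eq_zero_of_im_ne_zero (hu : IsRationalPotential c z) (hε : 0 < ε)
    (hs : HardySolution c z ε lam φ 0 q η Φ) (h : lam.im ≠ 0) : φ = 0 := by
  refine hs.eq_zero_of_integral_eq_zero hu ?_
  have := hs.energy hu hε
  simpa [h] using this

end BO

/-! ### Wu's identity for the norm of an eigenfunction. -/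

namespace BO

variable {P : ℕ} {c z : Fin P → ℂ} {ε : ℝ} {lam : ℂ} {φ : Fin P → ℂ} {ρ : ℂ} {q : Fin P} {η : ℝ}
  {Φ : ℂ → ℂ}

theorem tendsto_mul_I_atTop (a : ℂ) :
    Tendsto (fun T : ℝ => 1 / ((T : ℂ) * Complex.I - a)) atTop (𝓝 0) := by
  refine squeeze_zero_norm' (a := fun T : ℝ => 1 / (T - ‖a‖)) ?_
    (tendsto_const_nhds.div_atTop (tendsto_atTop_add_const_right _ _ tendsto_id))
  filter_upwards [eventually_gt_atTop ‖a‖] with T hT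
  have h0 := norm_nonneg a
  rw [norm_div, norm_one]
  have h1 : T - ‖a‖ ≤ ‖(T : ℂ) * Complex.I - a‖ := by
    refine le_trans ?_ (norm_sub_norm_le _ _)
    simp [abs_of_pos (h0.trans_lt hT)]
  have : 0 < T - ‖a‖ := by linarith
  gcongr

theorem tendsto_mul_I_mul_div (a b : ℂ) :
    Tendsto (fun T : ℝ => ((T : ℂ) * Complex.I) * (b * (1 / ((T : ℂ) * Complex.I - a)))) atTop (𝓝 b) := by
  have h := (tendsto_mul_I_atTop a).const_mul (b * a)
  have h2 := h.const_add b
  rw [mul_zero, add_zero] at h2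
  refine h2.congr' ?_
  filter_upwards [eventually_gt_atTop ‖a‖] with T hT
  have : (T : ℂ) * Complex.I - a ≠ 0 := by
    intro h0
    have h1 := congrArg norm (sub_eq_zero.mp h0)
    simp [abs_of_pos ((norm_nonneg a).trans_lt hT)] at h1
    linarith
  field_simp
  ring

theorem tendsto_mul_sourceStar (z φ : Fin P → ℂ) :
    Tendsto (fun T : ℝ => ((T : ℂ) * Complex.I) * sourceStar z φ ((T : ℂ) * Complex.I)) atTop
      (𝓝 (star (∑ p, φ p))) := by
  simp_rw [sourceStar, Finset.mul_sum, star_sum]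
  exact tendsto_finsetSum _ fun p _ => tendsto_mul_I_mul_div _ _

theorem tendsto_uC_mul_I (c z : Fin P → ℂ) :
    Tendsto (fun T : ℝ => uC c z ((T : ℂ) * Complex.I)) atTop (𝓝 0) := by
  have : Tendsto (fun T : ℝ => uC c z ((T : ℂ) * Complex.I)) atTop
      (𝓝 (∑ p, (c p * 0 + star (c p) * 0))) := by
    simp only [uC, div_eq_mul_one_div (c _), div_eq_mul_one_div (star (c _))]
    exact tendsto_finsetSum _ fun p _ => ((tendsto_mul_I_atTop _).const_mul _).add
      ((tendsto_mul_I_atTop _).const_mul _)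
  simpa using this

/-- In the equation at `i T`, multiplied by `i T`, the potential term vanishes since `uC → 0` while
`T Φ` stays bounded, and the derivative term is `O(T^(-1/2))` by the point bound for derivatives.
Only `lam Φ` balances the source. -/
theorem HardySolution.tendsto_mul (hs : HardySolution c z ε lam φ 0 q η Φ) (hlam : lam ≠ 0) :
    Tendsto (fun T : ℝ => ((T : ℂ) * Complex.I) * Φ ((T : ℂ) * Complex.I)) atTop
      (𝓝 ((∑ p, φ p) / lam)) := by
  obtain ⟨C, hC, hc⟩ := hs.decay.decay
  set N := ∫ x : ℝ, ‖Φ x‖ ^ 2 with hN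
  have hN0 : 0 ≤ N := integral_nonneg fun x => by positivity
  have h1 : Tendsto (fun T : ℝ => ((T : ℂ) * Complex.I) * source z φ 0 q ((T : ℂ) * Complex.I)) atTop
      (𝓝 (∑ p, φ p)) := by
    simp only [source, zero_div, sub_zero, Finset.mul_sum, div_eq_mul_one_div (φ _)]
    exact tendsto_finsetSum _ fun p _ => tendsto_mul_I_mul_div _ _
  have h2 : Tendsto (fun T : ℝ => uC c z ((T : ℂ) * Complex.I) *
      (((T : ℂ) * Complex.I) * Φ ((T : ℂ) * Complex.I))) atTop (𝓝 0) := by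
    refine squeeze_zero_norm' (a := fun T : ℝ => ‖uC c z ((T : ℂ) * Complex.I)‖ * C) ?_
      (by simpa using (tendsto_uC_mul_I c z).norm.mul_const C)
    filter_upwards [eventually_gt_atTop 0] with T hT
    rw [norm_mul]
    gcongr
    have h3 := hc ((T : ℂ) * Complex.I) (by simp [hT.le])
    rw [pow_one, le_div_iff₀ (by positivity)] at h3
    rw [norm_mul]
    nlinarith [norm_nonneg (Φ ((T : ℂ) * Complex.I))]
  have h3 : Tendsto (fun T : ℝ => ((T : ℂ) * Complex.I) *
      (-Complex.I * ε * deriv Φ ((T : ℂ) * Complex.I))) atTop (𝓝 0) := by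
    refine squeeze_zero_norm' (a := fun T : ℝ => |ε| * Real.sqrt (2 / Real.pi * N / T)) ?_ ?_
    · filter_upwards [eventually_gt_atTop 0] with T hT
      have h4 := hs.decay.normSq_deriv_le (w := (T : ℂ) * Complex.I) (by simpa using hT)
      have h5 : T * ‖deriv Φ ((T : ℂ) * Complex.I)‖ ≤ Real.sqrt (2 / Real.pi * N / T) := by
        refine Real.le_sqrt_of_sq_le ?_
        have e : ((T : ℂ) * Complex.I).im = T := by simp
        rw [e] at h4
        rw [mul_pow]
        calc _ ≤ T ^ 2 * (2 / (Real.pi * T ^ 3) * N) := by gcongr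
          _ = _ := by field_simp
      calc _ = |ε| * (T * ‖deriv Φ ((T : ℂ) * Complex.I)‖) := by
            simp [abs_of_pos hT]; ring
        _ ≤ _ := by gcongr
    · have : Tendsto (fun T : ℝ => 2 / Real.pi * N / T) atTop (𝓝 0) :=
        tendsto_const_nhds.div_atTop tendsto_id
      simpa using ((Real.continuous_sqrt.tendsto 0).comp this).const_mul |ε|
  have h4 := ((h3.add h1).sub h2).div_const lam
  rw [zero_add, sub_zero] at h4
  refine h4.congr' ?_
  have : ∀ᶠ T : ℝ in atTop, ∀ p, (T : ℂ) * Complex.I ≠ z p := by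
    rw [eventually_all]
    intro p
    filter_upwards [eventually_gt_atTop ‖z p‖] with T hT h0
    rw [← h0] at hT
    simp at hT
    exact absurd hT (not_lt.mpr (le_abs_self T))
  filter_upwards [this, eventually_gt_atTop 0] with T hT hT0
  have h5 := hs.ode _ (by simp; linarith [hs.eta_pos]) hT
  rw [h5]
  field_simp
  ring

/-- A bounded holomorphic substitute for the weight `w`, to which it tends as `T → ∞`. The weight
`w` itself would leave products with first order decay only, for which the contour argument fails.
-/
theorem upperDecay_cutoff {T : ℝ} (hT : 0 < T) :
    UpperDecay 0 (fun w => Complex.I * T * w / (w + T * Complex.I)) := by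
  have hne : ∀ w : ℂ, 0 ≤ w.im → w + T * Complex.I ≠ 0 := by
    intro w hw h
    have := congrArg Complex.im h
    simp at this
    linarith
  refine UpperDecay.of_large (C := T) (R := 0) ?_ ?_ ?_
  · exact ContinuousOn.div (by fun_prop) (by fun_prop) hne
  · exact DifferentiableOn.div (by fun_prop) (by fun_prop) fun w hw => hne w (le_of_lt hw)
  · intro w hw _
    have hp := norm_pos_iff.mpr (hne w hw)
    rw [norm_div, pow_zero, div_one, div_le_iff₀ hp, norm_mul, norm_mul, Complex.norm_I, one_mul,
      Complex.norm_real, Real.norm_of_nonneg hT.le]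
    gcongr
    rw [Complex.norm_def, Complex.norm_def]
    apply Real.sqrt_le_sqrt
    simp [Complex.normSq_apply]
    nlinarith

/-- Wu's identity for the norm of an eigenfunction. -/
theorem HardySolution.norm_identity (hu : IsRationalPotential c z) (hε : 0 < ε) {lam : ℝ}
    (hs : HardySolution c z ε lam φ 0 q η Φ) (hlam : lam ≠ 0) :
    lam * (ε * ∫ x : ℝ, ‖Φ x‖ ^ 2) = -(2 * Real.pi * ‖∑ p, φ p‖ ^ 2) := by
  have hε' : (ε : ℂ) ≠ 0 := by exact_mod_cast hε.ne'
  have hS := upperDecay_sourceStar hu.pole_im_pos φ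
  set N := ∫ x : ℝ, ‖Φ x‖ ^ 2 with hN
  set s : ℂ := ∑ p, φ p with hsdef
  -- the cutoff identity
  have key : ∀ T : ℝ, 0 < T →
      ε * ∫ x : ℝ, (T ^ 2 / ((x : ℂ) + T * Complex.I) ^ 2) * ((‖Φ x‖ ^ 2 : ℝ) : ℂ) =
      -(2 * Real.pi * star ((T * Complex.I * sourceStar z φ (T * Complex.I)) *
        (T * Complex.I * Φ (T * Complex.I)))) * (-1) := by
    intro T hT
    have hxT : ∀ x : ℝ, (x : ℂ) + T * Complex.I ≠ 0 := by
      intro x h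
      have := congrArg Complex.im h
      simp at this
      linarith
    have hTim : 0 < ((T : ℂ) * Complex.I).im := by simpa using hT
    have hcut := upperDecay_cutoff hT
    set χ : ℂ → ℂ := fun w => Complex.I * T * w / (w + T * Complex.I) with hχ
    -- first product integrates to zero
    have hA := (hcut.mul (hS.mul hs.decay))
    have hA0 := hA.integral_eq_zero
    -- second product by Cauchy
    have hw0 : UpperDecay 0 (fun w => w * sourceStar z φ w) := by
      obtain ⟨C, hC, hc⟩ := hS.decay
      refine ⟨continuousOn_id.mul hS.cont, differentiableOn_id.mul hS.diff, C, hC, fun w hw => ?_⟩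
      have := hc w hw
      rw [pow_one, le_div_iff₀ (by positivity)] at this
      rw [norm_mul, pow_zero, div_one]
      nlinarith [norm_nonneg w, norm_nonneg (sourceStar z φ w)]
    have hB := hw0.mul hs.decay
    have hBi := (hB.integrable_div_sub hTim).const_mul (-Complex.I * T)
    have hBc := hB.cauchy hTim
    -- Besides the derivative of the weight there are two conjugate halves. One is a boundary value
    -- of a holomorphic function. Since `star (χ x) = -I T x / (x - T I)`, the other is the
    -- conjugate of a function whose only pole in the upper half-plane is `T I`.
    have hd : ∀ x : ℝ, HasDerivAt (fun x : ℝ => χ x * ((‖Φ x‖ ^ 2 : ℝ) : ℂ))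
        (-(T ^ 2 / ((x : ℂ) + T * Complex.I) ^ 2) * ((‖Φ x‖ ^ 2 : ℝ) : ℂ) +
          Complex.I / ε * (χ x * (sourceStar z φ x * Φ x) -
            star (-Complex.I * T * (x * sourceStar z φ x * Φ x / (x - T * Complex.I))))) x := by
      intro x
      have h1 : HasDerivAt χ (-(T ^ 2 / ((x : ℂ) + T * Complex.I) ^ 2)) (x : ℂ) := by
        have := (((hasDerivAt_id (x : ℂ)).const_mul (Complex.I * T)).div
          ((hasDerivAt_id (x : ℂ)).add_const (T * Complex.I)) (hxT x))
        refine HasDerivAt.congr_deriv this ?_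
        simp only [id]
        rw [← neg_div]
        congr 1
        linear_combination (T : ℂ) ^ 2 * Complex.I_sq
      have h2 := hs.hasDerivAt hu hε x
      have h3 : HasDerivAt (fun x : ℝ => star (Φ x)) _ x := h2.star
      have h4 := h1.comp_ofReal.mul (h2.mul h3)
      have h5 : ∀ y : ℝ, ((‖Φ y‖ ^ 2 : ℝ) : ℂ) = Φ y * star (Φ y) := by
        intro y
        rw [← Complex.normSq_eq_norm_sq, ← Complex.mul_conj]; rfl
      simp_rw [h5]
      refine HasDerivAt.congr_deriv h4 ?_
      simp only [Pi.mul_apply]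
      have e1 : source z φ 0 q x = star (sourceStar z φ x) := by
        have := star_source_ofReal z φ 0 q x
        rw [star_zero, zero_div, sub_zero] at this
        rw [← this, star_star]
      rw [e1]
      have hx2 : (x : ℂ) - T * Complex.I ≠ 0 := by
        intro h
        have := congrArg Complex.im h
        simp at this
        linarith
      have hx3 := hxT x
      simp only [hχ, star_mul', star_sub, star_div₀, star_neg, star_add, Complex.star_def, Complex.conj_I,
        Complex.conj_ofReal, Complex.conj_conj, mul_neg, sub_neg_eq_add]
      field_simp
      ring
    have hi1 : Integrable (fun x : ℝ =>
        -(T ^ 2 / ((x : ℂ) + T * Complex.I) ^ 2) * ((‖Φ x‖ ^ 2 : ℝ) : ℂ)) := by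
      refine hs.decay.integrable_normSq.mono' ?_ (Eventually.of_forall fun x => ?_)
      · refine Continuous.aestronglyMeasurable ?_
        refine Continuous.mul (Continuous.neg (Continuous.div (by fun_prop) (by fun_prop) ?_)) ?_
        · exact fun x => pow_ne_zero _ (hxT x)
        · exact Complex.continuous_ofReal.comp (hs.decay.continuous_ofReal.norm.pow 2)
      · rw [norm_mul, norm_neg, Complex.norm_real, norm_div, norm_pow, norm_pow, Complex.norm_real,
          Real.norm_of_nonneg (by positivity : (0:ℝ) ≤ ‖Φ x‖ ^ 2), Real.norm_of_nonneg hT.le]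
        refine mul_le_of_le_one_left (by positivity) ?_
        rw [div_le_one (pow_pos (norm_pos_iff.mpr (hxT x)) 2)]
        gcongr
        refine le_trans ?_ (Complex.abs_im_le_norm _)
        simp [le_abs_self]
    have hBi' : Integrable (fun x : ℝ =>
        star (-Complex.I * T * (x * sourceStar z φ x * Φ x / (x - T * Complex.I)))) := by
      have := (LinearIsometryEquiv.integrable_comp_iff Complex.conjLIE).mpr hBi
      simpa using this
    have hi2 : Integrable (fun x : ℝ => Complex.I / ε * (χ x * (sourceStar z φ x * Φ x) -
            star (-Complex.I * T * (x * sourceStar z φ x * Φ x / (x - T * Complex.I))))) :=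
      (hA.integrable.sub hBi').const_mul _
    have hχb : ∀ x : ℝ, ‖χ x‖ ≤ T := by
      intro x
      rw [hχ]
      simp only
      rw [norm_div, div_le_iff₀ (norm_pos_iff.mpr (hxT x)), norm_mul, norm_mul, Complex.norm_I,
        one_mul, Complex.norm_real T, Real.norm_of_nonneg hT.le]
      gcongr
      refine le_trans ?_ (Complex.abs_re_le_norm _)
      simp
    have hlim : ∀ l : Filter ℝ, Tendsto (fun x : ℝ => Φ x) l (𝓝 0) →
        Tendsto (fun x : ℝ => χ x * ((‖Φ x‖ ^ 2 : ℝ) : ℂ)) l (𝓝 0) := by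
      intro l hl
      refine squeeze_zero_norm (a := fun x : ℝ => T * ‖Φ x‖ ^ 2) (fun x => ?_)
        (by simpa using (hl.norm.pow 2).const_mul T)
      rw [norm_mul, Complex.norm_real, Real.norm_of_nonneg (by positivity : (0:ℝ) ≤ ‖Φ x‖ ^ 2)]
      gcongr
      exact hχb x
    have h0 := integral_of_hasDerivAt_of_tendsto hd (hi1.add hi2)
      (hlim _ hs.decay.tendsto_ofReal_atBot) (hlim _ hs.decay.tendsto_ofReal_atTop)
    rw [integral_add hi1 hi2, integral_const_mul, integral_sub hA.integrable hBi', hA0, zero_sub,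
      sub_zero] at h0
    have hst : ∫ x : ℝ, star (-Complex.I * T * (x * sourceStar z φ x * Φ x / (x - T * Complex.I))) =
        star (∫ x : ℝ, -Complex.I * T * (x * sourceStar z φ x * Φ x / (x - T * Complex.I))) :=
      integral_conj
    rw [hst, integral_const_mul, hBc] at h0
    have hneg : ∫ x : ℝ, -(T ^ 2 / ((x : ℂ) + T * Complex.I) ^ 2) * ((‖Φ x‖ ^ 2 : ℝ) : ℂ) =
        -∫ x : ℝ, (T ^ 2 / ((x : ℂ) + T * Complex.I) ^ 2) * ((‖Φ x‖ ^ 2 : ℝ) : ℂ) := by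
      rw [← integral_neg]
      simp_rw [neg_mul]
    rw [hneg] at h0
    set X := star (-Complex.I * T * (2 * Real.pi * Complex.I *
          (T * Complex.I * sourceStar z φ (T * Complex.I) * Φ (T * Complex.I)))) with hX
    have h1 : ε * ∫ x : ℝ, (T ^ 2 / ((x : ℂ) + T * Complex.I) ^ 2) * ((‖Φ x‖ ^ 2 : ℝ) : ℂ) =
        -(Complex.I * X) := by
      have h2 : (ε : ℂ) * (Complex.I / ε) = Complex.I := by field_simp
      linear_combination (-(ε : ℂ)) * h0 - X * h2
    rw [h1, hX]
    simp only [star_mul', star_neg, Complex.star_def, Complex.conj_I,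
        Complex.conj_ofReal, map_ofNat]
    ring_nf
    simp only [Complex.I_sq, Complex.I_pow_four]
    ring
  -- pass to the limit
  have hL : Tendsto (fun T : ℝ => (ε : ℂ) * ∫ x : ℝ, (T ^ 2 / ((x : ℂ) + T * Complex.I) ^ 2) *
      ((‖Φ x‖ ^ 2 : ℝ) : ℂ)) atTop (𝓝 (ε * ∫ x : ℝ, (-1) * ((‖Φ x‖ ^ 2 : ℝ) : ℂ))) := by
    refine Tendsto.const_mul _ ?_
    refine tendsto_integral_filter_of_dominated_convergence (fun x : ℝ => ‖Φ x‖ ^ 2) ?_ ?_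
      hs.decay.integrable_normSq ?_
    · filter_upwards [eventually_gt_atTop 0] with T hT
      refine Continuous.aestronglyMeasurable ?_
      refine Continuous.mul (Continuous.div (by fun_prop) (by fun_prop) fun x => pow_ne_zero _ ?_)
        (Complex.continuous_ofReal.comp (hs.decay.continuous_ofReal.norm.pow 2))
      intro h
      have := congrArg Complex.im h
      simp at this
      linarith
    · filter_upwards [eventually_gt_atTop 0] with T hT
      refine Eventually.of_forall fun x => ?_
      have hp : 0 < ‖(x : ℂ) + T * Complex.I‖ := norm_pos_iff.mpr (by
        intro h
        have := congrArg Complex.im h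
        simp at this
        linarith)
      rw [norm_mul, Complex.norm_real, norm_div, norm_pow, norm_pow, Complex.norm_real,
          Real.norm_of_nonneg (by positivity : (0:ℝ) ≤ ‖Φ x‖ ^ 2), Real.norm_of_nonneg hT.le]
      refine mul_le_of_le_one_left (by positivity) ?_
      rw [div_le_one (pow_pos hp 2)]
      gcongr
      refine le_trans ?_ (Complex.abs_im_le_norm _)
      simp [le_abs_self]
    · refine Eventually.of_forall fun x => ?_
      refine Tendsto.mul_const _ ?_
      have h := ((tendsto_mul_I_mul_div (-(x : ℂ)) 1).pow 2).neg
      rw [one_pow] at h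
      refine h.congr fun T => ?_
      rw [one_mul, mul_one_div, div_pow, mul_pow, Complex.I_sq]
      ring
  have hR : Tendsto (fun T : ℝ => -(2 * Real.pi * star ((T * Complex.I * sourceStar z φ (T * Complex.I)) *
        (T * Complex.I * Φ (T * Complex.I)))) * (-1)) atTop
      (𝓝 (-(2 * Real.pi * star (star s * (s / lam))) * (-1))) := by
    have h1 := (tendsto_mul_sourceStar z φ).mul (hs.tendsto_mul (by exact_mod_cast hlam))
    exact (((h1.star).const_mul _).neg).mul_const _
  have h := tendsto_nhds_unique (hL.congr' (by
    filter_upwards [eventually_gt_atTop 0] with T hT using key T hT)) hR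
  rw [integral_const_mul, integral_complex_ofReal, ← hN] at h
  have hlam' : (lam : ℂ) ≠ 0 := by exact_mod_cast hlam
  have h2 : star (star s * (s / lam)) * lam = ((‖s‖ ^ 2 : ℝ) : ℂ) := by
    rw [← Complex.normSq_eq_norm_sq, ← Complex.mul_conj]
    simp only [star_mul', star_div₀, Complex.star_def, Complex.conj_ofReal, Complex.conj_conj]
    field_simp
  have h3 : ((lam * (ε * N) : ℝ) : ℂ) = ((-(2 * Real.pi * ‖s‖ ^ 2) : ℝ) : ℂ) := by
    push_cast at h2 ⊢
    linear_combination (-(lam : ℂ)) * h - 2 * Real.pi * h2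
  exact_mod_cast h3

end BO

/-! ### The exponential off the cuts, and primitives along paths from `i∞`. -/

namespace BO

variable {P : ℕ}

/-- The combination of logarithms in `f`, with free coefficients. -/
noncomputable def logSum (z a b : Fin P → ℂ) (w : ℂ) : ℂ :=
  ∑ p, (a p * (Complex.log (Complex.I * (w - z p)) + Real.pi * Complex.I / 2) +
    b p * (Complex.log (-Complex.I * (w - star (z p))) - Real.pi * Complex.I / 2))

theorem f_eq_logSum (c z : Fin P → ℂ) : f c z = logSum z c (star c) := rfl

/-- `-∞ < Im w` above the conjugate poles, off the upward cuts from the `z p` with `p ∈ s`. -/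
def slitDomain (z : Fin P → ℂ) (s : Set (Fin P)) : Set ℂ :=
  {w | ∀ p, -(z p).im < w.im ∧ (p ∈ s → w.re ≠ (z p).re ∨ w.im < (z p).im)}

theorem isOpen_slitDomain (z : Fin P → ℂ) (s : Set (Fin P)) : IsOpen (slitDomain z s) := by
  have : slitDomain z s = ⋂ p, ({w | -(z p).im < w.im} ∩
      {w | p ∈ s → w.re ≠ (z p).re ∨ w.im < (z p).im}) := by
    ext w; simp [slitDomain]
  rw [this]
  refine isOpen_iInter_of_finite fun p => (isOpen_neg_lt_im _).inter ?_
  by_cases hp : p ∈ s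
  · simp only [hp, true_imp_iff]
    exact (isOpen_ne_fun Complex.continuous_re continuous_const).union
      (isOpen_lt Complex.continuous_im continuous_const)
  · simp [hp]

theorem mem_slitDomain_of_uIcc {z : Fin P → ℂ} {s : Set (Fin P)} (hz : ∀ p, 0 < (z p).im)
    {v w : ℂ} (hw : w ∈ slitDomain z s) (hre : v.re = w.re) (him : v.im ∈ Set.uIcc 0 w.im) :
    v ∈ slitDomain z s := by
  intro p
  obtain ⟨h1, h2⟩ := hw p
  have hp := hz p
  rw [Set.mem_uIcc] at him
  refine ⟨by rcases him with h | h <;> linarith [h.1, h.2], fun hs => ?_⟩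
  rcases h2 hs with h | h
  · left; rwa [hre]
  · right
    rcases him with h' | h' <;> linarith [h'.1, h'.2]

theorem ofReal_mem_slitDomain {z : Fin P → ℂ} {s : Set (Fin P)} (hz : ∀ p, 0 < (z p).im) (x : ℝ) :
    (x : ℂ) ∈ slitDomain z s := by
  intro p
  have := hz p
  simp [this]

theorem slitDomain_ne {z : Fin P → ℂ} {s : Set (Fin P)} {w : ℂ} (hw : w ∈ slitDomain z s) {p : Fin P}
    (hp : p ∈ s) : w - z p ≠ 0 := by
  intro h
  have h1 := (hw p).2 hp
  rw [sub_eq_zero] at h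
  subst h
  simp at h1

theorem slitDomain_ne_star {z : Fin P → ℂ} {s : Set (Fin P)} {w : ℂ} (hw : w ∈ slitDomain z s)
    (p : Fin P) : w - star (z p) ≠ 0 :=
  sub_star_ne_zero (hw p).1

/-- The set `s` collects the cuts that are really present: a logarithm with coefficient zero does
not obstruct differentiability on its cut. This freedom is needed in the exceptional case. -/
theorem hasDerivAt_logSum {z a b : Fin P → ℂ} {s : Set (Fin P)} {w : ℂ} (hw : w ∈ slitDomain z s)
    (ha : ∀ p ∉ s, a p = 0) :
    HasDerivAt (logSum z a b) (∑ p, (a p / (w - z p) + b p / (w - star (z p)))) w := by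
  unfold logSum
  refine HasDerivAt.fun_sum fun p _ => HasDerivAt.add ?_ ?_
  · by_cases hp : p ∈ s
    · have hne := slitDomain_ne hw hp
      have h1 : HasDerivAt (fun w => Complex.I * (w - z p)) (Complex.I * 1) w :=
        ((hasDerivAt_id w).sub_const _).const_mul _
      have h2 := ((h1.clog (by
        rw [Complex.mem_slitPlane_iff]
        rcases (hw p).2 hp with h | h
        · right; simpa [sub_eq_zero] using h
        · left; simpa using h)).add_const (Real.pi * Complex.I / 2)).const_mul (a p)
      refine h2.congr_deriv ?_
      field_simp
    · simp only [ha p hp, zero_mul, zero_div]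
      exact hasDerivAt_const _ _
  · have hne := slitDomain_ne_star hw p
    have h1 : HasDerivAt (fun w => -Complex.I * (w - star (z p))) (-Complex.I * 1) w :=
      ((hasDerivAt_id w).sub_const _).const_mul _
    have h2 := ((h1.clog (by
      rw [Complex.mem_slitPlane_iff]
      left
      have := (hw p).1
      simp
      linarith)).sub_const (Real.pi * Complex.I / 2)).const_mul (b p)
    refine h2.congr_deriv ?_
    field_simp

/-- `e^{-i (lam w + f w) / ε}` for complex `lam`. -/
noncomputable def expF (c z : Fin P → ℂ) (ε : ℝ) (lam w : ℂ) : ℂ :=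
  Complex.exp (-Complex.I * (lam * w + f c z w) / ε)

theorem expFactor_eq (c z : Fin P → ℂ) (ε lam : ℝ) : expFactor c z ε lam = expF c z ε lam := rfl

theorem expF_ne_zero (c z : Fin P → ℂ) (ε : ℝ) (lam w : ℂ) : expF c z ε lam w ≠ 0 :=
  Complex.exp_ne_zero _

theorem hasDerivAt_expF {c z : Fin P → ℂ} {ε : ℝ} {lam w : ℂ} (hw : w ∈ slitDomain z Set.univ) :
    HasDerivAt (expF c z ε lam) (-Complex.I / ε * (lam + uC c z w) * expF c z ε lam w) w := by
  have h1 : HasDerivAt (f c z) (uC c z w) w := by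
    rw [f_eq_logSum]
    exact hasDerivAt_logSum hw (by simp)
  have h2 := ((((hasDerivAt_id w).const_mul lam).add h1).const_mul (-Complex.I)).div_const (ε : ℂ)
  refine h2.cexp.congr_deriv ?_
  simp only [expF, id, Pi.add_apply]
  ring

/-- On the real line the two logarithms for each `p` are conjugate, so `f` is real and the exponent
is imaginary. The exponential is the unimodular integrating factor of the equation. -/
theorem norm_expF_ofReal (c z : Fin P → ℂ) (ε lam : ℝ) (x : ℝ)
    (hz : ∀ p, 0 < (z p).im) : ‖expF c z ε lam x‖ = 1 := by
  have hreal : (starRingEnd ℂ) (f c z x) = f c z x := by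
    unfold f
    rw [map_sum]
    refine Finset.sum_congr rfl fun p _ => ?_
    have h1 : (Complex.I * (x - z p)).arg ≠ Real.pi := by
      rw [Ne, Complex.arg_eq_pi_iff]
      have := hz p
      simp
      intro h; linarith
    have h2 : (starRingEnd ℂ) (Complex.log (Complex.I * (x - z p))) =
        Complex.log (-Complex.I * (x - star (z p))) := by
      rw [← Complex.log_conj _ h1]
      simp
    have h3 : (starRingEnd ℂ) (Complex.log (-Complex.I * (x - star (z p)))) =
        Complex.log (Complex.I * (x - z p)) := by
      rw [← h2, Complex.conj_conj]
    set l₁ := Complex.log (Complex.I * (x - z p))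
    set l₂ := Complex.log (-Complex.I * (x - star (z p)))
    simp only [map_add, map_mul, map_sub, map_div₀, h2, h3, Complex.conj_I, Complex.conj_ofReal,
      map_ofNat, Complex.star_def, Complex.conj_conj]
    ring
  have h4 : (lam : ℂ) * x + f c z x = ((lam * x + (f c z x).re : ℝ) : ℂ) := by
    rw [← Complex.conj_eq_iff_re.mp hreal]; simp
  rw [expF, h4, Complex.norm_exp]
  have : (-Complex.I * ((lam * x + (f c z x).re : ℝ) : ℂ) / ε).re = 0 := by
    rw [Complex.div_ofReal_re, neg_mul, Complex.neg_re, Complex.I_mul_re, Complex.ofReal_im]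
    simp
  rw [this, Real.exp_zero]

/-- The primitive that vanishes at `i∞` to the left of all the cuts. -/
noncomputable def primitive [NeZero P] (z : Fin P → ℂ) (g : ℂ → ℂ) (w : ℂ) : ℂ :=
  integralDownTo g (leftAbscissa z) w.re + Complex.I * ∫ y in (0 : ℝ)..w.im, g (w.re + y * Complex.I)

/-- Near `w₀` the primitive differs from its value at `w₀` by a wedge integral, whose derivative is
known. -/
theorem hasDerivAt_primitive [NeZero P] {z : Fin P → ℂ} (hz : ∀ p, 0 < (z p).im) {g : ℂ → ℂ}
    (hg : DifferentiableOn ℂ g (slitDomain z Set.univ)) {w₀ : ℂ} (hw : w₀ ∈ slitDomain z Set.univ) :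
    HasDerivAt (primitive z g) (g w₀) w₀ := by
  obtain ⟨r, hr, hball⟩ := Metric.isOpen_iff.mp (isOpen_slitDomain z Set.univ) w₀ hw
  have hgb := hg.mono hball
  have hwedge := (hgb.isConservativeOn).hasDerivAt_wedgeIntegral hgb.continuousOn
    (Metric.mem_ball_self hr)
  have hvert : ∀ {w : ℂ}, w ∈ slitDomain z Set.univ →
      ContinuousOn (fun y : ℝ => g (w.re + y * Complex.I)) (Set.uIcc 0 w.im) := by
    intro w hw
    refine hg.continuousOn.comp (by fun_prop) fun y hy => ?_
    exact mem_slitDomain_of_uIcc hz hw (by simp) (by simpa using hy)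
  have hreal : Continuous (fun x : ℝ => g x) :=
    hg.continuousOn.comp_continuous Complex.continuous_ofReal fun x => ofReal_mem_slitDomain hz x
  have heq : ∀ w ∈ Metric.ball w₀ r,
      primitive z g w = primitive z g w₀ + Complex.wedgeIntegral w₀ w g := by
    intro w hwb
    have hcorner : (w.re + w₀.im * Complex.I : ℂ) ∈ slitDomain z Set.univ := by
      apply hball
      rw [Metric.mem_ball, Complex.dist_eq] at hwb ⊢
      refine lt_of_le_of_lt ?_ hwb
      have : (w.re + w₀.im * Complex.I : ℂ) - w₀ = ((w - w₀).re : ℝ) := by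
        apply Complex.ext <;> simp
      rw [this, Complex.norm_real]
      exact Complex.abs_re_le_norm _
    -- The rectangle between the real axis and the height of `w₀` avoids the cuts because vertical
    -- motion towards the real axis never leaves `slitDomain`.
    have hrect := Complex.integral_boundary_rect_eq_zero_of_differentiableOn g (w₀.re : ℂ)
      (w.re + w₀.im * Complex.I) (hg.mono (by
        intro v hv
        simp only [Complex.ofReal_re, Complex.ofReal_im, Complex.add_re, Complex.mul_re,
          Complex.I_re, mul_zero, Complex.I_im, mul_one, sub_self, add_zero, Complex.add_im,
          Complex.mul_im, zero_add] at hv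
        have h1 : (v.re + w₀.im * Complex.I : ℂ) ∈ slitDomain z Set.univ := by
          apply hball
          rw [Metric.mem_ball, Complex.dist_eq] at hwb ⊢
          refine lt_of_le_of_lt ?_ hwb
          have : (v.re + w₀.im * Complex.I : ℂ) - w₀ = ((v.re - w₀.re : ℝ) : ℂ) := by
            apply Complex.ext <;> simp
          rw [this, Complex.norm_real, Real.norm_eq_abs]
          refine le_trans ?_ (Complex.abs_re_le_norm _)
          rw [Complex.sub_re]
          exact Set.abs_sub_left_of_mem_uIcc hv.1
        exact mem_slitDomain_of_uIcc hz h1 (by simp) (by simpa using hv.2)))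
    simp only [Complex.ofReal_re, Complex.ofReal_im, Complex.add_re, Complex.mul_re,
          Complex.I_re, mul_zero, Complex.I_im, mul_one, sub_self, add_zero, Complex.add_im,
          Complex.mul_im, zero_add, Complex.ofReal_zero, zero_mul, smul_eq_mul] at hrect
    have hw' := hball hwb
    have hsplit1 : (∫ x in (leftAbscissa z)..w.re, g (x : ℂ)) =
        (∫ x in (leftAbscissa z)..w₀.re, g (x : ℂ)) + ∫ x in w₀.re..w.re, g (x : ℂ) :=
      (intervalIntegral.integral_add_adjacent_intervals (hreal.intervalIntegrable _ _)
        (hreal.intervalIntegrable _ _)).symm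
    have hi1 : IntervalIntegrable (fun y : ℝ => g (w.re + y * Complex.I)) volume 0 w₀.im := by
      have := (hvert hcorner).intervalIntegrable (μ := volume)
      simpa using this
    have hi2 : IntervalIntegrable (fun y : ℝ => g (w.re + y * Complex.I)) volume 0 w.im :=
      (hvert hw').intervalIntegrable
    have hsplit2 : (∫ y in (0:ℝ)..w.im, g (w.re + y * Complex.I)) =
        (∫ y in (0:ℝ)..w₀.im, g (w.re + y * Complex.I)) +
          ∫ y in w₀.im..w.im, g (w.re + y * Complex.I) :=
      (intervalIntegral.integral_add_adjacent_intervals hi1 (hi1.symm.trans hi2)).symm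
    rw [primitive, primitive, integralDownTo, integralDownTo, Complex.wedgeIntegral, hsplit1, hsplit2,
      smul_eq_mul]
    linear_combination hrect
  have h := hwedge.const_add (primitive z g w₀)
  refine h.congr_of_eventuallyEq ?_
  filter_upwards [Metric.ball_mem_nhds w₀ hr] with w hw using heq w hw

end BO

/-! ### Growth of the logarithms and decay of the integrand in the upward direction. -/

namespace BO

variable {P : ℕ}

theorem norm_log_le_add_pi (w : ℂ) : ‖Complex.log w‖ ≤ |Real.log ‖w‖| + Real.pi := by
  refine (Complex.norm_le_abs_re_add_abs_im _).trans ?_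
  rw [Complex.log_re, Complex.log_im]
  gcongr
  exact Complex.abs_arg_le_pi w

theorem norm_logSum_le (z a b : Fin P → ℂ) (w : ℂ) :
    ‖logSum z a b w‖ ≤ ∑ p, (‖a p‖ * (|Real.log ‖w - z p‖| + 2 * Real.pi) +
      ‖b p‖ * (|Real.log ‖w - star (z p)‖| + 2 * Real.pi)) := by
  refine (norm_sum_le _ _).trans (Finset.sum_le_sum fun p _ => (norm_add_le _ _).trans ?_)
  rw [norm_mul, norm_mul]
  have hpi : ‖(Real.pi * Complex.I / 2 : ℂ)‖ ≤ Real.pi := by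
    simp [abs_of_pos Real.pi_pos]
    linarith [Real.pi_pos]
  have h1 := norm_log_le_add_pi (Complex.I * (w - z p))
  have h2 := norm_log_le_add_pi (-Complex.I * (w - star (z p)))
  rw [norm_mul, Complex.norm_I, one_mul] at h1
  rw [norm_mul, norm_neg, Complex.norm_I, one_mul] at h2
  gcongr
  · exact (norm_add_le _ _).trans (by linarith)
  · exact (norm_sub_le _ _).trans (by linarith)

theorem abs_log_le_of_le {d t β : ℝ} (hd : 0 < d) (hβ : 0 < β) (h : d ≤ t) :
    |Real.log t| ≤ β * t + |Real.log β| + |Real.log d| := by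
  have ht : 0 < t := hd.trans_le h
  rw [abs_le]
  constructor
  · have h1 := Real.log_le_log hd h
    have h2 := neg_abs_le (Real.log d)
    have h3 := abs_nonneg (Real.log β)
    have : 0 < β * t := by positivity
    linarith
  · have h1 := Real.log_le_sub_one_of_pos (mul_pos hβ ht)
    rw [Real.log_mul hβ.ne' ht.ne'] at h1
    have h2 := neg_abs_le (Real.log β)
    have h3 := abs_nonneg (Real.log d)
    linarith

/-- Logarithms grow slower than any linear function. The arbitrary slope `α` lets the linear term
`lam w` win in the exponent for every `lam` with negative real part. -/
theorem exists_norm_logSum_le (z a b : Fin P → ℂ) {d α : ℝ} (hd : 0 < d) (hα : 0 < α) :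
    ∃ C : ℝ, ∀ w : ℂ, (∀ p, d ≤ ‖w - z p‖ ∧ d ≤ ‖w - star (z p)‖) →
      ‖logSum z a b w‖ ≤ C + α * ‖w‖ := by
  set S := ∑ p, (‖a p‖ + ‖b p‖) with hS
  have hS0 : 0 ≤ S := Finset.sum_nonneg fun p _ => by positivity
  set β := α / (S + 1) with hβdef
  have hβ : 0 < β := by positivity
  refine ⟨∑ p, (‖a p‖ + ‖b p‖) * (β * ‖z p‖ + |Real.log β| + |Real.log d| + 2 * Real.pi), ?_⟩
  intro w hw
  refine (norm_logSum_le z a b w).trans ?_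
  have h1 : ∀ p, ‖a p‖ * (|Real.log ‖w - z p‖| + 2 * Real.pi) +
      ‖b p‖ * (|Real.log ‖w - star (z p)‖| + 2 * Real.pi) ≤
      (‖a p‖ + ‖b p‖) * (β * ‖z p‖ + |Real.log β| + |Real.log d| + 2 * Real.pi) +
      (‖a p‖ + ‖b p‖) * (β * ‖w‖) := by
    intro p
    have e1 := abs_log_le_of_le hd hβ (hw p).1
    have e2 := abs_log_le_of_le hd hβ (hw p).2
    have e3 : β * ‖w - z p‖ ≤ β * (‖w‖ + ‖z p‖) := by gcongr; exact norm_sub_le _ _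
    have e4 : β * ‖w - star (z p)‖ ≤ β * (‖w‖ + ‖z p‖) := by
      gcongr
      refine (norm_sub_le _ _).trans ?_
      rw [norm_star]
    have f1 := mul_le_mul_of_nonneg_left (show |Real.log ‖w - z p‖| + 2 * Real.pi ≤
      (β * ‖z p‖ + |Real.log β| + |Real.log d| + 2 * Real.pi) + β * ‖w‖ by linarith)
      (norm_nonneg (a p))
    have f2 := mul_le_mul_of_nonneg_left (show |Real.log ‖w - star (z p)‖| + 2 * Real.pi ≤
      (β * ‖z p‖ + |Real.log β| + |Real.log d| + 2 * Real.pi) + β * ‖w‖ by linarith)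
      (norm_nonneg (b p))
    linarith
  refine (Finset.sum_le_sum fun p _ => h1 p).trans ?_
  rw [Finset.sum_add_distrib, ← Finset.sum_mul]
  refine add_le_add le_rfl ?_
  rw [← hS, ← mul_assoc]
  refine mul_le_mul_of_nonneg_right ?_ (norm_nonneg w)
  rw [hβdef, mul_div_assoc', div_le_iff₀ (by positivity)]
  nlinarith

theorem exists_pos_le_im {z : Fin P → ℂ} (hz : ∀ p, 0 < (z p).im) :
    ∃ η : ℝ, 0 < η ∧ ∀ p, η ≤ (z p).im := by
  rcases isEmpty_or_nonempty (Fin P) with h | h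
  · exact ⟨1, one_pos, fun p => h.elim p⟩
  · obtain ⟨p₀, hp₀⟩ := Finite.exists_min fun p => (z p).im
    exact ⟨(z p₀).im, hz p₀, hp₀⟩

theorem im_le_norm_sub_star {v w : ℂ} (hw : 0 ≤ w.im) : v.im ≤ ‖w - star v‖ := by
  refine le_trans ?_ (Complex.abs_im_le_norm _)
  refine le_trans ?_ (le_abs_self _)
  simp [hw]

theorem norm_expF_le_exp {c z : Fin P → ℂ} {ε : ℝ} (hε : 0 < ε) (lam w : ℂ) :
    ‖expF c z ε lam w‖ ≤ Real.exp ((lam.im * w.re + lam.re * w.im + ‖f c z w‖) / ε) := by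
  rw [expF, Complex.norm_exp, Complex.div_ofReal_re]
  gcongr
  have h := Complex.abs_im_le_norm (f c z w)
  have := (abs_le.mp h).2
  simp
  linarith

/-- Exponential decay of `expF` upwards, away from the poles. -/
theorem exists_norm_expF_le {c z : Fin P → ℂ} (hz : ∀ p, 0 < (z p).im) {ε : ℝ} (hε : 0 < ε)
    {lam : ℂ} (hlam : lam.re < 0) {d : ℝ} (hd : 0 < d) :
    ∃ C α k : ℝ, 0 < α ∧ 0 ≤ k ∧ 0 ≤ C ∧ ∀ w : ℂ, 0 ≤ w.im → (∀ p, d ≤ ‖w - z p‖) →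
      ‖expF c z ε lam w‖ ≤ C * Real.exp (k * |w.re|) * Real.exp (-(α * w.im)) := by
  obtain ⟨η, hη, hηz⟩ := exists_pos_le_im hz
  set μ := -lam.re with hμ
  have hμ0 : 0 < μ := by linarith
  -- Half of the rate `μ` is spent on the logarithms; the other half remains as exponential decay.
  obtain ⟨C₀, hC₀⟩ := exists_norm_logSum_le z c (star c) (lt_min hd hη) (half_pos hμ0)
  refine ⟨Real.exp (C₀ / ε), μ / 2 / ε, (|lam.im| + μ / 2) / ε, by positivity, by positivity,
    by positivity, fun w hw hdw => ?_⟩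
  refine (norm_expF_le_exp hε lam w).trans ?_
  rw [← Real.exp_add, ← Real.exp_add]
  gcongr
  have h1 := hC₀ w fun p => ⟨(min_le_left _ _).trans (hdw p),
    (min_le_right _ _).trans ((hηz p).trans (im_le_norm_sub_star hw))⟩
  rw [← f_eq_logSum] at h1
  have h2 : ‖w‖ ≤ |w.re| + w.im := by
    have := Complex.norm_le_abs_re_add_abs_im w
    rwa [abs_of_nonneg hw] at this
  have h3 : lam.im * w.re ≤ |lam.im| * |w.re| := by
    rw [← abs_mul]; exact le_abs_self _
  have e : C₀ / ε + (|lam.im| + μ / 2) / ε * |w.re| + -(μ / 2 / ε * w.im) =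
      (C₀ + (|lam.im| + μ / 2) * |w.re| - μ / 2 * w.im) / ε := by ring
  rw [e]
  gcongr
  have h4 : lam.re = -μ := by rw [hμ]; ring
  rw [h4]
  nlinarith

theorem differentiableOn_source (z φ : Fin P → ℂ) (ρ : ℂ) (q : Fin P) (s : Set (Fin P))
    (hφ : ∀ p ∉ s, φ p = 0) :
    DifferentiableOn ℂ (source z φ ρ q) (slitDomain z s) := by
  unfold source
  refine DifferentiableOn.sub (DifferentiableOn.fun_sum fun p _ => ?_) ?_
  · by_cases hp : p ∈ s
    · exact (differentiableOn_const _).div (by fun_prop) fun w hw => slitDomain_ne hw hp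
    · simp only [hφ p hp, zero_div]
      exact differentiableOn_const _
  · exact (differentiableOn_const _).div (by fun_prop) fun w hw => slitDomain_ne_star hw q

theorem norm_source_le {z φ : Fin P → ℂ} {ρ : ℂ} {q : Fin P} {w : ℂ} {d : ℝ} (hd : 0 < d)
    (h : ∀ p, d ≤ ‖w - z p‖) (h' : d ≤ ‖w - star (z q)‖) :
    ‖source z φ ρ q w‖ ≤ (∑ p, ‖φ p‖ + ‖ρ‖) / d := by
  unfold source
  refine (norm_sub_le _ _).trans ?_
  rw [add_div, Finset.sum_div]
  refine add_le_add ((norm_sum_le _ _).trans (Finset.sum_le_sum fun p _ => ?_)) ?_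
  · rw [norm_div]
    have := h p
    gcongr
  · rw [norm_div]
    gcongr

theorem exists_norm_source_le {z : Fin P → ℂ} (hz : ∀ p, 0 < (z p).im) (φ : Fin P → ℂ) (ρ : ℂ)
    (q : Fin P) {d : ℝ} (hd : 0 < d) :
    ∃ B : ℝ, 0 ≤ B ∧ ∀ w : ℂ, 0 ≤ w.im → (∀ p, d ≤ ‖w - z p‖) → ‖source z φ ρ q w‖ ≤ B := by
  have hm : 0 < min d (z q).im := lt_min hd (hz q)
  refine ⟨(∑ p, ‖φ p‖ + ‖ρ‖) / min d (z q).im, by positivity, fun w hw h => ?_⟩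
  exact norm_source_le hm (fun p => (min_le_left _ _).trans (h p))
    ((min_le_right _ _).trans (im_le_norm_sub_star hw))

theorem mem_slitDomain_of_re_ne {z : Fin P → ℂ} (hz : ∀ p, 0 < (z p).im) {s : Set (Fin P)} {w : ℂ}
    (hre : ∀ p, w.re ≠ (z p).re) (hw : 0 ≤ w.im) : w ∈ slitDomain z s :=
  fun p => ⟨by linarith [hz p], fun _ => Or.inl (hre p)⟩

/-- The integrand `e^{-i h / ε} source`. -/
noncomputable def integrand (c z : Fin P → ℂ) (ε : ℝ) (lam : ℂ) (φ : Fin P → ℂ) (ρ : ℂ) (q : Fin P)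
    (w : ℂ) : ℂ := expF c z ε lam w * source z φ ρ q w

theorem differentiableOn_integrand (c z : Fin P → ℂ) (ε : ℝ) (lam : ℂ) (φ : Fin P → ℂ) (ρ : ℂ)
    (q : Fin P) : DifferentiableOn ℂ (integrand c z ε lam φ ρ q) (slitDomain z Set.univ) :=
  DifferentiableOn.mul (fun _ hw => (hasDerivAt_expF hw).differentiableAt.differentiableWithinAt)
    (differentiableOn_source z φ ρ q Set.univ (by simp))

theorem exists_pos_le_abs_sub {z : Fin P → ℂ} {a : ℝ} (ha : ∀ p, a ≠ (z p).re) :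
    ∃ d : ℝ, 0 < d ∧ ∀ p, d ≤ |a - (z p).re| := by
  rcases isEmpty_or_nonempty (Fin P) with h | h
  · exact ⟨1, one_pos, fun p => h.elim p⟩
  · obtain ⟨p₀, hp₀⟩ := Finite.exists_min fun p => |a - (z p).re|
    exact ⟨_, abs_pos.mpr (sub_ne_zero.mpr (ha p₀)), hp₀⟩

theorem exists_norm_integrand_le {c z : Fin P → ℂ} (hz : ∀ p, 0 < (z p).im) {ε : ℝ} (hε : 0 < ε)
    {lam : ℂ} (hlam : lam.re < 0) (φ : Fin P → ℂ) (ρ : ℂ) (q : Fin P) {d : ℝ} (hd : 0 < d) :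
    ∃ C α k : ℝ, 0 < α ∧ 0 ≤ k ∧ 0 ≤ C ∧ ∀ w : ℂ, 0 ≤ w.im → (∀ p, d ≤ ‖w - z p‖) →
      ‖integrand c z ε lam φ ρ q w‖ ≤ C * Real.exp (k * |w.re|) * Real.exp (-(α * w.im)) := by
  obtain ⟨C, α, k, hα, hk, hC, h⟩ := exists_norm_expF_le (c := c) hz hε hlam hd
  obtain ⟨B, hB, hb⟩ := exists_norm_source_le hz φ ρ q hd
  refine ⟨C * B, α, k, hα, hk, by positivity, fun w hw hdw => ?_⟩
  rw [integrand, norm_mul]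
  calc _ ≤ (C * Real.exp (k * |w.re|) * Real.exp (-(α * w.im))) * B := by
        gcongr
        · exact h w hw hdw
        · exact hb w hw hdw
    _ = _ := by ring

theorem integrableOn_integrand_ray {c z : Fin P → ℂ} (hz : ∀ p, 0 < (z p).im) {ε : ℝ} (hε : 0 < ε)
    {lam : ℂ} (hlam : lam.re < 0) (φ : Fin P → ℂ) (ρ : ℂ) (q : Fin P) {a : ℝ}
    (ha : ∀ p, a ≠ (z p).re) :
    IntegrableOn (fun y : ℝ => integrand c z ε lam φ ρ q (a + y * Complex.I)) (Set.Ioi 0) := by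
  obtain ⟨d, hd, hda⟩ := exists_pos_le_abs_sub ha
  obtain ⟨C, α, k, hα, hk, hC, h⟩ := exists_norm_integrand_le (c := c) hz hε hlam φ ρ q hd
  have hint : IntegrableOn (fun y : ℝ => C * Real.exp (k * |a|) * Real.exp (-α * y)) (Set.Ioi 0) :=
    (exp_neg_integrableOn_Ioi 0 hα).const_mul _
  refine hint.mono' ?_ ?_
  · refine ContinuousOn.aestronglyMeasurable ?_ measurableSet_Ioi
    refine (differentiableOn_integrand c z ε lam φ ρ q).continuousOn.comp (by fun_prop) ?_
    intro y hy
    refine mem_slitDomain_of_re_ne hz (by simpa using ha) ?_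
    simpa using le_of_lt hy
  · refine (ae_restrict_iff' measurableSet_Ioi).mpr (Eventually.of_forall fun y hy => ?_)
    have h1 := h (a + y * Complex.I) (by simpa using le_of_lt hy) (fun p => by
      refine (hda p).trans ?_
      have := Complex.abs_re_le_norm (a + y * Complex.I - z p)
      simpa using this)
    simpa using h1

end BO

/-! ### The exceptional case, and the contour integrals as analytic functions of `lam`. -/

namespace BO

variable {P : ℕ}

/-- The case `i cₘ / ε = -n`, `n` a positive integer, in which the cut from `zₘ` disappears. -/
def IsExceptional (c : Fin P → ℂ) (ε : ℝ) (m : Fin P) : Prop :=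
  ∃ n : ℕ, 0 < n ∧ Complex.I * c m / ε = -(n : ℂ)

/-- The regular form of the integrand near `zₘ` in the exceptional case. -/
noncomputable def regIntegrand (c z : Fin P → ℂ) (ε : ℝ) (lam : ℂ) (φ : Fin P → ℂ) (ρ : ℂ) (q : Fin P)
    (m : Fin P) (n : ℕ) (w : ℂ) : ℂ :=
  Complex.exp (-Complex.I * (lam * w + logSum z (Function.update c m 0) (star c) w) / ε) *
    ((-(w - z m)) ^ n * source z (Function.update φ m 0) ρ q w - φ m * (-(w - z m)) ^ (n - 1))

theorem logSum_update (c z : Fin P → ℂ) (b : Fin P → ℂ) (m : Fin P) (w : ℂ) :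
    logSum z c b w = logSum z (Function.update c m 0) b w +
      c m * (Complex.log (Complex.I * (w - z m)) + Real.pi * Complex.I / 2) := by
  unfold logSum
  rw [← Finset.add_sum_erase _ _ (Finset.mem_univ m), ← Finset.add_sum_erase _ _ (Finset.mem_univ m)]
  have : ∀ p ∈ Finset.univ.erase m, Function.update c m 0 p = c p := fun p hp =>
    Function.update_of_ne (Finset.ne_of_mem_erase hp) _ _
  rw [Finset.sum_congr rfl fun p hp => by rw [← this p hp]]
  rw [Function.update_self]
  ring

theorem source_update (z φ : Fin P → ℂ) (ρ : ℂ) (q m : Fin P) (w : ℂ) :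
    source z φ ρ q w = source z (Function.update φ m 0) ρ q w + φ m / (w - z m) := by
  unfold source
  rw [← Finset.add_sum_erase _ _ (Finset.mem_univ m), ← Finset.add_sum_erase _ _ (Finset.mem_univ m)]
  have : ∀ p ∈ Finset.univ.erase m, Function.update φ m 0 p = φ p := fun p hp =>
    Function.update_of_ne (Finset.ne_of_mem_erase hp) _ _
  rw [Finset.sum_congr rfl fun p hp => by rw [← this p hp]]
  rw [Function.update_self]
  ring

/-- With `X = i (w - zₘ)`, the factor of `zₘ` is `exp (n (log X + π i / 2)) = (i X) ^ n`, a
polynomial: the cut is gone and a zero of order `n` is left. -/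
theorem expF_eq_of_exceptional {c z : Fin P → ℂ} {ε : ℝ} (hε : 0 < ε) {m : Fin P} {n : ℕ}
    (hn : Complex.I * c m / ε = -(n : ℂ)) (lam : ℂ) {w : ℂ} (hw : w ≠ z m) :
    expF c z ε lam w = Complex.exp (-Complex.I * (lam * w +
      logSum z (Function.update c m 0) (star c) w) / ε) * (-(w - z m)) ^ n := by
  have hε' : (ε : ℂ) ≠ 0 := by exact_mod_cast hε.ne'
  have hX : Complex.I * (w - z m) ≠ 0 := mul_ne_zero Complex.I_ne_zero (sub_ne_zero.mpr hw)
  set X := Complex.I * (w - z m) with hXdef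
  have h1 : (-(w - z m)) ^ n = Complex.exp (n * (Complex.log X + Real.pi * Complex.I / 2)) := by
    rw [Complex.exp_nat_mul, Complex.exp_add, Complex.exp_log hX]
    have : Complex.exp (Real.pi * Complex.I / 2) = Complex.I := by
      rw [show (Real.pi * Complex.I / 2 : ℂ) = (Real.pi / 2) * Complex.I by ring]
      exact Complex.exp_pi_div_two_mul_I
    rw [this, hXdef]
    congr 1
    linear_combination (-(w - z m)) * Complex.I_sq
  rw [h1, ← Complex.exp_add, expF, f_eq_logSum, logSum_update c z (star c) m]
  congr 1
  rw [← hXdef]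
  rw [div_eq_iff hε'] at hn
  field_simp
  linear_combination (-(2 * Complex.log X + Real.pi * Complex.I)) * hn

/-- As `n ≥ 1`, the zero of the exponential absorbs the simple pole of the source, so the integrand
extends holomorphically through `z m` and its former cut. -/
theorem integrand_eq_regIntegrand {c z : Fin P → ℂ} {ε : ℝ} (hε : 0 < ε) {m : Fin P} {n : ℕ}
    (hn0 : 0 < n) (hn : Complex.I * c m / ε = -(n : ℂ)) (lam : ℂ) (φ : Fin P → ℂ) (ρ : ℂ)
    (q : Fin P) {w : ℂ} (hw : w ≠ z m) :
    integrand c z ε lam φ ρ q w = regIntegrand c z ε lam φ ρ q m n w := by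
  rw [integrand, regIntegrand, expF_eq_of_exceptional hε hn lam hw, source_update z φ ρ q m]
  have hX : w - z m ≠ 0 := sub_ne_zero.mpr hw
  obtain ⟨k, rfl⟩ : ∃ k, n = k + 1 := ⟨n - 1, by omega⟩
  rw [Nat.add_sub_cancel, pow_succ]
  field_simp
  ring

theorem differentiableOn_regIntegrand (c z : Fin P → ℂ) (ε : ℝ) (lam : ℂ) (φ : Fin P → ℂ) (ρ : ℂ)
    (q m : Fin P) (n : ℕ) :
    DifferentiableOn ℂ (regIntegrand c z ε lam φ ρ q m n) (slitDomain z {m}ᶜ) := by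
  have h1 : DifferentiableOn ℂ (logSum z (Function.update c m 0) (star c)) (slitDomain z {m}ᶜ) :=
    fun w hw => (hasDerivAt_logSum hw (by
      intro p hp
      simp only [Set.mem_compl_iff, Set.mem_singleton_iff, not_not] at hp
      rw [hp, Function.update_self])).differentiableAt.differentiableWithinAt
  have h2 : DifferentiableOn ℂ (source z (Function.update φ m 0) ρ q) (slitDomain z {m}ᶜ) :=
    differentiableOn_source _ _ _ _ _ (by
      intro p hp
      simp only [Set.mem_compl_iff, Set.mem_singleton_iff, not_not] at hp
      rw [hp, Function.update_self])
  unfold regIntegrand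
  refine DifferentiableOn.mul ?_ ?_
  · exact (((((differentiableOn_id.const_mul lam).add h1).const_mul (-Complex.I))).div_const _).cexp
  · exact ((DifferentiableOn.pow (by fun_prop) n).mul h2).sub (by fun_prop)

/-- Integrability along the contour `Cₘ`. -/
structure ContourIntegrable [NeZero P] (c z : Fin P → ℂ) (ε : ℝ) (m : Fin P) (g : ℂ → ℂ) : Prop where
  left : IntegrableOn (fun y : ℝ => g (leftAbscissa z + y * Complex.I)) (Set.Ioi 0)
  right : IntegrableOn (fun y : ℝ => g (gapAbscissa z m + y * Complex.I)) (Set.Ioi 0)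
  real : ∀ a b : ℝ, IntervalIntegrable (fun x : ℝ => g x) volume a b
  stem : IsExceptional c ε m →
    IntervalIntegrable (fun y : ℝ => g ((z m).re + y * Complex.I)) volume 0 (z m).im

theorem integralC_add [NeZero P] {c z : Fin P → ℂ} {ε : ℝ} {m : Fin P} {g₁ g₂ : ℂ → ℂ}
    (h₁ : ContourIntegrable c z ε m g₁) (h₂ : ContourIntegrable c z ε m g₂) :
    integralC c z ε m (fun w => g₁ w + g₂ w) = integralC c z ε m g₁ + integralC c z ε m g₂ := by
  have hD : ∀ b, integralDownTo (fun w => g₁ w + g₂ w) (leftAbscissa z) b =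
      integralDownTo g₁ (leftAbscissa z) b + integralDownTo g₂ (leftAbscissa z) b := by
    intro b
    unfold integralDownTo
    rw [integral_add h₁.left h₂.left, intervalIntegral.integral_add (h₁.real _ _) (h₂.real _ _)]
    ring
  unfold integralC
  split_ifs with h
  · unfold integralEll
    rw [hD, intervalIntegral.integral_add (h₁.stem h) (h₂.stem h)]
    ring
  · unfold integralU
    rw [hD, integral_add h₁.right h₂.right]
    ring

theorem integralC_const_mul [NeZero P] (c z : Fin P → ℂ) (ε : ℝ) (m : Fin P) (a : ℂ) (g : ℂ → ℂ) :
    integralC c z ε m (fun w => a * g w) = a * integralC c z ε m g := by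
  unfold integralC integralEll integralU integralDownTo
  simp only [integral_const_mul, intervalIntegral.integral_const_mul]
  split_ifs <;> ring

theorem ContourIntegrable.add [NeZero P] {c z : Fin P → ℂ} {ε : ℝ} {m : Fin P} {g₁ g₂ : ℂ → ℂ}
    (h₁ : ContourIntegrable c z ε m g₁) (h₂ : ContourIntegrable c z ε m g₂) :
    ContourIntegrable c z ε m (fun w => g₁ w + g₂ w) :=
  ⟨h₁.left.add h₂.left, h₁.right.add h₂.right, fun a b => (h₁.real a b).add (h₂.real a b),
    fun h => (h₁.stem h).add (h₂.stem h)⟩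

theorem ContourIntegrable.const_mul [NeZero P] {c z : Fin P → ℂ} {ε : ℝ} {m : Fin P} {g : ℂ → ℂ}
    (h : ContourIntegrable c z ε m g) (a : ℂ) : ContourIntegrable c z ε m (fun w => a * g w) :=
  ⟨h.left.const_mul a, h.right.const_mul a, fun s t => (h.real s t).const_mul a,
    fun hx => (h.stem hx).const_mul a⟩

theorem ContourIntegrable.sum [NeZero P] {c z : Fin P → ℂ} {ε : ℝ} {m : Fin P} {ι : Type*}
    (s : Finset ι) {g : ι → ℂ → ℂ} (h : ∀ i, ContourIntegrable c z ε m (g i)) :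
    ContourIntegrable c z ε m (fun w => ∑ i ∈ s, g i w) ∧
    integralC c z ε m (fun w => ∑ i ∈ s, g i w) = ∑ i ∈ s, integralC c z ε m (g i) := by
  classical
  induction s using Finset.induction_on with
  | empty =>
    simp only [Finset.sum_empty]
    refine ⟨⟨by simp, by simp, by simp, by simp⟩, ?_⟩
    have := integralC_const_mul c z ε m 0 (fun _ => 0)
    simpa using this
  | insert a s ha ih =>
    simp only [Finset.sum_insert ha]
    refine ⟨(h a).add ih.1, ?_⟩
    rw [integralC_add (h a) ih.1, ih.2]

theorem re_lt_of_lt {c z : Fin P → ℂ} (hu : IsRationalPotential c z) {i j : Fin P} (h : i < j) :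
    (z i).re < (z j).re := hu.pole_re_strictMono h

theorem leftAbscissa_lt [NeZero P] {c z : Fin P → ℂ} (hu : IsRationalPotential c z) (p : Fin P) :
    leftAbscissa z < (z p).re := by
  have : (z 0).re ≤ (z p).re := hu.pole_re_strictMono.monotone (Fin.zero_le p)
  unfold leftAbscissa
  linarith

theorem lt_gapAbscissa {c z : Fin P → ℂ} (hu : IsRationalPotential c z) {m p : Fin P} (h : p ≤ m) :
    (z p).re < gapAbscissa z m := by
  have h1 : (z p).re ≤ (z m).re := hu.pole_re_strictMono.monotone h
  unfold gapAbscissa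
  split_ifs with hm
  · have : (z m).re < (z ⟨m + 1, hm⟩).re := re_lt_of_lt hu (by simp [Fin.lt_def])
    linarith
  · linarith

theorem gapAbscissa_lt {c z : Fin P → ℂ} (hu : IsRationalPotential c z) {m p : Fin P} (h : m < p) :
    gapAbscissa z m < (z p).re := by
  have hm : (m : ℕ) + 1 < P := lt_of_le_of_lt (Nat.succ_le_of_lt h) p.2
  have h2 : (z ⟨m + 1, hm⟩).re ≤ (z p).re :=
    hu.pole_re_strictMono.monotone (by rw [Fin.le_def]; exact Nat.succ_le_of_lt h)
  have : (z m).re < (z ⟨m + 1, hm⟩).re := re_lt_of_lt hu (by simp [Fin.lt_def])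
  unfold gapAbscissa
  rw [dif_pos hm]
  linarith

theorem gapAbscissa_ne {c z : Fin P → ℂ} (hu : IsRationalPotential c z) (m p : Fin P) :
    gapAbscissa z m ≠ (z p).re := by
  rcases le_or_gt p m with h | h
  · exact (lt_gapAbscissa hu h).ne'
  · exact (gapAbscissa_lt hu h).ne

theorem continuous_integrand_ofReal {c z : Fin P → ℂ} (hz : ∀ p, 0 < (z p).im) (ε : ℝ) (lam : ℂ)
    (φ : Fin P → ℂ) (ρ : ℂ) (q : Fin P) : Continuous (fun x : ℝ => integrand c z ε lam φ ρ q x) :=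
  (differentiableOn_integrand c z ε lam φ ρ q).continuousOn.comp_continuous
    Complex.continuous_ofReal fun x => ofReal_mem_slitDomain hz x

theorem stem_mem_slitDomain {c z : Fin P → ℂ} (hu : IsRationalPotential c z) (m : Fin P) {y : ℝ}
    (hy' : ∀ p, -(z p).im < y) :
    ((z m).re + y * Complex.I : ℂ) ∈ slitDomain z {m}ᶜ := by
  intro p
  refine ⟨by simpa using hy' p, fun hp => Or.inl ?_⟩
  simp only [Complex.add_re, Complex.ofReal_re, Complex.mul_re, Complex.I_re, mul_zero,
    Complex.ofReal_im, Complex.I_im, mul_one, sub_self, add_zero]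
  exact fun h => hp (hu.pole_re_strictMono.injective h).symm

/-- The stem ends at the pole `z m`. There the integrand agrees with its continuous regular form
except at the endpoint itself. -/
theorem intervalIntegrable_stem {c z : Fin P → ℂ} (hu : IsRationalPotential c z) {ε : ℝ}
    (hε : 0 < ε) (lam : ℂ) (φ : Fin P → ℂ) (ρ : ℂ) (q : Fin P) {m : Fin P}
    (h : IsExceptional c ε m) :
    IntervalIntegrable (fun y : ℝ => integrand c z ε lam φ ρ q ((z m).re + y * Complex.I)) volume 0
      (z m).im := by
  obtain ⟨n, hn0, hn⟩ := h
  have hc : ContinuousOn (fun y : ℝ => regIntegrand c z ε lam φ ρ q m n ((z m).re + y * Complex.I))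
      (Set.uIcc 0 (z m).im) := by
    refine (differentiableOn_regIntegrand c z ε lam φ ρ q m n).continuousOn.comp (by fun_prop) ?_
    intro y hy
    rw [Set.uIcc_of_le (hu.pole_im_pos m).le] at hy
    exact stem_mem_slitDomain hu m fun p => by linarith [hy.1, hu.pole_im_pos p]
  refine hc.intervalIntegrable.congr_ae ?_
  have hne : ∀ᵐ y : ℝ ∂volume, y ≠ (z m).im := by
    simp [ae_iff]
  refine ae_restrict_of_ae ?_
  filter_upwards [hne] with y hy
  refine (integrand_eq_regIntegrand hε hn0 hn lam φ ρ q ?_).symm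
  intro h
  apply hy
  have := congrArg Complex.im h
  simpa using this

theorem contourIntegrable_integrand [NeZero P] {c z : Fin P → ℂ} (hu : IsRationalPotential c z)
    {ε : ℝ} (hε : 0 < ε) {lam : ℂ} (hlam : lam.re < 0) (φ : Fin P → ℂ) (ρ : ℂ) (q m : Fin P) :
    ContourIntegrable c z ε m (integrand c z ε lam φ ρ q) where
  left := integrableOn_integrand_ray hu.pole_im_pos hε hlam φ ρ q fun p => (leftAbscissa_lt hu p).ne
  right := integrableOn_integrand_ray hu.pole_im_pos hε hlam φ ρ q fun p => gapAbscissa_ne hu m p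
  real := fun _ _ => (continuous_integrand_ofReal hu.pole_im_pos ε lam φ ρ q).intervalIntegrable _ _
  stem := intervalIntegrable_stem hu hε lam φ ρ q

theorem integrand_single (c z : Fin P → ℂ) (ε : ℝ) (lam : ℂ) (q p : Fin P) :
    integrand c z ε lam (Pi.single p 1) 0 q = fun w => expF c z ε lam w / (w - z p) := by
  funext w
  rw [integrand, source, Finset.sum_eq_single p]
  · simp [div_eq_mul_inv]
  · intro b _ hb; simp [hb]
  · simp

/-- Linearity in the coefficients is what turns the vanishing of all contour integrals into a linear
system with the matrix `A`. -/
theorem integralC_integrand [NeZero P] {c z : Fin P → ℂ} (hu : IsRationalPotential c z)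
    {ε : ℝ} (hε : 0 < ε) {lam : ℂ} (hlam : lam.re < 0) (φ : Fin P → ℂ) (ρ : ℂ) (q m : Fin P) :
    integralC c z ε m (integrand c z ε lam φ ρ q) =
      ∑ p, φ p * integralC c z ε m (integrand c z ε lam (Pi.single p 1) 0 q) +
        ρ * integralC c z ε m (integrand c z ε lam 0 1 q) := by
  have hi := fun φ ρ => contourIntegrable_integrand hu hε hlam φ ρ q m
  have hs := ContourIntegrable.sum Finset.univ fun p => (hi (Pi.single p 1) 0).const_mul (φ p)
  have e : integrand c z ε lam φ ρ q = fun w =>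
      (∑ p, φ p * integrand c z ε lam (Pi.single p 1) 0 q w) + ρ * integrand c z ε lam 0 1 q w := by
    funext w
    simp only [integrand_single]
    simp only [integrand, source, Pi.zero_apply, zero_div, Finset.sum_const_zero, mul_sub,
      Finset.mul_sum, zero_sub]
    rw [sub_eq_add_neg]
    congr 1
    · exact Finset.sum_congr rfl fun p _ => by ring
    · ring
  rw [e, integralC_add hs.1 ((hi 0 1).const_mul ρ), hs.2, integralC_const_mul]
  simp only [integralC_const_mul]

/-- On a path with bounded real part and nonnegative imaginary part the exponential is bounded
uniformly for `l` near `lam`, because `Re l < 0` makes the imaginary part of the path harmless. -/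
theorem differentiableAt_integral_exp {μ : Measure ℝ} {ε : ℝ} (hε : 0 < ε) {γ : ℝ → ℂ}
    (hγ : Measurable γ) {R : ℝ} (hR : ∀ᵐ t ∂μ, 0 ≤ (γ t).im ∧ |(γ t).re| ≤ R) {K : ℝ → ℂ}
    (hK : Integrable K μ) {lam : ℂ} (hlam : lam.re < 0) :
    DifferentiableAt ℂ (fun l => ∫ t, Complex.exp (-Complex.I * (l * γ t) / ε) * K t ∂μ) lam := by
  refine differentiableAt_integral_of_norm_le (r := -lam.re)
    (B := fun t => Real.exp ((|lam.im| + -lam.re) * R / ε) * ‖K t‖) (by linarith) ?_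
    (hK.norm.const_mul _) ?_ ?_
  · intro l _
    exact (by fun_prop : Measurable fun t => Complex.exp (-Complex.I * (l * γ t) / ε)).aestronglyMeasurable.mul
      hK.aestronglyMeasurable
  · exact Eventually.of_forall fun t => by fun_prop
  · filter_upwards [hR] with t ht l hl
    rw [norm_mul]
    refine mul_le_mul_of_nonneg_right ?_ (norm_nonneg _)
    rw [Complex.norm_exp, Complex.div_ofReal_re]
    gcongr
    rw [Metric.mem_ball, Complex.dist_eq] at hl
    have h1 := (Complex.abs_re_le_norm (l - lam)).trans hl.le
    have h2 := (Complex.abs_im_le_norm (l - lam)).trans hl.le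
    rw [Complex.sub_re, abs_le] at h1
    rw [Complex.sub_im] at h2
    have h3 : |l.im| ≤ |lam.im| + -lam.re := by
      have := abs_add_le (l.im - lam.im) lam.im
      rw [sub_add_cancel] at this
      linarith
    have h4 : l.im * (γ t).re ≤ (|lam.im| + -lam.re) * R := by
      refine (le_abs_self _).trans ?_
      rw [abs_mul]
      exact mul_le_mul h3 ht.2 (abs_nonneg _) ((abs_nonneg _).trans h3)
    have h5 : l.re * (γ t).im ≤ 0 := mul_nonpos_of_nonpos_of_nonneg (by linarith [h1.2]) ht.1
    simp
    linarith

theorem integrand_shift (c z : Fin P → ℂ) (ε : ℝ) (lam mu : ℂ) (φ : Fin P → ℂ) (ρ : ℂ) (q : Fin P)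
    (w : ℂ) : integrand c z ε lam φ ρ q w =
      Complex.exp (-Complex.I * ((lam - mu) * w) / ε) * integrand c z ε mu φ ρ q w := by
  rw [integrand, integrand, ← mul_assoc, expF, expF, ← Complex.exp_add]
  congr 2
  ring

theorem differentiableAt_integralC [NeZero P] {c z : Fin P → ℂ} (hu : IsRationalPotential c z)
    {ε : ℝ} (hε : 0 < ε) {lam : ℂ} (hlam : lam.re < 0) (φ : Fin P → ℂ) (ρ : ℂ) (q m : Fin P) :
    DifferentiableAt ℂ (fun l => integralC c z ε m (integrand c z ε l φ ρ q)) lam := by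
  -- Half of `lam.re` is kept in the integrand at `mu`, for integrability; the other half gives `lam
  -- - mu` a negative real part, for the uniform bound of the remaining exponential.
  set mu : ℂ := ((lam.re / 2 : ℝ) : ℂ) with hmu
  have hmu0 : mu.re < 0 := by rw [hmu, Complex.ofReal_re]; linarith
  have hsub : (lam - mu).re < 0 := by rw [Complex.sub_re, hmu, Complex.ofReal_re]; linarith
  have hi := contourIntegrable_integrand hu hε hmu0 φ ρ q m
  have piece : ∀ (μ : Measure ℝ) (γ : ℝ → ℂ), Measurable γ → ∀ R : ℝ,
      (∀ᵐ t ∂μ, 0 ≤ (γ t).im ∧ |(γ t).re| ≤ R) →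
      Integrable (fun t => integrand c z ε mu φ ρ q (γ t)) μ →
      DifferentiableAt ℂ (fun l => ∫ t, integrand c z ε l φ ρ q (γ t) ∂μ) lam := by
    intro μ γ hγ R hR hint
    have h := differentiableAt_integral_exp hε hγ hR hint hsub
    have h2 : DifferentiableAt ℂ (fun l : ℂ => l - mu) lam := by fun_prop
    have h3 := DifferentiableAt.comp (𝕜 := ℂ) lam h h2
    refine h3.congr_of_eventuallyEq (Eventually.of_forall fun l => ?_)
    simp only [Function.comp]
    congr 1
    funext t
    exact integrand_shift c z ε l mu φ ρ q (γ t)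
  have ray : ∀ a : ℝ, IntegrableOn (fun y : ℝ => integrand c z ε mu φ ρ q (a + y * Complex.I)) (Set.Ioi 0) →
      DifferentiableAt ℂ (fun l => ∫ y in Set.Ioi (0:ℝ), integrand c z ε l φ ρ q (a + y * Complex.I)) lam := by
    intro a ha
    refine piece _ (fun y => a + y * Complex.I) (by fun_prop) |a| ?_ ha
    refine (ae_restrict_iff' measurableSet_Ioi).mpr (Eventually.of_forall fun y hy => ?_)
    simpa using le_of_lt hy
  have hreal : ∀ a b : ℝ, DifferentiableAt ℂ (fun l => ∫ x in a..b, integrand c z ε l φ ρ q (x : ℂ)) lam := by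
    intro a b
    have key : ∀ a b : ℝ, DifferentiableAt ℂ
        (fun l => ∫ x in Set.Ioc a b, integrand c z ε l φ ρ q (x : ℂ)) lam := by
      intro a b
      refine piece _ (fun x => (x : ℂ)) (by fun_prop) (max |a| |b|) ?_ ?_
      · refine (ae_restrict_iff' measurableSet_Ioc).mpr (Eventually.of_forall fun y hy => ?_)
        simpa using abs_le_max_abs_abs hy.1.le hy.2
      · exact ((continuous_integrand_ofReal hu.pole_im_pos ε mu φ ρ q).integrableOn_Icc).mono_set
          Set.Ioc_subset_Icc_self
    exact (key a b).sub (key b a)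
  unfold integralC
  split_ifs with h
  · unfold integralEll integralDownTo
    refine ((((ray _ hi.left).const_mul _).neg).add (hreal _ _)).add (DifferentiableAt.const_mul ?_ _)
    have hp := hu.pole_im_pos m
    simp only [intervalIntegral.integral_of_le hp.le]
    refine piece _ (fun y => (z m).re + y * Complex.I) (by fun_prop) |(z m).re| ?_
      ((intervalIntegrable_iff_integrableOn_Ioc_of_le hp.le).mp (hi.stem h))
    refine (ae_restrict_iff' measurableSet_Ioc).mpr (Eventually.of_forall fun y hy => ?_)
    simpa using le_of_lt hy.1
  · unfold integralU integralDownTo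
    exact ((((ray _ hi.left).const_mul _).neg).add (hreal _ _)).add ((ray _ hi.right).const_mul _)

end BO

/-! ### Vanishing of the primitive at `i∞` in every gap between the cuts. -/

namespace BO

variable {P : ℕ}

/-- The limit of the primitive at `i∞` along `Re w = x`. -/
noncomputable def topLimit [NeZero P] (z : Fin P → ℂ) (g : ℂ → ℂ) (x : ℝ) : ℂ :=
  integralDownTo g (leftAbscissa z) x + Complex.I * ∫ y in Set.Ioi (0 : ℝ), g (x + y * Complex.I)

theorem primitive_vertical [NeZero P] (z : Fin P → ℂ) (g : ℂ → ℂ) (x Y : ℝ) :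
    primitive z g (x + Y * Complex.I) =
      integralDownTo g (leftAbscissa z) x + Complex.I * ∫ y in (0 : ℝ)..Y, g (x + y * Complex.I) := by
  simp [primitive]

theorem integralC_of_not_exceptional [NeZero P] {c z : Fin P → ℂ} {ε : ℝ} {m : Fin P}
    (h : ¬IsExceptional c ε m) (g : ℂ → ℂ) : integralC c z ε m g = integralU z m g :=
  if_neg h

theorem integralC_of_exceptional [NeZero P] {c z : Fin P → ℂ} {ε : ℝ} {m : Fin P}
    (h : IsExceptional c ε m) (g : ℂ → ℂ) : integralC c z ε m g = integralEll z m g :=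
  if_pos h

theorem exists_im_le (z : Fin P → ℂ) : ∃ M : ℝ, 0 ≤ M ∧ ∀ p, (z p).im ≤ M :=
  ⟨∑ p, |(z p).im|, Finset.sum_nonneg fun _ _ => abs_nonneg _, fun p =>
    (le_abs_self _).trans (Finset.single_le_sum (f := fun p => |(z p).im|)
      (fun _ _ => abs_nonneg _) (Finset.mem_univ p))⟩

variable [NeZero P] {c z : Fin P → ℂ} (hu : IsRationalPotential c z) {ε : ℝ} (hε : 0 < ε) {lam : ℂ}
  (hlam : lam.re < 0) (φ : Fin P → ℂ) (ρ : ℂ) (q : Fin P)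

include hu hε hlam

theorem tendsto_primitive_topLimit {x : ℝ} (hx : ∀ p, x ≠ (z p).re) :
    Tendsto (fun Y : ℝ => primitive z (integrand c z ε lam φ ρ q) (x + Y * Complex.I)) atTop
      (𝓝 (topLimit z (integrand c z ε lam φ ρ q) x)) := by
  simp_rw [primitive_vertical]
  refine tendsto_const_nhds.add (Tendsto.const_mul _ ?_)
  exact intervalIntegral_tendsto_integral_Ioi 0
    (integrableOn_integrand_ray hu.pole_im_pos hε hlam φ ρ q hx) tendsto_id

/-- Cauchy's theorem on tall rectangles, whose top side decays exponentially. The function `H` is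
the integrand with removable points filled in, so columns outside of `s` may be crossed. -/
theorem topLimit_eq {a b : ℝ} (ha : ∀ p, a ≠ (z p).re) (hb : ∀ p, b ≠ (z p).re)
    {s : Set (Fin P)} {H : ℂ → ℂ} (hH : DifferentiableOn ℂ H (slitDomain z s))
    (hGH : ∀ w, (∀ p ∉ s, w ≠ z p) → integrand c z ε lam φ ρ q w = H w)
    (hs : ∀ p ∈ s, (z p).re ∉ Set.uIcc a b) :
    topLimit z (integrand c z ε lam φ ρ q) a = topLimit z (integrand c z ε lam φ ρ q) b := by
  have hz := hu.pole_im_pos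
  set G := integrand c z ε lam φ ρ q with hG
  obtain ⟨M, hM0, hM⟩ := exists_im_le z
  obtain ⟨C, α, k, hα, hk, hC, hbd⟩ := exists_norm_integrand_le (c := c) hz hε hlam φ ρ q one_pos
  have hne : ∀ w : ℂ, (∀ p, w.re ≠ (z p).re) → G w = H w := fun w hw =>
    hGH w fun p _ h => hw p (congrArg Complex.re h)
  have key : ∀ Y : ℝ, M + 1 ≤ Y →
      primitive z G (b + Y * Complex.I) - primitive z G (a + Y * Complex.I) =
        ∫ x in a..b, G (x + Y * Complex.I) := by
    intro Y hY
    have hrect := Complex.integral_boundary_rect_eq_zero_of_differentiableOn H (a : ℂ)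
      (b + Y * Complex.I) (hH.mono (by
        intro v hv
        simp only [Complex.ofReal_re, Complex.ofReal_im, Complex.add_re, Complex.mul_re,
          Complex.I_re, mul_zero, Complex.I_im, mul_one, sub_self, add_zero, Complex.add_im,
          Complex.mul_im, zero_add] at hv
        have h2 := hv.2
        have hY0 : (0:ℝ) ≤ Y := by linarith
        rw [Set.mem_preimage, Set.uIcc_of_le hY0] at h2
        intro p
        refine ⟨by linarith [hz p, h2.1], fun hp => Or.inl fun h => hs p hp ?_⟩
        rw [← h]; exact hv.1))
    simp only [Complex.ofReal_re, Complex.ofReal_im, Complex.add_re, Complex.mul_re,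
          Complex.I_re, mul_zero, Complex.I_im, mul_one, sub_self, add_zero, Complex.add_im,
          Complex.mul_im, zero_add, Complex.ofReal_zero, zero_mul, smul_eq_mul] at hrect
    have e1 : ∀ x : ℝ, G x = H x := fun x => hGH x fun p _ h => by
      have := hz p
      rw [← h] at this
      simp at this
    have e2 : ∀ x : ℝ, G (x + Y * Complex.I) = H (x + Y * Complex.I) := fun x => hGH _ fun p _ h => by
      have h1 := hM p
      rw [← h] at h1
      simp at h1
      linarith
    have e3 : ∀ y : ℝ, G (a + y * Complex.I) = H (a + y * Complex.I) := fun y =>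
      hne _ (by simpa using ha)
    have e4 : ∀ y : ℝ, G (b + y * Complex.I) = H (b + y * Complex.I) := fun y =>
      hne _ (by simpa using hb)
    have hcont := continuous_integrand_ofReal (c := c) hz ε lam φ ρ q
    have hsplit : (∫ x in (leftAbscissa z)..b, G (x : ℂ)) =
        (∫ x in (leftAbscissa z)..a, G (x : ℂ)) + ∫ x in a..b, G (x : ℂ) :=
      (intervalIntegral.integral_add_adjacent_intervals (hcont.intervalIntegrable _ _)
        (hcont.intervalIntegrable _ _)).symm
    rw [primitive_vertical, primitive_vertical, integralDownTo, integralDownTo, hsplit]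
    simp_rw [e2, e3, e4]
    simp_rw [e1]
    linear_combination hrect
  have hlim : Tendsto (fun Y : ℝ => ∫ x in a..b, G (x + Y * Complex.I)) atTop (𝓝 0) := by
    refine squeeze_zero_norm' (a := fun Y : ℝ =>
      C * Real.exp (k * max |a| |b|) * Real.exp (-(α * Y)) * |b - a|) ?_ ?_
    · filter_upwards [eventually_ge_atTop (M + 1)] with Y hY
      refine intervalIntegral.norm_integral_le_of_norm_le_const fun x hx => ?_
      have h1 := hbd (x + Y * Complex.I) (by simp; linarith) (fun p => by
        refine le_trans ?_ (Complex.abs_im_le_norm _)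
        refine le_trans ?_ (le_abs_self _)
        have := hM p
        simp; linarith)
      refine h1.trans ?_
      have h2 : |x| ≤ max |a| |b| := by
        rcases Set.mem_uIoc.mp hx with h | h
        · exact abs_le_max_abs_abs h.1.le h.2
        · rw [max_comm]; exact abs_le_max_abs_abs h.1.le h.2
      simp only [Complex.add_re, Complex.ofReal_re, Complex.mul_re, Complex.I_re, mul_zero,
        Complex.ofReal_im, Complex.I_im, mul_one, sub_self, add_zero, Complex.add_im,
        Complex.mul_im, zero_add]
      gcongr
    · have h1 : Tendsto (fun Y : ℝ => Real.exp (-(α * Y))) atTop (𝓝 0) :=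
        Real.tendsto_exp_neg_atTop_nhds_zero.comp (tendsto_id.const_mul_atTop hα)
      simpa using (h1.const_mul (C * Real.exp (k * max |a| |b|))).mul_const |b - a|
  have h := (tendsto_primitive_topLimit hu hε hlam φ ρ q hb).sub
    (tendsto_primitive_topLimit hu hε hlam φ ρ q ha)
  have h2 := h.congr' (f₂ := fun Y : ℝ => ∫ x in a..b, G (x + Y * Complex.I)) (by
    filter_upwards [eventually_ge_atTop (M + 1)] with Y hY using key Y hY)
  exact (sub_eq_zero.mp (tendsto_nhds_unique h2 hlim)).symm

theorem topLimit_eq_of_exceptional {m : Fin P} (hm : IsExceptional c ε m) {a b : ℝ}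
    (ha : ∀ p, a ≠ (z p).re) (hb : ∀ p, b ≠ (z p).re)
    (hs : ∀ p ≠ m, (z p).re ∉ Set.uIcc a b) :
    topLimit z (integrand c z ε lam φ ρ q) a = topLimit z (integrand c z ε lam φ ρ q) b := by
  obtain ⟨n, hn0, hn⟩ := hm
  exact topLimit_eq hu hε hlam φ ρ q ha hb (differentiableOn_regIntegrand c z ε lam φ ρ q m n)
    (fun w hw => integrand_eq_regIntegrand hε hn0 hn lam φ ρ q (hw m (by simp)))
    (fun p hp => hs p hp)

/-- Going from gap to gap to the right: a contour `Uₘ` gives the value beyond `zₘ` directly, while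
in the exceptional case nothing separates that gap from the preceding one. -/
theorem topLimit_gapAbscissa_eq_zero
    (hA : ∀ m, integralC c z ε m (integrand c z ε lam φ ρ q) = 0) (m : Fin P) :
    topLimit z (integrand c z ε lam φ ρ q) (gapAbscissa z m) = 0 := by
  have hleft : topLimit z (integrand c z ε lam φ ρ q) (leftAbscissa z) = 0 := by
    simp [topLimit, integralDownTo]
  obtain ⟨k, hk⟩ := m
  induction k with
  | zero =>
    by_cases hm : IsExceptional c ε ⟨0, hk⟩
    · rw [← topLimit_eq_of_exceptional hu hε hlam φ ρ q hm
        (fun p => (leftAbscissa_lt hu p).ne) (fun p => gapAbscissa_ne hu _ p), hleft]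
      intro p hp h
      have h0 : (⟨0, hk⟩ : Fin P) < p := by
        rw [Fin.lt_def]
        exact Nat.pos_of_ne_zero fun h0 => hp (Fin.ext h0)
      have h1 := leftAbscissa_lt hu p
      have h2 := gapAbscissa_lt hu h0
      rcases Set.mem_uIcc.mp h with h | h <;> linarith [h.1, h.2]
    · have := hA ⟨0, hk⟩
      rw [integralC_of_not_exceptional hm] at this
      exact this
  | succ k ih =>
    by_cases hm : IsExceptional c ε ⟨k + 1, hk⟩
    · rw [← topLimit_eq_of_exceptional hu hε hlam φ ρ q hm
        (fun p => gapAbscissa_ne hu ⟨k, by omega⟩ p) (fun p => gapAbscissa_ne hu _ p), ih]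
      intro p hp h
      rcases lt_or_gt_of_ne hp with h0 | h0
      · have h1 : p ≤ ⟨k, by omega⟩ := by
          rw [Fin.lt_def] at h0; rw [Fin.le_def]; exact Nat.lt_succ_iff.mp h0
        have h2 := lt_gapAbscissa hu h1
        have h3 := lt_gapAbscissa hu h0.le
        rcases Set.mem_uIcc.mp h with h | h <;> linarith [h.1, h.2]
      · have h1 : (⟨k, by omega⟩ : Fin P) < p := lt_trans (by simp [Fin.lt_def]) h0
        have h2 := gapAbscissa_lt hu h1
        have h3 := gapAbscissa_lt hu h0
        rcases Set.mem_uIcc.mp h with h | h <;> linarith [h.1, h.2]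
    · have := hA ⟨k + 1, hk⟩
      rw [integralC_of_not_exceptional hm] at this
      exact this

/-- An abscissa is either to the left of all poles or in the gap that follows the last pole to its
left; within a gap the limit does not change. -/
theorem topLimit_eq_zero (hA : ∀ m, integralC c z ε m (integrand c z ε lam φ ρ q) = 0) {x : ℝ}
    (hx : ∀ p, x ≠ (z p).re) : topLimit z (integrand c z ε lam φ ρ q) x = 0 := by
  by_cases h : ∀ p, x < (z p).re
  · have hleft : topLimit z (integrand c z ε lam φ ρ q) (leftAbscissa z) = 0 := by
      simp [topLimit, integralDownTo]
    rw [← hleft]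
    refine topLimit_eq hu hε hlam φ ρ q hx (fun p => (leftAbscissa_lt hu p).ne) (s := Set.univ)
      (differentiableOn_integrand c z ε lam φ ρ q) (fun _ _ => rfl) fun p _ hp => ?_
    have h1 := leftAbscissa_lt hu p
    have h2 := h p
    rcases Set.mem_uIcc.mp hp with h | h <;> linarith [h.1, h.2]
  · push Not at h
    obtain ⟨p₀, hp₀⟩ := h
    have hne : (Finset.univ.filter fun p => (z p).re ≤ x).Nonempty := ⟨p₀, by simpa using hp₀⟩
    obtain ⟨m, hm, hmax⟩ := Finset.exists_max_image _ (fun p : Fin P => p) hne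
    simp only [Finset.mem_filter, Finset.mem_univ, true_and] at hm hmax
    rw [← topLimit_gapAbscissa_eq_zero hu hε hlam φ ρ q hA m]
    refine topLimit_eq hu hε hlam φ ρ q hx (fun p => gapAbscissa_ne hu m p) (s := Set.univ)
      (differentiableOn_integrand c z ε lam φ ρ q) (fun _ _ => rfl) fun p _ hp => ?_
    rcases le_or_gt p m with h1 | h1
    · have h2 := lt_gapAbscissa hu h1
      have h3 : (z p).re ≤ (z m).re := hu.pole_re_strictMono.monotone h1
      have h4 := lt_of_le_of_ne hm (hx m).symm
      rcases Set.mem_uIcc.mp hp with h | h <;> linarith [h.1, h.2]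
    · have h2 := gapAbscissa_lt hu h1
      have h3 : x < (z p).re := by
        by_contra h4
        exact absurd (hmax p (not_lt.mp h4)) (not_le.mpr h1)
      rcases Set.mem_uIcc.mp hp with h | h <;> linarith [h.1, h.2]

end BO

/-! ### The solution given by upward rays, with the cuts turned downwards. -/

namespace BO

variable {P : ℕ}

/-- Above the conjugate poles, off the downward cuts from the poles. -/
def downDomain (z : Fin P → ℂ) : Set ℂ :=
  {w | ∀ p, -(z p).im < w.im ∧ (w.re ≠ (z p).re ∨ (z p).im < w.im)}

theorem isOpen_downDomain (z : Fin P → ℂ) : IsOpen (downDomain z) := by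
  have : downDomain z = ⋂ p, ({w | -(z p).im < w.im} ∩
      {w | w.re ≠ (z p).re ∨ (z p).im < w.im}) := by
    ext w; simp [downDomain]
  rw [this]
  exact isOpen_iInter_of_finite fun p => (isOpen_neg_lt_im _).inter
    ((isOpen_ne_fun Complex.continuous_re continuous_const).union
      (isOpen_lt continuous_const Complex.continuous_im))

theorem add_mem_downDomain {z : Fin P → ℂ} {w : ℂ} (hw : w ∈ downDomain z) {s : ℝ} (hs : 0 ≤ s) :
    w + s * Complex.I ∈ downDomain z := by
  intro p
  obtain ⟨h1, h2⟩ := hw p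
  simp only [Complex.add_re, Complex.add_im, Complex.mul_re, Complex.mul_im, Complex.ofReal_re,
    Complex.ofReal_im, Complex.I_re, Complex.I_im, mul_zero, mul_one, sub_zero, add_zero]
  refine ⟨by linarith, h2.imp id fun h => by linarith⟩

theorem downDomain_ne {z : Fin P → ℂ} {w : ℂ} (hw : w ∈ downDomain z) (p : Fin P) : w ≠ z p := by
  rintro rfl
  have := (hw p).2
  simp at this

/-- The variant of `expF` with downward cuts. -/
noncomputable def downExp (c z : Fin P → ℂ) (ε : ℝ) (lam w : ℂ) : ℂ :=
  Complex.exp (-Complex.I * (lam * w + ∑ p, (c p * Complex.log (-Complex.I * (w - z p)) +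
    star (c p) * Complex.log (-Complex.I * (w - star (z p))))) / ε)

theorem differentiableAt_downExp {c z : Fin P → ℂ} {ε : ℝ} {lam w : ℂ} (hw : w ∈ downDomain z) :
    DifferentiableAt ℂ (downExp c z ε lam) w := by
  unfold downExp
  have h : ∀ p, DifferentiableAt ℂ (fun w => c p * Complex.log (-Complex.I * (w - z p)) +
      star (c p) * Complex.log (-Complex.I * (w - star (z p)))) w := by
    intro p
    obtain ⟨h1, h2⟩ := hw p
    refine (DifferentiableAt.const_mul (DifferentiableAt.clog (by fun_prop) ?_) _).add
      (DifferentiableAt.const_mul (DifferentiableAt.clog (by fun_prop) ?_) _)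
    · rw [Complex.mem_slitPlane_iff]
      rcases h2 with h2 | h2
      · right; simpa [sub_eq_zero, eq_comm] using h2
      · left; simpa using h2
    · rw [Complex.mem_slitPlane_iff]
      left; simp; linarith
  exact (((by fun_prop : DifferentiableAt ℂ (fun w : ℂ => lam * w) w).add
    (DifferentiableAt.fun_sum fun p _ => h p)).const_mul _).div_const _ |>.cexp

/-- Along the ray from `w` upwards the distances to the poles and their conjugates stay comparable
to what they are at `w`. -/
def RayBound (z : Fin P → ℂ) (d : ℝ) (w : ℂ) : Prop :=
  ∀ p, ∀ s : ℝ, 0 ≤ s → d ≤ ‖w - z p‖ ∧ d * ‖w - z p‖ ≤ ‖w + s * Complex.I - z p‖ ∧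
    d ≤ ‖w - star (z p)‖ ∧ d * ‖w - star (z p)‖ ≤ ‖w + s * Complex.I - star (z p)‖

theorem norm_log_sub_log_le {d s : ℝ} (hd : 0 < d) (hd1 : d ≤ 1) (hs : 0 ≤ s) {A B : ℂ}
    (hB : d ≤ ‖B‖) (hAB : d * ‖B‖ ≤ ‖A‖) (hBA : ‖A‖ ≤ ‖B‖ + s) :
    ‖Complex.log A - Complex.log B‖ ≤ -Real.log d + Real.log (1 + s) + 2 * Real.pi := by
  have hB0 : 0 < ‖B‖ := hd.trans_le hB
  have hA0 : 0 < ‖A‖ := (mul_pos hd hB0).trans_le hAB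
  have h1 := Complex.norm_le_abs_re_add_abs_im (Complex.log A - Complex.log B)
  rw [Complex.sub_re, Complex.sub_im, Complex.log_re, Complex.log_re, Complex.log_im,
    Complex.log_im] at h1
  have h2 : |A.arg - B.arg| ≤ 2 * Real.pi := by
    have := abs_sub A.arg B.arg
    linarith [Complex.abs_arg_le_pi A, Complex.abs_arg_le_pi B]
  have h3 : |Real.log ‖A‖ - Real.log ‖B‖| ≤ -Real.log d + Real.log (1 + s) := by
    have hld : Real.log d ≤ 0 := Real.log_nonpos hd.le hd1
    have hls : 0 ≤ Real.log (1 + s) := Real.log_nonneg (by linarith)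
    rw [abs_le]
    constructor
    · have := Real.log_le_log (by positivity) hAB
      rw [Real.log_mul hd.ne' hB0.ne'] at this
      linarith
    · have h4 : ‖A‖ ≤ d⁻¹ * (1 + s) * ‖B‖ := by
        rw [inv_mul_eq_div, div_mul_eq_mul_div, le_div_iff₀ hd]
        nlinarith
      have := Real.log_le_log hA0 h4
      rw [Real.log_mul (by positivity) hB0.ne', Real.log_mul (by positivity) (by positivity),
        Real.log_inv] at this
      linarith
  linarith

/-- Along an upward ray of length `s` the logarithms change only by `O(log (1 + s))`, which the
factor `exp (lam s / ε)` beats. -/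
theorem exists_norm_downExp_div_le (c z : Fin P → ℂ) {ε : ℝ} (hε : 0 < ε) {lam : ℂ}
    (hlam : lam.re < 0) {d : ℝ} (hd : 0 < d) (hd1 : d ≤ 1) :
    ∃ C α : ℝ, 0 < α ∧ 0 ≤ C ∧ ∀ w, RayBound z d w → ∀ s : ℝ, 0 ≤ s →
      ‖downExp c z ε lam (w + s * Complex.I) / downExp c z ε lam w‖ ≤ C * Real.exp (-(α * s)) := by
  set M := ∑ p, (‖c p‖ + ‖c p‖) with hM
  have hM0 : 0 ≤ M := Finset.sum_nonneg fun p _ => by positivity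
  set μ := -lam.re with hμ
  have hμ0 : 0 < μ := by linarith
  -- With this slope in `log (1 + s) ≤ β (1 + s) - log β`, the logarithms cost at most half of the
  -- decay rate, because `M β ≤ μ / 2`.
  set β := μ / (2 * (M + 1)) with hβdef
  have hβ : 0 < β := by positivity
  refine ⟨Real.exp ((M * (-Real.log d + β - Real.log β + 2 * Real.pi)) / ε), μ / 2 / ε,
    by positivity, by positivity, fun w hw s hs => ?_⟩
  have hrew : downExp c z ε lam (w + s * Complex.I) / downExp c z ε lam w =
      Complex.exp ((lam * s + -Complex.I * ∑ p,
        (c p * (Complex.log (-Complex.I * (w + s * Complex.I - z p)) -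
          Complex.log (-Complex.I * (w - z p))) +
        star (c p) * (Complex.log (-Complex.I * (w + s * Complex.I - star (z p))) -
          Complex.log (-Complex.I * (w - star (z p)))))) / ε) := by
    rw [downExp, downExp, ← Complex.exp_sub]
    congr 1
    rw [← sub_div]
    congr 1
    have : ∀ p, (c p * (Complex.log (-Complex.I * (w + s * Complex.I - z p)) -
          Complex.log (-Complex.I * (w - z p))) +
        star (c p) * (Complex.log (-Complex.I * (w + s * Complex.I - star (z p))) -
          Complex.log (-Complex.I * (w - star (z p))))) =
        (c p * Complex.log (-Complex.I * (w + s * Complex.I - z p)) +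
          star (c p) * Complex.log (-Complex.I * (w + s * Complex.I - star (z p)))) -
        (c p * Complex.log (-Complex.I * (w - z p)) +
          star (c p) * Complex.log (-Complex.I * (w - star (z p)))) := fun p => by ring
    simp_rw [this]
    rw [Finset.sum_sub_distrib]
    linear_combination (-lam * s) * Complex.I_sq
  rw [hrew, Complex.norm_exp, ← Real.exp_add, Real.exp_le_exp, Complex.div_ofReal_re]
  have hlog : ∀ v : ℂ, d ≤ ‖w - v‖ → d * ‖w - v‖ ≤ ‖w + s * Complex.I - v‖ →
      ‖Complex.log (-Complex.I * (w + s * Complex.I - v)) - Complex.log (-Complex.I * (w - v))‖ ≤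
        -Real.log d + Real.log (1 + s) + 2 * Real.pi := by
    intro v h1 h2
    refine norm_log_sub_log_le hd hd1 hs (by simpa using h1) (by simpa using h2) ?_
    simp only [norm_mul, norm_neg, Complex.norm_I, one_mul]
    calc ‖w + s * Complex.I - v‖ = ‖(w - v) + s * Complex.I‖ := by congr 1; ring
      _ ≤ ‖w - v‖ + ‖(s * Complex.I : ℂ)‖ := norm_add_le _ _
      _ = _ := by simp [abs_of_nonneg hs]
  have hsum : ‖∑ p, (c p * (Complex.log (-Complex.I * (w + s * Complex.I - z p)) -
          Complex.log (-Complex.I * (w - z p))) +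
        star (c p) * (Complex.log (-Complex.I * (w + s * Complex.I - star (z p))) -
          Complex.log (-Complex.I * (w - star (z p)))))‖ ≤
        M * (-Real.log d + Real.log (1 + s) + 2 * Real.pi) := by
    rw [hM, Finset.sum_mul]
    refine (norm_sum_le _ _).trans (Finset.sum_le_sum fun p _ => (norm_add_le _ _).trans ?_)
    obtain ⟨h1, h2, h3, h4⟩ := hw p s hs
    rw [norm_mul, norm_mul, norm_star, add_mul]
    exact add_le_add (mul_le_mul_of_nonneg_left (hlog _ h1 h2) (norm_nonneg _))
      (mul_le_mul_of_nonneg_left (hlog _ h3 h4) (norm_nonneg _))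
  set S := ∑ p, (c p * (Complex.log (-Complex.I * (w + s * Complex.I - z p)) -
          Complex.log (-Complex.I * (w - z p))) +
        star (c p) * (Complex.log (-Complex.I * (w + s * Complex.I - star (z p))) -
          Complex.log (-Complex.I * (w - star (z p)))))
  have hlog1 : Real.log (1 + s) ≤ β * (1 + s) - Real.log β := by
    have := Real.log_le_sub_one_of_pos (show 0 < β * (1 + s) by positivity)
    rw [Real.log_mul hβ.ne' (by positivity)] at this
    linarith
  have h1 : (lam * s + -Complex.I * S).re ≤ -μ * s + ‖S‖ := by
    have : (lam * s + -Complex.I * S).re = -μ * s + S.im := by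
      simp [hμ]
    rw [this]
    have := (abs_le.mp (Complex.abs_im_le_norm S)).2
    linarith
  have h2 : M * Real.log (1 + s) ≤ M * (β - Real.log β) + μ / 2 * s := by
    have h3 := mul_le_mul_of_nonneg_left hlog1 hM0
    have h4 : M * β ≤ μ / 2 := by
      rw [hβdef, ← mul_div_assoc, div_le_div_iff₀ (by positivity) (by positivity)]
      nlinarith
    nlinarith
  have h3 : (M * (-Real.log d + β - Real.log β + 2 * Real.pi)) / ε + -(μ / 2 / ε * s) =
      (M * (-Real.log d + β - Real.log β + 2 * Real.pi) - μ / 2 * s) / ε := by ring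
  rw [h3]
  gcongr
  nlinarith

/-- The norm of `w + s I - v` is the distance of `w` from `v - s I`. If `v` is a pole or a conjugate
pole, then `v - s I` is outside of `downDomain` for all `s ≥ 0`, and a small ball keeps a fixed
distance `r` from there. Division by the bound `D` of `‖w - v‖` makes this relative. -/
theorem exists_ball_rayBound {z : Fin P → ℂ} {w₀ : ℂ} (hw : w₀ ∈ downDomain z) :
    ∃ r d : ℝ, 0 < r ∧ 0 < d ∧ d ≤ 1 ∧
      ∀ w ∈ Metric.ball w₀ r, w ∈ downDomain z ∧ RayBound z d w := by
  obtain ⟨R, hR, hball⟩ := Metric.isOpen_iff.mp (isOpen_downDomain z) w₀ hw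
  set r := R / 2 with hr
  have hr0 : 0 < r := by positivity
  set D := r + ‖w₀‖ + ∑ p, ‖z p‖ with hD
  have hD0 : 0 < D := by positivity
  refine ⟨r, min 1 (min r (r / D)), hr0, by positivity, min_le_left _ _, fun w hwr => ?_⟩
  have hfar : ∀ v : ℂ, v ∉ downDomain z → r ≤ ‖w - v‖ := by
    intro v hv
    by_contra h
    refine hv (hball ?_)
    rw [Metric.mem_ball, dist_eq_norm] at hwr ⊢
    calc ‖v - w₀‖ = ‖(w - w₀) - (w - v)‖ := by congr 1; ring
      _ ≤ ‖w - w₀‖ + ‖w - v‖ := norm_sub_le _ _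
      _ < R := by rw [not_le] at h; linarith
  have hnear : ∀ v : ℂ, ∀ p, ‖v‖ = ‖z p‖ → ‖w - v‖ ≤ D := by
    intro v p hv
    have h1 : ‖z p‖ ≤ ∑ p, ‖z p‖ :=
      Finset.single_le_sum (f := fun p => ‖z p‖) (fun p _ => norm_nonneg _) (Finset.mem_univ p)
    rw [Metric.mem_ball, dist_eq_norm] at hwr
    have h2 := norm_sub_le w v
    have h3 := norm_le_norm_add_norm_sub' w w₀
    linarith
  have key : ∀ v : ℂ, ∀ p, ‖v‖ = ‖z p‖ → (∀ s : ℝ, 0 ≤ s → v - s * Complex.I ∉ downDomain z) →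
      ∀ s : ℝ, 0 ≤ s → min 1 (min r (r / D)) ≤ ‖w - v‖ ∧
        min 1 (min r (r / D)) * ‖w - v‖ ≤ ‖w + s * Complex.I - v‖ := by
    intro v p hv hs s hs0
    constructor
    · have := hfar v (by simpa using hs 0 le_rfl)
      exact ((min_le_right _ _).trans (min_le_left _ _)).trans this
    · have h1 := hfar _ (hs s hs0)
      rw [show w - (v - s * Complex.I) = w + s * Complex.I - v by ring] at h1
      refine le_trans ?_ h1
      calc _ ≤ r / D * D := by
            have := hnear v p hv
            gcongr
            exact (min_le_right _ _).trans (min_le_right _ _)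
        _ = r := by field_simp
  refine ⟨hball (Metric.ball_subset_ball (by linarith) hwr), fun p s hs => ?_⟩
  have h1 := key (z p) p rfl (fun s hs h => by
    have := (h p).2
    simp at this
    linarith) s hs
  have h2 := key (star (z p)) p (norm_star _) (fun s hs h => by
    have := (h p).1
    simp at this
    linarith) s hs
  exact ⟨h1.1, h1.2, h2.1, h2.2⟩

theorem RayBound.sq_le {z : Fin P → ℂ} {d : ℝ} (hd : 0 < d) {w : ℂ} (h : RayBound z d w) {s : ℝ}
    (hs : 0 ≤ s) (p : Fin P) :
    d * d ≤ ‖w + s * Complex.I - z p‖ ∧ d * d ≤ ‖w + s * Complex.I - star (z p)‖ := by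
  obtain ⟨h1, h2, h3, h4⟩ := h p s hs
  exact ⟨(mul_le_mul_of_nonneg_left h1 hd.le).trans h2,
    (mul_le_mul_of_nonneg_left h3 hd.le).trans h4⟩

/-- The solution of the differential equation that is given by integration along the upward ray. -/
noncomputable def raySol (c z : Fin P → ℂ) (ε : ℝ) (lam : ℂ) (φ : Fin P → ℂ) (ρ : ℂ) (q : Fin P)
    (w : ℂ) : ℂ :=
  -(1 / ε) * ∫ s in Set.Ioi (0 : ℝ), downExp c z ε lam (w + s * Complex.I) / downExp c z ε lam w *
    source z φ ρ q (w + s * Complex.I)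

theorem differentiableAt_source {z : Fin P → ℂ} (φ : Fin P → ℂ) (ρ : ℂ) (q : Fin P) {w : ℂ}
    (hw : ∀ p, w ≠ z p) (hw' : -(z q).im < w.im) : DifferentiableAt ℂ (source z φ ρ q) w := by
  unfold source
  refine DifferentiableAt.sub (DifferentiableAt.fun_sum fun p _ => ?_) ?_
  · exact (differentiableAt_const _).div (by fun_prop) (sub_ne_zero.mpr (hw p))
  · exact (differentiableAt_const _).div (by fun_prop) (sub_star_ne_zero hw')

theorem differentiableAt_raySol (c : Fin P → ℂ) {z : Fin P → ℂ} {ε : ℝ} (hε : 0 < ε) {lam : ℂ}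
    (hlam : lam.re < 0) (φ : Fin P → ℂ) (ρ : ℂ) (q : Fin P) {w₀ : ℂ} (hw : w₀ ∈ downDomain z) :
    DifferentiableAt ℂ (raySol c z ε lam φ ρ q) w₀ := by
  obtain ⟨r, d, hr, hd, hd1, hball⟩ := exists_ball_rayBound hw
  obtain ⟨C, α, hα, hC, hbd⟩ := exists_norm_downExp_div_le c z hε hlam hd hd1
  have hdiff : ∀ s : ℝ, 0 ≤ s → ∀ w ∈ downDomain z, DifferentiableAt ℂ (fun w =>
      downExp c z ε lam (w + s * Complex.I) / downExp c z ε lam w *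
        source z φ ρ q (w + s * Complex.I)) w := by
    intro s hs w hw
    have hw' := add_mem_downDomain hw hs
    have hadd : DifferentiableAt ℂ (fun w : ℂ => w + s * Complex.I) w := by fun_prop
    refine DifferentiableAt.mul (DifferentiableAt.div ?_ (differentiableAt_downExp hw)
      (Complex.exp_ne_zero _)) ?_
    · exact DifferentiableAt.comp (𝕜 := ℂ) (f := fun w : ℂ => w + s * Complex.I)
        (g := downExp c z ε lam) w (differentiableAt_downExp hw') hadd
    · exact DifferentiableAt.comp (𝕜 := ℂ) (f := fun w : ℂ => w + s * Complex.I) w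
        (differentiableAt_source φ ρ q (downDomain_ne hw') (hw' q).1) hadd
  unfold raySol
  refine DifferentiableAt.const_mul (differentiableAt_integral_of_norm_le hr
    (B := fun s => C * Real.exp (-α * s) * ((∑ p, ‖φ p‖ + ‖ρ‖) / (d * d))) ?_ ?_ ?_ ?_) _
  · intro w hw
    refine ContinuousOn.aestronglyMeasurable (fun s hs => ContinuousAt.continuousWithinAt ?_)
      measurableSet_Ioi
    have hw' := add_mem_downDomain (hball w hw).1 (le_of_lt hs : (0:ℝ) ≤ s)
    have hadd : ContinuousAt (fun s : ℝ => w + s * Complex.I) s := by fun_prop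
    refine ContinuousAt.mul (ContinuousAt.div_const ?_ _) ?_
    · exact ContinuousAt.comp (f := fun s : ℝ => w + s * Complex.I) (g := downExp c z ε lam)
        (differentiableAt_downExp hw').continuousAt hadd
    · exact ContinuousAt.comp (f := fun s : ℝ => w + s * Complex.I)
        (differentiableAt_source φ ρ q (downDomain_ne hw') (hw' q).1).continuousAt hadd
  · exact ((exp_neg_integrableOn_Ioi 0 hα).const_mul _).mul_const _
  · refine (ae_restrict_iff' measurableSet_Ioi).mpr (Eventually.of_forall fun s hs => ?_)
    exact fun w hw => (hdiff s (le_of_lt hs) w (hball w hw).1).differentiableWithinAt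
  · refine (ae_restrict_iff' measurableSet_Ioi).mpr (Eventually.of_forall fun s hs w hw => ?_)
    have h := (hball w hw).2
    rw [norm_mul, neg_mul]
    have h1 := hbd w h s (le_of_lt hs)
    have h2 := norm_source_le (φ := φ) (ρ := ρ) (q := q) (mul_pos hd hd)
      (fun p => (h.sq_le hd (le_of_lt hs) p).1) (h.sq_le hd (le_of_lt hs) q).2
    gcongr

/-- For large `w` in the upper half-plane all distances along the ray are at least `‖w‖ / 2`, so the
source is `O(1/‖w‖)` on it, and the exponential factor is integrable. This is where the decay of the
Hardy solution comes from. -/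
theorem exists_norm_raySol_le (c z : Fin P → ℂ) {ε : ℝ} (hε : 0 < ε) {lam : ℂ}
    (hlam : lam.re < 0) (φ : Fin P → ℂ) (ρ : ℂ) (q : Fin P) :
    ∃ C R : ℝ, ∀ w : ℂ, 0 ≤ w.im → R ≤ ‖w‖ →
      ‖raySol c z ε lam φ ρ q w‖ ≤ C / ‖w‖ := by
  obtain ⟨C, α, hα, hC, hbd⟩ := exists_norm_downExp_div_le c z hε hlam (d := 1 / 2) (by norm_num)
    (by norm_num)
  set Z := ∑ p, ‖z p‖ with hZ
  have hZ0 : 0 ≤ Z := Finset.sum_nonneg fun p _ => norm_nonneg _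
  have hzZ : ∀ p, ‖z p‖ ≤ Z := fun p => Finset.single_le_sum (f := fun p => ‖z p‖)
    (fun p _ => norm_nonneg _) (Finset.mem_univ p)
  set B := ∑ p, ‖φ p‖ + ‖ρ‖ with hB
  have hB0 : 0 ≤ B := by positivity
  refine ⟨‖(-(1 / ε) : ℂ)‖ * (C * (4 * B) / α), 3 * Z + 1, fun w hw hwR => ?_⟩
  have hw0 : 0 < ‖w‖ := by linarith
  have hup : ∀ s : ℝ, 0 ≤ s → ‖w‖ ≤ ‖w + s * Complex.I‖ := by
    intro s hs
    rw [Complex.norm_def, Complex.norm_def]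
    refine Real.sqrt_le_sqrt ?_
    rw [Complex.normSq_apply, Complex.normSq_apply]
    simp
    nlinarith
  have key : ∀ v : ℂ, ‖v‖ ≤ Z → ∀ s : ℝ, 0 ≤ s → ‖w‖ / 2 ≤ ‖w + s * Complex.I - v‖ ∧
      1 / 2 ≤ ‖w - v‖ ∧ 1 / 2 * ‖w - v‖ ≤ ‖w + s * Complex.I - v‖ := by
    intro v hv s hs
    have h1 := norm_sub_norm_le (w + s * Complex.I) v
    have h2 := norm_sub_norm_le w v
    have h3 := norm_sub_le w v
    have h4 := hup s hs
    refine ⟨by linarith, by linarith, by linarith⟩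
  have hray : RayBound z (1 / 2) w := by
    intro p s hs
    have h1 := key (z p) (hzZ p) s hs
    have h2 := key (star (z p)) (by rw [norm_star]; exact hzZ p) s hs
    exact ⟨h1.2.1, h1.2.2, h2.2.1, h2.2.2⟩
  have hint : ‖∫ s in Set.Ioi (0 : ℝ), downExp c z ε lam (w + s * Complex.I) /
      downExp c z ε lam w * source z φ ρ q (w + s * Complex.I)‖ ≤
      ∫ s in Set.Ioi (0 : ℝ), C * (B / (‖w‖ / 2)) * Real.exp (-α * s) := by
    refine norm_integral_le_of_norm_le ((exp_neg_integrableOn_Ioi 0 hα).const_mul _) ?_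
    refine (ae_restrict_iff' measurableSet_Ioi).mpr (Eventually.of_forall fun s hs => ?_)
    have hs0 : (0 : ℝ) ≤ s := le_of_lt hs
    rw [norm_mul, neg_mul]
    have h1 := hbd w hray s hs0
    have h2 := norm_source_le (φ := φ) (ρ := ρ) (q := q) (half_pos hw0)
      (fun p => (key (z p) (hzZ p) s hs0).1)
      (key (star (z q)) (by rw [norm_star]; exact hzZ q) s hs0).1
    calc _ ≤ (C * Real.exp (-(α * s))) * (B / (‖w‖ / 2)) := by gcongr
      _ = _ := by ring
  have hexp : ∫ s in Set.Ioi (0 : ℝ), Real.exp (-α * s) = 1 / α := by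
    have := integral_exp_mul_Ioi (a := -α) (by linarith) 0
    rw [this]; simp
  rw [integral_const_mul, hexp] at hint
  rw [raySol, norm_mul]
  calc _ ≤ ‖(-(1 / ε) : ℂ)‖ * (C * (B / (‖w‖ / 2)) * (1 / α)) := by gcongr
    _ ≤ ‖(-(1 / ε) : ℂ)‖ * (C * (4 * B) / α / ‖w‖) := by
      gcongr
      have : C * (B / (‖w‖ / 2)) * (1 / α) = C * (2 * B) / α / ‖w‖ := by field_simp
      rw [this]
      gcongr
      norm_num
    _ = _ := by ring

end BO

/-! ### Isolated singularities of moderate growth, and comparison of upward and downward cuts. -/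

namespace BO

/-- Along the radius `γ τ = a + exp (-τ) v` the hypothesis is a linear differential inequality in
`τ`. Grönwall gives growth of order `exp (N τ)`, which is a power of the inverse distance; `τ = log
t` leads from the circle to `w`. -/
theorem exists_norm_mul_pow_le_of_norm_deriv_le {Ψ : ℂ → ℂ} {a : ℂ} {K : ℝ}
    (h : ∀ᶠ w in 𝓝[≠] a, DifferentiableAt ℂ Ψ w ∧ ‖deriv Ψ w‖ * ‖w - a‖ ≤ K * (‖Ψ w‖ + 1)) :
    ∃ (N : ℕ) (C : ℝ), ∀ᶠ w in 𝓝[≠] a, ‖Ψ w‖ * ‖w - a‖ ^ N ≤ C := by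
  obtain ⟨r, hr, hball⟩ := (nhdsWithin_hasBasis Metric.nhds_basis_closedBall _).eventually_iff.mp h
  obtain ⟨N, hN⟩ := exists_nat_ge (max K 1)
  have hN1 : (1 : ℝ) ≤ N := (le_max_right _ _).trans hN
  have hNK : K ≤ N := (le_max_left _ _).trans hN
  have hcirc : ContinuousOn Ψ (Metric.sphere a r) := fun w hw =>
    (hball ⟨Metric.sphere_subset_closedBall hw, Metric.ne_of_mem_sphere hw hr.ne'⟩).1.continuousAt.continuousWithinAt
  obtain ⟨δ, hδ⟩ := (isCompact_sphere a r).exists_bound_of_continuousOn hcirc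
  refine ⟨N, (δ + 1) * r ^ N, ?_⟩
  have hmem : Metric.ball a r ∩ {a}ᶜ ∈ 𝓝[≠] a :=
    inter_mem (nhdsWithin_le_nhds (Metric.ball_mem_nhds a hr)) self_mem_nhdsWithin
  filter_upwards [hmem] with w hw
  have hwa : 0 < ‖w - a‖ := norm_pos_iff.mpr (sub_ne_zero.mpr hw.2)
  have hwr : ‖w - a‖ < r := by simpa [dist_eq_norm] using hw.1
  set t := r / ‖w - a‖ with ht
  have ht1 : 1 ≤ t := by rw [ht, le_div_iff₀ hwa]; linarith
  have ht0 : 0 < t := by linarith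
  set v : ℂ := (w - a) * t with hv
  have hvr : ‖v‖ = r := by
    rw [hv, norm_mul, Complex.norm_real, Real.norm_of_nonneg ht0.le, ht]
    field_simp
  set γ : ℝ → ℂ := fun τ => a + (Real.exp (-τ) : ℝ) * v with hγ
  have hγa : ∀ τ, ‖γ τ - a‖ = Real.exp (-τ) * r := by
    intro τ
    rw [hγ]
    simp only [add_sub_cancel_left, norm_mul, Complex.norm_real, hvr, Real.norm_eq_abs, Real.abs_exp]
  have hγmem : ∀ τ, 0 ≤ τ → γ τ ∈ Metric.closedBall a r ∩ {a}ᶜ := by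
    intro τ hτ
    constructor
    · rw [Metric.mem_closedBall, dist_eq_norm, hγa]
      have : Real.exp (-τ) ≤ 1 := Real.exp_le_one_iff.mpr (by linarith)
      nlinarith
    · intro h0
      have := hγa τ
      rw [Set.mem_singleton_iff.mp h0] at this
      simp only [sub_self, norm_zero] at this
      have h2 : 0 < Real.exp (-τ) * r := by positivity
      linarith
  have hγd : ∀ τ, HasDerivAt γ (-(γ τ - a)) τ := by
    intro τ
    have h1 : HasDerivAt (fun τ : ℝ => Real.exp (-τ)) (-Real.exp (-τ)) τ := by
      simpa using (hasDerivAt_neg τ).exp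
    have h2 := (h1.ofReal_comp.mul_const v).const_add a
    refine h2.congr_deriv ?_
    simp [hγ]
  have hΨγ : ∀ τ, 0 ≤ τ → HasDerivAt (fun τ => Ψ (γ τ)) (-(γ τ - a) * deriv Ψ (γ τ)) τ := by
    intro τ hτ
    exact HasDerivAt.scomp τ (hball (hγmem τ hτ)).1.hasDerivAt (hγd τ)
  have hT : 0 ≤ Real.log t := Real.log_nonneg ht1
  have hgr := norm_le_gronwallBound_of_norm_deriv_right_le (f := fun τ => Ψ (γ τ))
    (f' := fun τ => -(γ τ - a) * deriv Ψ (γ τ)) (δ := δ) (K := N) (ε := N) (a := 0) (b := Real.log t)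
    (fun τ hτ => (hΨγ τ hτ.1).continuousAt.continuousWithinAt)
    (fun τ hτ => (hΨγ τ hτ.1).hasDerivWithinAt)
    (hδ _ (by simp [hγ, hvr])) (fun τ hτ => by
      have h1 := (hball (hγmem τ hτ.1)).2
      rw [norm_mul, norm_neg, mul_comm]
      have h2 : 0 ≤ ‖Ψ (γ τ)‖ := norm_nonneg _
      nlinarith) (Real.log t) ⟨hT, le_rfl⟩
  have hγT : γ (Real.log t) = w := by
    have htc : (t : ℂ) ≠ 0 := by exact_mod_cast ht0.ne'
    simp only [hγ, hv, Real.exp_neg, Real.exp_log ht0, Complex.ofReal_inv]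
    field_simp
    ring
  simp only [hγT, sub_zero] at hgr
  rw [gronwallBound_of_K_ne_0 (by linarith), div_self (by linarith)] at hgr
  simp only [one_mul] at hgr
  have hpow : Real.exp (N * Real.log t) = t ^ N := by
    rw [Real.exp_nat_mul, Real.exp_log ht0]
  rw [hpow] at hgr
  have htN : t ^ N * ‖w - a‖ ^ N = r ^ N := by
    rw [← mul_pow, ht]; field_simp
  calc ‖Ψ w‖ * ‖w - a‖ ^ N ≤ ((δ + 1) * t ^ N) * ‖w - a‖ ^ N := by
        gcongr; linarith
    _ = (δ + 1) * r ^ N := by rw [mul_assoc, htN]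

/-- Algebraic growth excludes an essential singularity, and the order of a meromorphic function
decides between the two cases. -/
theorem tendsto_or_pole_of_norm_deriv_le {Ψ : ℂ → ℂ} {a : ℂ} {K : ℝ}
    (h : ∀ᶠ w in 𝓝[≠] a, DifferentiableAt ℂ Ψ w ∧ ‖deriv Ψ w‖ * ‖w - a‖ ≤ K * (‖Ψ w‖ + 1)) :
    (∃ l, Tendsto Ψ (𝓝[≠] a) (𝓝 l)) ∨ ∃ (k : ℕ) (g : ℂ → ℂ), 0 < k ∧ AnalyticAt ℂ g a ∧ g a ≠ 0 ∧
      ∀ᶠ w in 𝓝[≠] a, Ψ w * (w - a) ^ k = g w := by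
  obtain ⟨N, C, hC⟩ := exists_norm_mul_pow_le_of_norm_deriv_le h
  have hmer : MeromorphicAt Ψ a := by
    refine ⟨N + 1, Complex.analyticAt_of_differentiable_on_punctured_nhds_of_continuousAt ?_ ?_⟩
    · filter_upwards [h] with w hw
      exact DifferentiableAt.fun_smul ((differentiableAt_id.sub_const a).pow (N + 1)) hw.1
    · rw [continuousAt_iff_punctured_nhds]
      simp only [sub_self, zero_pow (Nat.succ_ne_zero N), zero_smul]
      refine squeeze_zero_norm' (a := fun w => ‖w - a‖ * C) ?_ ?_
      · filter_upwards [hC] with w hw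
        rw [norm_smul, norm_pow, pow_succ]
        calc _ = ‖w - a‖ * (‖Ψ w‖ * ‖w - a‖ ^ N) := by ring
          _ ≤ _ := by gcongr
      · have : ContinuousAt (fun w => ‖w - a‖ * C) a := by fun_prop
        have h2 := this.tendsto.mono_left (nhdsWithin_le_nhds (s := {a}ᶜ))
        simpa using h2
  rcases eq_or_ne (meromorphicOrderAt Ψ a) ⊤ with htop | hne
  · left
    refine ⟨0, ?_⟩
    have := meromorphicOrderAt_eq_top_iff.mp htop
    exact tendsto_const_nhds.congr' (this.mono fun w hw => hw.symm)
  · obtain ⟨n, hn⟩ := WithTop.ne_top_iff_exists.mp hne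
    rcases le_or_gt 0 n with h0 | h0
    · left
      exact tendsto_nhds_of_meromorphicOrderAt_nonneg hmer (by rw [← hn]; exact_mod_cast h0)
    · right
      obtain ⟨g, hg, hg0, hev⟩ := (meromorphicOrderAt_eq_int_iff hmer).mp hn.symm
      refine ⟨n.natAbs, g, Int.natAbs_pos.mpr h0.ne, hg, hg0, ?_⟩
      filter_upwards [hev, self_mem_nhdsWithin] with w hw hwa
      have hwa' : w - a ≠ 0 := sub_ne_zero.mpr hwa
      rw [hw, smul_eq_mul, ← zpow_natCast, Int.natCast_natAbs, abs_of_neg h0, zpow_neg]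
      field_simp

variable {P : ℕ}

/-- The two branches differ by `π i` or `-π i`. The sign depends only on the side of `v` on which
`w` lies, so it is constant along a vertical ray and cancels in the difference. -/
theorem log_neg_mul_I {w v : ℂ} (h : w.re ≠ v.re) {s : ℝ} :
    Complex.log (Complex.I * (w + s * Complex.I - v)) - Complex.log (Complex.I * (w - v)) =
      Complex.log (-Complex.I * (w + s * Complex.I - v)) - Complex.log (-Complex.I * (w - v)) := by
  have hneg : ∀ x : ℂ, -Complex.I * x = -(Complex.I * x) := fun x => by ring
  rw [hneg, hneg]
  have him : ∀ s : ℝ, (Complex.I * (w + s * Complex.I - v)).im = w.re - v.re := by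
    intro s; simp
  have him0 : (Complex.I * (w - v)).im = w.re - v.re := by simp
  rcases lt_or_gt_of_ne h with h1 | h1
  · have e : ∀ X : ℂ, X.im = w.re - v.re → Complex.log (-X) = Complex.log X + Real.pi * Complex.I := by
      intro X hX
      rw [Complex.log, Complex.log, norm_neg, Complex.arg_neg_eq_arg_add_pi_of_im_neg (by linarith)]
      push_cast; ring
    rw [e _ (him s), e _ him0]; ring
  · have e : ∀ X : ℂ, X.im = w.re - v.re → Complex.log (-X) = Complex.log X - Real.pi * Complex.I := by
      intro X hX
      rw [Complex.log, Complex.log, norm_neg, Complex.arg_neg_eq_arg_sub_pi_of_im_pos (by linarith)]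
      push_cast; ring
    rw [e _ (him s), e _ him0]; ring

theorem downExp_div {c z : Fin P → ℂ} {ε : ℝ} {lam w : ℂ} (hw : ∀ p, w.re ≠ (z p).re) (s : ℝ) :
    downExp c z ε lam (w + s * Complex.I) / downExp c z ε lam w =
      expF c z ε lam (w + s * Complex.I) / expF c z ε lam w := by
  rw [downExp, downExp, expF, expF, ← Complex.exp_sub, ← Complex.exp_sub, ← sub_div, ← sub_div]
  congr 2
  have : (∑ p, (c p * Complex.log (-Complex.I * (w + s * Complex.I - z p)) +
      star (c p) * Complex.log (-Complex.I * (w + s * Complex.I - star (z p))))) -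
      (∑ p, (c p * Complex.log (-Complex.I * (w - z p)) +
      star (c p) * Complex.log (-Complex.I * (w - star (z p))))) =
      f c z (w + s * Complex.I) - f c z w := by
    rw [f, f, ← Finset.sum_sub_distrib, ← Finset.sum_sub_distrib]
    refine Finset.sum_congr rfl fun p _ => ?_
    linear_combination (-c p) * log_neg_mul_I (hw p) (s := s)
  linear_combination (-Complex.I) * this

end BO

/-! ### Gluing the two representations across the upward cuts. -/

namespace BO

variable {P : ℕ}

/-- As the real parts of the poles are distinct, a vertical line contains at most one of them, and a
point of it is either not above or not below that pole. -/
theorem slit_or_down {c z : Fin P → ℂ} (hu : IsRationalPotential c z) {w : ℂ}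
    (hw : ∀ p, -(z p).im < w.im) (hne : ∀ p, w ≠ z p) :
    w ∈ slitDomain z Set.univ ∨ w ∈ downDomain z := by
  by_cases h : w ∈ slitDomain z Set.univ
  · exact Or.inl h
  · right
    simp only [slitDomain, Set.mem_ofPred_eq, not_forall] at h
    obtain ⟨p, hp⟩ := h
    simp only [hw p, true_and, Set.mem_univ, true_imp_iff, not_or, not_not, not_lt] at hp
    intro j
    refine ⟨hw j, ?_⟩
    by_cases hj : j = p
    · subst hj
      right
      exact lt_of_le_of_ne hp.2 fun h => hne j (Complex.ext hp.1 h.symm)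
    · left
      rw [hp.1]
      exact fun h => hj (hu.pole_re_strictMono.injective h).symm

theorem re_ne_of_slit_of_down {z : Fin P → ℂ} {w : ℂ} (h1 : w ∈ slitDomain z Set.univ)
    (h2 : w ∈ downDomain z) (p : Fin P) : w.re ≠ (z p).re := by
  rcases (h1 p).2 trivial with h | h
  · exact h
  · rcases (h2 p).2 with h' | h'
    · exact h'
    · linarith

theorem eventually_ne_add_pos (z : Fin P → ℂ) (w : ℂ) :
    ∀ᶠ t : ℝ in 𝓝[>] 0, ∀ p, (w + t).re ≠ (z p).re := by
  rw [eventually_all]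
  intro p
  by_cases h : w.re = (z p).re
  · filter_upwards [self_mem_nhdsWithin] with t ht
    simp only [Complex.add_re, Complex.ofReal_re, h]
    have : (0 : ℝ) < t := ht
    linarith
  · refine nhdsWithin_le_nhds ?_
    have hc : ContinuousAt (fun t : ℝ => (w + t).re) 0 := by fun_prop
    exact hc.eventually_ne (by simpa using h)

theorem eventually_punctured_ne {z : Fin P → ℂ} (w : ℂ) : ∀ᶠ v in 𝓝[≠] w, ∀ p, v ≠ z p := by
  rw [eventually_all]
  intro p
  by_cases h : w = z p
  · rw [h]; exact self_mem_nhdsWithin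
  · exact nhdsWithin_le_nhds (isOpen_ne.mem_nhds h)

variable [NeZero P]

/-- The solution of the differential equation in terms of the primitive of the integrand. -/
noncomputable def slitSol (c z : Fin P → ℂ) (ε : ℝ) (lam : ℂ) (φ : Fin P → ℂ) (ρ : ℂ) (q : Fin P)
    (w : ℂ) : ℂ :=
  -(Complex.I / ε) * (primitive z (integrand c z ε lam φ ρ q) w / expF c z ε lam w)

open scoped Classical in
/-- `slitSol` continued across the upward cuts. -/
noncomputable def gluedSol (c z : Fin P → ℂ) (ε : ℝ) (lam : ℂ) (φ : Fin P → ℂ) (ρ : ℂ) (q : Fin P)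
    (w : ℂ) : ℂ :=
  if w ∈ slitDomain z Set.univ then slitSol c z ε lam φ ρ q w else raySol c z ε lam φ ρ q w

variable {c z : Fin P → ℂ} (hu : IsRationalPotential c z) {ε : ℝ} (hε : 0 < ε) {lam : ℂ}
  (φ : Fin P → ℂ) (ρ : ℂ) (q : Fin P)

include hu hε

theorem hasDerivAt_slitSol {w : ℂ} (hw : w ∈ slitDomain z Set.univ) :
    HasDerivAt (slitSol c z ε lam φ ρ q)
      (Complex.I / ε * ((lam + uC c z w) * slitSol c z ε lam φ ρ q w - source z φ ρ q w)) w := by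
  have h1 := hasDerivAt_primitive hu.pole_im_pos (differentiableOn_integrand c z ε lam φ ρ q) hw
  have h2 := hasDerivAt_expF (c := c) (ε := ε) (lam := lam) hw
  have h3 := ((h1.div h2 (expF_ne_zero c z ε lam w)).const_mul (-(Complex.I / ε)))
  refine h3.congr_deriv ?_
  have hE := expF_ne_zero c z ε lam w
  have hε' : (ε : ℂ) ≠ 0 := by exact_mod_cast hε.ne'
  rw [slitSol, integrand]
  field_simp
  ring

variable (hlam : lam.re < 0)
  (hA : ∀ m, integralC c z ε m (integrand c z ε lam φ ρ q) = 0)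

include hlam hA

/-- Since the primitive vanishes at the top of every column, it is minus the integral over the rest
of that column. -/
theorem primitive_eq_integral_ray {w : ℂ} (hw : ∀ p, -(z p).im < w.im)
    (hre : ∀ p, w.re ≠ (z p).re) :
    primitive z (integrand c z ε lam φ ρ q) w =
      -Complex.I * ∫ s in Set.Ioi (0 : ℝ), integrand c z ε lam φ ρ q (w + s * Complex.I) := by
  have h0 := topLimit_eq_zero hu hε hlam φ ρ q hA hre
  set G := integrand c z ε lam φ ρ q with hG
  have hslit : w ∈ slitDomain z Set.univ := fun p => ⟨hw p, fun _ => Or.inl (hre p)⟩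
  have hi0 := integrableOn_integrand_ray (c := c) hu.pole_im_pos hε hlam φ ρ q hre
  have hc : ContinuousOn (fun y : ℝ => G (w.re + y * Complex.I)) (Set.uIcc 0 w.im) := by
    refine (differentiableOn_integrand c z ε lam φ ρ q).continuousOn.comp (by fun_prop) fun y hy => ?_
    exact mem_slitDomain_of_uIcc hu.pole_im_pos hslit (by simp) (by simpa using hy)
  have hi1 : IntegrableOn (fun y : ℝ => G (w.re + y * Complex.I)) (Set.Ioi w.im) := by
    refine ((hc.integrableOn_compact isCompact_uIcc).union hi0).mono_set fun y hy => ?_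
    by_cases h : 0 < y
    · exact Or.inr h
    · exact Or.inl (Set.mem_uIcc.mpr (Or.inr ⟨le_of_lt hy, not_lt.mp h⟩))
  have hsplit := intervalIntegral.integral_interval_add_Ioi hi0 hi1
  have hshift : ∫ s in Set.Ioi (0 : ℝ), G (w + s * Complex.I) =
      ∫ y in Set.Ioi w.im, G (w.re + y * Complex.I) := by
    have h := (measurePreserving_add_right (volume : Measure ℝ) w.im).setIntegral_preimage_emb
      (measurableEmbedding_addRight w.im) (fun y : ℝ => G (w.re + y * Complex.I)) (Set.Ioi w.im)
    rw [← h]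
    have hset : (fun x : ℝ => x + w.im) ⁻¹' Set.Ioi w.im = Set.Ioi 0 := by
      ext x; simp
    rw [hset]
    congr 1
    funext s
    congr 1
    apply Complex.ext <;> simp [add_comm]
  rw [hshift]
  rw [topLimit] at h0
  rw [primitive]
  linear_combination h0 + Complex.I * hsplit

theorem slitSol_eq_raySol {w : ℂ} (hw : ∀ p, -(z p).im < w.im) (hre : ∀ p, w.re ≠ (z p).re) :
    slitSol c z ε lam φ ρ q w = raySol c z ε lam φ ρ q w := by
  rw [slitSol, raySol, primitive_eq_integral_ray hu hε φ ρ q hlam hA hw hre]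
  simp_rw [downExp_div hre]
  have e : ∀ s : ℝ, expF c z ε lam (w + s * Complex.I) / expF c z ε lam w *
      source z φ ρ q (w + s * Complex.I) =
      (expF c z ε lam w)⁻¹ * integrand c z ε lam φ ρ q (w + s * Complex.I) := by
    intro s; rw [integrand]; ring
  simp_rw [e]
  rw [integral_const_mul]
  linear_combination (1 / ε * ((expF c z ε lam w)⁻¹ *
    ∫ s in Set.Ioi (0 : ℝ), integrand c z ε lam φ ρ q (w + s * Complex.I))) * Complex.I_sq

/-- Off the columns of the poles the ray solution is the slit solution, which solves the equation.
On such a column the equation follows by approaching horizontally, as both sides are continuous. -/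
theorem hasDerivAt_raySol {w : ℂ} (hw : w ∈ downDomain z) :
    HasDerivAt (raySol c z ε lam φ ρ q)
      (Complex.I / ε * ((lam + uC c z w) * raySol c z ε lam φ ρ q w - source z φ ρ q w)) w := by
  have hd : DifferentiableOn ℂ (raySol c z ε lam φ ρ q) (downDomain z) := fun v hv =>
    (differentiableAt_raySol c hε hlam φ ρ q hv).differentiableWithinAt
  have hopen := isOpen_downDomain z
  have hnhds := hopen.mem_nhds hw
  have key : ∀ v ∈ downDomain z, (∀ p, v.re ≠ (z p).re) →
      deriv (raySol c z ε lam φ ρ q) v = Complex.I / ε *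
        ((lam + uC c z v) * raySol c z ε lam φ ρ q v - source z φ ρ q v) := by
    intro v hv hre
    have hslit : v ∈ slitDomain z Set.univ := fun p => ⟨(hv p).1, fun _ => Or.inl (hre p)⟩
    rw [← slitSol_eq_raySol hu hε φ ρ q hlam hA (fun p => (hv p).1) hre]
    refine ((hasDerivAt_slitSol hu hε φ ρ q hslit).congr_of_eventuallyEq ?_).deriv
    filter_upwards [(isOpen_slitDomain z Set.univ).mem_nhds hslit, hopen.mem_nhds hv] with x hx hx'
    exact (slitSol_eq_raySol hu hε φ ρ q hlam hA (fun p => (hx p).1)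
      (re_ne_of_slit_of_down hx hx')).symm
  have hpath : Tendsto (fun t : ℝ => w + t) (𝓝[>] 0) (𝓝 w) := by
    have : ContinuousAt (fun t : ℝ => w + t) 0 := by fun_prop
    have h2 := this.tendsto
    simp only [Complex.ofReal_zero, add_zero] at h2
    exact h2.mono_left nhdsWithin_le_nhds
  have h1 : Tendsto (fun t : ℝ => deriv (raySol c z ε lam φ ρ q) (w + t)) (𝓝[>] 0)
      (𝓝 (deriv (raySol c z ε lam φ ρ q) w)) :=
    ((hd.deriv hopen).differentiableAt hnhds).continuousAt.tendsto.comp hpath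
  have huc : ContinuousAt (uC c z) w := by
    unfold uC
    refine tendsto_finsetSum _ fun p _ => ?_
    have e1 : w - z p ≠ 0 := sub_ne_zero.mpr (downDomain_ne hw p)
    have e2 : w - star (z p) ≠ 0 := sub_star_ne_zero (hw p).1
    have : ContinuousAt (fun w => c p / (w - z p) + star (c p) / (w - star (z p))) w := by
      refine ContinuousAt.add ?_ ?_
      · exact continuousAt_const.div (by fun_prop) e1
      · exact continuousAt_const.div (by fun_prop) e2
    exact this
  have h2 : Tendsto (fun t : ℝ => Complex.I / ε * ((lam + uC c z (w + t)) *
      raySol c z ε lam φ ρ q (w + t) - source z φ ρ q (w + t))) (𝓝[>] 0)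
      (𝓝 (Complex.I / ε * ((lam + uC c z w) * raySol c z ε lam φ ρ q w - source z φ ρ q w))) :=
    ((((tendsto_const_nhds.add (huc.tendsto.comp hpath)).mul
      ((hd.differentiableAt hnhds).continuousAt.tendsto.comp hpath)).sub
      ((differentiableAt_source φ ρ q (downDomain_ne hw) (hw q).1).continuousAt.tendsto.comp
        hpath)).const_mul _)
  have h3 := h1.congr' (f₂ := fun t : ℝ => Complex.I / ε * ((lam + uC c z (w + t)) *
      raySol c z ε lam φ ρ q (w + t) - source z φ ρ q (w + t))) (by
    filter_upwards [eventually_ne_add_pos z w, hpath hnhds] with t ht ht2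
    exact key _ ht2 ht)
  rw [← tendsto_nhds_unique h3 h2]
  exact (hd.differentiableAt hnhds).hasDerivAt

theorem gluedSol_eq_raySol {w : ℂ} (hw : w ∈ downDomain z) :
    gluedSol c z ε lam φ ρ q w = raySol c z ε lam φ ρ q w := by
  unfold gluedSol
  split_ifs with h
  · exact slitSol_eq_raySol hu hε φ ρ q hlam hA (fun p => (hw p).1) (re_ne_of_slit_of_down h hw)
  · rfl

theorem hasDerivAt_gluedSol {w : ℂ} (hw : ∀ p, -(z p).im < w.im) (hne : ∀ p, w ≠ z p) :
    HasDerivAt (gluedSol c z ε lam φ ρ q)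
      (Complex.I / ε * ((lam + uC c z w) * gluedSol c z ε lam φ ρ q w - source z φ ρ q w)) w := by
  rcases slit_or_down hu hw hne with h | h
  · have e : ∀ v ∈ slitDomain z Set.univ,
        gluedSol c z ε lam φ ρ q v = slitSol c z ε lam φ ρ q v := fun v hv => if_pos hv
    rw [e w h]
    refine (hasDerivAt_slitSol hu hε φ ρ q h).congr_of_eventuallyEq ?_
    filter_upwards [(isOpen_slitDomain z Set.univ).mem_nhds h] with v hv using e v hv
  · rw [gluedSol_eq_raySol hu hε φ ρ q hlam hA h]
    refine (hasDerivAt_raySol hu hε φ ρ q hlam hA h).congr_of_eventuallyEq ?_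
    filter_upwards [(isOpen_downDomain z).mem_nhds h] with v hv
      using gluedSol_eq_raySol hu hε φ ρ q hlam hA hv

end BO

/-! ### Removability of the singularities at the poles, and existence of Hardy solutions. -/

namespace BO

variable {P : ℕ} [NeZero P] {c z : Fin P → ℂ} (hu : IsRationalPotential c z) {ε : ℝ} (hε : 0 < ε)
  {lam : ℂ} (φ : Fin P → ℂ) (ρ : ℂ) (q : Fin P) (hlam : lam.re < 0)
  (hA : ∀ m, integralC c z ε m (integrand c z ε lam φ ρ q) = 0)

omit [NeZero P] in
include hu in
theorem eventually_neg_lt_im (m : Fin P) : ∀ᶠ w in 𝓝[≠] z m, ∀ p, -(z p).im < w.im := by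
  rw [eventually_all]
  intro p
  exact nhdsWithin_le_nhds ((isOpen_neg_lt_im _).mem_nhds
    (show -(z p).im < (z m).im by linarith [hu.pole_im_pos p, hu.pole_im_pos m]))

include hu hε hlam hA

theorem eventually_hasDerivAt_gluedSol (m : Fin P) :
    ∀ᶠ w in 𝓝[≠] z m, HasDerivAt (gluedSol c z ε lam φ ρ q)
      (Complex.I / ε * ((lam + uC c z w) * gluedSol c z ε lam φ ρ q w - source z φ ρ q w)) w := by
  filter_upwards [eventually_punctured_ne (z m), eventually_neg_lt_im hu m] with w h1 h2
  exact hasDerivAt_gluedSol hu hε φ ρ q hlam hA h2 h1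

/-- `uC` and the source have simple poles at `z m`, so the equation has a regular singular point
there: `(w - z m) Φ' = O(‖Φ‖ + 1)`. -/
theorem tendsto_or_pole_gluedSol (m : Fin P) :
    (∃ l, Tendsto (gluedSol c z ε lam φ ρ q) (𝓝[≠] z m) (𝓝 l)) ∨
    ∃ (k : ℕ) (g : ℂ → ℂ), 0 < k ∧ AnalyticAt ℂ g (z m) ∧ g (z m) ≠ 0 ∧
      ∀ᶠ w in 𝓝[≠] z m, gluedSol c z ε lam φ ρ q w * (w - z m) ^ k = g w := by
  refine tendsto_or_pole_of_norm_deriv_le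
    (K := (‖lam‖ + (‖c m‖ + 1) + (‖φ m‖ + 1)) / ε) ?_
  have h1 := (tendsto_sub_mul_uC hu m).norm.eventually (gt_mem_nhds (lt_add_one ‖c m‖))
  have h2 := (tendsto_sub_mul_source hu.injective hu.pole_im_pos φ ρ q m).norm.eventually
    (gt_mem_nhds (lt_add_one ‖φ m‖))
  have h3 : ∀ᶠ w in 𝓝[≠] z m, ‖w - z m‖ < 1 := by
    refine nhdsWithin_le_nhds ?_
    filter_upwards [Metric.ball_mem_nhds (z m) one_pos] with w hw
    simpa [dist_eq_norm] using hw
  filter_upwards [eventually_hasDerivAt_gluedSol hu hε φ ρ q hlam hA m, h1, h2, h3]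
    with w hd h1 h2 h3
  refine ⟨hd.differentiableAt, ?_⟩
  rw [hd.deriv]
  set Φ := gluedSol c z ε lam φ ρ q w
  have e : ‖Complex.I / ε * ((lam + uC c z w) * Φ - source z φ ρ q w)‖ * ‖w - z m‖ =
      ‖((w - z m) * lam + (w - z m) * uC c z w) * Φ - (w - z m) * source z φ ρ q w‖ / ε := by
    rw [← norm_mul, show Complex.I / ε * ((lam + uC c z w) * Φ - source z φ ρ q w) * (w - z m) =
      Complex.I / ε * (((w - z m) * lam + (w - z m) * uC c z w) * Φ - (w - z m) * source z φ ρ q w)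
      by ring, norm_mul, norm_div, Complex.norm_I, Complex.norm_real, Real.norm_of_nonneg hε.le]
    ring
  rw [e, div_mul_eq_mul_div]
  gcongr
  have hΦ := norm_nonneg Φ
  have h4 : ‖(w - z m) * lam + (w - z m) * uC c z w‖ ≤ ‖lam‖ + (‖c m‖ + 1) := by
    refine (norm_add_le _ _).trans (add_le_add ?_ h1.le)
    rw [norm_mul]
    nlinarith [norm_nonneg lam]
  calc _ ≤ ‖(w - z m) * lam + (w - z m) * uC c z w‖ * ‖Φ‖ + ‖(w - z m) * source z φ ρ q w‖ := by
        refine (norm_sub_le _ _).trans ?_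
        rw [norm_mul]
    _ ≤ (‖lam‖ + (‖c m‖ + 1)) * ‖Φ‖ + (‖φ m‖ + 1) := by gcongr
    _ ≤ _ := by nlinarith [norm_nonneg lam, norm_nonneg (c m), norm_nonneg (φ m)]

/-- A pole of order `k` can only occur in the exceptional case. -/
theorem coeff_eq_of_pole {m : Fin P} {k : ℕ} {g : ℂ → ℂ} (hk : 0 < k) (hg : AnalyticAt ℂ g (z m))
    (hg0 : g (z m) ≠ 0)
    (hev : ∀ᶠ w in 𝓝[≠] z m, gluedSol c z ε lam φ ρ q w * (w - z m) ^ k = g w) :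
    Complex.I * c m / ε = -(k : ℂ) := by
  set Φ := gluedSol c z ε lam φ ρ q with hΦ
  obtain ⟨l, rfl⟩ : ∃ l, k = l + 1 := ⟨k - 1, by omega⟩
  have hsub : Tendsto (fun w => w - z m) (𝓝[≠] z m) (𝓝 0) := by
    have : ContinuousAt (fun w => w - z m) (z m) := by fun_prop
    have := this.tendsto
    rw [sub_self] at this
    exact this.mono_left nhdsWithin_le_nhds
  have hgt : Tendsto g (𝓝[≠] z m) (𝓝 (g (z m))) :=
    hg.continuousAt.tendsto.mono_left nhdsWithin_le_nhds
  -- The limit of `(w - z m) g'` is computed twice. Regularity of `g` gives zero; the differential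
  -- equation for `g / (w - z m) ^ k` gives `(I c m / ε + k) g (z m)`.
  have hL : Tendsto (fun w => (w - z m) * deriv g w) (𝓝[≠] z m) (𝓝 0) := by
    have := hsub.mul (hg.deriv.continuousAt.tendsto.mono_left (nhdsWithin_le_nhds (s := {z m}ᶜ)))
    simpa using this
  have hR : Tendsto (fun w => Complex.I / ε * (((w - z m) * lam + (w - z m) * uC c z w) * g w -
      (w - z m) ^ (l + 1) * ((w - z m) * source z φ ρ q w)) + (l + 1 : ℕ) * g w) (𝓝[≠] z m)
      (𝓝 (Complex.I / ε * ((0 * lam + c m) * g (z m) - 0 ^ (l + 1) * φ m) +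
        (l + 1 : ℕ) * g (z m))) :=
    (((((hsub.mul_const lam).add (tendsto_sub_mul_uC hu m)).mul hgt).sub
      ((hsub.pow (l + 1)).mul (tendsto_sub_mul_source hu.injective hu.pole_im_pos φ ρ q m))).const_mul
      _).add (hgt.const_mul _)
  have hev2 := (eventually_eventually_nhdsWithin.mpr hev)
  have heq := hL.congr' (f₂ := fun w => Complex.I / ε * (((w - z m) * lam + (w - z m) * uC c z w) * g w -
      (w - z m) ^ (l + 1) * ((w - z m) * source z φ ρ q w)) + (l + 1 : ℕ) * g w) (by
    filter_upwards [eventually_hasDerivAt_gluedSol hu hε φ ρ q hlam hA m, hev, hev2,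
      self_mem_nhdsWithin] with w hd h1 h2 hw
    have h3 : ∀ᶠ v in 𝓝 w, Φ v * (v - z m) ^ (l + 1) = g v := by
      rwa [nhdsWithin_eq_nhds.mpr (isOpen_compl_singleton.mem_nhds hw)] at h2
    have hpow : HasDerivAt (fun v => (v - z m) ^ (l + 1)) ((l + 1 : ℕ) * (w - z m) ^ l * 1) w := by
      exact ((hasDerivAt_id w).sub_const (z m)).pow (l + 1)
    have h4 := ((hd.mul hpow).congr_of_eventuallyEq (h3.mono fun v hv => hv.symm)).deriv
    rw [h4, ← h1, hΦ]
    ring)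
  have h := tendsto_nhds_unique heq hR
  rw [zero_pow (Nat.succ_ne_zero l)] at h
  have hε' : (ε : ℂ) ≠ 0 := by exact_mod_cast hε.ne'
  have h5 : (Complex.I * c m / ε + (l + 1 : ℕ)) * g (z m) = 0 := by
    rw [h]; ring
  rcases mul_eq_zero.mp h5 with h6 | h6
  · exact eq_neg_of_add_eq_zero_left h6
  · exact absurd h6 hg0

/-- A pole of order `k` forces the exceptional case with `n = k`. The exponential then has a zero of
the same order, so the primitive, which is `I ε Φ` times the exponential, has a nonzero limit at `z
m`. But along the stem its limit is the integral over `Cₘ`, which is zero. -/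
theorem tendsto_gluedSol (m : Fin P) :
    ∃ l, Tendsto (gluedSol c z ε lam φ ρ q) (𝓝[≠] z m) (𝓝 l) := by
  rcases tendsto_or_pole_gluedSol hu hε φ ρ q hlam hA m with h | ⟨k, g, hk, hg, hg0, hev⟩
  · exact h
  exfalso
  have hexc := coeff_eq_of_pole hu hε φ ρ q hlam hA hk hg hg0 hev
  have hm : IsExceptional c ε m := ⟨k, hk, hexc⟩
  set G := integrand c z ε lam φ ρ q with hG
  set γ : ℝ → ℂ := fun y => (z m).re + y * Complex.I with hγ
  have hγm : γ (z m).im = z m := Complex.re_add_im _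
  have hb := hu.pole_im_pos m
  have hγt : Tendsto γ (𝓝[<] (z m).im) (𝓝[≠] z m) := by
    refine tendsto_nhdsWithin_iff.mpr ⟨?_, ?_⟩
    · have : ContinuousAt γ (z m).im := by fun_prop
      have h2 := this.tendsto
      rw [hγm] at h2
      exact h2.mono_left nhdsWithin_le_nhds
    · filter_upwards [self_mem_nhdsWithin] with y hy h
      have := congrArg Complex.im (Set.mem_singleton_iff.mp h)
      simp only [hγ, Complex.add_im, Complex.ofReal_im, Complex.mul_im, Complex.ofReal_re,
        Complex.I_im, Complex.I_re, mul_one, mul_zero, add_zero, zero_add] at this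
      exact absurd this (ne_of_lt hy)
  have hpos : ∀ᶠ y in 𝓝[<] (z m).im, (0 : ℝ) < y :=
    nhdsWithin_le_nhds (lt_mem_nhds hb)
  have hslit : ∀ᶠ y in 𝓝[<] (z m).im, γ y ∈ slitDomain z Set.univ := by
    filter_upwards [hpos, self_mem_nhdsWithin] with y hy hy'
    intro p
    have hre : (γ y).re = (z m).re := by simp [hγ]
    have him : (γ y).im = y := by simp [hγ]
    rw [hre, him]
    refine ⟨by linarith [hu.pole_im_pos p], fun _ => ?_⟩
    by_cases hp : p = m
    · subst hp; exact Or.inr hy'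
    · exact Or.inl fun h => hp (hu.pole_re_strictMono.injective h).symm
  have hprim : Tendsto (fun y => primitive z G (γ y)) (𝓝[<] (z m).im) (𝓝 0) := by
    have h0 := hA m
    rw [integralC_of_exceptional hm, integralEll] at h0
    rw [← h0]
    simp only [hγ, primitive_vertical]
    refine tendsto_const_nhds.add (Tendsto.const_mul _ ?_)
    have hi := intervalIntegrable_stem hu hε lam φ ρ q hm
    have hcont := intervalIntegral.continuousOn_primitive_interval' hi Set.left_mem_uIcc
    have h2 := hcont (z m).im Set.right_mem_uIcc
    refine h2.mono_left (nhdsWithin_le_of_mem ?_)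
    filter_upwards [hpos, self_mem_nhdsWithin] with y hy hy'
    rw [Set.uIcc_of_le hb.le]
    exact ⟨hy.le, le_of_lt hy'⟩
  set E₀ : ℂ → ℂ := fun w => Complex.exp (-Complex.I * (lam * w +
      logSum z (Function.update c m 0) (star c) w) / ε) with hE₀
  have hE₀c : ContinuousAt E₀ (z m) := by
    have h1 : ContinuousAt (logSum z (Function.update c m 0) (star c)) (z m) := by
      refine (hasDerivAt_logSum (s := {m}ᶜ) ?_ ?_).continuousAt
      · have := stem_mem_slitDomain hu m (y := (z m).im)
          fun p => by linarith [hu.pole_im_pos p]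
        rwa [Complex.re_add_im] at this
      · intro p hp
        simp only [Set.mem_compl_iff, Set.mem_singleton_iff, not_not] at hp
        rw [hp, Function.update_self]
    exact ((((by fun_prop : ContinuousAt (fun w : ℂ => lam * w) (z m)).add h1).const_mul _).div_const
      _).cexp
  have hlim : Tendsto (fun w => Complex.I * ε * (E₀ w * ((-1) ^ k * g w))) (𝓝[≠] z m)
      (𝓝 (Complex.I * ε * (E₀ (z m) * ((-1) ^ k * g (z m))))) :=
    Tendsto.const_mul _ ((hE₀c.tendsto.mono_left nhdsWithin_le_nhds).mul
      ((hg.continuousAt.tendsto.mono_left nhdsWithin_le_nhds).const_mul _))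
  have hlim2 := hlim.comp hγt
  have hε' : (ε : ℂ) ≠ 0 := by exact_mod_cast hε.ne'
  have heq := hlim2.congr' (f₂ := fun y => primitive z G (γ y)) (by
    filter_upwards [hslit, hγt.eventually hev, hγt.eventually self_mem_nhdsWithin] with y h1 h2 h3
    have h4 : gluedSol c z ε lam φ ρ q (γ y) = slitSol c z ε lam φ ρ q (γ y) := if_pos h1
    have hE : expF c z ε lam (γ y) = E₀ (γ y) * (-(γ y - z m)) ^ k :=
      expF_eq_of_exceptional hε hexc lam h3
    have hE0 := expF_ne_zero c z ε lam (γ y)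
    have h5 : primitive z G (γ y) = Complex.I * ε * (gluedSol c z ε lam φ ρ q (γ y) *
        expF c z ε lam (γ y)) := by
      rw [h4, slitSol]
      field_simp
      linear_combination (primitive z G (γ y)) * Complex.I_sq
    simp only [Function.comp]
    rw [h5, hE, ← h2, neg_pow (γ y - z m)]
    ring)
  have h := tendsto_nhds_unique heq hprim
  have hne : E₀ (z m) ≠ 0 := Complex.exp_ne_zero _
  refine mul_ne_zero (mul_ne_zero Complex.I_ne_zero hε') (mul_ne_zero hne (mul_ne_zero ?_ hg0)) h
  exact pow_ne_zero _ (by norm_num)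

/-- If all contour integrals vanish, the differential equation has a solution in the Hardy space. -/
theorem exists_hardySolution_of_integralC : ∃ η Φ, HardySolution c z ε lam φ ρ q η Φ := by
  classical
  obtain ⟨η, hη, hηz⟩ := exists_pos_le_im hu.pole_im_pos
  set Φ₀ := gluedSol c z ε lam φ ρ q with hΦ₀
  -- The values of `gluedSol` at the poles mean nothing and are replaced by the limits.
  set Φ : ℂ → ℂ := fun w => if ∃ m, w = z m then limUnder (𝓝[≠] w) Φ₀ else Φ₀ w with hΦ
  have hne : ∀ w, (∀ p, w ≠ z p) → Φ w = Φ₀ w := fun w hw => if_neg (by push Not; exact hw)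
  have hev : ∀ w, (∀ p, w ≠ z p) → ∀ᶠ v in 𝓝 w, ∀ p, v ≠ z p := by
    intro w hw
    rw [eventually_all]
    exact fun p => isOpen_ne.mem_nhds (hw p)
  have him : ∀ w : ℂ, -η < w.im → ∀ p, -(z p).im < w.im := fun w hw p => by linarith [hηz p]
  have hderiv : ∀ w : ℂ, -η < w.im → (∀ p, w ≠ z p) → HasDerivAt Φ
      (Complex.I / ε * ((lam + uC c z w) * Φ₀ w - source z φ ρ q w)) w := by
    intro w hw hwz
    refine (hasDerivAt_gluedSol hu hε φ ρ q hlam hA (him w hw) hwz).congr_of_eventuallyEq ?_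
    filter_upwards [hev w hwz] with v hv using hne v hv
  have hdiff : DifferentiableOn ℂ Φ {w | -η < w.im} := by
    intro w hw
    refine DifferentiableAt.differentiableWithinAt ?_
    by_cases hwz : ∀ p, w ≠ z p
    · exact (hderiv w hw hwz).differentiableAt
    · push Not at hwz
      obtain ⟨m, rfl⟩ := hwz
      obtain ⟨l, hl⟩ := tendsto_gluedSol hu hε φ ρ q hlam hA m
      refine (Complex.analyticAt_of_differentiable_on_punctured_nhds_of_continuousAt ?_ ?_).differentiableAt
      · filter_upwards [eventually_punctured_ne (z := z) (z m),
          nhdsWithin_le_nhds ((isOpen_neg_lt_im η).mem_nhds hw)] with v h1 h2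
        exact (hderiv v h2 h1).differentiableAt
      · rw [continuousAt_iff_punctured_nhds]
        have h1 : Φ (z m) = l := by
          rw [hΦ]; simp only
          rw [if_pos ⟨m, rfl⟩]
          exact hl.limUnder_eq
        rw [h1]
        refine hl.congr' ?_
        filter_upwards [eventually_punctured_ne (z := z) (z m)] with v h1 using (hne v h1).symm
  obtain ⟨C, R, hCR⟩ := exists_norm_raySol_le c z hε hlam φ ρ q
  refine ⟨η, Φ, hη, hdiff, ?_, ?_⟩
  · have hsub : {w : ℂ | 0 ≤ w.im} ⊆ {w | -η < w.im} := fun w (hw : 0 ≤ w.im) =>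
      show -η < w.im by linarith
    refine UpperDecay.of_large (C := C) (R := max R (∑ p, ‖z p‖ + 1)) (hdiff.continuousOn.mono hsub)
      (hdiff.mono fun w hw => hsub (show 0 ≤ w.im from le_of_lt hw)) fun w hw hwR => ?_
    have hbig : ∀ p, ‖z p‖ < ‖w‖ := fun p => by
      have := Finset.single_le_sum (f := fun p => ‖z p‖) (fun p _ => norm_nonneg _) (Finset.mem_univ p)
      have := (le_max_right _ _).trans hwR
      linarith
    have hwz : ∀ p, w ≠ z p := fun p h => by
      have := hbig p
      rw [h] at this
      exact lt_irrefl _ this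
    -- A point of the closed upper half-plane below a pole has at most the norm of that pole.
    have hdown : w ∈ downDomain z := by
      intro p
      refine ⟨by linarith [hu.pole_im_pos p], ?_⟩
      by_contra h
      push Not at h
      have h1 := hbig p
      rw [Complex.norm_def, Complex.norm_def] at h1
      refine absurd h1 (not_lt.mpr (Real.sqrt_le_sqrt ?_))
      rw [Complex.normSq_apply, Complex.normSq_apply, h.1]
      nlinarith [h.2]
    rw [hne w hwz, hΦ₀, gluedSol_eq_raySol hu hε φ ρ q hlam hA hdown, pow_one]
    exact hCR w hw ((le_max_left _ _).trans hwR)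
  · intro w hw hwz
    rw [(hderiv w hw hwz).deriv, hne w hwz]
    have hε' : (ε : ℂ) ≠ 0 := by exact_mod_cast hε.ne'
    field_simp
    linear_combination (-((lam + uC c z w) * Φ₀ w - source z φ ρ q w)) * Complex.I_sq

end BO

/-! ### The potential on the real line: decay of derivatives and the two turning points. -/

namespace BO

variable {P : ℕ}

/-- Up to a factor, the `k`-th derivative of `∑ₚ aₚ / (w - zₚ)`. -/
noncomputable def poleSum (z a : Fin P → ℂ) (k : ℕ) (w : ℂ) : ℂ := ∑ p, a p / (w - z p) ^ k

theorem hasDerivAt_poleSum {z : Fin P → ℂ} (a : Fin P → ℂ) (k : ℕ) {w : ℂ} (hw : ∀ p, w ≠ z p) :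
    HasDerivAt (poleSum z a (k + 1)) (-((k + 1 : ℕ) * poleSum z a (k + 2) w)) w := by
  unfold poleSum
  rw [Finset.mul_sum, ← Finset.sum_neg_distrib]
  refine HasDerivAt.fun_sum fun p _ => ?_
  have hne : w - z p ≠ 0 := sub_ne_zero.mpr (hw p)
  have h1 := (((hasDerivAt_id w).sub_const (z p)).pow (k + 1))
  have h2 := (hasDerivAt_const w (a p)).div h1 (pow_ne_zero _ hne)
  refine h2.congr_deriv ?_
  simp only [Pi.pow_apply, id_eq, Nat.add_sub_cancel]
  field_simp
  ring

theorem exists_one_add_abs_le {z : Fin P → ℂ} (hz : ∀ p, 0 < (z p).im) :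
    ∃ C : ℝ, 0 < C ∧ ∀ p, ∀ x : ℝ, 1 + |x| ≤ C * ‖(x : ℂ) - z p‖ := by
  obtain ⟨η, hη, hηz⟩ := exists_pos_le_im hz
  set Z := ∑ p, ‖z p‖ with hZ
  have hZ0 : 0 ≤ Z := Finset.sum_nonneg fun p _ => norm_nonneg _
  refine ⟨1 + (1 + Z) / η, by positivity, fun p x => ?_⟩
  have h1 : ‖z p‖ ≤ Z := Finset.single_le_sum (f := fun p => ‖z p‖)
    (fun p _ => norm_nonneg _) (Finset.mem_univ p)
  have h2 : |x| ≤ ‖(x : ℂ) - z p‖ + ‖z p‖ := by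
    have := norm_le_norm_sub_add (x : ℂ) (z p)
    rwa [Complex.norm_real] at this
  have h3 : η ≤ ‖(x : ℂ) - z p‖ := by
    refine (hηz p).trans ((le_abs_self _).trans ?_)
    have := Complex.abs_im_le_norm ((x : ℂ) - z p)
    simpa using this
  have h4 : 1 + Z ≤ (1 + Z) / η * ‖(x : ℂ) - z p‖ := by
    rw [div_mul_eq_mul_div, le_div_iff₀ hη]
    gcongr
  linarith

theorem exists_norm_poleSum_le {z : Fin P → ℂ} (hz : ∀ p, 0 < (z p).im) (k : ℕ) :
    ∃ C : ℝ, 0 < C ∧ ∀ (a : Fin P → ℂ) (x : ℝ), ‖poleSum z a k x‖ ≤ C * (∑ p, ‖a p‖) / (1 + |x|) ^ k := by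
  obtain ⟨C, hC, h⟩ := exists_one_add_abs_le hz
  refine ⟨C ^ k, by positivity, fun a x => ?_⟩
  have hx : 0 < 1 + |x| := by positivity
  rw [poleSum, Finset.mul_sum, Finset.sum_div]
  refine (norm_sum_le _ _).trans (Finset.sum_le_sum fun p _ => ?_)
  have h1 := h p x
  have h2 : 0 < ‖(x : ℂ) - z p‖ := by
    by_contra h0
    have : ‖(x : ℂ) - z p‖ = 0 := le_antisymm (not_lt.mp h0) (norm_nonneg _)
    rw [this, mul_zero] at h1
    linarith
  rw [norm_div, norm_pow, div_le_div_iff₀ (by positivity) (by positivity)]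
  calc _ ≤ ‖a p‖ * (C * ‖(x : ℂ) - z p‖) ^ k := by gcongr
    _ = _ := by rw [mul_pow]; ring

theorem ofReal_ne {z : Fin P → ℂ} (hz : ∀ p, 0 < (z p).im) (x : ℝ) (p : Fin P) : (x : ℂ) ≠ z p := by
  intro h
  have := hz p
  rw [← h] at this
  simp at this

theorem ofReal_ne_star {z : Fin P → ℂ} (hz : ∀ p, 0 < (z p).im) (x : ℝ) (p : Fin P) :
    (x : ℂ) ≠ star (z p) := by
  intro h
  have := hz p
  have h2 := congrArg Complex.im h
  simp at h2
  linarith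

theorem uC_eq_poleSum (c z : Fin P → ℂ) (w : ℂ) :
    uC c z w = poleSum z c 1 w + poleSum (star z) (star c) 1 w := by
  simp [uC, poleSum, Finset.sum_add_distrib]

/-- The `k`-th derivative of `uC` is `(-1) ^ k * k! * uPow c z (k + 1)`. -/
noncomputable def uPow (c z : Fin P → ℂ) (k : ℕ) (w : ℂ) : ℂ :=
  poleSum z c k w + poleSum (star z) (star c) k w

theorem hasDerivAt_uPow {c z : Fin P → ℂ} (k : ℕ) {w : ℂ} (hw : ∀ p, w ≠ z p ∧ w ≠ star (z p)) :
    HasDerivAt (uPow c z (k + 1)) (-((k + 1 : ℕ) * uPow c z (k + 2) w)) w := by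
  have h1 := (hasDerivAt_poleSum c k fun p => (hw p).1).add
    (hasDerivAt_poleSum (z := star z) (star c) k fun p => (hw p).2)
  refine h1.congr_deriv ?_
  rw [uPow]; ring

theorem uC_eq_uPow (c z : Fin P → ℂ) : uC c z = uPow c z 1 := funext (uC_eq_poleSum c z)

theorem hasDerivAt_uC {c z : Fin P → ℂ} {w : ℂ} (hw : ∀ p, w ≠ z p ∧ w ≠ star (z p)) :
    HasDerivAt (uC c z) (-uPow c z 2 w) w := by
  rw [uC_eq_uPow]
  refine (hasDerivAt_uPow 0 hw).congr_deriv ?_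
  simp

theorem exists_norm_uPow_le (c : Fin P → ℂ) {z : Fin P → ℂ} (hz : ∀ p, 0 < (z p).im) (k : ℕ) :
    ∃ C : ℝ, 0 < C ∧ ∀ x : ℝ, ‖uPow c z k x‖ ≤ C / (1 + |x|) ^ k := by
  obtain ⟨C, hC, h⟩ := exists_norm_poleSum_le hz k
  have hstar : ∀ x : ℝ, ‖poleSum (star z) (star c) k x‖ = ‖poleSum z c k x‖ := by
    intro x
    rw [← norm_star (poleSum z c k x)]
    congr 1
    simp [poleSum]
  refine ⟨2 * (C * ∑ p, ‖c p‖) + 1, by positivity, fun x => ?_⟩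
  have h1 := h c x
  refine (norm_add_le _ _).trans ?_
  rw [hstar]
  have h2 : 0 ≤ 1 / (1 + |x|) ^ k := by positivity
  calc _ ≤ C * (∑ p, ‖c p‖) / (1 + |x|) ^ k + C * (∑ p, ‖c p‖) / (1 + |x|) ^ k := add_le_add h1 h1
    _ ≤ C * (∑ p, ‖c p‖) / (1 + |x|) ^ k + C * (∑ p, ‖c p‖) / (1 + |x|) ^ k + 1 / (1 + |x|) ^ k := by
      linarith
    _ = _ := by ring

theorem hasDerivAt_u₀ (c : Fin P → ℂ) {z : Fin P → ℂ} (hz : ∀ p, 0 < (z p).im) (x : ℝ) :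
    HasDerivAt (u₀ c z) (-uPow c z 2 x).re x :=
  (hasDerivAt_uC fun p => ⟨ofReal_ne hz x p, ofReal_ne_star hz x p⟩).real_of_complex

theorem continuous_uPow_ofReal (c : Fin P → ℂ) {z : Fin P → ℂ} (hz : ∀ p, 0 < (z p).im) (k : ℕ) :
    Continuous fun x : ℝ => uPow c z k x := by
  unfold uPow poleSum
  refine (continuous_finsetSum _ fun p _ => ?_).add (continuous_finsetSum _ fun p _ => ?_)
  · exact continuous_const.div (by fun_prop) fun x =>
      pow_ne_zero _ (sub_ne_zero.mpr (ofReal_ne hz x p))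
  · exact continuous_const.div (by fun_prop) fun x =>
      pow_ne_zero _ (sub_ne_zero.mpr (ofReal_ne_star hz x p))

theorem continuous_u₀ (c : Fin P → ℂ) {z : Fin P → ℂ} (hz : ∀ p, 0 < (z p).im) :
    Continuous (u₀ c z) :=
  continuous_iff_continuousAt.mpr fun x => (hasDerivAt_u₀ c hz x).continuousAt

theorem exists_abs_u₀_le (c : Fin P → ℂ) {z : Fin P → ℂ} (hz : ∀ p, 0 < (z p).im) :
    ∃ C : ℝ, 0 < C ∧ ∀ x, |u₀ c z x| ≤ C / (1 + |x|) := by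
  obtain ⟨C, hC, h⟩ := exists_norm_uPow_le c hz 1
  refine ⟨C, hC, fun x => ?_⟩
  have h1 := h x
  rw [← uC_eq_uPow, uC_ofReal, Complex.norm_real, pow_one] at h1
  exact h1

variable {c z : Fin P → ℂ} (hu : IsPositiveKlausShaw c z)

include hu

/-- By continuity strict monotonicity persists on the closed half-lines, so that comparison with the
value at the maximum is possible. -/
theorem IsPositiveKlausShaw.exists_max : ∃ xc : ℝ, StrictMonoOn (u₀ c z) (Set.Iic xc) ∧
    StrictAntiOn (u₀ c z) (Set.Ici xc) ∧ ∀ x, deriv (u₀ c z) x = 0 ↔ x = xc := by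
  obtain ⟨xc, h1, h2, h3⟩ := hu.lobe
  have hc := continuous_u₀ c hu.pole_im_pos
  refine ⟨xc, ?_, ?_, h3⟩
  · rw [← Set.Iio_insert, Set.insert_eq, Set.union_comm]
    intro x hx y hy hxy
    have hx' : x < xc := by
      rcases hx with h | h
      · exact h
      · rw [Set.mem_singleton_iff] at h
        rcases hy with h' | h'
        · exact lt_trans hxy h'
        · rw [Set.mem_singleton_iff] at h'; linarith
    rcases hy with hy | hy
    · exact h1 hx' hy hxy
    · rw [Set.mem_singleton_iff] at hy
      subst hy
      obtain ⟨m, hm1, hm2⟩ := exists_between hx'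
      refine (h1 hx' hm2 hm1).trans_le ?_
      refine ge_of_tendsto (hc.continuousAt.tendsto.mono_left
        (nhdsWithin_le_nhds (a := y) (s := Set.Iio y))) ?_
      filter_upwards [Ioo_mem_nhdsLT hm2] with t ht
      exact (h1 hm2 ht.2 ht.1).le
  · rw [← Set.Ioi_insert, Set.insert_eq, Set.union_comm]
    intro x hx y hy hxy
    have hy' : xc < y := by
      rcases hy with h | h
      · exact h
      · rw [Set.mem_singleton_iff] at h
        rcases hx with h' | h'
        · exact lt_trans h' hxy
        · rw [Set.mem_singleton_iff] at h'; linarith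
    rcases hx with hx | hx
    · exact h2 hx hy' hxy
    · rw [Set.mem_singleton_iff] at hx
      subst hx
      obtain ⟨m, hm1, hm2⟩ := exists_between hy'
      refine (h2 hm1 hy' hm2).trans_le ?_
      refine ge_of_tendsto (hc.continuousAt.tendsto.mono_left
        (nhdsWithin_le_nhds (a := x) (s := Set.Ioi x))) ?_
      filter_upwards [Ioo_mem_nhdsGT hm1] with t ht
      exact (h2 ht.1 hm1 ht.2).le

theorem bulk_neg {lam : ℝ} (h : lam ∈ bulk c z) : lam < 0 := by
  have : 0 ≤ ⨅ x, u₀ c z x := Real.iInf_nonneg fun x => (hu.pos x).le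
  linarith [h.2]

/-- The geometry of the two turning points. -/
theorem exists_turning {lam : ℝ} (h : lam ∈ bulk c z) : ∃ xc a b : ℝ, a < xc ∧ xc < b ∧
    StrictMonoOn (u₀ c z) (Set.Iic xc) ∧ StrictAntiOn (u₀ c z) (Set.Ici xc) ∧
    u₀ c z a = -lam ∧ u₀ c z b = -lam ∧ deriv (u₀ c z) a ≠ 0 ∧ deriv (u₀ c z) b ≠ 0 ∧
    (∀ x, u₀ c z x = -lam ↔ x = a ∨ x = b) ∧ xMinus c z lam = a ∧ xPlus c z lam = b := by
  obtain ⟨xc, h1, h2, h3⟩ := hu.exists_max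
  have hc := continuous_u₀ c hu.pole_im_pos
  have hneg := bulk_neg hu h
  have hle : ∀ x, u₀ c z x ≤ u₀ c z xc := by
    intro x
    rcases le_total x xc with hx | hx
    · exact h1.monotoneOn hx (Set.mem_Iic.mpr le_rfl) hx
    · exact h2.antitoneOn (Set.mem_Ici.mpr le_rfl) hx hx
  have hmax : -lam < u₀ c z xc := by
    have := ciSup_le hle
    linarith [h.1]
  obtain ⟨C, hC, hb⟩ := exists_abs_u₀_le c hu.pole_im_pos
  have hfar : ∀ x, C / (-lam) ≤ |x| → u₀ c z x < -lam := by
    intro x hx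
    refine ((le_abs_self _).trans (hb x)).trans_lt ?_
    rw [div_le_iff₀ (by linarith)] at hx
    rw [div_lt_iff₀ (by positivity)]
    nlinarith
  -- The decay bound puts the potential below `-lam` from `C / (-lam)` on; the other summands place
  -- `xc` strictly between `-R` and `R`.
  set R := C / (-lam) + |xc| + 1 with hR
  have hCl : 0 < C / (-lam) := div_pos hC (by linarith)
  have hxcR := abs_le.mp (show |xc| ≤ |xc| from le_rfl)
  have hl : u₀ c z (-R) < -lam := hfar _ (by rw [abs_neg]; exact le_trans (by linarith [abs_nonneg xc]) (le_abs_self R))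
  have hr : u₀ c z R < -lam := hfar _ (le_trans (by linarith [abs_nonneg xc]) (le_abs_self R))
  obtain ⟨a, ⟨ha1, ha2⟩, ha3⟩ := intermediate_value_Ioo (by linarith [hxcR.1]) hc.continuousOn
    (show -lam ∈ Set.Ioo (u₀ c z (-R)) (u₀ c z xc) from ⟨hl, hmax⟩)
  obtain ⟨b, ⟨hb1, hb2⟩, hb3⟩ := intermediate_value_Ioo' (by linarith [hxcR.2]) hc.continuousOn
    (show -lam ∈ Set.Ioo (u₀ c z R) (u₀ c z xc) from ⟨hr, hmax⟩)
  have hroot : ∀ x, u₀ c z x = -lam ↔ x = a ∨ x = b := by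
    intro x
    constructor
    · intro hx
      rcases le_total x xc with hxc | hxc
      · exact Or.inl (h1.injOn hxc ha2.le (hx.trans ha3.symm))
      · exact Or.inr (h2.injOn hxc hb1.le (hx.trans hb3.symm))
    · rintro (rfl | rfl)
      · exact ha3
      · exact hb3
  have hset : {x | u₀ c z x = -lam} = {a, b} := by
    ext x; simp [hroot]
  refine ⟨xc, a, b, ha2, hb1, h1, h2, ha3, hb3, ?_, ?_, hroot, ?_, ?_⟩
  · exact fun h0 => ha2.ne ((h3 a).mp h0)
  · exact fun h0 => hb1.ne' ((h3 b).mp h0)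
  · rw [xMinus, hset, csInf_pair]; exact min_eq_left (ha2.trans hb1).le
  · rw [xPlus, hset, csSup_pair]; exact max_eq_right (ha2.trans hb1).le

theorem exists_local_slope {x₀ : ℝ} (h : deriv (u₀ c z) x₀ ≠ 0) :
    ∃ k r : ℝ, 0 < k ∧ 0 < r ∧ ∀ x y, |x - x₀| ≤ r → |y - x₀| ≤ r →
      k * |x - y| ≤ |u₀ c z x - u₀ c z y| := by
  have hz := hu.pole_im_pos
  have hd : ∀ x, deriv (u₀ c z) x = (-uPow c z 2 x).re := fun x => (hasDerivAt_u₀ c hz x).deriv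
  have hcont : Continuous (deriv (u₀ c z)) := by
    rw [funext hd]
    exact Complex.continuous_re.comp (continuous_uPow_ofReal c hz 2).neg
  have hev : ∀ᶠ x in 𝓝 x₀, |deriv (u₀ c z) x₀| / 2 < |deriv (u₀ c z) x| :=
    hcont.abs.continuousAt.eventually (lt_mem_nhds (by
      have := abs_pos.mpr h
      simp only
      linarith))
  obtain ⟨r, hr, hball⟩ := Metric.nhds_basis_closedBall.eventually_iff.mp hev
  refine ⟨|deriv (u₀ c z) x₀| / 2, r, half_pos (abs_pos.mpr h), hr, ?_⟩
  have key : ∀ x y, x < y → |x - x₀| ≤ r → |y - x₀| ≤ r →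
      |deriv (u₀ c z) x₀| / 2 * |x - y| ≤ |u₀ c z x - u₀ c z y| := by
    intro x y hxy hx hy
    obtain ⟨t, ht, hte⟩ := exists_deriv_eq_slope (u₀ c z) hxy
      (continuous_u₀ c hz).continuousOn
      (fun t _ => (hasDerivAt_u₀ c hz t).differentiableAt.differentiableWithinAt)
    have htr : t ∈ Metric.closedBall x₀ r := by
      rw [Metric.mem_closedBall, Real.dist_eq, abs_le]
      rw [abs_le] at hx hy
      constructor <;> linarith [hx.1, hy.2, ht.1, ht.2]
    have h1 := hball htr
    rw [hte, abs_div] at h1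
    have h2 : 0 < |y - x| := abs_pos.mpr (by linarith)
    rw [lt_div_iff₀ h2, abs_sub_comm (u₀ c z y)] at h1
    rw [abs_sub_comm x y]
    exact h1.le
  intro x y hx hy
  rcases lt_trichotomy x y with h1 | h1 | h1
  · exact key x y h1 hx hy
  · simp [h1]
  · rw [abs_sub_comm x, abs_sub_comm (u₀ c z x)]
    exact key y x h1 hy hx

/-- Uniformly for `lam` close to `Lam`, the function `lam + u₀` has two turning points, close to
those of `Lam + u₀`, and it vanishes there to first order only. -/
theorem exists_turning_bound {Lam : ℝ} (h : Lam ∈ bulk c z) : ∃ κ : ℝ, 0 < κ ∧ κ ≤ 1 ∧ ∀ r : ℝ, 0 < r →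
    ∀ᶠ lam in 𝓝 Lam, ∃ s t : ℝ, |s - xMinus c z Lam| ≤ r ∧ |t - xPlus c z Lam| ≤ r ∧
      ∀ x, κ * min 1 (min |x - s| |x - t|) ≤ |lam + u₀ c z x| := by
  obtain ⟨xc, a, b, hac, hcb, hmono, hanti, ha, hb, ha', hb', -, hxm, hxp⟩ := exists_turning hu h
  rw [hxm, hxp]
  have hc := continuous_u₀ c hu.pole_im_pos
  obtain ⟨k₁, r₁, hk₁, hr₁, hs₁⟩ := exists_local_slope hu ha'
  obtain ⟨k₂, r₂, hk₂, hr₂, hs₂⟩ := exists_local_slope hu hb'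
  -- Within `r₀` of a turning point the slope bound applies; farther away monotonicity on each side
  -- of `xc` keeps `u₀ + Lam` away from zero. Half of the distance to `xc` keeps each neighbourhood
  -- on its own side.
  set r₀ := min (min r₁ r₂) (min (xc - a) (b - xc) / 2) with hr₀
  have hr₀0 : 0 < r₀ := by
    have : 0 < min (xc - a) (b - xc) := lt_min (by linarith) (by linarith)
    positivity
  have hr₀1 : r₀ ≤ r₁ := (min_le_left _ _).trans (min_le_left _ _)
  have hr₀2 : r₀ ≤ r₂ := (min_le_left _ _).trans (min_le_right _ _)
  have hr₀a : a + r₀ < xc := by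
    have : r₀ ≤ (xc - a) / 2 := (min_le_right _ _).trans (by gcongr; exact min_le_left _ _)
    linarith
  have hr₀b : xc < b - r₀ := by
    have : r₀ ≤ (b - xc) / 2 := (min_le_right _ _).trans (by gcongr; exact min_le_right _ _)
    linarith
  have hm1 : u₀ c z (a - r₀) < -Lam := by
    rw [← ha]; exact hmono (by simp; linarith) hac.le (by linarith)
  have hm2 : -Lam < u₀ c z (a + r₀) := by
    rw [← ha]; exact hmono hac.le hr₀a.le (by linarith)
  have hm3 : -Lam < u₀ c z (b - r₀) := by
    rw [← hb]; exact hanti hr₀b.le hcb.le (by linarith)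
  have hm4 : u₀ c z (b + r₀) < -Lam := by
    rw [← hb]; exact hanti hcb.le (by simp; linarith) (by linarith)
  obtain ⟨m, hm0, hmm⟩ : ∃ m : ℝ, 0 < m ∧ (u₀ c z (a - r₀) + m < -Lam ∧ u₀ c z (b + r₀) + m < -Lam ∧
      -Lam < u₀ c z (a + r₀) - m ∧ -Lam < u₀ c z (b - r₀) - m) := by
    set m := min (min (-Lam - u₀ c z (a - r₀)) (-Lam - u₀ c z (b + r₀)))
      (min (u₀ c z (a + r₀) + Lam) (u₀ c z (b - r₀) + Lam)) with hm
    have e1 : m ≤ -Lam - u₀ c z (a - r₀) := (min_le_left _ _).trans (min_le_left _ _)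
    have e2 : m ≤ -Lam - u₀ c z (b + r₀) := (min_le_left _ _).trans (min_le_right _ _)
    have e3 : m ≤ u₀ c z (a + r₀) + Lam := (min_le_right _ _).trans (min_le_left _ _)
    have e4 : m ≤ u₀ c z (b - r₀) + Lam := (min_le_right _ _).trans (min_le_right _ _)
    have hm0 : 0 < m := lt_min (lt_min (by linarith) (by linarith)) (lt_min (by linarith) (by linarith))
    exact ⟨m / 2, half_pos hm0, by linarith, by linarith, by linarith, by linarith⟩
  refine ⟨min (min 1 (m / 2)) (min k₁ k₂), by positivity, (min_le_left _ _).trans (min_le_left _ _),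
    fun r hr => ?_⟩
  set κ := min (min 1 (m / 2)) (min k₁ k₂) with hκ
  have hκ0 : 0 < κ := by positivity
  have hκm : κ ≤ m / 2 := (min_le_left _ _).trans (min_le_right _ _)
  have hκ1 : κ ≤ k₁ := (min_le_right _ _).trans (min_le_left _ _)
  have hκ2 : κ ≤ k₂ := (min_le_right _ _).trans (min_le_right _ _)
  -- Only the interval in which the roots are sought depends on `r`; the constant `κ` is already
  -- fixed.
  set r' := min r r₀ with hr'
  have hr'0 : 0 < r' := lt_min hr hr₀0
  have hr'r : r' ≤ r := min_le_left _ _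
  have hr'0' : r' ≤ r₀ := min_le_right _ _
  have hn1 : u₀ c z (a - r') < -Lam := by
    rw [← ha]; exact hmono (by simp; linarith) hac.le (by linarith)
  have hn2 : -Lam < u₀ c z (a + r') := by
    rw [← ha]; exact hmono hac.le (by simp; linarith) (by linarith)
  have hn3 : -Lam < u₀ c z (b - r') := by
    rw [← hb]; exact hanti (by simp; linarith) hcb.le (by linarith)
  have hn4 : u₀ c z (b + r') < -Lam := by
    rw [← hb]; exact hanti hcb.le (by simp; linarith) (by linarith)
  have hneg : Tendsto (fun lam : ℝ => -lam) (𝓝 Lam) (𝓝 (-Lam)) := continuous_neg.continuousAt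
  filter_upwards [hneg.eventually (lt_mem_nhds hn1), hneg.eventually (gt_mem_nhds hn2),
    hneg.eventually (gt_mem_nhds hn3), hneg.eventually (lt_mem_nhds hn4),
    Metric.ball_mem_nhds Lam (half_pos hm0)] with lam e1 e2 e3 e4 e5
  rw [Metric.mem_ball, Real.dist_eq, abs_lt] at e5
  obtain ⟨s, ⟨hs1, hs2⟩, hs3⟩ := intermediate_value_Ioo (by linarith) hc.continuousOn
    (show -lam ∈ Set.Ioo (u₀ c z (a - r')) (u₀ c z (a + r')) from ⟨e1, e2⟩)
  obtain ⟨t, ⟨ht1, ht2⟩, ht3⟩ := intermediate_value_Ioo' (by linarith) hc.continuousOn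
    (show -lam ∈ Set.Ioo (u₀ c z (b + r')) (u₀ c z (b - r')) from ⟨e4, e3⟩)
  refine ⟨s, t, abs_le.mpr ⟨by linarith, by linarith⟩, abs_le.mpr ⟨by linarith, by linarith⟩, fun x => ?_⟩
  have hfar : m / 2 ≤ |lam + u₀ c z x| → κ * min 1 (min |x - s| |x - t|) ≤ |lam + u₀ c z x| := by
    intro hx
    refine le_trans ?_ (hκm.trans hx)
    exact mul_le_of_le_one_right hκ0.le (min_le_left _ _)
  rcases le_or_gt |x - a| r₀ with hxa | hxa
  · have h1 := hs₁ x s (hxa.trans hr₀1) (abs_le.mpr ⟨by linarith, by linarith⟩)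
    rw [hs3, sub_neg_eq_add, add_comm (u₀ c z x)] at h1
    refine le_trans ?_ h1
    gcongr
    exact (min_le_right _ _).trans (min_le_left _ _)
  rcases le_or_gt |x - b| r₀ with hxb | hxb
  · have h1 := hs₂ x t (hxb.trans hr₀2) (abs_le.mpr ⟨by linarith, by linarith⟩)
    rw [ht3, sub_neg_eq_add, add_comm (u₀ c z x)] at h1
    refine le_trans ?_ h1
    gcongr
    exact (min_le_right _ _).trans (min_le_right _ _)
  refine hfar ?_
  rcases le_total x xc with hxc | hxc
  · rcases lt_abs.mp hxa with h1 | h1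
    · have h2 : u₀ c z (a + r₀) ≤ u₀ c z x := hmono.monotoneOn hr₀a.le hxc (by linarith)
      exact le_trans (by linarith) (le_abs_self _)
    · have h2 : u₀ c z x ≤ u₀ c z (a - r₀) := hmono.monotoneOn hxc (by simp; linarith) (by linarith)
      exact le_trans (by linarith) (neg_le_abs _)
  · rcases lt_abs.mp hxb with h1 | h1
    · have h2 : u₀ c z x ≤ u₀ c z (b + r₀) := hanti.antitoneOn (by simp; linarith) hxc (by linarith)
      exact le_trans (by linarith) (neg_le_abs _)
    · have h2 : u₀ c z (b - r₀) ≤ u₀ c z x := hanti.antitoneOn hxc hr₀b.le (by linarith)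
      exact le_trans (by linarith) (le_abs_self _)

end BO

/-! ### Interpolation by partial fractions. -/

namespace BO

section PartialFractions

open Polynomial

variable {ι : Type*} [Fintype ι] [DecidableEq ι]

/-- The numerator of `∑ᵢ aᵢ / (X - vᵢ)`. -/
noncomputable def numerator (v a : ι → ℂ) : ℂ[X] :=
  ∑ i, C (a i) * Lagrange.nodal (Finset.univ.erase i) v

theorem eval_numerator {v : ι → ℂ} (a : ι → ℂ) {w : ℂ} (hw : ∀ i, w ≠ v i) :
    (numerator v a).eval w = (∑ i, a i / (w - v i)) * (Lagrange.nodal Finset.univ v).eval w := by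
  rw [numerator, eval_finsetSum, Finset.sum_mul]
  refine Finset.sum_congr rfl fun i _ => ?_
  have hne : w - v i ≠ 0 := sub_ne_zero.mpr (hw i)
  rw [eval_mul, eval_C, Lagrange.eval_nodal, Lagrange.eval_nodal,
    ← Finset.mul_prod_erase _ _ (Finset.mem_univ i)]
  field_simp

theorem eval_numerator_self (v a : ι → ℂ) (i : ι) :
    (numerator v a).eval (v i) = a i * ∏ j ∈ Finset.univ.erase i, (v i - v j) := by
  rw [numerator, eval_finsetSum, Finset.sum_eq_single i]
  · rw [eval_mul, eval_C, Lagrange.eval_nodal]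
  · intro j _ hj
    rw [eval_mul, Lagrange.eval_nodal_at_node (Finset.mem_erase.mpr ⟨hj.symm, Finset.mem_univ i⟩),
      mul_zero]
  · simp

theorem prod_erase_sub_ne_zero {v : ι → ℂ} (hv : Function.Injective v) (i : ι) :
    ∏ j ∈ Finset.univ.erase i, (v i - v j) ≠ 0 :=
  Finset.prod_ne_zero_iff.mpr fun _ hj =>
    sub_ne_zero.mpr fun h => Finset.ne_of_mem_erase hj (hv h).symm

theorem eq_zero_of_numerator_eq_zero {v a : ι → ℂ} (hv : Function.Injective v)
    (h : numerator v a = 0) : a = 0 := by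
  funext i
  have h1 := eval_numerator_self v a i
  rw [h, eval_zero] at h1
  exact (mul_eq_zero.mp h1.symm).resolve_right (prod_erase_sub_ne_zero hv i)

theorem degree_numerator_lt [Nonempty ι] (v a : ι → ℂ) : (numerator v a).degree < Fintype.card ι := by
  refine (degree_sum_le _ _).trans_lt ?_
  rw [Finset.sup_lt_iff (by exact_mod_cast WithBot.bot_lt_coe _)]
  intro i _
  rw [← smul_eq_C_mul]
  refine (degree_smul_le _ _).trans_lt ?_
  rw [Lagrange.degree_nodal, Finset.card_erase_of_mem (Finset.mem_univ i), Finset.card_univ]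
  exact_mod_cast Nat.sub_lt Fintype.card_pos one_pos

theorem coeff_numerator [Nonempty ι] (v a : ι → ℂ) :
    (numerator v a).coeff (Fintype.card ι - 1) = ∑ i, a i := by
  rw [numerator, finsetSum_coeff]
  refine Finset.sum_congr rfl fun i _ => ?_
  have h := (Lagrange.nodal_monic (s := Finset.univ.erase i) (v := v)).coeff_natDegree
  rw [Lagrange.natDegree_nodal, Finset.card_erase_of_mem (Finset.mem_univ i), Finset.card_univ] at h
  rw [coeff_C_mul, h, mul_one]

/-- The numerator has degree below the number of poles, so as many zeros annihilate it, and its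
values at the poles return the coefficients. -/
theorem eq_zero_of_sum_div_eq_zero [Nonempty ι] {v a : ι → ℂ} (hv : Function.Injective v)
    {s : Finset ℂ} (hs : Fintype.card ι ≤ s.card) (hsv : ∀ w ∈ s, ∀ i, w ≠ v i)
    (h : ∀ w ∈ s, ∑ i, a i / (w - v i) = 0) : a = 0 := by
  refine eq_zero_of_numerator_eq_zero hv
    (eq_zero_of_degree_lt_of_eval_finset_eq_zero s ?_ fun w hw => ?_)
  · exact (degree_numerator_lt v a).trans_le (by exact_mod_cast hs)
  · rw [eval_numerator a (hsv w hw), h w hw, zero_mul]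

/-- The sum of the coefficients is the top coefficient of the numerator; if it vanishes, one zero
less suffices. -/
theorem eq_zero_of_sum_div_eq_zero_of_sum_eq_zero [Nonempty ι] {v a : ι → ℂ}
    (hv : Function.Injective v) {s : Finset ℂ} (hs : Fintype.card ι ≤ s.card + 1)
    (hsv : ∀ w ∈ s, ∀ i, w ≠ v i) (h : ∀ w ∈ s, ∑ i, a i / (w - v i) = 0) (hsum : ∑ i, a i = 0) :
    a = 0 := by
  refine eq_zero_of_numerator_eq_zero hv
    (eq_zero_of_degree_lt_of_eval_finset_eq_zero s ?_ fun w hw => ?_)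
  · have h1 : (numerator v a).degree < ((Fintype.card ι - 1 : ℕ) : WithBot ℕ) := by
      rw [degree_lt_iff_coeff_zero]
      intro m hm
      rcases hm.eq_or_lt with rfl | hm
      · rw [coeff_numerator, hsum]
      · refine coeff_eq_zero_of_degree_lt ((degree_numerator_lt v a).trans_le ?_)
        exact_mod_cast (by omega : Fintype.card ι ≤ m)
    exact h1.trans_le (by exact_mod_cast (by omega : Fintype.card ι - 1 ≤ s.card))
  · rw [eval_numerator a (hsv w hw), h w hw, zero_mul]

end PartialFractions

variable {P : ℕ} {c z : Fin P → ℂ}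

/-- The reflected pole `star (z q)` joins the `P` poles `z p`, with coefficient `-ρ`. Hence `P + 1`
points are needed. -/
theorem eq_zero_of_source_eq_zero (hz : ∀ p, 0 < (z p).im) (hinj : Function.Injective z)
    {φ : Fin P → ℂ} {ρ : ℂ} {q : Fin P} {s : Finset ℂ} (hs : P + 1 ≤ s.card)
    (hsz : ∀ w ∈ s, 0 ≤ w.im ∧ ∀ p, w ≠ z p) (h : ∀ w ∈ s, source z φ ρ q w = 0) : ρ = 0 := by
  set v : Option (Fin P) → ℂ := fun o => o.elim (star (z q)) z with hv
  set a : Option (Fin P) → ℂ := fun o => o.elim (-ρ) φ with ha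
  have hvim : ∀ p, star (z q) ≠ z p := fun p h => by
    have h1 := congrArg Complex.im h
    simp at h1
    linarith [hz p, hz q]
  have hvinj : Function.Injective v := by
    rintro (_ | i) (_ | j) hij
    · rfl
    · exact absurd hij (hvim j)
    · exact absurd hij.symm (hvim i)
    · exact congrArg some (hinj hij)
  have hzero := eq_zero_of_sum_div_eq_zero (a := a) hvinj (s := s) (by simpa using hs)
    (by
      rintro w hw (_ | i)
      · exact fun h => sub_star_ne_zero (v := z q) (w := w)
          (by linarith [hz q, (hsz w hw).1]) (sub_eq_zero.mpr h)
      · exact (hsz w hw).2 i)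
    (by
      intro w hw
      have h1 := h w hw
      rw [source] at h1
      rw [Fintype.sum_option]
      simp only [hv, ha, Option.elim]
      rw [← h1]; ring)
  have := congrFun hzero none
  simpa [ha] using this

theorem eq_zero_of_source_eq_zero_of_sum_eq_zero [NeZero P] (hinj : Function.Injective z)
    {φ : Fin P → ℂ} {q : Fin P} {s : Finset ℂ} (hs : P ≤ s.card + 1)
    (hsz : ∀ w ∈ s, ∀ p, w ≠ z p) (h : ∀ w ∈ s, source z φ 0 q w = 0) (hsum : ∑ p, φ p = 0) :
    φ = 0 :=
  eq_zero_of_sum_div_eq_zero_of_sum_eq_zero hinj (by simpa using hs) hsz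
    (fun w hw => by simpa [source] using h w hw) hsum

/-! ### Counting the critical points in the upper half-plane. -/

section CriticalPoints

open Polynomial

/-- The poles of `hDeriv`. -/
def allPoles (z : Fin P → ℂ) : Fin P ⊕ Fin P → ℂ := Sum.elim z fun p => star (z p)

/-- The numerator of `hDeriv`. -/
noncomputable def hPoly (c z : Fin P → ℂ) (lam : ℝ) : ℂ[X] :=
  C (lam : ℂ) * Lagrange.nodal Finset.univ (allPoles z) +
    numerator (allPoles z) (Sum.elim c fun p => star (c p))

theorem allPoles_injective (hu : IsRationalPotential c z) : Function.Injective (allPoles z) := by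
  have h : ∀ i j, z i ≠ star (z j) := fun i j h => by
    have h1 := congrArg Complex.im h
    simp at h1
    linarith [hu.pole_im_pos i, hu.pole_im_pos j]
  rintro (i | i) (j | j) hij
  · exact congrArg Sum.inl (hu.injective hij)
  · exact absurd hij (h i j)
  · exact absurd hij.symm (h j i)
  · exact congrArg Sum.inr (hu.injective (star_injective hij))

theorem eval_hPoly (lam : ℝ) {w : ℂ} (hw : ∀ i, w ≠ allPoles z i) :
    (hPoly c z lam).eval w =
      hDeriv c z lam w * (Lagrange.nodal Finset.univ (allPoles z)).eval w := by
  rw [hPoly, eval_add, eval_mul, eval_C, eval_numerator _ hw, hDeriv, uC, Fintype.sum_sum_type,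
    Finset.sum_add_distrib]
  simp only [allPoles, Sum.elim_inl, Sum.elim_inr]
  ring

/-- None of the poles cancels, since all residues are nonzero. So the roots of the polynomial are
exactly the critical points, without spurious ones. -/
theorem eval_hPoly_pole (hu : IsRationalPotential c z) (lam : ℝ) (i : Fin P ⊕ Fin P) :
    (hPoly c z lam).eval (allPoles z i) ≠ 0 := by
  rw [hPoly, eval_add, eval_mul, Lagrange.eval_nodal_at_node (Finset.mem_univ i), mul_zero, zero_add,
    eval_numerator_self]
  refine mul_ne_zero ?_ (prod_erase_sub_ne_zero (allPoles_injective hu) i)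
  rcases i with i | i
  · exact hu.coeff_ne_zero i
  · exact star_ne_zero.mpr (hu.coeff_ne_zero i)

theorem natDegree_hPoly [NeZero P] {lam : ℝ} (hlam : lam ≠ 0) : (hPoly c z lam).natDegree = P + P := by
  have hd : (C (lam : ℂ) * Lagrange.nodal Finset.univ (allPoles z)).degree = ((P + P : ℕ) : WithBot ℕ) := by
    rw [degree_C_mul (by exact_mod_cast hlam), Lagrange.degree_nodal]
    simp
  have hlt := degree_numerator_lt (allPoles z) (Sum.elim c fun p => star (c p))
  rw [show Fintype.card (Fin P ⊕ Fin P) = P + P by simp, ← hd] at hlt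
  rw [hPoly, natDegree_add_eq_left_of_degree_lt hlt]
  exact natDegree_eq_of_degree_eq_some hd

theorem isRoot_hPoly_iff (hu : IsRationalPotential c z) {lam : ℝ} {w : ℂ} :
    (hPoly c z lam).IsRoot w ↔ (∀ i, w ≠ allPoles z i) ∧ hDeriv c z lam w = 0 := by
  by_cases hw : ∀ i, w ≠ allPoles z i
  · rw [IsRoot, eval_hPoly lam hw, mul_eq_zero, or_iff_left]
    · exact ⟨fun h => ⟨hw, h⟩, fun h => h.2⟩
    · rw [Lagrange.eval_nodal]
      exact Finset.prod_ne_zero_iff.mpr fun i _ => sub_ne_zero.mpr (hw i)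
  · refine iff_of_false ?_ fun h => hw h.1
    push Not at hw
    obtain ⟨i, rfl⟩ := hw
    exact eval_hPoly_pole hu lam i

theorem ne_allPoles_iff {w : ℂ} : (∀ i, w ≠ allPoles z i) ↔ ∀ p, w ≠ z p ∧ w ≠ star (z p) := by
  constructor
  · exact fun h p => ⟨h (Sum.inl p), h (Sum.inr p)⟩
  · rintro h (p | p)
    · exact (h p).1
    · exact (h p).2

theorem hDeriv_star (c z : Fin P → ℂ) (lam : ℝ) (w : ℂ) :
    hDeriv c z lam (star w) = star (hDeriv c z lam w) := by
  simp [hDeriv, uC, add_comm]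

theorem hasDerivAt_hDeriv {lam : ℝ} {w : ℂ} (hw : ∀ p, w ≠ z p ∧ w ≠ star (z p)) :
    HasDerivAt (hDeriv c z lam) (-uPow c z 2 w) w :=
  (hasDerivAt_uC hw).const_add _

theorem derivative_hPoly_ne_zero {lam : ℝ} {w : ℂ} (hw : ∀ i, w ≠ allPoles z i)
    (h0 : hDeriv c z lam w = 0) (h1 : deriv (hDeriv c z lam) w ≠ 0) :
    ¬ (derivative (hPoly c z lam)).IsRoot w := by
  intro hroot
  set N := Lagrange.nodal Finset.univ (allPoles z) with hN
  have hev : ∀ᶠ v in 𝓝 w, ∀ i, v ≠ allPoles z i := by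
    rw [eventually_all]
    exact fun i => isOpen_ne.mem_nhds (hw i)
  have hd := (hasDerivAt_hDeriv (c := c) (lam := lam) (ne_allPoles_iff.mp hw))
  have h2 := (hd.mul (N.hasDerivAt w)).congr_of_eventuallyEq
    (f₁ := fun v => (hPoly c z lam).eval v) (hev.mono fun v hv => eval_hPoly lam hv)
  have h3 := h2.unique ((hPoly c z lam).hasDerivAt w)
  rw [hroot.eq_zero, h0, zero_mul, add_zero] at h3
  rw [hd.deriv] at h1
  refine (mul_ne_zero h1 ?_) h3
  rw [hN, Lagrange.eval_nodal]
  exact Finset.prod_ne_zero_iff.mpr fun i _ => sub_ne_zero.mpr (hw i)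

/-- The numerator of `h'` has degree `2 P` and only simple roots: the nonreal ones by assumption,
the real ones because `u₀` has its only critical point at the maximum. Two roots are real and the
others form conjugate pairs, which leaves `P - 1` in the upper half-plane. -/
theorem exists_upper_critical [NeZero P] (hu : IsPositiveKlausShaw c z) {Lam : ℝ} (hLam : Lam ∈ bulk c z)
    (hsimple : SimpleComplexCriticalPoints c z Lam) : ∃ Y : Finset ℂ, Y.card + 1 = P ∧ ∀ y ∈ Y,
      0 < y.im ∧ (∀ p, y ≠ z p) ∧ hDeriv c z Lam y = 0 ∧ deriv (hDeriv c z Lam) y ≠ 0 := by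
  classical
  have hneg := bulk_neg hu hLam
  obtain ⟨xc, a, b, hac, hcb, -, -, -, -, ha', hb', hroot, -, -⟩ := exists_turning hu hLam
  have hz := hu.pole_im_pos
  set H := hPoly c z Lam with hH
  have hdeg : H.natDegree = P + P := natDegree_hPoly hneg.ne
  have hP := NeZero.pos P
  have hH0 : H ≠ 0 := fun h => by rw [h, natDegree_zero] at hdeg; omega
  have hreal : ∀ x : ℝ, hDeriv c z Lam x = ((Lam + u₀ c z x : ℝ) : ℂ) := by
    intro x; rw [hDeriv, uC_ofReal]; push_cast; rfl
  have hder : ∀ w, (∀ i, w ≠ allPoles z i) → hDeriv c z Lam w = 0 →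
      deriv (hDeriv c z Lam) w ≠ 0 := by
    intro w hw h0
    by_cases him : w.im = 0
    · obtain ⟨x, rfl⟩ : ∃ x : ℝ, w = x := ⟨w.re, Complex.ext rfl (by simpa using him)⟩
      rw [hreal] at h0
      have h1 : u₀ c z x = -Lam := by
        have : Lam + u₀ c z x = 0 := by exact_mod_cast h0
        linarith
      rw [(hasDerivAt_hDeriv (ne_allPoles_iff.mp hw)).deriv]
      have h2 : deriv (u₀ c z) x ≠ 0 := by
        rcases (hroot x).mp h1 with rfl | rfl
        · exact ha'
        · exact hb'
      rw [(hasDerivAt_u₀ c hz x).deriv] at h2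
      exact fun h => h2 (by rw [h]; rfl)
    · exact hsimple w him (ne_allPoles_iff.mp hw) h0
  have hnodup : H.roots.Nodup := by
    rw [Multiset.nodup_iff_count_le_one]
    intro w
    rw [count_roots]
    by_contra hcon
    obtain ⟨h1, h2⟩ := (one_lt_rootMultiplicity_iff_isRoot hH0).mp (not_le.mp hcon)
    obtain ⟨h3, h4⟩ := (isRoot_hPoly_iff hu.toIsRationalPotential).mp h1
    exact derivative_hPoly_ne_zero h3 h4 (hder w h3 h4) h2
  set R := H.roots.toFinset with hR
  have hRcard : R.card = P + P := by
    rw [hR, Multiset.toFinset_card_of_nodup hnodup, ← hdeg]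
    exact (splits_iff_card_roots.mp (IsAlgClosed.splits H))
  have hmem : ∀ w, w ∈ R ↔ (∀ i, w ≠ allPoles z i) ∧ hDeriv c z Lam w = 0 := by
    intro w
    rw [hR, Multiset.mem_toFinset, mem_roots hH0]
    exact isRoot_hPoly_iff hu.toIsRationalPotential
  set Y := R.filter fun w => 0 < w.im with hY
  have hlow : (R.filter fun w => w.im < 0).card = Y.card := by
    refine Finset.card_nbij' (fun w => star w) (fun w => star w) ?_ ?_ (by simp [Set.LeftInvOn]) (by simp [Set.LeftInvOn])
    · intro w hw
      simp only [hY, Finset.coe_filter, Set.mem_ofPred_eq, hmem, ne_allPoles_iff] at hw ⊢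
      refine ⟨⟨fun p => ⟨fun h => (hw.1.1 p).2 (by rw [← h, star_star]), fun h => (hw.1.1 p).1 (star_injective h)⟩, ?_⟩, by simpa using hw.2⟩
      rw [hDeriv_star, hw.1.2, star_zero]
    · intro w hw
      simp only [hY, Finset.coe_filter, Set.mem_ofPred_eq, hmem, ne_allPoles_iff] at hw ⊢
      refine ⟨⟨fun p => ⟨fun h => (hw.1.1 p).2 (by rw [← h, star_star]), fun h => (hw.1.1 p).1 (star_injective h)⟩, ?_⟩, by simpa using hw.2⟩
      rw [hDeriv_star, hw.1.2, star_zero]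
  have hmid : (R.filter fun w => w.im = 0) = {(a : ℂ), (b : ℂ)} := by
    ext w
    simp only [Finset.mem_filter, hmem, Finset.mem_insert, Finset.mem_singleton, ne_allPoles_iff]
    constructor
    · rintro ⟨⟨-, h0⟩, him⟩
      obtain ⟨x, rfl⟩ : ∃ x : ℝ, w = x := ⟨w.re, Complex.ext rfl (by simpa using him)⟩
      rw [hreal] at h0
      have : Lam + u₀ c z x = 0 := by exact_mod_cast h0
      rcases (hroot x).mp (by linarith) with rfl | rfl
      · exact Or.inl rfl
      · exact Or.inr rfl
    · intro h
      obtain ⟨x, rfl, hx⟩ : ∃ x : ℝ, w = x ∧ (x = a ∨ x = b) := by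
        rcases h with rfl | rfl
        · exact ⟨a, rfl, Or.inl rfl⟩
        · exact ⟨b, rfl, Or.inr rfl⟩
      refine ⟨⟨fun p => ⟨ofReal_ne hz x p, ofReal_ne_star hz x p⟩, ?_⟩, by simp⟩
      rw [hreal, (hroot x).mpr hx]
      simp
  have hmidcard : (R.filter fun w => w.im = 0).card = 2 := by
    rw [hmid]
    refine Finset.card_pair fun h => ?_
    have : a = b := by exact_mod_cast h
    linarith
  have hsplit : R.card = Y.card + ((R.filter fun w => w.im = 0).card + (R.filter fun w => w.im < 0).card) := by
    rw [← Finset.card_filter_add_card_filter_not (s := R) (fun w => 0 < w.im)]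
    congr 1
    rw [← Finset.card_filter_add_card_filter_not (s := R.filter fun w => ¬0 < w.im) (fun w => w.im = 0)]
    congr 2
    · ext w; simp only [Finset.mem_filter]
      exact ⟨fun h => ⟨h.1.1, h.2⟩, fun h => ⟨⟨h.1, by rw [h.2]; exact lt_irrefl _⟩, h.2⟩⟩
    · ext w; simp only [Finset.mem_filter]
      exact ⟨fun h => ⟨h.1.1, lt_of_le_of_ne (not_lt.mp h.1.2) h.2⟩,
        fun h => ⟨⟨h.1, h.2.not_gt⟩, h.2.ne⟩⟩
  refine ⟨Y, by omega, fun y hy => ?_⟩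
  rw [hY, Finset.mem_filter, hmem] at hy
  exact ⟨hy.2, fun p => (ne_allPoles_iff.mp hy.1.1 p).1, hy.1.2, hder y hy.1.1 hy.1.2⟩

end CriticalPoints

end BO

/-! ### The Evans matrix for complex `lam`. -/

namespace BO

variable {P : ℕ} [NeZero P]

/-- The matrix `A` for complex `lam`. -/
noncomputable def evansMatrix (c z : Fin P → ℂ) (ε : ℝ) (lam : ℂ) : Matrix (Fin P) (Fin P) ℂ :=
  Matrix.of fun m p => integralC c z ε m fun w => expF c z ε lam w / (w - z p)

/-- The contour integrals of the inhomogeneity `-e^{-i h / ε} / (w - z_q^*)`. -/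
noncomputable def evansRhs (c z : Fin P → ℂ) (ε : ℝ) (q : Fin P) (lam : ℂ) (m : Fin P) : ℂ :=
  integralC c z ε m (integrand c z ε lam 0 1 q)

variable {c z : Fin P → ℂ} (hu : IsRationalPotential c z) {ε : ℝ} (hε : 0 < ε)

include hu hε

theorem integralC_integrand_eq {lam : ℂ} (hlam : lam.re < 0) (φ : Fin P → ℂ) (ρ : ℂ) (q m : Fin P) :
    integralC c z ε m (integrand c z ε lam φ ρ q) =
      (evansMatrix c z ε lam).mulVec φ m + ρ * evansRhs c z ε q lam m := by
  rw [integralC_integrand hu hε hlam, evansRhs, Matrix.mulVec_eq_sum]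
  simp [integrand_single, evansMatrix, Finset.sum_apply]

theorem differentiableAt_evansMatrix {lam : ℂ} (hlam : lam.re < 0) (m p : Fin P) :
    DifferentiableAt ℂ (fun l => evansMatrix c z ε l m p) lam := by
  have h := differentiableAt_integralC hu hε hlam (Pi.single p 1) 0 p m
  simp only [integrand_single] at h
  exact h

theorem differentiableAt_evansRhs {lam : ℂ} (hlam : lam.re < 0) (q m : Fin P) :
    DifferentiableAt ℂ (fun l => evansRhs c z ε q l m) lam :=
  differentiableAt_integralC hu hε hlam 0 1 q m

omit [NeZero P] hu hε in
theorem differentiableAt_det {n : ℕ} {M : ℂ → Matrix (Fin n) (Fin n) ℂ} {lam : ℂ}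
    (h : ∀ i j, DifferentiableAt ℂ (fun l => M l i j) lam) :
    DifferentiableAt ℂ (fun l => (M l).det) lam := by
  simp only [Matrix.det_apply]
  exact DifferentiableAt.fun_sum fun σ _ => DifferentiableAt.const_smul
    (DifferentiableAt.fun_finsetProd fun i _ => h _ _) _

theorem exists_hardySolution_of_mulVec {lam : ℂ} (hlam : lam.re < 0) {φ : Fin P → ℂ}
    (q : Fin P) (h : (evansMatrix c z ε lam).mulVec φ = 0) :
    ∃ η Φ, HardySolution c z ε lam φ 0 q η Φ :=
  exists_hardySolution_of_integralC hu hε φ 0 q hlam fun m => by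
    rw [integralC_integrand_eq hu hε hlam, h]; simp

/-- A nullvector would give a Hardy solution with `ρ = 0`, which the energy identity forbids off the
real axis. -/
theorem det_evansMatrix_ne_zero {lam : ℂ} (hlam : lam.re < 0) (him : lam.im ≠ 0) :
    (evansMatrix c z ε lam).det ≠ 0 := by
  intro h
  obtain ⟨φ, hφ, h0⟩ := Matrix.exists_mulVec_eq_zero_iff.mpr h
  obtain ⟨η, Φ, hs⟩ := exists_hardySolution_of_mulVec hu hε hlam 0 h0
  exact hφ (hs.eq_zero_of_im_ne_zero hu hε him)

/-- Away from the eigenvalues the inhomogeneous problem has a solution, analytic in `lam`. -/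
theorem exists_analytic_solution (q : Fin P) {s : Set ℂ} (hs : ∀ lam ∈ s, lam.re < 0)
    (hdet : ∀ lam ∈ s, (evansMatrix c z ε lam).det ≠ 0) :
    ∃ φ : ℂ → Fin P → ℂ, (∀ lam ∈ s, ∀ p, DifferentiableAt ℂ (fun l => φ l p) lam) ∧
      ∀ lam ∈ s, ∃ η Φ, HardySolution c z ε lam (φ lam) 1 q η Φ := by
  -- Cramer's rule makes the analytic dependence on `lam` visible: numerator and denominator are
  -- determinants with analytic entries.
  refine ⟨fun lam p => (evansMatrix c z ε lam).cramer (fun m => -evansRhs c z ε q lam m) p /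
    (evansMatrix c z ε lam).det, fun lam hlam p => ?_, fun lam hlam => ?_⟩
  · refine DifferentiableAt.div ?_ (differentiableAt_det fun i j =>
      differentiableAt_evansMatrix hu hε (hs lam hlam) i j) (hdet lam hlam)
    simp only [Matrix.cramer_apply]
    refine differentiableAt_det fun i j => ?_
    by_cases hj : j = p
    · subst hj
      simp only [Matrix.updateCol_self]
      exact (differentiableAt_evansRhs hu hε (hs lam hlam) q i).neg
    · simp only [Matrix.updateCol_ne hj]
      exact differentiableAt_evansMatrix hu hε (hs lam hlam) i j
  · refine exists_hardySolution_of_integralC hu hε _ 1 q (hs lam hlam) fun m => ?_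
    rw [integralC_integrand_eq hu hε (hs lam hlam)]
    have h1 := Matrix.mulVec_cramer (evansMatrix c z ε lam) (fun m => -evansRhs c z ε q lam m)
    have h2 : (fun p => (evansMatrix c z ε lam).cramer (fun m => -evansRhs c z ε q lam m) p /
        (evansMatrix c z ε lam).det) = ((evansMatrix c z ε lam).det)⁻¹ •
        (evansMatrix c z ε lam).cramer (fun m => -evansRhs c z ε q lam m) := by
      funext p; simp [div_eq_inv_mul]
    beta_reduce
    rw [h2, Matrix.mulVec_smul, h1]
    have := hdet lam hlam
    simp only [Pi.smul_apply, smul_eq_mul]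
    field_simp
    ring

end BO

/-! ### A bounded solution of the inhomogeneous problem when there is no eigenvalue nearby. -/

namespace BO

variable {P : ℕ} {c z : Fin P → ℂ} (hu : IsRationalPotential c z) {ε : ℝ} (hε : 0 < ε)

include hu hε

/-- The energy identity bounds `|lam.im| ∫ ‖Φ‖²` by a multiple of `‖Φ (z q)‖`, and the point bound
estimates the integral from below by a multiple of its square. One factor cancels. -/
theorem HardySolution.apply_mul_im_le {lam : ℂ} {φ : Fin P → ℂ} {q : Fin P} {η : ℝ} {Φ : ℂ → ℂ}
    (hs : HardySolution c z ε lam φ 1 q η Φ) : ‖Φ (z q)‖ * |lam.im| * (2 * (z q).im) ≤ 1 := by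
  have hb := hu.pole_im_pos q
  have h1 := hs.energy hu hε
  have h2 := hs.decay.normSq_le hb
  set N := ∫ x : ℝ, ‖Φ x‖ ^ 2
  rcases eq_or_ne (Φ (z q)) 0 with h0 | h0
  · rw [h0]; simp
  have hpos : 0 < ‖Φ (z q)‖ := norm_pos_iff.mpr h0
  have hN : 0 ≤ N := le_trans (by positivity) h2
  have h3 : |lam.im| * N ≤ 2 * Real.pi * ‖Φ (z q)‖ := by
    rw [← abs_of_nonneg hN, ← abs_mul, h1, star_one, one_mul, abs_mul,
      abs_of_pos (by positivity : 0 < 2 * Real.pi)]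
    gcongr
    exact Complex.abs_re_le_norm _
  have h4 : |lam.im| * (4 * Real.pi * (z q).im * ‖Φ (z q)‖ ^ 2) ≤ 2 * Real.pi * ‖Φ (z q)‖ :=
    (mul_le_mul_of_nonneg_left h2 (abs_nonneg _)).trans h3
  have h5 : (2 * Real.pi * ‖Φ (z q)‖) * (‖Φ (z q)‖ * |lam.im| * (2 * (z q).im)) ≤
      (2 * Real.pi * ‖Φ (z q)‖) * 1 := by nlinarith
  exact le_of_mul_le_mul_left h5 (by positivity)

/-- If there is no eigenvalue within `δ` of `Lam`, the inhomogeneous problem has a bounded solution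
at `Lam + i ε`. -/
theorem exists_bounded_solution [NeZero P] {Lam δ : ℝ} (hδ : 0 < δ) (hneg : Lam + δ < 0)
    (hεδ : ε ≤ δ / 4) (q : Fin P) (hno : ∀ lam : ℝ, |lam - Lam| ≤ δ → evans c z ε lam ≠ 0) :
    ∃ φ η Φ, HardySolution c z ε (Lam + ε * Complex.I) φ 1 q η Φ ∧
      ∫ x : ℝ, ‖Φ x‖ ^ 2 ≤ 16 * Real.pi / (δ ^ 2 * (z q).im) := by
  have hb := hu.pole_im_pos q
  set b := (z q).im with hbdef
  have hneg' : ∀ lam ∈ Metric.closedBall (Lam : ℂ) δ, lam.re < 0 := by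
    intro lam hlam
    rw [Metric.mem_closedBall, dist_eq_norm] at hlam
    have := (Complex.abs_re_le_norm _).trans hlam
    rw [Complex.sub_re, Complex.ofReal_re, abs_le] at this
    linarith [this.2]
  have hdet : ∀ lam ∈ Metric.closedBall (Lam : ℂ) δ, (evansMatrix c z ε lam).det ≠ 0 := by
    intro lam hlam
    by_cases him : lam.im = 0
    · obtain ⟨x, rfl⟩ : ∃ x : ℝ, lam = x := ⟨lam.re, Complex.ext rfl (by simpa using him)⟩
      refine hno x ?_
      rwa [Metric.mem_closedBall, dist_eq_norm, ← Complex.ofReal_sub, Complex.norm_real,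
        Real.norm_eq_abs] at hlam
    · exact det_evansMatrix_ne_zero hu hε (hneg' lam hlam) him
  obtain ⟨φ, hφd, hφs⟩ := exists_analytic_solution hu hε q hneg' hdet
  set m : ℂ → ℂ := fun lam => φ lam q / c q with hm
  have hcq := hu.coeff_ne_zero q
  have hmval : ∀ lam η Φ, HardySolution c z ε lam (φ lam) 1 q η Φ → Φ (z q) = m lam := by
    intro lam η Φ hs
    simp only [hm]
    rw [← hs.coeff_mul_eq hu q]
    field_simp
  have hmd : ∀ lam ∈ Metric.closedBall (Lam : ℂ) δ, DifferentiableAt ℂ m lam := fun lam hlam =>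
    (hφd lam hlam q).div_const _
  have hmle : ∀ lam ∈ Metric.closedBall (Lam : ℂ) δ, ‖m lam‖ * |lam.im| * (2 * b) ≤ 1 := by
    intro lam hlam
    obtain ⟨η, Φ, hs⟩ := hφs lam hlam
    rw [← hmval lam η Φ hs]
    exact hs.apply_mul_im_le hu hε
  -- On the circle the modulus of the factor is `2 δ |lam.im|`, which compensates the blow-up of the
  -- bound for `m` at the real axis. The maximum principle then bounds `m` inside.
  set g : ℂ → ℂ := fun lam => ((lam - Lam) ^ 2 - δ ^ 2) * m lam with hg
  have hgle : ∀ lam ∈ Metric.closedBall (Lam : ℂ) δ, ‖g lam‖ ≤ δ / b := by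
    intro lam hlam
    have hgd : DiffContOnCl ℂ g (Metric.ball (Lam : ℂ) δ) := by
      refine DifferentiableOn.diffContOnCl fun v hv => ?_
      rw [closure_ball _ hδ.ne'] at hv
      exact (DifferentiableAt.mul (by fun_prop) (hmd v hv)).differentiableWithinAt
    refine Complex.norm_le_of_forall_mem_frontier_norm_le Metric.isBounded_ball hgd ?_
      (by rwa [closure_ball _ hδ.ne'])
    intro v hv
    rw [frontier_ball _ hδ.ne', mem_sphere_iff_norm] at hv
    have h1 := hmle v (by rw [Metric.mem_closedBall, dist_eq_norm, hv])
    have h2 : (v - Lam) ^ 2 - (δ : ℂ) ^ 2 = (v - Lam) * (2 * v.im * Complex.I) := by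
      have h3 := Complex.mul_conj (v - Lam)
      rw [Complex.normSq_eq_norm_sq, hv] at h3
      push_cast at h3
      have h4 : (v - Lam) - (starRingEnd ℂ) (v - Lam) = 2 * v.im * Complex.I := by
        rw [Complex.sub_conj]; simp
      rw [← h3, ← h4]; ring
    rw [hg, norm_mul, h2, norm_mul, hv]
    simp only [norm_mul, Complex.norm_I, Complex.norm_real, Real.norm_eq_abs, mul_one]
    rw [le_div_iff₀ hb]
    rw [show ‖(2 : ℂ)‖ = 2 by simp]
    nlinarith
  have hmle2 : ∀ lam ∈ Metric.closedBall (Lam : ℂ) (δ / 2), ‖m lam‖ ≤ 2 / (δ * b) := by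
    intro lam hlam
    have h1 := hgle lam (Metric.closedBall_subset_closedBall (by linarith) hlam)
    rw [Metric.mem_closedBall, dist_eq_norm] at hlam
    have h2 : 3 / 4 * δ ^ 2 ≤ ‖(lam - Lam) ^ 2 - (δ : ℂ) ^ 2‖ := by
      have h3 := norm_sub_norm_le ((δ : ℂ) ^ 2) ((lam - Lam) ^ 2)
      rw [norm_sub_rev, norm_pow, norm_pow, Complex.norm_real, Real.norm_of_nonneg hδ.le] at h3
      have : ‖lam - Lam‖ ^ 2 ≤ (δ / 2) ^ 2 := by gcongr
      nlinarith
    rw [hg, norm_mul, le_div_iff₀ hb] at h1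
    rw [le_div_iff₀ (by positivity)]
    have h4 : 3 / 4 * δ ^ 2 * (‖m lam‖ * b) ≤ δ := by
      refine le_trans (mul_le_mul_of_nonneg_right h2 (by positivity)) ?_
      rwa [← mul_assoc]
    have h5 : δ * (‖m lam‖ * (δ * b)) ≤ δ * 2 := by nlinarith
    exact le_of_mul_le_mul_left h5 hδ
  have hderiv : ∀ lam ∈ Metric.closedBall (Lam : ℂ) (δ / 4), ‖deriv m lam‖ ≤ 8 / (δ ^ 2 * b) := by
    intro lam hlam
    have hsub : Metric.closedBall lam (δ / 4) ⊆ Metric.closedBall (Lam : ℂ) (δ / 2) := by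
      refine Metric.closedBall_subset_closedBall' ?_
      rw [Metric.mem_closedBall] at hlam
      linarith
    have h1 := Complex.norm_deriv_le_of_forall_mem_sphere_norm_le (c := lam) (R := δ / 4)
      (C := 2 / (δ * b)) (f := m) (by linarith) (DifferentiableOn.diffContOnCl fun v hv => by
        rw [closure_ball _ (by linarith : δ / 4 ≠ 0)] at hv
        exact (hmd v (Metric.closedBall_subset_closedBall (by linarith) (hsub hv))).differentiableWithinAt)
      (fun v hv => hmle2 v (hsub (Metric.sphere_subset_closedBall hv)))
    refine h1.trans (le_of_eq ?_)
    field_simp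
    norm_num
  have hLam : (Lam : ℂ) ∈ Metric.closedBall (Lam : ℂ) (δ / 4) :=
    Metric.mem_closedBall_self (by linarith)
  have hLamε : (Lam + ε * Complex.I : ℂ) ∈ Metric.closedBall (Lam : ℂ) (δ / 4) := by
    rw [Metric.mem_closedBall, dist_eq_norm]
    simpa [abs_of_pos hε] using hεδ
  have hball4 : Metric.closedBall (Lam : ℂ) (δ / 4) ⊆ Metric.closedBall (Lam : ℂ) δ :=
    Metric.closedBall_subset_closedBall (by linarith)
  have hmvt := (convex_closedBall (Lam : ℂ) (δ / 4)).norm_image_sub_le_of_norm_deriv_le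
    (fun v hv => hmd v (hball4 hv)) hderiv hLam hLamε
  -- For real `lam` the left side of the energy identity is zero, so `m Lam` is imaginary. With the
  -- derivative bound, the real part at `Lam + i ε` is `O(ε)`; there the identity reads `ε ∫ ‖Φ‖² =
  -- 2 π Re m`, and the factor `ε` cancels.
  have hm0 : (m Lam).re = 0 := by
    obtain ⟨η, Φ, hs⟩ := hφs Lam (hball4 hLam)
    have h1 := hs.energy hu hε
    rw [hmval _ η Φ hs, Complex.ofReal_im, zero_mul, star_one, one_mul] at h1
    have h2 : (2 * Real.pi) * (m Lam).re = 0 := h1.symm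
    exact (mul_eq_zero.mp h2).resolve_left (by positivity)
  obtain ⟨η, Φ, hs⟩ := hφs _ (hball4 hLamε)
  refine ⟨_, η, Φ, hs, ?_⟩
  have h1 := hs.energy hu hε
  rw [hmval _ η Φ hs] at h1
  simp only [Complex.add_im, Complex.ofReal_im, Complex.mul_im, Complex.ofReal_re, Complex.I_im,
    mul_one, Complex.I_re, mul_zero, add_zero, zero_add, star_one, one_mul] at h1
  have h2 : (m (Lam + ε * Complex.I)).re ≤ 8 / (δ ^ 2 * b) * ε := by
    have h3 := (Complex.abs_re_le_norm _).trans hmvt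
    rw [Complex.sub_re, hm0, sub_zero] at h3
    have h4 : ‖(Lam + ε * Complex.I : ℂ) - Lam‖ = ε := by simp [abs_of_pos hε]
    rw [h4] at h3
    exact (le_abs_self _).trans h3
  have h5 : ε * ∫ x : ℝ, ‖Φ x‖ ^ 2 ≤ ε * (16 * Real.pi / (δ ^ 2 * b)) := by
    rw [h1]
    calc _ ≤ 2 * Real.pi * (8 / (δ ^ 2 * b) * ε) := by gcongr
      _ = _ := by ring
  exact le_of_mul_le_mul_left h5 hε

end BO

/-! ### Existence of eigenvalues close to a point of the bulk. -/

namespace BO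

variable {P : ℕ} {c z : Fin P → ℂ}

theorem HardySolution.source_eq {ε : ℝ} {lam : ℂ} {φ : Fin P → ℂ} {ρ : ℂ} {q : Fin P} {η : ℝ}
    {Φ : ℂ → ℂ} (hs : HardySolution c z ε lam φ ρ q η Φ) {v : ℂ} (hv : 0 ≤ v.im) (hvz : ∀ p, v ≠ z p) :
    source z φ ρ q v = (lam + uC c z v) * Φ v + Complex.I * ε * deriv Φ v := by
  have := hs.ode v (by linarith [hs.eta_pos]) hvz
  linear_combination this

/-- By the equation the source is `h' Φ` plus `ε Φ'` up to a phase. Where `h'` is small, bounded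
norm forces a small source. -/
theorem HardySolution.normSq_source_le {ε : ℝ} {lam : ℂ} {φ : Fin P → ℂ} {ρ : ℂ} {q : Fin P} {η : ℝ}
    {Φ : ℂ → ℂ} (hs : HardySolution c z ε lam φ ρ q η Φ) {v : ℂ} (hv : 0 < v.im)
    (hvz : ∀ p, v ≠ z p) : ‖source z φ ρ q v‖ ^ 2 ≤
      (‖lam + uC c z v‖ ^ 2 / v.im + 2 * ε ^ 2 / v.im ^ 3) * ∫ x : ℝ, ‖Φ x‖ ^ 2 := by
  have h1 := hs.decay.normSq_le hv
  have h2 := hs.decay.normSq_deriv_le hv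
  set N := ∫ x : ℝ, ‖Φ x‖ ^ 2
  have hN : 0 ≤ N := le_trans (by positivity) h1
  have hpi := Real.pi_gt_three
  have h3 : 2 * ‖Φ v‖ ^ 2 ≤ N / v.im := by
    rw [le_div_iff₀ hv]
    have : 0 ≤ v.im * ‖Φ v‖ ^ 2 := by positivity
    nlinarith
  have h4 : 2 * ‖deriv Φ v‖ ^ 2 ≤ 2 * N / v.im ^ 3 := by
    have h5 : 2 / (Real.pi * v.im ^ 3) * N ≤ N / v.im ^ 3 := by
      rw [div_mul_eq_mul_div, div_le_div_iff₀ (by positivity) (by positivity)]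
      have : 0 ≤ N * v.im ^ 3 := by positivity
      nlinarith
    calc _ ≤ 2 * (N / v.im ^ 3) := by linarith
      _ = _ := by ring
  rw [hs.source_eq hv.le hvz]
  have h6 : ‖(lam + uC c z v) * Φ v + Complex.I * ε * deriv Φ v‖ ≤
      ‖lam + uC c z v‖ * ‖Φ v‖ + |ε| * ‖deriv Φ v‖ := by
    refine (norm_add_le _ _).trans (le_of_eq ?_)
    rw [norm_mul, norm_mul, norm_mul, Complex.norm_I, Complex.norm_real, Real.norm_eq_abs, one_mul]
  calc _ ≤ (‖lam + uC c z v‖ * ‖Φ v‖ + |ε| * ‖deriv Φ v‖) ^ 2 := by gcongr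
    _ ≤ 2 * (‖lam + uC c z v‖ * ‖Φ v‖) ^ 2 + 2 * (|ε| * ‖deriv Φ v‖) ^ 2 := by
      nlinarith [sq_nonneg (‖lam + uC c z v‖ * ‖Φ v‖ - |ε| * ‖deriv Φ v‖)]
    _ = ‖lam + uC c z v‖ ^ 2 * (2 * ‖Φ v‖ ^ 2) + ε ^ 2 * (2 * ‖deriv Φ v‖ ^ 2) := by
      rw [mul_pow, mul_pow, sq_abs]; ring
    _ ≤ ‖lam + uC c z v‖ ^ 2 * (N / v.im) + ε ^ 2 * (2 * N / v.im ^ 3) := by gcongr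
    _ = _ := by ring

theorem norm_le_of_normSq_le {E : Type*} [NormedAddCommGroup E] {x : E} {κ : ℝ} (hκ : 0 ≤ κ)
    (h : ‖x‖ ^ 2 ≤ κ ^ 2) : ‖x‖ ≤ κ :=
  (sq_le_sq₀ (norm_nonneg _) hκ).mp h

/-- At a critical point of `h(·; Lam)` the coefficient `lam + uC` at `lam = Lam + i ε` is just `i
ε`. -/
theorem eventually_norm_source_le_of_critical {Lam B : ℝ} (q : Fin P) {y : ℂ}
    (hy : 0 < y.im) (hyz : ∀ p, y ≠ z p) (h0 : hDeriv c z Lam y = 0) {κ : ℝ} (hκ : 0 < κ) :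
    ∀ᶠ ε : ℝ in 𝓝[>] 0, ∀ φ η Φ, HardySolution c z ε (Lam + ε * Complex.I) φ 1 q η Φ →
      ∫ x : ℝ, ‖Φ x‖ ^ 2 ≤ B → ‖source z φ 1 q y‖ ≤ κ := by
  have hlim : ∀ᶠ ε : ℝ in 𝓝[>] 0, (ε ^ 2 / y.im + 2 * ε ^ 2 / y.im ^ 3) * B < κ ^ 2 := by
    refine nhdsWithin_le_nhds ?_
    have hc : ContinuousAt (fun ε : ℝ => (ε ^ 2 / y.im + 2 * ε ^ 2 / y.im ^ 3) * B) 0 := by fun_prop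
    refine hc.eventually (gt_mem_nhds ?_)
    simp only
    norm_num
    positivity
  filter_upwards [hlim] with ε hε φ η Φ hs hN
  refine norm_le_of_normSq_le hκ.le ((hs.normSq_source_le hy hyz).trans (le_trans ?_ hε.le))
  have h1 : (Lam + ε * Complex.I : ℂ) + uC c z y = ε * Complex.I := by
    rw [hDeriv] at h0
    linear_combination h0
  rw [h1, norm_mul, Complex.norm_I, mul_one, Complex.norm_real, Real.norm_eq_abs, sq_abs]
  gcongr

/-- The point bounds degenerate at the real axis, so the equation is used at `x + i √ε`. There the
coefficient is `O(√ε)`, and both terms of the bound for the squared source are `O(√ε)`. The way back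
to `x` is harmless because the bounded norm controls the coefficients `φ`. -/
theorem eventually_norm_source_le_of_real (hu : IsRationalPotential c z) {Lam B : ℝ}
    (q : Fin P) {x : ℝ} (h0 : hDeriv c z Lam x = 0) {κ : ℝ} (hκ : 0 < κ) :
    ∀ᶠ ε : ℝ in 𝓝[>] 0, ∀ φ η Φ, HardySolution c z ε (Lam + ε * Complex.I) φ 1 q η Φ →
      ∫ x : ℝ, ‖Φ x‖ ^ 2 ≤ B → ‖source z φ 1 q x‖ ≤ κ := by
  have hz := hu.pole_im_pos
  have hxz : ∀ p, (x : ℂ) ≠ z p ∧ (x : ℂ) ≠ star (z p) := fun p => ⟨ofReal_ne hz x p, ofReal_ne_star hz x p⟩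
  set M := ∑ p, Real.sqrt (‖c p‖ ^ 2 / (4 * Real.pi * (z p).im) * B) with hM
  have hM0 : 0 ≤ M := Finset.sum_nonneg fun p _ => Real.sqrt_nonneg _
  set γ : ℝ → ℂ := fun ε => x + Real.sqrt ε * Complex.I with hγ
  have hγ0 : Tendsto γ (𝓝[>] 0) (𝓝 x) := by
    have : ContinuousAt γ 0 := by fun_prop
    have h2 := this.tendsto
    simp only [hγ, Real.sqrt_zero, Complex.ofReal_zero, zero_mul, add_zero] at h2
    exact h2.mono_left nhdsWithin_le_nhds
  obtain ⟨D, hD⟩ := ((hasDerivAt_hDeriv (c := c) (lam := Lam) hxz).isBigO_sub).bound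
  have hD' := hγ0.eventually hD
  set κ' := κ / 2 / (M * P + 1) with hκ'
  have hκ'0 : 0 < κ' := by positivity
  have hpole : ∀ p, ∀ᶠ ε : ℝ in 𝓝[>] 0, ‖1 / (γ ε - z p) - 1 / ((x : ℂ) - z p)‖ < κ' := by
    intro p
    have hne : (x : ℂ) - z p ≠ 0 := sub_ne_zero.mpr (hxz p).1
    have hc : ContinuousAt (fun w : ℂ => ‖1 / (w - z p) - 1 / ((x : ℂ) - z p)‖) x := by
      fun_prop (disch := exact hne)
    exact (hc.tendsto.comp hγ0).eventually (gt_mem_nhds (by simpa using hκ'0))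
  have hpole' : ∀ᶠ ε : ℝ in 𝓝[>] 0, ‖1 / (γ ε - star (z q)) - 1 / ((x : ℂ) - star (z q))‖ < κ' := by
    have hne : (x : ℂ) - star (z q) ≠ 0 := sub_ne_zero.mpr (hxz q).2
    have hc : ContinuousAt (fun w : ℂ => ‖1 / (w - star (z q)) - 1 / ((x : ℂ) - star (z q))‖) x := by
      fun_prop (disch := exact hne)
    exact (hc.tendsto.comp hγ0).eventually (gt_mem_nhds (by simpa using hκ'0))
  have hγz : ∀ᶠ ε : ℝ in 𝓝[>] 0, ∀ p, γ ε ≠ z p := by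
    rw [eventually_all]
    exact fun p => hγ0.eventually (isOpen_ne.mem_nhds (hxz p).1)
  have hsmall : ∀ᶠ ε : ℝ in 𝓝[>] 0, ((1 + D) ^ 2 + 2) * B * Real.sqrt ε < (κ / 2) ^ 2 := by
    refine nhdsWithin_le_nhds ?_
    have hc : ContinuousAt (fun ε : ℝ => ((1 + D) ^ 2 + 2) * B * Real.sqrt ε) 0 := by fun_prop
    refine hc.eventually (gt_mem_nhds ?_)
    simp only [Real.sqrt_zero, mul_zero]
    positivity
  have hle1 : ∀ᶠ ε : ℝ in 𝓝[>] 0, ε < 1 := nhdsWithin_le_nhds (gt_mem_nhds one_pos)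
  filter_upwards [hD', eventually_all.mpr hpole, hpole', hγz, hsmall, hle1, self_mem_nhdsWithin]
    with ε hDε hp hp' hzε hsm hε1 hε φ η Φ hs hN
  have hε0 : (0 : ℝ) < ε := hε
  set τ := Real.sqrt ε with hτ
  have hτ0 : 0 < τ := Real.sqrt_pos.mpr hε0
  have hτε : τ ^ 2 = ε := Real.sq_sqrt hε0.le
  have hετ : ε ≤ τ := by
    have : τ ≤ 1 := Real.sqrt_le_one.mpr hε1.le
    nlinarith
  have him : (γ ε).im = τ := by simp [hγ, hτ]
  have hsub : γ ε - x = τ * Complex.I := by simp [hγ, hτ]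
  rw [h0, sub_zero, hsub] at hDε
  simp only [norm_mul, Complex.norm_I, mul_one, Complex.norm_real, Real.norm_of_nonneg hτ0.le] at hDε
  have h1 : ‖(Lam + ε * Complex.I : ℂ) + uC c z (γ ε)‖ ≤ (1 + D) * τ := by
    have : (Lam + ε * Complex.I : ℂ) + uC c z (γ ε) = ε * Complex.I + hDeriv c z Lam (γ ε) := by
      rw [hDeriv]; ring
    rw [this]
    refine (norm_add_le _ _).trans ?_
    rw [norm_mul, Complex.norm_I, mul_one, Complex.norm_real, Real.norm_of_nonneg hε0.le]
    linarith
  have hsγ : ‖source z φ 1 q (γ ε)‖ ≤ κ / 2 := by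
    refine norm_le_of_normSq_le (by positivity) ?_
    refine (hs.normSq_source_le (by rw [him]; exact hτ0) hzε).trans (le_trans ?_ hsm.le)
    rw [him, ← hτε]
    have h2 : ‖(Lam + (τ ^ 2 : ℝ) * Complex.I : ℂ) + uC c z (γ ε)‖ ^ 2 ≤ ((1 + D) * τ) ^ 2 := by
      rw [hτε]; gcongr
    have h3 : 2 * (τ ^ 2) ^ 2 / τ ^ 3 = 2 * τ := by field_simp
    have h4 : ((1 + D) * τ) ^ 2 / τ = (1 + D) ^ 2 * τ := by field_simp
    have h5 : 0 ≤ ∫ x : ℝ, ‖Φ x‖ ^ 2 := integral_nonneg fun x => by positivity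
    calc _ ≤ (((1 + D) * τ) ^ 2 / τ + 2 * (τ ^ 2) ^ 2 / τ ^ 3) * B := by
          gcongr
          rw [← hτε] at h1
          exact h1
      _ = _ := by rw [h3, h4]; ring
  have hφM : ∀ p, ‖φ p‖ ≤ M := by
    intro p
    have h2 := hs.normSq_coeff_le hu p
    have hp := hz p
    have h3 : ‖φ p‖ ≤ Real.sqrt (‖c p‖ ^ 2 / (4 * Real.pi * (z p).im) * B) := by
      refine Real.le_sqrt_of_sq_le (h2.trans ?_)
      gcongr
    exact h3.trans (Finset.single_le_sum
      (f := fun p => Real.sqrt (‖c p‖ ^ 2 / (4 * Real.pi * (z p).im) * B))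
      (fun p _ => Real.sqrt_nonneg _) (Finset.mem_univ p))
  have hdiff : ‖source z φ 1 q (γ ε) - source z φ 1 q x‖ ≤ κ / 2 := by
    have e : source z φ 1 q (γ ε) - source z φ 1 q x =
        ∑ p, φ p * (1 / (γ ε - z p) - 1 / ((x : ℂ) - z p)) -
          (1 / (γ ε - star (z q)) - 1 / ((x : ℂ) - star (z q))) := by
      rw [source, source]
      have : ∀ p, φ p * (1 / (γ ε - z p) - 1 / ((x : ℂ) - z p)) =
          φ p / (γ ε - z p) - φ p / ((x : ℂ) - z p) := fun p => by ring
      simp_rw [this]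
      rw [Finset.sum_sub_distrib]; ring
    rw [e]
    calc _ ≤ ∑ _p : Fin P, M * κ' + κ' := by
          refine (norm_sub_le _ _).trans (add_le_add ((norm_sum_le _ _).trans
            (Finset.sum_le_sum fun p _ => ?_)) hp'.le)
          rw [norm_mul]
          exact mul_le_mul (hφM p) (hp p).le (norm_nonneg _) hM0
      _ = κ' * (M * P + 1) := by
          rw [Finset.sum_const, Finset.card_univ, Fintype.card_fin, nsmul_eq_mul]; ring
      _ = κ / 2 := by rw [hκ']; field_simp
  calc ‖source z φ 1 q x‖ = ‖source z φ 1 q (γ ε) - (source z φ 1 q (γ ε) - source z φ 1 q x)‖ := by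
        congr 1; ring
    _ ≤ _ := norm_sub_le _ _
    _ ≤ κ := by linarith

/-- `source` as a linear functional of the coefficients. -/
noncomputable def sourceFunctional (z : Fin P → ℂ) (q : Fin P) (w : ℂ) : ((Fin P → ℂ) × ℂ) →ₗ[ℂ] ℂ where
  toFun v := source z v.1 v.2 q w
  map_add' u v := by
    simp only [source, Prod.fst_add, Prod.snd_add, Pi.add_apply, add_div, Finset.sum_add_distrib]
    ring
  map_smul' a v := by
    simp only [source, Prod.smul_fst, Prod.smul_snd, Pi.smul_apply, smul_eq_mul, RingHom.id_apply,
      mul_sub, Finset.mul_sum, mul_div_assoc]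

/-- By unique interpolation, `ρ` is a linear combination of the values of the source. The
coefficients depend on the points only, so small values force a small `ρ`. -/
theorem exists_residue_eq_sum (hu : IsRationalPotential c z) (q : Fin P) {s : Finset ℂ}
    (hs : P + 1 ≤ s.card) (hsz : ∀ w ∈ s, 0 ≤ w.im ∧ ∀ p, w ≠ z p) :
    ∃ a : s → ℂ, ∀ φ ρ, ρ = ∑ w : s, a w * source z φ ρ q w := by
  have h := mem_span_of_iInf_ker_le_ker (L := fun w : s => sourceFunctional z q w)
    (K := LinearMap.snd ℂ (Fin P → ℂ) ℂ) (by
      intro v hv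
      simp only [Submodule.mem_iInf, LinearMap.mem_ker] at hv ⊢
      exact eq_zero_of_source_eq_zero hu.pole_im_pos hu.injective hs hsz fun w hw => hv ⟨w, hw⟩)
  obtain ⟨a, ha⟩ := (Submodule.mem_span_range_iff_exists_fun ℂ).mp h
  refine ⟨a, fun φ ρ => ?_⟩
  have := congrArg (fun L : ((Fin P → ℂ) × ℂ) →ₗ[ℂ] ℂ => L (φ, ρ)) ha
  simp only [LinearMap.snd_apply, LinearMap.sum_apply, LinearMap.smul_apply, smul_eq_mul] at this
  exact this.symm

/-- Without an eigenvalue the bounded solution has a small source at the `P - 1` upper critical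
points and the two turning points, which is incompatible with `ρ = 1`. -/
theorem eventually_exists_eigenvalue [NeZero P] (hu : IsPositiveKlausShaw c z) {Lam : ℝ}
    (hLam : Lam ∈ bulk c z) (hsimple : SimpleComplexCriticalPoints c z Lam) {δ : ℝ} (hδ : 0 < δ) :
    ∀ᶠ ε : ℝ in 𝓝[>] 0, ∃ lam, |lam - Lam| ≤ δ ∧ IsEigenvalue c z ε lam := by
  classical
  have hr := hu.toIsRationalPotential
  have hneg := bulk_neg hu hLam
  obtain ⟨xc, a, b, hac, hcb, -, -, ha, hb, -, -, -, -, -⟩ := exists_turning hu hLam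
  obtain ⟨Y, hYc, hY⟩ := exists_upper_critical hu hLam hsimple
  set δ' := min δ (-Lam / 2) with hδ'
  have hδ'0 : 0 < δ' := lt_min hδ (by linarith)
  have hδ'n : Lam + δ' < 0 := by
    have : δ' ≤ -Lam / 2 := min_le_right _ _
    linarith
  set q : Fin P := 0
  set B := 16 * Real.pi / (δ' ^ 2 * (z q).im) with hB
  have hreal : ∀ x : ℝ, u₀ c z x = -Lam → hDeriv c z Lam x = 0 := by
    intro x hx
    rw [hDeriv, uC_ofReal, hx]; simp
  set s : Finset ℂ := insert (a : ℂ) (insert (b : ℂ) Y) with hs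
  have hnot : ∀ x : ℝ, (x : ℂ) ∉ Y := fun x hx => by
    have := (hY x hx).1
    simp at this
  have hcard : P + 1 ≤ s.card := by
    rw [hs, Finset.card_insert_of_notMem, Finset.card_insert_of_notMem (hnot b)]
    · omega
    · rw [Finset.mem_insert, not_or]
      refine ⟨fun h => ?_, hnot a⟩
      have : a = b := by exact_mod_cast h
      linarith
  have hsz : ∀ w ∈ s, 0 ≤ w.im ∧ ∀ p, w ≠ z p := by
    intro w hw
    rcases Finset.mem_insert.mp hw with rfl | hw
    · exact ⟨by simp, ofReal_ne hr.pole_im_pos a⟩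
    rcases Finset.mem_insert.mp hw with rfl | hw
    · exact ⟨by simp, ofReal_ne hr.pole_im_pos b⟩
    · exact ⟨(hY w hw).1.le, (hY w hw).2.1⟩
  obtain ⟨A, hA⟩ := exists_residue_eq_sum hr q hcard hsz
  set S := ∑ w : s, ‖A w‖ with hS
  have hS0 : 0 ≤ S := Finset.sum_nonneg fun w _ => norm_nonneg _
  -- Chosen so that `S κ < 1`, which is less than the norm of `ρ = 1`.
  set κ := 1 / (2 * (S + 1)) with hκ
  have hκ0 : 0 < κ := by positivity
  have hsmall : ∀ᶠ ε : ℝ in 𝓝[>] 0, ∀ w : s, ∀ φ η Φ,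
      HardySolution c z ε (Lam + ε * Complex.I) φ 1 q η Φ →
      ∫ x : ℝ, ‖Φ x‖ ^ 2 ≤ B → ‖source z φ 1 q w‖ ≤ κ := by
    rw [eventually_all]
    rintro ⟨w, hw⟩
    rcases Finset.mem_insert.mp hw with rfl | hw
    · exact eventually_norm_source_le_of_real hr q (hreal a ha) hκ0
    rcases Finset.mem_insert.mp hw with rfl | hw
    · exact eventually_norm_source_le_of_real hr q (hreal b hb) hκ0
    · exact eventually_norm_source_le_of_critical q (hY w hw).1 (hY w hw).2.1 (hY w hw).2.2.1 hκ0
  have hle : ∀ᶠ ε : ℝ in 𝓝[>] 0, ε < δ' / 4 :=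
    nhdsWithin_le_nhds (gt_mem_nhds (by linarith))
  filter_upwards [hsmall, hle, self_mem_nhdsWithin] with ε hsm hεδ hε
  by_contra hcon
  push Not at hcon
  have hno : ∀ lam : ℝ, |lam - Lam| ≤ δ' → evans c z ε lam ≠ 0 := by
    intro lam hlam h0
    refine hcon lam (hlam.trans (min_le_left _ _)) ⟨?_, h0⟩
    have := (abs_le.mp hlam).2
    linarith
  obtain ⟨φ, η, Φ, hsol, hN⟩ := exists_bounded_solution hr hε hδ'0 hδ'n hεδ.le q hno
  have h1 : (1 : ℝ) ≤ S * κ := by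
    have h2 := hA φ 1
    have h3 : ‖(1 : ℂ)‖ ≤ ∑ w : s, ‖A w‖ * κ := by
      conv_lhs => rw [h2]
      refine (norm_sum_le _ _).trans (Finset.sum_le_sum fun w _ => ?_)
      rw [norm_mul]
      exact mul_le_mul_of_nonneg_left (hsm w φ η Φ hsol hN) (norm_nonneg _)
    rw [norm_one, ← Finset.sum_mul] at h3
    exact h3
  have h2 : S * κ < 1 := by
    rw [hκ, mul_one_div, div_lt_one (by positivity)]
    linarith
  linarith

end BO

/-! ### The nearest eigenvalue, uniqueness of the nullvector, and bounds on it. -/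

namespace BO

variable {P : ℕ} {c z : Fin P → ℂ}

section Nearest

variable [NeZero P] (hu : IsRationalPotential c z) {ε : ℝ} (hε : 0 < ε)

include hu hε

theorem continuousAt_evans {lam : ℝ} (hlam : lam < 0) : ContinuousAt (evans c z ε) lam := by
  have h : DifferentiableAt ℂ (fun l => (evansMatrix c z ε l).det) (lam : ℂ) :=
    differentiableAt_det fun i j => differentiableAt_evansMatrix hu hε (by simpa using hlam) i j
  exact ContinuousAt.comp (f := fun x : ℝ => (x : ℂ)) h.continuousAt
    Complex.continuous_ofReal.continuousAt

/-- The eigenvalues in the compact interval around `Lam` form a compact set by continuity of the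
determinant, so the minimal distance is attained. The tie rule leaves one candidate. -/
theorem existsUnique_nearest {Lam δ lam₀ : ℝ} (hδ : Lam + δ < 0) (h₀ : |lam₀ - Lam| ≤ δ)
    (he : IsEigenvalue c z ε lam₀) : ∃! lam, IsNearestEigenvalue c z ε Lam lam := by
  set K := Set.Icc (Lam - δ) (Lam + δ) ∩ evans c z ε ⁻¹' {0} with hK
  have hcont : ContinuousOn (evans c z ε) (Set.Icc (Lam - δ) (Lam + δ)) := fun x hx =>
    (continuousAt_evans hu hε (by linarith [hx.2])).continuousWithinAt
  have hKc : IsCompact K :=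
    isCompact_Icc.of_isClosed_subset
      (hcont.preimage_isClosed_of_isClosed isClosed_Icc isClosed_singleton) Set.inter_subset_left
  have hmem : ∀ μ, |μ - Lam| ≤ δ → IsEigenvalue c z ε μ → μ ∈ K := by
    intro μ hμ hμe
    rw [abs_le] at hμ
    exact ⟨⟨by linarith, by linarith⟩, hμe.2⟩
  obtain ⟨lam₁, hlam₁, hmin⟩ := hKc.exists_isMinOn (f := fun x => |x - Lam|) ⟨lam₀, hmem _ h₀ he⟩
    (by fun_prop)
  have he₁ : IsEigenvalue c z ε lam₁ := ⟨by linarith [hlam₁.1.2], hlam₁.2⟩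
  have hmin' : ∀ μ, IsEigenvalue c z ε μ → |lam₁ - Lam| ≤ |μ - Lam| := by
    intro μ hμ
    by_cases h : |μ - Lam| ≤ δ
    · exact hmin (hmem μ h hμ)
    · exact (abs_le.mpr ⟨by linarith [hlam₁.1.1], by linarith [hlam₁.1.2]⟩ : |lam₁ - Lam| ≤ δ).trans
        (not_le.mp h).le
  have huniq : ∀ a b, IsNearestEigenvalue c z ε Lam a → IsNearestEigenvalue c z ε Lam b → a ≤ b := by
    intro a b ha hb
    have h1 := (ha.2 b hb.1).1
    have h2 := hb.2 a ha.1
    exact h2.2 (le_antisymm h1 h2.1)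
  refine existsUnique_of_exists_of_unique ?_ fun a b ha hb => le_antisymm (huniq a b ha hb) (huniq b a hb ha)
  set d := |lam₁ - Lam| with hd
  have hd0 : 0 ≤ d := abs_nonneg _
  -- At distance `d` only `Lam + d` and `Lam - d` are possible, and the larger one has precedence.
  by_cases h : IsEigenvalue c z ε (Lam + d)
  · refine ⟨Lam + d, h, fun μ hμ => ?_⟩
    rw [add_sub_cancel_left, abs_of_nonneg hd0]
    exact ⟨hmin' μ hμ, fun he => by linarith [le_abs_self (μ - Lam)]⟩
  · refine ⟨lam₁, he₁, fun μ hμ => ⟨hmin' μ hμ, fun he => ?_⟩⟩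
    have h1 : μ - Lam = d ∨ μ - Lam = -d := by
      rw [← abs_eq hd0]; exact he
    rcases h1 with h1 | h1
    · exact absurd (by rwa [show Lam + d = μ by linarith]) h
    · have := neg_abs_le (lam₁ - Lam)
      linarith

/-- By Wu's identity a nullvector with sum zero has a solution of zero norm and is zero. So the sum
is injective on the kernel, which is therefore a line on which the normalization is possible. -/
theorem existsUnique_nullvector {lam : ℝ} (he : IsEigenvalue c z ε lam) :
    ∃! φ : Fin P → ℂ, IsNormalizedNullvector c z ε lam φ := by
  have hlam : ((lam : ℝ) : ℂ).re < 0 := by simpa using he.1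
  have hzero : ∀ φ : Fin P → ℂ, (A c z ε lam).mulVec φ = 0 → ∑ p, φ p = 0 → φ = 0 := by
    intro φ hφ hsum
    obtain ⟨η, Φ, hs⟩ := exists_hardySolution_of_mulVec hu hε hlam 0 hφ
    refine hs.eq_zero_of_integral_eq_zero hu ?_
    have h1 := hs.norm_identity hu hε he.1.ne
    rw [hsum, norm_zero] at h1
    have h2 : lam * (ε * ∫ x : ℝ, ‖Φ x‖ ^ 2) = 0 := by rw [h1]; ring
    exact ((mul_eq_zero.mp ((mul_eq_zero.mp h2).resolve_left he.1.ne))).resolve_left hε.ne'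
  obtain ⟨φ, hφ, h0⟩ := Matrix.exists_mulVec_eq_zero_iff.mpr he.2
  have hsum : ∑ p, φ p ≠ 0 := fun h => hφ (hzero φ h0 h)
  refine existsUnique_of_exists_of_unique ⟨((lam : ℂ) / ∑ p, φ p) • φ, ?_, ?_⟩ ?_
  · rw [Matrix.mulVec_smul, h0, smul_zero]
  · simp only [Pi.smul_apply, smul_eq_mul, ← Finset.mul_sum]
    field_simp
  · intro φ₁ φ₂ h₁ h₂
    refine sub_eq_zero.mp (hzero _ ?_ ?_)
    · rw [Matrix.mulVec_sub, h₁.1, h₂.1, sub_zero]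
    · simp only [Pi.sub_apply, Finset.sum_sub_distrib, h₁.2, h₂.2, sub_self]

end Nearest

/-- The eigenvalue nearest to `Lam` exists for small `ε` and tends to `Lam`, and its eigenfunction is
in the Hardy space. -/
theorem eventually_lamEps [NeZero P] (hu : IsPositiveKlausShaw c z) {Lam : ℝ}
    (hLam : Lam ∈ bulk c z) (hsimple : SimpleComplexCriticalPoints c z Lam) {δ : ℝ} (hδ : 0 < δ) :
    ∀ᶠ ε : ℝ in 𝓝[>] 0, (∃! lam : ℝ, IsNearestEigenvalue c z ε Lam lam) ∧
      (∃! φ : Fin P → ℂ, IsNormalizedNullvector c z ε (lamEps c z Lam ε) φ) ∧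
      |lamEps c z Lam ε - Lam| ≤ δ ∧ lamEps c z Lam ε < 0 ∧
      (∑ p, phi c z ε (lamEps c z Lam ε) p = lamEps c z Lam ε) ∧
      ∃ η Φ, HardySolution c z ε (lamEps c z Lam ε) (phi c z ε (lamEps c z Lam ε)) 0 0 η Φ := by
  have hr := hu.toIsRationalPotential
  have hneg := bulk_neg hu hLam
  set δ' := min δ (-Lam / 2) with hδ'
  have hδ'0 : 0 < δ' := lt_min hδ (by linarith)
  have hδ'n : Lam + δ' < 0 := by
    have : δ' ≤ -Lam / 2 := min_le_right _ _
    linarith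
  filter_upwards [eventually_exists_eigenvalue hu hLam hsimple hδ'0, self_mem_nhdsWithin]
    with ε ⟨lam₀, h₀, he₀⟩ hε
  have hex := existsUnique_nearest hr hε hδ'n h₀ he₀
  have hnear : IsNearestEigenvalue c z ε Lam (lamEps c z Lam ε) := Classical.epsilon_spec hex.exists
  have hnull := existsUnique_nullvector hr hε hnear.1
  have hphi : IsNormalizedNullvector c z ε (lamEps c z Lam ε) (phi c z ε (lamEps c z Lam ε)) :=
    Classical.epsilon_spec hnull.exists
  refine ⟨hex, hnull, ?_, hnear.1.1, hphi.2, ?_⟩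
  · exact ((hnear.2 lam₀ he₀).1.trans h₀).trans (min_le_left _ _)
  · exact exists_hardySolution_of_mulVec hr hε (by simpa using hnear.1.1) 0 hphi.1

/-- At `y` the equation reads `source = (lam - Lam) Φ + I ε Φ'`. The last term is bounded because `ε
∫ ‖Φ‖²` is. As the zero `y` of `h'` is simple, `h'` does not vanish on a small circle around it;
there the equation can be solved for `Φ`, and the maximum principle brings the bound to `y`. -/
theorem exists_norm_source_critical_le {Lam : ℝ} {C₀ : ℝ} (hC₀ : 0 ≤ C₀) (q : Fin P)
    {y : ℂ} (hy : 0 < y.im) (hyz : ∀ p, y ≠ z p) (h0 : hDeriv c z Lam y = 0)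
    (h1 : deriv (hDeriv c z Lam) y ≠ 0) (hz : ∀ p, 0 < (z p).im) :
    ∃ C δ : ℝ, 0 < C ∧ 0 < δ ∧ ∀ lam : ℝ, |lam - Lam| ≤ δ → ∀ ε : ℝ, 0 < ε → ε ≤ 1 → ∀ φ η Φ,
      HardySolution c z ε lam φ 0 q η Φ → ε * ∫ x : ℝ, ‖Φ x‖ ^ 2 ≤ C₀ →
      ‖source z φ 0 q y‖ ≤ |lam - Lam| * (C * (∑ p, ‖φ p‖ + 1)) + C := by
  have hpole : ∀ w : ℂ, 0 < w.im → (∀ p, w ≠ z p) → ∀ p, w ≠ z p ∧ w ≠ star (z p) := by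
    intro w hw hwz p
    refine ⟨hwz p, fun h => ?_⟩
    rw [h] at hw
    simp at hw
    linarith [hz p]
  have hd : HasDerivAt (hDeriv c z Lam) (deriv (hDeriv c z Lam) y) y :=
    (hasDerivAt_hDeriv (hpole y hy hyz)).differentiableAt.hasDerivAt
  have hev1 : ∀ᶠ w in 𝓝[≠] y, hDeriv c z Lam w ≠ 0 := hd.eventually_ne h1
  have hev2 : ∀ᶠ w in 𝓝[≠] y, y.im / 2 < w.im :=
    nhdsWithin_le_nhds ((isOpen_lt continuous_const Complex.continuous_im).mem_nhds
      (show y.im / 2 < y.im by linarith))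
  obtain ⟨r, hr, hball⟩ := (nhdsWithin_hasBasis Metric.nhds_basis_closedBall _).eventually_iff.mp
    (hev1.and (hev2.and (eventually_punctured_ne (z := z) y)))
  have him : ∀ w ∈ Metric.closedBall y r, y.im / 2 < w.im := by
    intro w hw
    by_cases h : w = y
    · rw [h]; linarith
    · exact (hball ⟨hw, h⟩).2.1
  have hsph : ∀ w ∈ Metric.sphere y r, hDeriv c z Lam w ≠ 0 ∧ y.im / 2 < w.im ∧ ∀ p, w ≠ z p :=
    fun w hw => hball ⟨Metric.sphere_subset_closedBall hw, Metric.ne_of_mem_sphere hw hr.ne'⟩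
  have hcont : ContinuousOn (hDeriv c z Lam) (Metric.sphere y r) := fun w hw =>
    (hasDerivAt_hDeriv (hpole w (by linarith [(hsph w hw).2.1]) (hsph w hw).2.2)).continuousAt.continuousWithinAt
  obtain ⟨w₀, hw₀, hmin⟩ := (isCompact_sphere y r).exists_isMinOn
    (NormedSpace.sphere_nonempty.mpr hr.le) hcont.norm
  set κ := ‖hDeriv c z Lam w₀‖ / 2 with hκ
  have hκ0 : 0 < κ := half_pos (norm_pos_iff.mpr (hsph w₀ hw₀).1)
  obtain ⟨C₁, hC₁⟩ := (isCompact_sphere y r).exists_bound_of_continuousOn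
    (f := fun w => ∑ p, ‖1 / (w - z p)‖) (by
      refine continuousOn_finsetSum _ fun p _ => ContinuousOn.norm ?_
      exact continuousOn_const.div (by fun_prop) fun w hw => sub_ne_zero.mpr ((hsph w hw).2.2 p))
  have hC₁0 : 0 ≤ C₁ := (norm_nonneg _).trans (hC₁ w₀ hw₀)
  set C₂ := Real.sqrt (2 / (Real.pi * (y.im / 2) ^ 3) * C₀) with hC₂
  have hC₂0 : 0 ≤ C₂ := Real.sqrt_nonneg _
  have hC₂sq : C₂ ^ 2 = 2 / (Real.pi * (y.im / 2) ^ 3) * C₀ := Real.sq_sqrt (by positivity)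
  refine ⟨(C₁ + C₂) / κ + C₂ + 1, κ, by positivity, hκ0, fun lam hlam ε hε hε1 φ η Φ hs hN => ?_⟩
  set S := ∑ p, ‖φ p‖ with hS
  have hS0 : 0 ≤ S := Finset.sum_nonneg fun p _ => norm_nonneg _
  have hder : ∀ w ∈ Metric.closedBall y r, ε * ‖deriv Φ w‖ ≤ C₂ := by
    intro w hw
    have hw0 := him w hw
    have h2 := hs.decay.normSq_deriv_le (w := w) (by linarith)
    refine (sq_le_sq₀ (by positivity) hC₂0).mp ?_
    have h3 : 2 / (Real.pi * w.im ^ 3) ≤ 2 / (Real.pi * (y.im / 2) ^ 3) := by gcongr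
    have h4 : 0 ≤ ∫ x : ℝ, ‖Φ x‖ ^ 2 := integral_nonneg fun x => by positivity
    rw [hC₂sq, mul_pow]
    calc ε ^ 2 * ‖deriv Φ w‖ ^ 2
        ≤ ε ^ 2 * (2 / (Real.pi * (y.im / 2) ^ 3) * ∫ x : ℝ, ‖Φ x‖ ^ 2) := by
          gcongr; exact h2.trans (by gcongr)
      _ = 2 / (Real.pi * (y.im / 2) ^ 3) * (ε * (ε * ∫ x : ℝ, ‖Φ x‖ ^ 2)) := by ring
      _ ≤ 2 / (Real.pi * (y.im / 2) ^ 3) * (1 * C₀) := by gcongr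
      _ = _ := by ring
  have hIε : ∀ w : ℂ, ‖Complex.I * ε * deriv Φ w‖ = ε * ‖deriv Φ w‖ := by
    intro w
    rw [norm_mul, norm_mul, Complex.norm_I, one_mul, Complex.norm_real, Real.norm_of_nonneg hε.le]
  have hΦs : ∀ w ∈ Metric.sphere y r, ‖Φ w‖ ≤ (C₁ * S + C₂) / κ := by
    intro w hw
    obtain ⟨h2, h3, h4⟩ := hsph w hw
    have h5 := hs.source_eq (v := w) (by linarith) h4
    have h6 : κ ≤ ‖(lam : ℂ) + uC c z w‖ := by
      have h7 : (lam : ℂ) + uC c z w = hDeriv c z Lam w - ((Lam - lam : ℝ) : ℂ) := by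
        rw [hDeriv]; push_cast; ring
      rw [h7]
      have h8 := norm_sub_norm_le (hDeriv c z Lam w) ((Lam - lam : ℝ) : ℂ)
      rw [Complex.norm_real, Real.norm_eq_abs, abs_sub_comm] at h8
      have h9 : ‖hDeriv c z Lam w₀‖ ≤ ‖hDeriv c z Lam w‖ := hmin hw
      have h10 : 2 * κ = ‖hDeriv c z Lam w₀‖ := by rw [hκ]; ring
      linarith
    have h7 : ‖source z φ 0 q w‖ ≤ C₁ * S := by
      simp only [source, zero_div, sub_zero]
      have h8 := hC₁ w hw
      rw [Real.norm_of_nonneg (Finset.sum_nonneg fun p _ => norm_nonneg _)] at h8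
      rw [hS, Finset.mul_sum]
      refine (norm_sum_le _ _).trans (Finset.sum_le_sum fun p _ => ?_)
      have h9 : ‖1 / (w - z p)‖ ≤ C₁ := (Finset.single_le_sum (f := fun p => ‖1 / (w - z p)‖)
        (fun p _ => norm_nonneg _) (Finset.mem_univ p)).trans h8
      rw [div_eq_mul_one_div, norm_mul, mul_comm]
      gcongr
    rw [le_div_iff₀ hκ0]
    calc ‖Φ w‖ * κ ≤ ‖Φ w‖ * ‖(lam : ℂ) + uC c z w‖ := by gcongr
      _ = ‖source z φ 0 q w - Complex.I * ε * deriv Φ w‖ := by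
        rw [h5, add_sub_cancel_right, norm_mul, mul_comm]
      _ ≤ C₁ * S + C₂ := (norm_sub_le _ _).trans (add_le_add h7 (by
          rw [hIε]; exact hder w (Metric.sphere_subset_closedBall hw)))
  have hΦy : ‖Φ y‖ ≤ (C₁ * S + C₂) / κ := by
    refine Complex.norm_le_of_forall_mem_frontier_norm_le (U := Metric.ball y r) Metric.isBounded_ball
      (DifferentiableOn.diffContOnCl fun v hv => ?_) ?_ (subset_closure (Metric.mem_ball_self hr))
    · rw [closure_ball _ hr.ne'] at hv
      exact (hs.differentiableAt (by linarith [him v hv])).differentiableWithinAt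
    · rw [frontier_ball _ hr.ne']
      exact hΦs
  rw [hs.source_eq hy.le hyz]
  have h2 : (lam : ℂ) + uC c z y = ((lam - Lam : ℝ) : ℂ) := by
    rw [hDeriv] at h0
    push_cast
    linear_combination h0
  rw [h2]
  refine (norm_add_le _ _).trans (add_le_add ?_ ?_)
  · rw [norm_mul, Complex.norm_real, Real.norm_eq_abs]
    gcongr
    refine hΦy.trans ?_
    rw [div_le_iff₀ hκ0]
    have e : ((C₁ + C₂) / κ + C₂ + 1) * (S + 1) * κ = (C₁ + C₂) * (S + 1) + (C₂ + 1) * (S + 1) * κ := by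
      field_simp
      ring
    rw [e]
    have : 0 ≤ (C₂ + 1) * (S + 1) * κ := by positivity
    nlinarith
  · rw [hIε]
    refine (hder y (Metric.mem_closedBall_self hr.le)).trans ?_
    have : 0 ≤ (C₁ + C₂) / κ := by positivity
    linarith

/-- The sum of the coefficients takes the place of one interpolation point, so the `P - 1` upper
critical points suffice and the turning points are not needed. -/
theorem exists_coeff_eq_sum [NeZero P] (hu : IsRationalPotential c z) (q : Fin P) {s : Finset ℂ}
    (hs : P ≤ s.card + 1) (hsz : ∀ w ∈ s, ∀ p, w ≠ z p) :
    ∃ a : Fin P → Option s → ℂ, ∀ φ : Fin P → ℂ, ∀ p,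
      φ p = a p none * (∑ j, φ j) + ∑ w : s, a p (some w) * source z φ 0 q w := by
  set Lf : Option s → ((Fin P → ℂ) →ₗ[ℂ] ℂ) := fun o => o.elim
    (∑ j, LinearMap.proj j) (fun w => (sourceFunctional z q w).comp (LinearMap.inl ℂ _ _)) with hLf
  have h : ∀ p, ∃ a : Option s → ℂ, ∑ o, a o • Lf o = LinearMap.proj p := by
    intro p
    rw [← Submodule.mem_span_range_iff_exists_fun ℂ]
    refine mem_span_of_iInf_ker_le_ker fun φ hφ => ?_
    simp only [Submodule.mem_iInf, LinearMap.mem_ker] at hφ ⊢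
    have h0 : φ = 0 := eq_zero_of_source_eq_zero_of_sum_eq_zero (q := q) hu.injective hs hsz
      (fun w hw => hφ (some ⟨w, hw⟩)) (by simpa [hLf] using hφ none)
    rw [h0]; simp
  choose a ha using h
  refine ⟨a, fun φ p => ?_⟩
  have := congrArg (fun L : (Fin P → ℂ) →ₗ[ℂ] ℂ => L φ) (ha p)
  simp only [Fintype.sum_option, LinearMap.add_apply, LinearMap.sum_apply, LinearMap.smul_apply,
    smul_eq_mul, LinearMap.proj_apply] at this
  rw [← this]
  simp [hLf, sourceFunctional]

/-- The normalized nullvectors stay bounded. -/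
theorem exists_sum_norm_le [NeZero P] (hu : IsPositiveKlausShaw c z) {Lam : ℝ}
    (hLam : Lam ∈ bulk c z) (hsimple : SimpleComplexCriticalPoints c z Lam) (q : Fin P) :
    ∃ M δ : ℝ, 0 < δ ∧ ∀ lam : ℝ, |lam - Lam| ≤ δ → lam < 0 → ∀ ε : ℝ, 0 < ε → ε ≤ 1 → ∀ φ η Φ,
      HardySolution c z ε lam φ 0 q η Φ → ∑ p, φ p = lam → ∑ p, ‖φ p‖ ≤ M := by
  have hr := hu.toIsRationalPotential
  obtain ⟨Y, hYc, hY⟩ := exists_upper_critical hu hLam hsimple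
  obtain ⟨a, ha⟩ := exists_coeff_eq_sum hr q (s := Y) hYc.ge fun w hw => (hY w hw).2.1
  set C₀ := 2 * Real.pi * (|Lam| + 1) with hC₀
  have hC₀0 : 0 ≤ C₀ := by positivity
  have h : ∀ w : Y, ∃ C δ : ℝ, 0 < C ∧ 0 < δ ∧ ∀ lam : ℝ, |lam - Lam| ≤ δ → ∀ ε : ℝ, 0 < ε → ε ≤ 1 →
      ∀ φ η Φ, HardySolution c z ε lam φ 0 q η Φ → ε * ∫ x : ℝ, ‖Φ x‖ ^ 2 ≤ C₀ →
      ‖source z φ 0 q w‖ ≤ |lam - Lam| * (C * (∑ p, ‖φ p‖ + 1)) + C := fun w =>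
    exists_norm_source_critical_le hC₀0 q (hY w w.2).1 (hY w w.2).2.1 (hY w w.2).2.2.1
      (hY w w.2).2.2.2 hr.pole_im_pos
  choose C δ hC hδ hb using h
  set T := ∑ p, ∑ w, ‖a p (some w)‖ * C w with hT
  have hT0 : 0 ≤ T := Finset.sum_nonneg fun p _ => Finset.sum_nonneg fun w _ =>
    mul_nonneg (norm_nonneg _) (hC w).le
  set T' := ∑ p, ‖a p none‖ with hT'
  have hT'0 : 0 ≤ T' := Finset.sum_nonneg fun p _ => norm_nonneg _
  obtain ⟨δ₁, hδ₁, hδ₁w⟩ : ∃ δ₁ : ℝ, 0 < δ₁ ∧ ∀ w : Y, δ₁ ≤ δ w := by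
    rcases isEmpty_or_nonempty Y with he | he
    · exact ⟨1, one_pos, fun w => he.elim w⟩
    · obtain ⟨w₀, hw₀⟩ := Finite.exists_min δ
      exact ⟨δ w₀, hδ w₀, hw₀⟩
  -- The threshold makes `T |lam - Lam| ≤ 1 / 2`. The resulting inequality `S ≤ T' (|Lam| + 1) + S /
  -- 2 + 2 T` for the norm sum `S` can then be solved.
  refine ⟨2 * (T' * (|Lam| + 1) + 2 * T), min 1 (min δ₁ (1 / (2 * (T + 1)))), by positivity,
    fun lam hlam hlam0 ε hε hε1 φ η Φ hs hsum => ?_⟩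
  have hl1 : |lam - Lam| ≤ 1 := hlam.trans (min_le_left _ _)
  have hl2 : |lam - Lam| ≤ δ₁ := hlam.trans ((min_le_right _ _).trans (min_le_left _ _))
  have hl3 : |lam - Lam| ≤ 1 / (2 * (T + 1)) := hlam.trans ((min_le_right _ _).trans (min_le_right _ _))
  have hlamabs : |lam| ≤ |Lam| + 1 := by
    have := abs_sub_abs_le_abs_sub lam Lam
    linarith
  have hN : ε * ∫ x : ℝ, ‖Φ x‖ ^ 2 ≤ C₀ := by
    have h1 := hs.norm_identity hr hε hlam0.ne
    rw [hsum, Complex.norm_real, Real.norm_eq_abs, sq_abs] at h1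
    have h2 : ε * ∫ x : ℝ, ‖Φ x‖ ^ 2 = -(2 * Real.pi * lam) := by
      apply mul_left_cancel₀ hlam0.ne
      rw [h1]; ring
    rw [h2, hC₀]
    rw [abs_of_neg hlam0] at hlamabs
    nlinarith [Real.pi_pos]
  set S := ∑ p, ‖φ p‖ with hS
  have hS0 : 0 ≤ S := Finset.sum_nonneg fun p _ => norm_nonneg _
  set X := |lam - Lam| * (S + 1) + 1 with hX
  have hX0 : 0 ≤ X := by positivity
  have hp : ∀ p, ‖φ p‖ ≤ ‖a p none‖ * (|Lam| + 1) + (∑ w, ‖a p (some w)‖ * C w) * X := by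
    intro p
    rw [ha φ p, hsum]
    refine (norm_add_le _ _).trans (add_le_add ?_ ?_)
    · rw [norm_mul, Complex.norm_real, Real.norm_eq_abs]
      gcongr
    · rw [Finset.sum_mul]
      refine (norm_sum_le _ _).trans (Finset.sum_le_sum fun w _ => ?_)
      rw [norm_mul, mul_assoc]
      gcongr
      refine (hb w lam (hl2.trans (hδ₁w w)) ε hε hε1 φ η Φ hs hN).trans (le_of_eq ?_)
      rw [hX]; ring
  have hSle : S ≤ T' * (|Lam| + 1) + T * X := by
    rw [hT', hT, Finset.sum_mul, Finset.sum_mul, ← Finset.sum_add_distrib]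
    exact Finset.sum_le_sum fun p _ => hp p
  have h4 : T * |lam - Lam| ≤ 1 / 2 := by
    have h5 : T * |lam - Lam| ≤ T * (1 / (2 * (T + 1))) := by gcongr
    refine h5.trans ?_
    rw [mul_one_div, div_le_div_iff₀ (by positivity) (by norm_num)]
    linarith
  have h6 : T * X ≤ 1 / 2 * (S + 1) + T := by
    rw [hX, mul_add, ← mul_assoc, mul_one]
    gcongr
  have h7 : T * X ≤ 1 / 2 * S + 2 * T := by
    have h8 : T * |lam - Lam| ≤ T := mul_le_of_le_one_right hT0 hl1
    rw [hX]
    nlinarith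
  linarith

end BO

/-! ### Transport of the modulus along the real line. -/

namespace BO

section Transport

variable {ε : ℝ} {k : ℝ → ℝ} {g : ℝ → ℂ}

/-- Along the real line, the modulus of a solution of `W' = (i/ε) k W + r` varies by at most the
integral of `‖r‖`. -/
theorem abs_norm_sub_norm_le (hg : ∀ x, HasDerivAt g (-Complex.I / ε * k x * g x) x)
    (hg1 : ∀ x, ‖g x‖ = 1) {W r : ℝ → ℂ} {B B' : ℝ → ℝ} {a b : ℝ} (hab : a ≤ b)
    (hW : ∀ x ∈ Set.Icc a b, HasDerivAt W (Complex.I / ε * k x * W x + r x) x)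
    (hB : ∀ x ∈ Set.Icc a b, HasDerivAt B (B' x) x)
    (hr : ∀ x ∈ Set.Icc a b, ‖r x‖ ≤ B' x) : |‖W b‖ - ‖W a‖| ≤ B b - B a := by
  -- The unimodular integrating factor `g` removes the oscillating term without changing the
  -- modulus.
  have hd : ∀ x ∈ Set.Icc a b, HasDerivAt (fun y => W y * g y - W a * g a) (r x * g x) x := by
    intro x hx
    refine (((hW x hx).mul (hg x)).sub_const _).congr_deriv ?_
    ring
  have hBd : ∀ x ∈ Set.Icc a b, HasDerivAt (fun y => B y - B a) (B' x) x := fun x hx =>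
    (hB x hx).sub_const _
  have h := image_norm_le_of_norm_deriv_right_le_deriv_boundary'
    (fun x hx => (hd x hx).continuousAt.continuousWithinAt)
    (fun x hx => (hd x (Set.Ico_subset_Icc_self hx)).hasDerivWithinAt) (by simp)
    (fun x hx => (hBd x hx).continuousAt.continuousWithinAt)
    (fun x hx => (hBd x (Set.Ico_subset_Icc_self hx)).hasDerivWithinAt)
    (fun x hx => by
      rw [norm_mul, hg1, mul_one]
      exact hr x (Set.Ico_subset_Icc_self hx)) (Set.right_mem_Icc.mpr hab)
  refine le_trans ?_ h
  have := _root_.abs_norm_sub_norm_le (W b * g b) (W a * g a)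
  simpa [norm_mul, hg1] using this

/-- The modulus is transported back from infinity, where it vanishes; `-K / y ^ m` is the
antiderivative of the assumed bound on the remainder. -/
theorem norm_le_of_tendsto_atTop (hg : ∀ x, HasDerivAt g (-Complex.I / ε * k x * g x) x)
    (hg1 : ∀ x, ‖g x‖ = 1) {W r : ℝ → ℂ} {K N : ℝ} (hN : 0 < N) {m : ℕ} (hm : m ≠ 0)
    (hW : ∀ x, N ≤ x → HasDerivAt W (Complex.I / ε * k x * W x + r x) x)
    (hr : ∀ x, N ≤ x → ‖r x‖ ≤ m * K / x ^ (m + 1)) (hlim : Tendsto W atTop (𝓝 0)) {x : ℝ}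
    (hx : N ≤ x) : ‖W x‖ ≤ K / x ^ m := by
  have hx0 : 0 < x := hN.trans_le hx
  have hB : ∀ y, N ≤ y → HasDerivAt (fun y => -(K / y ^ m)) (m * K / y ^ (m + 1)) y := by
    intro y hy
    have hy0 : 0 < y := hN.trans_le hy
    have h := (((hasDerivAt_pow m y).fun_inv (pow_ne_zero m hy0.ne')).const_mul K).neg
    refine (h.congr_deriv ?_).congr_of_eventuallyEq
      (Eventually.of_forall fun v => by simp [div_eq_mul_inv])
    obtain ⟨j, rfl⟩ := Nat.exists_eq_succ_of_ne_zero hm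
    simp only [Nat.succ_eq_add_one, Nat.add_sub_cancel]
    field_simp
    ring
  have h : ∀ᶠ R in atTop, ‖W x‖ ≤ ‖W R‖ - K / R ^ m + K / x ^ m := by
    filter_upwards [eventually_ge_atTop x] with R hR
    have := abs_norm_sub_norm_le hg hg1 (B := fun y => -(K / y ^ m)) hR
      (fun y hy => hW y (hx.trans hy.1)) (fun y hy => hB y (hx.trans hy.1))
      (fun y hy => hr y (hx.trans hy.1))
    have h2 := (abs_le.mp this).1
    linarith
  have h2 : Tendsto (fun R : ℝ => ‖W R‖ - K / R ^ m + K / x ^ m) atTop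
      (𝓝 (0 - 0 + K / x ^ m)) :=
    ((tendsto_zero_iff_norm_tendsto_zero.mp hlim).sub
      (tendsto_const_nhds.div_atTop (tendsto_pow_atTop hm))).add_const _
  simpa using ge_of_tendsto h2 h

theorem norm_le_of_tendsto (hg : ∀ x, HasDerivAt g (-Complex.I / ε * k x * g x) x)
    (hg1 : ∀ x, ‖g x‖ = 1) {W r : ℝ → ℂ} {K N : ℝ} (hN : 0 < N) {m : ℕ} (hm : m ≠ 0)
    (hW : ∀ x, N ≤ |x| → HasDerivAt W (Complex.I / ε * k x * W x + r x) x)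
    (hr : ∀ x, N ≤ |x| → ‖r x‖ ≤ m * K / |x| ^ (m + 1)) (htop : Tendsto W atTop (𝓝 0))
    (hbot : Tendsto W atBot (𝓝 0)) {x : ℝ} (hx : N ≤ |x|) : ‖W x‖ ≤ K / |x| ^ m := by
  rcases le_total 0 x with h | h
  · rw [abs_of_nonneg h] at hx ⊢
    refine norm_le_of_tendsto_atTop hg hg1 hN hm (fun y hy => hW y ?_) (fun y hy => ?_) htop hx
    · exact hy.trans (le_abs_self y)
    · simpa [abs_of_pos (hN.trans_le hy)] using hr y (hy.trans (le_abs_self y))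
  · rw [abs_of_nonpos h] at hx ⊢
    have habs : ∀ y, N ≤ y → |(-y)| = y := fun y hy => by rw [abs_neg, abs_of_pos (hN.trans_le hy)]
    -- The reflection `y ↦ -y` changes the sign of the derivative, which amounts to replacing `ε` by
    -- `-ε`; the lemma requires no sign of `ε`.
    have := norm_le_of_tendsto_atTop (ε := -ε) (k := fun y => k (-y)) (g := fun y => g (-y))
      (W := fun y => W (-y)) (r := fun y => -r (-y)) (K := K) (m := m)
      (fun y => by
        refine ((hg (-y)).scomp y (hasDerivAt_neg y)).congr_deriv ?_
        push_cast
        simp [div_neg])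
      (fun y => hg1 _) hN hm
      (fun y hy => by
        refine ((hW (-y) (hy.trans (habs y hy).ge)).scomp y (hasDerivAt_neg y)).congr_deriv ?_
        push_cast
        simp [div_neg])
      (fun y hy => by
        have := hr (-y) (hy.trans (habs y hy).ge)
        rwa [habs y hy, ← norm_neg] at this)
      (hbot.comp tendsto_neg_atTop_atBot) hx
    simpa using this

end Transport

/-! ### Real-line estimates for an equation with two simple turning points. -/

/-- The equation `Φ' = (i/ε) (k Φ - S)` on the real line with a real coefficient `k` that has at most
the two simple zeros `s` and `t`, and a solution that vanishes at infinity. -/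
structure TurningPointEquation (ε C κ s t : ℝ) (k k₁ k₂ : ℝ → ℝ) (S S₁ S₂ g Φ : ℝ → ℂ) : Prop where
  eps_pos : 0 < ε
  C_nonneg : 0 ≤ C
  κ_pos : 0 < κ
  hasDerivAt_k : ∀ x, HasDerivAt k (k₁ x) x
  hasDerivAt_k₁ : ∀ x, HasDerivAt k₁ (k₂ x) x
  hasDerivAt_S : ∀ x, HasDerivAt S (S₁ x) x
  hasDerivAt_S₁ : ∀ x, HasDerivAt S₁ (S₂ x) x
  hasDerivAt_g : ∀ x, HasDerivAt g (-Complex.I / ε * k x * g x) x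
  norm_g : ∀ x, ‖g x‖ = 1
  hasDerivAt : ∀ x, HasDerivAt Φ (Complex.I / ε * (k x * Φ x - S x)) x
  abs_k_le : ∀ x, |k x| ≤ C
  abs_k₁_le : ∀ x, |k₁ x| ≤ C / (1 + |x|) ^ 2
  abs_k₂_le : ∀ x, |k₂ x| ≤ C / (1 + |x|) ^ 3
  norm_S_le : ∀ x, ‖S x‖ ≤ C / (1 + |x|)
  norm_S₁_le : ∀ x, ‖S₁ x‖ ≤ C / (1 + |x|) ^ 2
  norm_S₂_le : ∀ x, ‖S₂ x‖ ≤ C / (1 + |x|) ^ 3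
  le_abs_k : ∀ x, κ * min 1 (min |x - s| |x - t|) ≤ |k x|
  tendsto_atTop : Tendsto Φ atTop (𝓝 0)
  tendsto_atBot : Tendsto Φ atBot (𝓝 0)

namespace TurningPointEquation

variable {ε C κ s t : ℝ} {k k₁ k₂ : ℝ → ℝ} {S S₁ S₂ g Φ : ℝ → ℂ}
  (H : TurningPointEquation ε C κ s t k k₁ k₂ S S₁ S₂ g Φ)
include H

theorem ne_zero {w x : ℝ} (hw : 0 < w) (hw1 : w ≤ 1) (hs : w ≤ |x - s|) (ht : w ≤ |x - t|) :
    κ * w ≤ |k x| ∧ k x ≠ 0 := by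
  have h1 : κ * w ≤ |k x| :=
    (mul_le_mul_of_nonneg_left (le_min hw1 (le_min hs ht)) H.κ_pos.le).trans (H.le_abs_k x)
  exact ⟨h1, fun h => by
    rw [h, abs_zero] at h1
    exact absurd h1 (not_le.mpr (mul_pos H.κ_pos hw))⟩

theorem hasDerivAt_quot {x : ℝ} (hk : k x ≠ 0) :
    HasDerivAt (fun y => S y / k y) ((S₁ x * k x - S x * k₁ x) / (k x) ^ 2) x :=
  (H.hasDerivAt_S x).div (H.hasDerivAt_k x).ofReal_comp (by exact_mod_cast hk)

/-- Subtracting `S / k` trades the inhomogeneity of order `1 / ε` for the derivative of `S / k`,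
which does not depend on `ε` but is singular at the turning points. -/
theorem hasDerivAt_sub_quot {x : ℝ} (hk : k x ≠ 0) :
    HasDerivAt (fun y => Φ y - S y / k y)
      (Complex.I / ε * k x * (Φ x - S x / k x) + -((S₁ x * k x - S x * k₁ x) / (k x) ^ 2)) x := by
  refine ((H.hasDerivAt x).sub (H.hasDerivAt_quot hk)).congr_deriv ?_
  have : (k x : ℂ) ≠ 0 := by exact_mod_cast hk
  field_simp
  ring

theorem norm_S_le' (x : ℝ) : ‖S x‖ ≤ C :=
  (H.norm_S_le x).trans (div_le_self H.C_nonneg (by linarith [abs_nonneg x]))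

theorem norm_quot_le {w x : ℝ} (hw : 0 < w) (hw1 : w ≤ 1) (hs : w ≤ |x - s|) (ht : w ≤ |x - t|) :
    ‖S x / k x‖ ≤ C / (κ * w) := by
  obtain ⟨h1, h2⟩ := H.ne_zero hw hw1 hs ht
  have := H.κ_pos
  have := H.C_nonneg
  rw [norm_div, Complex.norm_real, Real.norm_eq_abs]
  gcongr
  exact H.norm_S_le' x

theorem norm_deriv_quot_le {w x : ℝ} (hw : 0 < w) (hw1 : w ≤ 1) (hs : w ≤ |x - s|)
    (ht : w ≤ |x - t|) :
    ‖(S₁ x * k x - S x * k₁ x) / (k x : ℂ) ^ 2‖ ≤ (C / κ + C ^ 2 / κ ^ 2) / w ^ 2 / (1 + |x|) ^ 2 := by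
  obtain ⟨h1, h2⟩ := H.ne_zero hw hw1 hs ht
  have hκ := H.κ_pos
  have hC := H.C_nonneg
  have hk0 : 0 < |k x| := abs_pos.mpr h2
  have hX : 0 < 1 + |x| := by positivity
  have e : (S₁ x * k x - S x * k₁ x) / (k x : ℂ) ^ 2 = S₁ x / k x - S x * k₁ x / (k x : ℂ) ^ 2 := by
    have : (k x : ℂ) ≠ 0 := by exact_mod_cast h2
    field_simp
  rw [e]
  refine (norm_sub_le _ _).trans ?_
  rw [norm_div, norm_div, norm_mul, norm_pow, Complex.norm_real, Complex.norm_real,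
    Real.norm_eq_abs, Real.norm_eq_abs]
  have a1 : ‖S₁ x‖ / |k x| ≤ C / κ / w ^ 2 / (1 + |x|) ^ 2 := by
    calc ‖S₁ x‖ / |k x| ≤ (C / (1 + |x|) ^ 2) / (κ * w) := by
          gcongr
          exact H.norm_S₁_le x
      _ ≤ (C / (1 + |x|) ^ 2) / (κ * w ^ 2) := by
          gcongr
          nlinarith
      _ = _ := by field_simp
  have a2 : ‖S x‖ * |k₁ x| / |k x| ^ 2 ≤ C ^ 2 / κ ^ 2 / w ^ 2 / (1 + |x|) ^ 2 := by
    calc ‖S x‖ * |k₁ x| / |k x| ^ 2 ≤ C * (C / (1 + |x|) ^ 2) / (κ * w) ^ 2 := by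
          gcongr
          · exact H.norm_S_le' x
          · exact H.abs_k₁_le x
      _ = _ := by field_simp
  calc _ ≤ C / κ / w ^ 2 / (1 + |x|) ^ 2 + C ^ 2 / κ ^ 2 / w ^ 2 / (1 + |x|) ^ 2 := add_le_add a1 a2
    _ = _ := by ring

/-- Away from the turning points. -/
theorem abs_norm_sub_le_of_Icc {N w a b : ℝ} (hw : 0 < w) (hw1 : w ≤ 1) (hab : a ≤ b)
    (hN : b - a ≤ N) (h : ∀ x ∈ Set.Icc a b, w ≤ |x - s| ∧ w ≤ |x - t|) :
    |‖Φ b‖ - ‖Φ a‖| ≤ (2 * C / κ + (C / κ + C ^ 2 / κ ^ 2) * (N + 4)) / w := by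
  have hκ := H.κ_pos
  have hC := H.C_nonneg
  set K := C / κ + C ^ 2 / κ ^ 2 with hK
  have hK0 : 0 ≤ K := by positivity
  have hne : ∀ x ∈ Set.Icc a b, k x ≠ 0 := fun x hx => (H.ne_zero hw hw1 (h x hx).1 (h x hx).2).2
  have hpos : ∀ x ∈ Set.Icc a b, 0 < |x - s| ∧ 0 < |x - t| := fun x hx =>
    ⟨hw.trans_le (h x hx).1, hw.trans_le (h x hx).2⟩
  -- The derivative of `S / k` has second order poles at worst. The increment of this antiderivative
  -- is at most `K (N + 4) / w`, with one term `1 / w` for each of the two poles at each end.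
  have hB : ∀ x ∈ Set.Icc a b, HasDerivAt (fun y => K * (y - (y - s)⁻¹ - (y - t)⁻¹))
      (K * (1 + 1 / (x - s) ^ 2 + 1 / (x - t) ^ 2)) x := by
    intro x hx
    have h1 := ((hasDerivAt_id x).sub_const s).fun_inv (abs_pos.mp (hpos x hx).1)
    have h2 := ((hasDerivAt_id x).sub_const t).fun_inv (abs_pos.mp (hpos x hx).2)
    refine ((((hasDerivAt_id x).sub h1).sub h2).const_mul K).congr_deriv ?_
    simp only [id]
    ring
  have hr : ∀ x ∈ Set.Icc a b, ‖-((S₁ x * k x - S x * k₁ x) / (k x : ℂ) ^ 2)‖ ≤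
      K * (1 + 1 / (x - s) ^ 2 + 1 / (x - t) ^ 2) := by
    intro x hx
    rw [norm_neg]
    have hd : 0 < min 1 (min |x - s| |x - t|) := lt_min one_pos (lt_min (hpos x hx).1 (hpos x hx).2)
    refine (H.norm_deriv_quot_le hd (min_le_left _ _)
      ((min_le_right _ _).trans (min_le_left _ _))
      ((min_le_right _ _).trans (min_le_right _ _))).trans ?_
    have h1 : K / min 1 (min |x - s| |x - t|) ^ 2 / (1 + |x|) ^ 2 ≤
        K / min 1 (min |x - s| |x - t|) ^ 2 :=
      div_le_self (by positivity) (one_le_pow₀ (by linarith [abs_nonneg x]))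
    refine h1.trans ?_
    rw [div_eq_mul_one_div]
    refine mul_le_mul_of_nonneg_left ?_ hK0
    have i1 : 0 ≤ 1 / (x - s) ^ 2 := by positivity
    have i2 : 0 ≤ 1 / (x - t) ^ 2 := by positivity
    rcases min_choice 1 (min |x - s| |x - t|) with h | h
    · rw [h, one_pow, div_one]; linarith
    · rw [h]
      rcases min_choice |x - s| |x - t| with h | h
      · rw [h, sq_abs]; linarith
      · rw [h, sq_abs]; linarith
  have hmain := abs_norm_sub_norm_le H.hasDerivAt_g H.norm_g hab
    (fun x hx => H.hasDerivAt_sub_quot (hne x hx)) hB hr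
  have hinv : ∀ y : ℝ, w ≤ |y| → |y⁻¹| ≤ w⁻¹ := fun y hy => by
    rw [abs_inv]; exact inv_anti₀ hw hy
  have ha := h a (Set.left_mem_Icc.mpr hab)
  have hb := h b (Set.right_mem_Icc.mpr hab)
  have e1 := abs_le.mp (hinv _ ha.1)
  have e2 := abs_le.mp (hinv _ ha.2)
  have e3 := abs_le.mp (hinv _ hb.1)
  have e4 := abs_le.mp (hinv _ hb.2)
  have hw1' : 1 ≤ w⁻¹ := (one_le_inv₀ hw).mpr hw1
  have hBB : K * (b - (b - s)⁻¹ - (b - t)⁻¹) - K * (a - (a - s)⁻¹ - (a - t)⁻¹) ≤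
      K * ((N + 4) * w⁻¹) := by
    rw [← mul_sub]
    refine mul_le_mul_of_nonneg_left ?_ hK0
    nlinarith
  have q1 := H.norm_quot_le hw hw1 ha.1 ha.2
  have q2 := H.norm_quot_le hw hw1 hb.1 hb.2
  have t1 := abs_le.mp (_root_.abs_norm_sub_norm_le (Φ a) (Φ a - S a / k a))
  have t2 := abs_le.mp (_root_.abs_norm_sub_norm_le (Φ b) (Φ b - S b / k b))
  rw [sub_sub_cancel] at t1 t2
  have m := abs_le.mp hmain
  have e : (2 * C / κ + K * (N + 4)) / w = C / (κ * w) + C / (κ * w) + K * ((N + 4) * w⁻¹) := by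
    field_simp
    ring
  rw [e, abs_le]
  constructor <;> linarith

/-- Across a turning point. -/
theorem abs_norm_sub_le {a b : ℝ} (hab : a ≤ b) : |‖Φ b‖ - ‖Φ a‖| ≤ C / ε * (b - a) := by
  have hε := H.eps_pos
  have := abs_norm_sub_norm_le H.hasDerivAt_g H.norm_g (W := Φ) (r := fun x => -(Complex.I / ε * S x))
    (B := fun x => C / ε * x) (B' := fun _ => C / ε) hab
    (fun x _ => (H.hasDerivAt x).congr_deriv (by ring))
    (fun x _ => by simpa using (hasDerivAt_id x).const_mul (C / ε))
    (fun x _ => by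
      rw [norm_neg, norm_mul, norm_div, Complex.norm_I, Complex.norm_real,
        Real.norm_of_nonneg hε.le, div_mul_eq_mul_div, one_mul]
      gcongr
      exact H.norm_S_le' x)
  linarith

variable {N : ℝ} (hN : 1 ≤ N) (hfar : ∀ x, N ≤ |x| → 1 / 2 ≤ |x - s| ∧ 1 / 2 ≤ |x - t|)
include hN hfar

omit hN in
theorem half_le_abs {x : ℝ} (hx : N ≤ |x|) : κ / 2 ≤ |k x| ∧ k x ≠ 0 := by
  have h := H.ne_zero (w := 1 / 2) (by norm_num) (by norm_num) (hfar x hx).1 (hfar x hx).2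
  exact ⟨by linarith [h.1], h.2⟩

theorem norm_quot_le_of_le_abs {x : ℝ} (hx : N ≤ |x|) :
    ‖S x / k x‖ ≤ 2 * C / κ / |x| := by
  have hκ := H.κ_pos
  have hC := H.C_nonneg
  have hx0 : 0 < |x| := by linarith
  rw [norm_div, Complex.norm_real, Real.norm_eq_abs]
  calc ‖S x‖ / |k x| ≤ (C / (1 + |x|)) / (κ / 2) := by
        gcongr
        · exact H.norm_S_le x
        · exact (H.half_le_abs hfar hx).1
    _ ≤ (C / |x|) / (κ / 2) := by gcongr; linarith
    _ = _ := by field_simp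

omit hfar in
theorem norm_numer_le {x : ℝ} (hx : N ≤ |x|) :
    ‖S₁ x * k x - S x * k₁ x‖ ≤ 2 * C ^ 2 / |x| ^ 2 := by
  have hC := H.C_nonneg
  have hx0 : 0 < |x| := by linarith
  have h1 : C / (1 + |x|) ^ 2 ≤ C / |x| ^ 2 := by gcongr; linarith
  refine (norm_sub_le _ _).trans ?_
  rw [norm_mul, norm_mul, Complex.norm_real, Complex.norm_real, Real.norm_eq_abs, Real.norm_eq_abs]
  calc ‖S₁ x‖ * |k x| + ‖S x‖ * |k₁ x| ≤ (C / |x| ^ 2) * C + C * (C / |x| ^ 2) := by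
        gcongr
        · exact (H.norm_S₁_le x).trans h1
        · exact H.abs_k_le x
        · exact H.norm_S_le' x
        · exact (H.abs_k₁_le x).trans h1
    _ = _ := by ring

omit hfar in
theorem norm_numer₂_le {x : ℝ} (hx : N ≤ |x|) :
    ‖S₂ x * k x - S x * k₂ x‖ ≤ 2 * C ^ 2 / |x| ^ 3 := by
  have hC := H.C_nonneg
  have hx0 : 0 < |x| := by linarith
  have h1 : C / (1 + |x|) ^ 3 ≤ C / |x| ^ 3 := by gcongr; linarith
  refine (norm_sub_le _ _).trans ?_
  rw [norm_mul, norm_mul, Complex.norm_real, Complex.norm_real, Real.norm_eq_abs, Real.norm_eq_abs]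
  calc ‖S₂ x‖ * |k x| + ‖S x‖ * |k₂ x| ≤ (C / |x| ^ 3) * C + C * (C / |x| ^ 3) := by
        gcongr
        · exact (H.norm_S₂_le x).trans h1
        · exact H.abs_k_le x
        · exact H.norm_S_le' x
        · exact (H.abs_k₂_le x).trans h1
    _ = _ := by ring

omit H hN hfar in
theorem tendsto_zero_of_norm_le {u : ℝ → ℂ} {D : ℝ} {m : ℕ} (hm : m ≠ 0)
    (h : ∀ x, N ≤ |x| → ‖u x‖ ≤ D / |x| ^ m) : Tendsto u atTop (𝓝 0) ∧ Tendsto u atBot (𝓝 0) := by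
  have h0 : Tendsto (fun y : ℝ => D / y ^ m) atTop (𝓝 0) :=
    tendsto_const_nhds.div_atTop (tendsto_pow_atTop hm)
  constructor
  · exact squeeze_zero_norm' ((tendsto_abs_atTop_atTop.eventually_ge_atTop N).mono h)
      (h0.comp tendsto_abs_atTop_atTop)
  · exact squeeze_zero_norm' ((tendsto_abs_atBot_atTop.eventually_ge_atTop N).mono h)
      (h0.comp tendsto_abs_atBot_atTop)

/-- The leading order approximation `S / k` near infinity. -/
theorem norm_sub_quot_le {x : ℝ} (hx : N ≤ |x|) :
    ‖Φ x - S x / k x‖ ≤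
      (2 * C ^ 2 / (κ / 2) ^ 3 + (2 * C ^ 2 / (κ / 2) ^ 3 + 6 * C ^ 3 / (κ / 2) ^ 4)) * ε / |x| ^ 2 := by
  have hε := H.eps_pos
  have hκ := H.κ_pos
  have hC := H.C_nonneg
  have hN0 : 0 < N := by linarith
  set β := κ / 2 with hβ
  have hβ0 : 0 < β := by positivity
  have hk : ∀ x, N ≤ |x| → β ≤ |k x| ∧ (k x : ℂ) ≠ 0 := fun x hx =>
    ⟨(H.half_le_abs hfar hx).1, by exact_mod_cast (H.half_le_abs hfar hx).2⟩
  -- `E` is the derivative of `S / k` divided by `k`, the next term of the expansion in `ε`. Adding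
  -- `I ε E` cancels the remainder of order one and leaves `I ε E'`, which is `O(ε / |x|³)`.
  set E : ℝ → ℂ := fun x => (S₁ x * k x - S x * k₁ x) / (k x : ℂ) ^ 3 with hE
  set E' : ℝ → ℂ := fun x => (S₂ x * k x - S x * k₂ x) / (k x : ℂ) ^ 3 -
    3 * (S₁ x * k x - S x * k₁ x) * k₁ x / (k x : ℂ) ^ 4 with hE'
  have hEd : ∀ x, N ≤ |x| → HasDerivAt E (E' x) x := by
    intro x hx
    have h1 := ((H.hasDerivAt_S₁ x).mul (H.hasDerivAt_k x).ofReal_comp).sub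
      ((H.hasDerivAt_S x).mul (H.hasDerivAt_k₁ x).ofReal_comp)
    refine (h1.div ((H.hasDerivAt_k x).ofReal_comp.fun_pow 3)
      (pow_ne_zero 3 (hk x hx).2)).congr_deriv ?_
    have := (hk x hx).2
    simp only [hE', Pi.mul_apply, Pi.sub_apply]
    field_simp
    ring
  have hEn : ∀ x, N ≤ |x| → ‖E x‖ ≤ 2 * C ^ 2 / β ^ 3 / |x| ^ 2 := by
    intro x hx
    have hx0 : 0 < |x| := by linarith
    simp only [hE, norm_div, norm_pow, Complex.norm_real, Real.norm_eq_abs]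
    calc _ ≤ (2 * C ^ 2 / |x| ^ 2) / β ^ 3 := by
          gcongr
          · exact H.norm_numer_le hN hx
          · exact (hk x hx).1
      _ = _ := by field_simp
  have hEn' : ∀ x, N ≤ |x| → ‖E' x‖ ≤ (2 * C ^ 2 / β ^ 3 + 6 * C ^ 3 / β ^ 4) / |x| ^ 3 := by
    intro x hx
    have hx0 : 0 < |x| := by linarith
    have hk1 : |k₁ x| ≤ C / |x| := by
      refine (H.abs_k₁_le x).trans ?_
      have : |x| ≤ (1 + |x|) ^ 2 := by nlinarith
      gcongr
    refine (norm_sub_le _ _).trans ?_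
    simp only [norm_div, norm_mul, norm_pow, Complex.norm_real, Real.norm_eq_abs, Complex.norm_ofNat]
    calc _ ≤ (2 * C ^ 2 / |x| ^ 3) / β ^ 3 + 3 * (2 * C ^ 2 / |x| ^ 2) * (C / |x|) / β ^ 4 := by
          gcongr
          · exact H.norm_numer₂_le hN hx
          · exact (hk x hx).1
          · exact H.norm_numer_le hN hx
          · exact (hk x hx).1
      _ = _ := by field_simp; ring
  have hq := tendsto_zero_of_norm_le (u := fun x => S x / k x) (D := 2 * C / κ) (N := N)
    one_ne_zero fun x hx => by
      rw [pow_one]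
      exact H.norm_quot_le_of_le_abs hN hfar hx
  have hEl := tendsto_zero_of_norm_le two_ne_zero hEn
  have hlim : ∀ {l : Filter ℝ}, Tendsto Φ l (𝓝 0) → Tendsto (fun x => S x / k x) l (𝓝 0) →
      Tendsto E l (𝓝 0) →
      Tendsto (fun x => Φ x - S x / k x + Complex.I * ε * E x) l (𝓝 0) := by
    intro l h1 h2 h3
    simpa using (h1.sub h2).add (h3.const_mul (Complex.I * ε))
  have hεc : (ε : ℂ) ≠ 0 := by exact_mod_cast hε.ne'
  have hmain := norm_le_of_tendsto H.hasDerivAt_g H.norm_g hN0 two_ne_zero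
    (W := fun x => Φ x - S x / k x + Complex.I * ε * E x) (r := fun x => Complex.I * ε * E' x)
    (K := (2 * C ^ 2 / β ^ 3 + 6 * C ^ 3 / β ^ 4) * ε)
    (fun x hx => by
      refine ((H.hasDerivAt_sub_quot (H.half_le_abs hfar hx).2).add
        ((hEd x hx).const_mul (Complex.I * ε))).congr_deriv ?_
      have := (hk x hx).2
      simp only [hE]
      field_simp
      ring_nf
      simp only [Complex.I_sq]
      ring)
    (fun x hx => by
      have hx0 : 0 < |x| := by linarith
      have h := hEn' x hx
      rw [norm_mul, norm_mul, Complex.norm_I, one_mul, Complex.norm_real, Real.norm_of_nonneg hε.le]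
      calc ε * ‖E' x‖ ≤ ε * ((2 * C ^ 2 / β ^ 3 + 6 * C ^ 3 / β ^ 4) / |x| ^ 3) := by gcongr
        _ = (2 * C ^ 2 / β ^ 3 + 6 * C ^ 3 / β ^ 4) * ε / |x| ^ 3 := by ring
        _ ≤ _ := by
          have : 0 ≤ (2 * C ^ 2 / β ^ 3 + 6 * C ^ 3 / β ^ 4) * ε := by positivity
          refine div_le_div_of_nonneg_right ?_ (by positivity)
          push_cast
          linarith)
    (hlim H.tendsto_atTop hq.1 hEl.1) (hlim H.tendsto_atBot hq.2 hEl.2) hx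
  have h1 : Φ x - S x / k x = (Φ x - S x / k x + Complex.I * ε * E x) - Complex.I * ε * E x := by ring
  rw [h1]
  refine (norm_sub_le _ _).trans ?_
  have h2 : ‖Complex.I * ε * E x‖ ≤ ε * (2 * C ^ 2 / β ^ 3 / |x| ^ 2) := by
    rw [norm_mul, norm_mul, Complex.norm_I, one_mul, Complex.norm_real, Real.norm_of_nonneg hε.le]
    gcongr
    exact hEn x hx
  calc _ ≤ (2 * C ^ 2 / β ^ 3 + 6 * C ^ 3 / β ^ 4) * ε / |x| ^ 2 +
        ε * (2 * C ^ 2 / β ^ 3 / |x| ^ 2) := add_le_add hmain h2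
    _ = _ := by ring

theorem norm_le_of_le_abs (hε1 : ε ≤ 1) {x : ℝ} (hx : N ≤ |x|) : ‖Φ x‖ ≤ (2 * C / κ +
    (2 * C ^ 2 / (κ / 2) ^ 3 + (2 * C ^ 2 / (κ / 2) ^ 3 + 6 * C ^ 3 / (κ / 2) ^ 4))) / |x| := by
  have hκ := H.κ_pos
  have hC := H.C_nonneg
  have hx1 : 1 ≤ |x| := hN.trans hx
  have h1 := H.norm_quot_le_of_le_abs hN hfar hx
  have h2 := H.norm_sub_quot_le hN hfar hx
  set K := 2 * C ^ 2 / (κ / 2) ^ 3 + (2 * C ^ 2 / (κ / 2) ^ 3 + 6 * C ^ 3 / (κ / 2) ^ 4)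
  have hK : 0 ≤ K := by positivity
  have h3 : K * ε / |x| ^ 2 ≤ K / |x| := by
    have : |x| ≤ |x| ^ 2 := by nlinarith
    have : K * ε ≤ K := mul_le_of_le_one_right hK hε1
    gcongr
  calc ‖Φ x‖ = ‖S x / k x + (Φ x - S x / k x)‖ := by rw [add_sub_cancel]
    _ ≤ _ := norm_add_le _ _
    _ ≤ 2 * C / κ / |x| + K / |x| := add_le_add h1 (h2.trans h3)
    _ = _ := by ring

omit hfar in
/-- The bound of order `ε ^ (-1/2)` on compact intervals. -/
theorem norm_le_of_abs_le (hε1 : ε ≤ 1 / 4) (hst : 2 * √ε ≤ t - s) (hs : -N ≤ s - 1 / 2)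
    (ht : t + 1 / 2 ≤ N) {x : ℝ} (hx : |x| ≤ N) : ‖Φ x‖ ≤ (2 * C / κ +
    (2 * C ^ 2 / (κ / 2) ^ 3 + (2 * C ^ 2 / (κ / 2) ^ 3 + 6 * C ^ 3 / (κ / 2) ^ 4)) +
    5 * (2 * C / κ + (C / κ + C ^ 2 / κ ^ 2) * (2 * N + 4) + 2 * C)) / √ε := by
  have hκ := H.κ_pos
  have hC := H.C_nonneg
  have hε := H.eps_pos
  set w := √ε with hw
  have hw0 : 0 < w := Real.sqrt_pos.mpr hε
  have hww : w * w = ε := Real.mul_self_sqrt hε.le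
  have hw1 : w ≤ 1 / 2 := by nlinarith
  have hNN : |N| = N := abs_of_pos (by linarith)
  have h0 := H.norm_le_of_le_abs hN (fun y hy => by
    rcases le_abs.mp hy with h | h
    · exact ⟨le_abs.mpr (Or.inl (by linarith)), le_abs.mpr (Or.inl (by linarith))⟩
    · exact ⟨le_abs.mpr (Or.inr (by linarith)), le_abs.mpr (Or.inr (by linarith))⟩)
    (by linarith) hNN.ge
  rw [hNN] at h0
  set K := 2 * C / κ +
    (2 * C ^ 2 / (κ / 2) ^ 3 + (2 * C ^ 2 / (κ / 2) ^ 3 + 6 * C ^ 3 / (κ / 2) ^ 4)) with hK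
  have hK0 : 0 ≤ K := by positivity
  set D := 2 * C / κ + (C / κ + C ^ 2 / κ ^ 2) * (2 * N + 4) + 2 * C with hD
  have hD1 : 2 * C / κ + (C / κ + C ^ 2 / κ ^ 2) * (2 * N + 4) ≤ D := by linarith
  have hD2 : 2 * C ≤ D := by
    have : 0 ≤ 2 * C / κ + (C / κ + C ^ 2 / κ ^ 2) * (2 * N + 4) := by positivity
    linarith
  have good : ∀ {a b : ℝ}, a ≤ b → b - a ≤ 2 * N →
      (∀ y ∈ Set.Icc a b, w ≤ |y - s| ∧ w ≤ |y - t|) → ‖Φ a‖ ≤ ‖Φ b‖ + D / w := by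
    intro a b hab hb h
    have h1 := H.abs_norm_sub_le_of_Icc hw0 (by linarith) hab hb h
    have h2 := (abs_le.mp h1).1
    have h3 := div_le_div_of_nonneg_right hD1 hw0.le
    linarith
  have bad : ∀ {a b : ℝ}, a ≤ b → b - a ≤ 2 * w → ‖Φ a‖ ≤ ‖Φ b‖ + D / w := by
    intro a b hab hb
    have h1 := (abs_le.mp (H.abs_norm_sub_le hab)).1
    have h2 : C / ε * (b - a) ≤ D / w := by
      calc C / ε * (b - a) ≤ C / ε * (2 * w) := by gcongr
        _ = 2 * C / w := by rw [← hww]; field_simp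
        _ ≤ D / w := by gcongr
    linarith
  have hx' := abs_le.mp hx
  have hDw : 0 ≤ D / w := by
    have : 0 ≤ D := by linarith
    positivity
  have hKw : K / N ≤ K / w := by gcongr; linarith
  have e : (K + 5 * D) / w = K / w + 5 * (D / w) := by ring
  rw [e]
  -- Going from `N`, where the far bound holds, to the left through three regular intervals and two
  -- windows, each at the cost of `D / w`.
  have p1 : ∀ y ∈ Set.Icc (t + w) N, ‖Φ y‖ ≤ K / w + D / w := fun y hy => by
    have := good hy.2 (by linarith [hy.1]) fun v hv =>
      ⟨le_abs.mpr (Or.inl (by linarith [hv.1, hy.1])), le_abs.mpr (Or.inl (by linarith [hv.1, hy.1]))⟩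
    linarith
  have p2 : ∀ y ∈ Set.Icc (t - w) (t + w), ‖Φ y‖ ≤ K / w + 2 * (D / w) := fun y hy => by
    have := bad hy.2 (by linarith [hy.1])
    have := p1 (t + w) ⟨le_rfl, by linarith⟩
    linarith
  have p3 : ∀ y ∈ Set.Icc (s + w) (t - w), ‖Φ y‖ ≤ K / w + 3 * (D / w) := fun y hy => by
    have := good hy.2 (by linarith [hy.1]) fun v hv =>
      ⟨le_abs.mpr (Or.inl (by linarith [hv.1, hy.1])), le_abs.mpr (Or.inr (by linarith [hv.2]))⟩
    have := p2 (t - w) ⟨le_rfl, by linarith⟩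
    linarith
  have p4 : ∀ y ∈ Set.Icc (s - w) (s + w), ‖Φ y‖ ≤ K / w + 4 * (D / w) := fun y hy => by
    have := bad hy.2 (by linarith [hy.1])
    have := p3 (s + w) ⟨le_rfl, by linarith⟩
    linarith
  have p5 : ∀ y ∈ Set.Icc (-N) (s - w), ‖Φ y‖ ≤ K / w + 5 * (D / w) := fun y hy => by
    have := good hy.2 (by linarith [hy.1]) fun v hv =>
      ⟨le_abs.mpr (Or.inr (by linarith [hv.2])), le_abs.mpr (Or.inr (by linarith [hv.2]))⟩
    have := p4 (s - w) ⟨le_rfl, by linarith⟩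
    linarith
  rcases le_total x (s - w) with h | h
  · exact p5 x ⟨hx'.1, h⟩
  rcases le_total x (s + w) with h2 | h2
  · linarith [p4 x ⟨h, h2⟩]
  rcases le_total x (t - w) with h3 | h3
  · linarith [p3 x ⟨h2, h3⟩]
  rcases le_total x (t + w) with h4 | h4
  · linarith [p2 x ⟨h3, h4⟩]
  · linarith [p1 x ⟨h4, hx'.2⟩]

/-- Outside of the turning points the solution stays bounded. -/
theorem norm_le_of_le_sub (hε1 : ε ≤ 1) {ρ x : ℝ} (hρ : 0 < ρ) (hρ1 : ρ ≤ 1 / 2) (hst : s ≤ t)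
    (hx : x ≤ s - ρ ∨ t + ρ ≤ x) : ‖Φ x‖ ≤ 2 * C / κ +
    (2 * C ^ 2 / (κ / 2) ^ 3 + (2 * C ^ 2 / (κ / 2) ^ 3 + 6 * C ^ 3 / (κ / 2) ^ 4)) +
    (2 * C / κ + (C / κ + C ^ 2 / κ ^ 2) * (2 * N + 4)) / ρ := by
  have hκ := H.κ_pos
  have hC := H.C_nonneg
  have h0 := fun y hy => H.norm_le_of_le_abs hN hfar hε1 (x := y) hy
  set K := 2 * C / κ +
    (2 * C ^ 2 / (κ / 2) ^ 3 + (2 * C ^ 2 / (κ / 2) ^ 3 + 6 * C ^ 3 / (κ / 2) ^ 4)) with hK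
  have hK0 : 0 ≤ K := by positivity
  have hD : 0 ≤ (2 * C / κ + (C / κ + C ^ 2 / κ ^ 2) * (2 * N + 4)) / ρ := by positivity
  have h0' : ∀ y, N ≤ |y| → ‖Φ y‖ ≤ K := fun y hy => (h0 y hy).trans (div_le_self hK0 (hN.trans hy))
  rcases le_total N |x| with h | h
  · linarith [h0' x h]
  have hx' := abs_le.mp h
  rcases hx with hx | hx
  · have h1 := H.abs_norm_sub_le_of_Icc hρ (by linarith) hx'.1 (by linarith : x - -N ≤ 2 * N)
      fun v hv =>
        ⟨le_abs.mpr (Or.inr (by linarith [hv.2])), le_abs.mpr (Or.inr (by linarith [hv.2]))⟩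
    have h2 := h0' (-N) (by rw [abs_neg]; exact le_abs_self N)
    linarith [(abs_le.mp h1).2]
  · have h1 := H.abs_norm_sub_le_of_Icc hρ (by linarith) hx'.2 (by linarith : N - x ≤ 2 * N)
      fun v hv =>
        ⟨le_abs.mpr (Or.inl (by linarith [hv.1])), le_abs.mpr (Or.inl (by linarith [hv.1]))⟩
    have h2 := h0' N (le_abs_self N)
    linarith [(abs_le.mp h1).1]

end TurningPointEquation

end BO

/-! ### The eigenfunction as a solution of the turning point equation. -/

namespace BO

/-- `I ε Φ g` is an antiderivative of `g S` that vanishes at `-∞`. This proves convergence of the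
improper integral and identifies the solution that it defines. -/
theorem TurningPointEquation.tendsto_integral {ε C κ s t : ℝ} {k k₁ k₂ : ℝ → ℝ}
    {S S₁ S₂ g Φ : ℝ → ℂ} (H : TurningPointEquation ε C κ s t k k₁ k₂ S S₁ S₂ g Φ) (x : ℝ) :
    Tendsto (fun R : ℝ => ∫ y in (-R)..x, g y * S y) atTop (𝓝 (Complex.I * ε * (Φ x * g x))) := by
  have hεc : (ε : ℂ) ≠ 0 := by exact_mod_cast H.eps_pos.ne'
  have hd : ∀ y, HasDerivAt (fun y => Complex.I * ε * (Φ y * g y)) (g y * S y) y := by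
    intro y
    refine (((H.hasDerivAt y).mul (H.hasDerivAt_g y)).const_mul (Complex.I * ε)).congr_deriv ?_
    field_simp
    ring_nf
    simp only [Complex.I_sq]
    ring
  have hcS : Continuous S := continuous_iff_continuousAt.mpr fun y => (H.hasDerivAt_S y).continuousAt
  have hcg : Continuous g := continuous_iff_continuousAt.mpr fun y => (H.hasDerivAt_g y).continuousAt
  have h : ∀ R : ℝ, ∫ y in (-R)..x, g y * S y =
      Complex.I * ε * (Φ x * g x) - Complex.I * ε * (Φ (-R) * g (-R)) := fun R =>
    intervalIntegral.integral_eq_sub_of_hasDerivAt (fun y _ => hd y)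
      ((hcg.mul hcS).intervalIntegrable _ _)
  simp only [h]
  have h0 : Tendsto (fun y => Φ y * g y) atBot (𝓝 0) := by
    rw [tendsto_zero_iff_norm_tendsto_zero]
    simpa [H.norm_g] using tendsto_zero_iff_norm_tendsto_zero.mp H.tendsto_atBot
  simpa using tendsto_const_nhds.sub ((h0.comp tendsto_neg_atTop_atBot).const_mul (Complex.I * ε))

theorem TurningPointEquation.mono {ε C C' κ s t : ℝ} {k k₁ k₂ : ℝ → ℝ} {S S₁ S₂ g Φ : ℝ → ℂ}
    (H : TurningPointEquation ε C κ s t k k₁ k₂ S S₁ S₂ g Φ) (hC : C ≤ C') :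
    TurningPointEquation ε C' κ s t k k₁ k₂ S S₁ S₂ g Φ :=
  have hle : ∀ {y : ℝ} (x : ℝ) (j : ℕ), y ≤ C / (1 + |x|) ^ j → y ≤ C' / (1 + |x|) ^ j :=
    fun x j h => h.trans (div_le_div_of_nonneg_right hC (by positivity))
  { H with
    C_nonneg := H.C_nonneg.trans hC
    abs_k_le := fun x => (H.abs_k_le x).trans hC
    abs_k₁_le := fun x => hle x 2 (H.abs_k₁_le x)
    abs_k₂_le := fun x => hle x 3 (H.abs_k₂_le x)
    norm_S_le := fun x => (H.norm_S_le x).trans (div_le_div_of_nonneg_right hC (by positivity))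
    norm_S₁_le := fun x => hle x 2 (H.norm_S₁_le x)
    norm_S₂_le := fun x => hle x 3 (H.norm_S₂_le x) }

variable {P : ℕ} {c z : Fin P → ℂ}

/-- The point is uniformity: `C` is chosen before `ε`, `lam` and `φ` and depends on these only
through the common bound `M` of `lam` and the coefficients. -/
theorem exists_turningPointEquation [NeZero P] (hu : IsRationalPotential c z) (M : ℝ) :
    ∃ C : ℝ, 0 ≤ C ∧ (∀ x, |u₀ c z x| ≤ C / (1 + |x|)) ∧ ∀ (ε lam κ s t η : ℝ) (φ : Fin P → ℂ)
      (q : Fin P) (Φ : ℂ → ℂ), 0 < ε → 0 < κ → |lam| ≤ M → ∑ p, ‖φ p‖ ≤ M →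
      (∀ x, κ * min 1 (min |x - s| |x - t|) ≤ |lam + u₀ c z x|) →
      HardySolution c z ε lam φ 0 q η Φ →
      TurningPointEquation ε C κ s t (fun x => lam + u₀ c z x) (fun x => (-uPow c z 2 x).re)
        (fun x => (2 * uPow c z 3 x).re) (fun x => poleSum z φ 1 x) (fun x => -poleSum z φ 2 x)
        (fun x => 2 * poleSum z φ 3 x) (fun x => expF c z ε lam x) (fun x => Φ x) ∧
      ∀ x : ℝ, ‖x * poleSum z φ 1 x - ∑ p, φ p‖ ≤ C / (1 + |x|) := by
  have hz := hu.pole_im_pos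
  obtain ⟨U₁, hU₁, hu₁⟩ := exists_abs_u₀_le c hz
  obtain ⟨U₂, hU₂, hu₂⟩ := exists_norm_uPow_le c hz 2
  obtain ⟨U₃, hU₃, hu₃⟩ := exists_norm_uPow_le c hz 3
  obtain ⟨D₁, hD₁, hd₁⟩ := exists_norm_poleSum_le hz 1
  obtain ⟨D₂, hD₂, hd₂⟩ := exists_norm_poleSum_le hz 2
  obtain ⟨D₃, hD₃, hd₃⟩ := exists_norm_poleSum_le hz 3
  set m := |M| with hm
  set Z := ∑ p, ‖z p‖ with hZ
  have hZ0 : 0 ≤ Z := Finset.sum_nonneg fun p _ => norm_nonneg _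
  have hm0 : 0 ≤ m := abs_nonneg M
  set C := m + U₁ + U₂ + 2 * U₃ + D₁ * m + D₂ * m + 2 * (D₃ * m) + D₁ * (m * Z) with hC
  have n1 : 0 ≤ D₁ * m := by positivity
  have n2 : 0 ≤ D₂ * m := by positivity
  have n3 : 0 ≤ D₃ * m := by positivity
  have n4 : 0 ≤ D₁ * (m * Z) := by positivity
  have hC0 : 0 ≤ C := by positivity
  have hle : ∀ {y K : ℝ} (x : ℝ) (j : ℕ), y ≤ K / (1 + |x|) ^ j → K ≤ C → y ≤ C / (1 + |x|) ^ j :=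
    fun x j h1 h2 => h1.trans (div_le_div_of_nonneg_right h2 (by positivity))
  have hle1 : ∀ {y K : ℝ} (x : ℝ), y ≤ K / (1 + |x|) → K ≤ C → y ≤ C / (1 + |x|) :=
    fun x h1 h2 => h1.trans (div_le_div_of_nonneg_right h2 (by positivity))
  have hne : ∀ (x : ℝ) p, (x : ℂ) ≠ z p ∧ (x : ℂ) ≠ star (z p) := fun x p =>
    ⟨ofReal_ne hz x p, ofReal_ne_star hz x p⟩
  refine ⟨C, hC0, fun x => hle1 x (hu₁ x) (by linarith),
    fun ε lam κ s t η φ q Φ hε hκ hlam hφ hk hs => ?_⟩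
  have hφm : ∑ p, ‖φ p‖ ≤ m := hφ.trans (le_abs_self M)
  have hp : ∀ {D : ℝ} {y : ℝ} (x : ℝ) (j : ℕ), 0 < D → y ≤ D * (∑ p, ‖φ p‖) / (1 + |x|) ^ j →
      y ≤ D * m / (1 + |x|) ^ j := fun x j hD h =>
    h.trans (div_le_div_of_nonneg_right (mul_le_mul_of_nonneg_left hφm hD.le) (by positivity))
  refine ⟨⟨hε, hC0, hκ, fun x => (hasDerivAt_u₀ c hz x).const_add lam, fun x => ?_, fun x => ?_,
    fun x => ?_, fun x => ?_, fun x => norm_expF_ofReal c z ε lam x hz, fun x => ?_, fun x => ?_,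
    fun x => ?_, fun x => ?_, fun x => ?_, fun x => ?_, fun x => ?_, hk, hs.decay.tendsto_ofReal_atTop,
    hs.decay.tendsto_ofReal_atBot⟩, fun x => ?_⟩
  · refine ((hasDerivAt_uPow 1 (hne x)).neg.real_of_complex).congr_deriv ?_
    norm_num
  · refine ((hasDerivAt_poleSum φ 0 fun p => (hne x p).1).comp_ofReal).congr_deriv ?_
    norm_num
  · refine ((hasDerivAt_poleSum φ 1 fun p => (hne x p).1).neg.comp_ofReal).congr_deriv ?_
    norm_num
  · have := (hasDerivAt_expF (c := c) (ε := ε) (lam := lam) (ofReal_mem_slitDomain hz x)).comp_ofReal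
    refine this.congr_deriv ?_
    rw [uC_ofReal]
    push_cast
    ring
  · refine (hs.hasDerivAt hu hε x).congr_deriv ?_
    simp [source, poleSum]
  · refine (abs_add_le _ _).trans ?_
    have h1 : |u₀ c z x| ≤ U₁ := (hu₁ x).trans (div_le_self hU₁.le (by linarith [abs_nonneg x]))
    have h2 : |lam| ≤ m := hlam.trans (le_abs_self M)
    linarith
  · refine hle x 2 ((Complex.abs_re_le_norm _).trans ?_) (by linarith : U₂ ≤ C)
    rw [norm_neg]
    exact hu₂ x
  · refine hle x 3 ((Complex.abs_re_le_norm _).trans ?_) (by linarith : 2 * U₃ ≤ C)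
    rw [norm_mul, Complex.norm_ofNat, mul_div_assoc]
    exact mul_le_mul_of_nonneg_left (hu₃ x) (by norm_num)
  · refine hle1 x ?_ (by linarith : D₁ * m ≤ C)
    simpa using hp x 1 hD₁ (hd₁ φ x)
  · rw [norm_neg]
    exact hle x 2 (hp x 2 hD₂ (hd₂ φ x)) (by linarith)
  · refine hle x 3 ?_ (by linarith : 2 * (D₃ * m) ≤ C)
    rw [norm_mul, Complex.norm_ofNat, mul_div_assoc]
    exact mul_le_mul_of_nonneg_left (hp x 3 hD₃ (hd₃ φ x)) (by norm_num)
  · have e : x * poleSum z φ 1 x - ∑ p, φ p = poleSum z (fun p => φ p * z p) 1 x := by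
      rw [poleSum, poleSum, Finset.mul_sum, ← Finset.sum_sub_distrib]
      refine Finset.sum_congr rfl fun p _ => ?_
      have : (x : ℂ) - z p ≠ 0 := sub_ne_zero.mpr (hne x p).1
      field_simp
      ring
    rw [e]
    have h1 := hd₁ (fun p => φ p * z p) x
    rw [pow_one] at h1
    have h2 : ∑ p, ‖φ p * z p‖ ≤ m * Z := by
      calc ∑ p, ‖φ p * z p‖ ≤ ∑ p, ‖φ p‖ * Z := by
            refine Finset.sum_le_sum fun p _ => ?_
            rw [norm_mul]
            gcongr
            exact Finset.single_le_sum (f := fun p => ‖z p‖) (fun _ _ => norm_nonneg _)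
              (Finset.mem_univ p)
        _ = (∑ p, ‖φ p‖) * Z := by rw [Finset.sum_mul]
        _ ≤ _ := by gcongr
    refine hle1 x (h1.trans (div_le_div_of_nonneg_right
      (mul_le_mul_of_nonneg_left h2 hD₁.le) (by positivity))) (by linarith)

/-- The objects of the semiclassical limit for small `ε`, with all the facts about the
eigenfunction on the real line that the asymptotic analysis uses. -/
theorem exists_eventually_Phi [NeZero P] (hu : IsPositiveKlausShaw c z) {Lam : ℝ}
    (hLam : Lam ∈ bulk c z) (hsimple : SimpleComplexCriticalPoints c z Lam) :
    ∃ C κ m : ℝ, 0 ≤ C ∧ 0 < κ ∧ 0 < m ∧ ∀ r : ℝ, 0 < r → ∀ᶠ ε : ℝ in 𝓝[>] 0, 0 < ε ∧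
      (∃! lam : ℝ, IsNearestEigenvalue c z ε Lam lam) ∧
      (∃! φ : Fin P → ℂ, IsNormalizedNullvector c z ε (lamEps c z Lam ε) φ) ∧
      (∀ x, ∃ l : ℂ, Tendsto (truncatedIntegral c z ε (lamEps c z Lam ε) x) atTop (𝓝 l)) ∧
      lamEps c z Lam ε ≤ -m ∧
      ε * ∫ x : ℝ, ‖Phi c z ε (lamEps c z Lam ε) x‖ ^ 2 = -(2 * Real.pi * lamEps c z Lam ε) ∧
      Integrable (fun x => ‖Phi c z ε (lamEps c z Lam ε) x‖ ^ 2) ∧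
      ∃ s t k k₁ k₂ S S₁ S₂ g, |s - xMinus c z Lam| ≤ r ∧ |t - xPlus c z Lam| ≤ r ∧
        TurningPointEquation ε C κ s t k k₁ k₂ S S₁ S₂ g (Phi c z ε (lamEps c z Lam ε)) ∧
        ∀ x : ℝ, ‖x * S x - k x‖ ≤ C / (1 + |x|) := by
  obtain ⟨M, δ, hδ, hM⟩ := exists_sum_norm_le hu hLam hsimple 0
  have hneg := bulk_neg hu hLam
  obtain ⟨C, hC, hCu, hC'⟩ := exists_turningPointEquation hu.toIsRationalPotential (max M (2 * |Lam|))
  obtain ⟨κ, hκ, -, hturn⟩ := exists_turning_bound hu hLam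
  refine ⟨2 * C, κ, -Lam / 2, by positivity, hκ, by linarith, fun r hr => ?_⟩
  obtain ⟨δ', hδ', hball⟩ := Metric.eventually_nhds_iff.mp (hturn r hr)
  have hδ₀ : 0 < min δ (min (δ' / 2) (-Lam / 2)) := by
    refine lt_min hδ (lt_min ?_ ?_) <;> linarith
  filter_upwards [eventually_lamEps hu hLam hsimple hδ₀, self_mem_nhdsWithin,
    Ioo_mem_nhdsGT (zero_lt_one' ℝ)] with ε ⟨h1, h2, h3, h4, h5, η, Φ, h6⟩ hε hε1
  replace hε : 0 < ε := hε
  set lam := lamEps c z Lam ε with hlam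
  set φ := phi c z ε lam with hφ
  have hd1 : |lam - Lam| ≤ δ := h3.trans (min_le_left _ _)
  have hd2 : |lam - Lam| ≤ δ' / 2 := h3.trans ((min_le_right _ _).trans (min_le_left _ _))
  have hd3 : |lam - Lam| ≤ -Lam / 2 := h3.trans ((min_le_right _ _).trans (min_le_right _ _))
  obtain ⟨s, t, hs, ht, hst⟩ := hball (y := lam) (by rw [Real.dist_eq]; linarith)
  have habs : |lam| ≤ max M (2 * |Lam|) := by
    refine le_max_of_le_right ?_
    rw [abs_of_neg h4, abs_of_neg hneg]
    linarith [(abs_le.mp hd3).1]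
  have hsum := hM lam hd1 h4 ε hε hε1.2.le φ η Φ h6 h5
  obtain ⟨H, hS⟩ := hC' ε lam κ s t η φ 0 Φ hε hκ habs (hsum.trans (le_max_left _ _)) hst h6
  have hint := H.tendsto_integral
  have htr : ∀ x, Tendsto (truncatedIntegral c z ε lam x) atTop
      (𝓝 (Complex.I * ε * (Φ x * expF c z ε lam x))) := by
    intro x
    refine (hint x).congr fun R => ?_
    simp [truncatedIntegral, expFactor_eq, poleSum, ← hφ]
  -- The eigenfunction defined by the improper integral is the boundary value of the Hardy solution,
  -- because the exponential prefactor inverts `expF`.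
  have hPhi : Phi c z ε lam = fun x : ℝ => Φ x := by
    funext x
    have hεc : (ε : ℂ) ≠ 0 := by exact_mod_cast hε.ne'
    have he : Complex.exp (Complex.I * h c z lam (x : ℂ) / ε) * expF c z ε lam x = 1 := by
      rw [← expFactor_eq, expFactor, ← Complex.exp_add]
      ring_nf
      simp
    rw [Phi, (htr x).limUnder_eq]
    calc -(Complex.I / ε) * Complex.exp (Complex.I * h c z lam (x : ℂ) / ε) *
        (Complex.I * ε * (Φ x * expF c z ε lam x)) = -(Complex.I * Complex.I) * Φ x *
          (Complex.exp (Complex.I * h c z lam (x : ℂ) / ε) * expF c z ε lam x) := by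
          field_simp
      _ = Φ x := by rw [he, Complex.I_mul_I]; ring
  rw [hPhi]
  refine ⟨hε, h1, h2, fun x => ⟨_, htr x⟩, by linarith [(abs_le.mp hd3).2], ?_,
    h6.decay.integrable_normSq, s, t, _, _, _, _, _, _, _, hs, ht,
    H.mono (by linarith), ?_⟩
  · have h := h6.norm_identity hu.toIsRationalPotential hε h4.ne
    rw [h5, Complex.norm_real, Real.norm_eq_abs, sq_abs] at h
    have := mul_left_cancel₀ h4.ne (h.trans (by ring :
      -(2 * Real.pi * lam ^ 2) = lam * -(2 * Real.pi * lam)))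
    exact this
  · intro x
    -- The normalization `∑ φ = lam` cancels the limits of `x S` and `k` at infinity, so that `S /
    -- k` behaves like `1 / x`.
    have e : (x : ℂ) * poleSum z φ 1 x - ((lam + u₀ c z x : ℝ) : ℂ) =
        (x * poleSum z φ 1 x - ∑ p, φ p) - (u₀ c z x : ℂ) := by
      rw [h5]; push_cast; ring
    rw [e]
    refine (norm_sub_le _ _).trans ?_
    rw [Complex.norm_real, Real.norm_eq_abs]
    have := add_le_add (hS x) (hCu x)
    calc _ ≤ _ := this
      _ = _ := by ring

end BO

/-! ### The semiclassical limit. -/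

namespace BO

/-- The difference of `J ε` and `J ε y` times the characteristic function tends to zero almost
everywhere under an integrable majorant, hence so does its integral `1 - J ε y (b - a)`. No limit of
`J ε y` has to be known beforehand. -/
theorem tendsto_one_div_of_integral_eq_one {l : Filter ℝ} [l.IsCountablyGenerated]
    {J : ℝ → ℝ → ℝ} {a b K : ℝ} (hab : a < b) (hint : ∀ᶠ ε in l, Integrable (J ε))
    (h1 : ∀ᶠ ε in l, ∫ x, J ε x = 1) (hK : ∀ᶠ ε in l, ∀ x, |J ε x| ≤ K * (1 + x ^ 2)⁻¹)
    (hout : ∀ x, x < a ∨ b < x → Tendsto (fun ε => J ε x) l (𝓝 0))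
    (hin : ∀ x ∈ Set.Ioo a b, ∀ y ∈ Set.Ioo a b, Tendsto (fun ε => J ε x - J ε y) l (𝓝 0))
    {y : ℝ} (hy : y ∈ Set.Ioo a b) : Tendsto (fun ε => J ε y) l (𝓝 (1 / (b - a))) := by
  have hI : Integrable (Set.indicator (Set.Ioo a b) fun _ => (1 : ℝ)) :=
    (integrable_indicator_iff measurableSet_Ioo).mpr (integrableOn_const (by simp))
  have hI1 : ∫ x, Set.indicator (Set.Ioo a b) (fun _ => (1 : ℝ)) x = b - a := by
    rw [integral_indicator measurableSet_Ioo]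
    simp [hab.le]
  set G : ℝ → ℝ → ℝ := fun ε x => J ε x - J ε y * Set.indicator (Set.Ioo a b) (fun _ => (1 : ℝ)) x
    with hG
  have hG0 : Tendsto (fun ε => ∫ x : ℝ, G ε x) l (𝓝 (∫ _ : ℝ, (0 : ℝ))) := by
    refine tendsto_integral_filter_of_dominated_convergence
      (fun x => K * (1 + x ^ 2)⁻¹ + K * Set.indicator (Set.Ioo a b) (fun _ => (1 : ℝ)) x) ?_ ?_ ?_ ?_
    · filter_upwards [hint] with ε h
      exact (h.sub (hI.const_mul _)).aestronglyMeasurable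
    · filter_upwards [hK] with ε h
      refine Eventually.of_forall fun x => (norm_sub_le _ _).trans (add_le_add (h x) ?_)
      rw [norm_mul, Real.norm_eq_abs]
      have h0 : 0 ≤ Set.indicator (Set.Ioo a b) (fun _ => (1 : ℝ)) x :=
        Set.indicator_nonneg (fun _ _ => zero_le_one) x
      rw [Real.norm_of_nonneg h0]
      refine mul_le_mul_of_nonneg_right ?_ h0
      have hK0 : 0 ≤ K := by simpa using (abs_nonneg _).trans (h 0)
      refine (h y).trans (mul_le_of_le_one_right hK0 (inv_le_one_of_one_le₀ ?_))
      linarith [sq_nonneg y]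
    · exact (integrable_inv_one_add_sq.const_mul K).add (hI.const_mul K)
    · have hae : ∀ᵐ x : ℝ, x ≠ a ∧ x ≠ b :=
        (Measure.ae_ne volume a).and (Measure.ae_ne volume b)
      filter_upwards [hae] with x hx
      by_cases hm : x ∈ Set.Ioo a b
      · simpa [hG, Set.indicator_of_mem hm] using hin x hm y hy
      · have : x < a ∨ b < x := by
          rcases lt_or_gt_of_ne hx.1 with h | h
          · exact Or.inl h
          · exact Or.inr (lt_of_le_of_ne (not_lt.mp fun h2 => hm ⟨h, h2⟩) hx.2.symm)
        simpa [hG, Set.indicator_of_notMem hm] using hout x this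
  rw [integral_zero] at hG0
  have h2 : Tendsto (fun ε => 1 - J ε y * (b - a)) l (𝓝 0) := by
    refine hG0.congr' ?_
    filter_upwards [hint, h1] with ε h h'
    rw [hG, integral_sub h (hI.const_mul _), h', integral_const_mul, hI1]
  have h3 := (h2.const_sub 1).div_const (b - a)
  have : b - a ≠ 0 := by linarith
  simpa [this] using h3

section Limit

variable {P : ℕ} {c z : Fin P → ℂ} [NeZero P] (hu : IsPositiveKlausShaw c z) {Lam : ℝ}
  (hLam : Lam ∈ bulk c z) (hsimple : SimpleComplexCriticalPoints c z Lam)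
include hu hLam

omit [NeZero P] in
-- The summand `1` in `L` keeps perturbed turning points at distance at least `1 / 2` from
-- everything beyond `L`.
theorem L_bounds : xMinus c z Lam < xPlus c z Lam ∧ 1 ≤ L c z Lam ∧
    ∀ s t, |s - xMinus c z Lam| ≤ 1 / 2 → |t - xPlus c z Lam| ≤ 1 / 2 →
      -L c z Lam ≤ s - 1 / 2 ∧ t + 1 / 2 ≤ L c z Lam ∧
      ∀ x, L c z Lam ≤ |x| → 1 / 2 ≤ |x - s| ∧ 1 / 2 ≤ |x - t| := by
  obtain ⟨xc, a, b, h1, h2, -, -, -, -, -, -, -, h3, h4⟩ := exists_turning hu hLam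
  rw [L, h3, h4]
  have ha := le_max_right |b| |a|
  have hb := le_max_left |b| |a|
  refine ⟨h1.trans h2, by linarith [abs_nonneg a], fun s t hs ht => ?_⟩
  have hs' := abs_le.mp hs
  have ht' := abs_le.mp ht
  have ha' := abs_le.mp ha
  have hb' := abs_le.mp hb
  refine ⟨by linarith, by linarith, fun x hx => ?_⟩
  rcases le_abs.mp hx with h | h
  · exact ⟨le_abs.mpr (Or.inl (by linarith)), le_abs.mpr (Or.inl (by linarith))⟩
  · exact ⟨le_abs.mpr (Or.inr (by linarith)), le_abs.mpr (Or.inr (by linarith))⟩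

include hsimple

/-- `Φ - 1 / x` is the sum of `Φ - S / k` and `S / k - 1 / x`, both `O(x⁻²)`. In the difference of
the squares the other factor `‖Φ‖ + 1 / |x|` gives one more power. -/
theorem exists_eventually_abs_normSq_sub_le : ∃ K : ℝ, ∀ᶠ ε : ℝ in 𝓝[>] 0, ∀ x : ℝ,
    L c z Lam ≤ |x| →
      |‖Phi c z ε (lamEps c z Lam ε) x‖ ^ 2 - 1 / x ^ 2| ≤ K / |x| ^ 3 := by
  obtain ⟨C, κ, m, hC, hκ, hm, h⟩ := exists_eventually_Phi hu hLam hsimple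
  obtain ⟨hlt, hL1, hst⟩ := L_bounds hu hLam
  set T := 2 * C / κ +
    (2 * C ^ 2 / (κ / 2) ^ 3 + (2 * C ^ 2 / (κ / 2) ^ 3 + 6 * C ^ 3 / (κ / 2) ^ 4)) with hT
  refine ⟨T * (T + 1), ?_⟩
  filter_upwards [h (1 / 2) (by norm_num), Ioo_mem_nhdsGT (zero_lt_one' ℝ)] with ε
    ⟨hε, _, _, _, _, _, _, s, t, k, k₁, k₂, S, S₁, S₂, g, hs, ht, H, hS⟩ hε1 x hx
  obtain ⟨-, -, hfar⟩ := hst s t hs ht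
  have hx1 : 1 ≤ |x| := hL1.trans hx
  have hx0 : 0 < |x| := by linarith
  have hxc : (x : ℂ) ≠ 0 := by exact_mod_cast abs_pos.mp hx0
  obtain ⟨hk, hk0⟩ := H.half_le_abs hfar hx
  have hkc : (k x : ℂ) ≠ 0 := by exact_mod_cast hk0
  have h1 := H.norm_sub_quot_le hL1 hfar hx
  have h2 := H.norm_le_of_le_abs hL1 hfar hε1.2.le hx
  have h3 : ‖S x / k x - 1 / x‖ ≤ 2 * C / κ / |x| ^ 2 := by
    have e : S x / k x - 1 / x = (x * S x - k x) / (k x * x) := by field_simp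
    rw [e, norm_div, norm_mul, Complex.norm_real, Complex.norm_real, Real.norm_eq_abs,
      Real.norm_eq_abs]
    calc _ ≤ (C / |x|) / (κ / 2 * |x|) := by
          gcongr
          exact (hS x).trans (by gcongr; linarith)
      _ = _ := by field_simp
  have h4 : ‖Phi c z ε (lamEps c z Lam ε) x - 1 / x‖ ≤ T / |x| ^ 2 := by
    calc _ = ‖(Phi c z ε (lamEps c z Lam ε) x - S x / k x) + (S x / k x - 1 / x)‖ := by ring_nf
      _ ≤ _ := norm_add_le _ _
      _ ≤ (T - 2 * C / κ) / |x| ^ 2 + 2 * C / κ / |x| ^ 2 := by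
          refine add_le_add (h1.trans ?_) h3
          rw [hT, add_sub_cancel_left]
          refine div_le_div_of_nonneg_right (mul_le_of_le_one_right (by positivity) hε1.2.le)
            (by positivity)
      _ = _ := by ring
  have h5 := (_root_.abs_norm_sub_norm_le (Phi c z ε (lamEps c z Lam ε) x) (1 / x)).trans h4
  rw [norm_div, norm_one, Complex.norm_real, Real.norm_eq_abs] at h5
  have e : ‖Phi c z ε (lamEps c z Lam ε) x‖ ^ 2 - 1 / x ^ 2 =
      (‖Phi c z ε (lamEps c z Lam ε) x‖ - 1 / |x|) * (‖Phi c z ε (lamEps c z Lam ε) x‖ + 1 / |x|) := by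
    rw [← sq_abs x]
    field_simp
    ring
  rw [e, abs_mul, abs_of_nonneg (by positivity :
    0 ≤ ‖Phi c z ε (lamEps c z Lam ε) x‖ + 1 / |x|)]
  have hT0 : 0 ≤ T := by positivity
  calc _ ≤ (T / |x| ^ 2) * (T / |x| + 1 / |x|) := by gcongr
    _ = _ := by field_simp

/-- The global bound of order `(ε (1 + x²))⁻¹` of the squared modulus. -/
theorem exists_eventually_normSq_le : ∃ K : ℝ, ∀ᶠ ε : ℝ in 𝓝[>] 0, ∀ x : ℝ,
    ε * ‖Phi c z ε (lamEps c z Lam ε) x‖ ^ 2 ≤ K * (1 + x ^ 2)⁻¹ := by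
  obtain ⟨C, κ, m, hC, hκ, hm, h⟩ := exists_eventually_Phi hu hLam hsimple
  obtain ⟨hlt, hL1, hst⟩ := L_bounds hu hLam
  set N := L c z Lam with hN
  set T := 2 * C / κ +
    (2 * C ^ 2 / (κ / 2) ^ 3 + (2 * C ^ 2 / (κ / 2) ^ 3 + 6 * C ^ 3 / (κ / 2) ^ 4)) with hT
  set D := T + 5 * (2 * C / κ + (C / κ + C ^ 2 / κ ^ 2) * (2 * N + 4) + 2 * C) with hD
  set G := xPlus c z Lam - xMinus c z Lam with hG
  have hG0 : 0 < G := by linarith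
  refine ⟨D ^ 2 * (1 + N ^ 2) + 2 * T ^ 2, ?_⟩
  -- With both turning points moved by at most `G / 4` their distance is still at least `G / 2`,
  -- which leaves room for the two windows once `√ε ≤ G / 4`.
  have hr : 0 < min (1 / 2) (G / 4) := lt_min (by norm_num) (by linarith)
  filter_upwards [h _ hr, Ioo_mem_nhdsGT (by norm_num : (0 : ℝ) < 1 / 4),
    Ioo_mem_nhdsGT (by positivity : 0 < (G / 4) ^ 2)] with ε
    ⟨hε, _, _, _, _, _, _, s, t, k, k₁, k₂, S, S₁, S₂, g, hs, ht, H, hS⟩ hε1 hε2 x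
  obtain ⟨hs1, ht1, hfar⟩ := hst s t (hs.trans (min_le_left _ _)) (ht.trans (min_le_left _ _))
  have hs2 := abs_le.mp (hs.trans (min_le_right _ _))
  have ht2 := abs_le.mp (ht.trans (min_le_right _ _))
  have hw : √ε ≤ G / 4 := Real.sqrt_le_iff.mpr ⟨by linarith, hε2.2.le⟩
  have hT0 : 0 ≤ T := by positivity
  rw [← div_eq_mul_inv, le_div_iff₀ (by positivity)]
  rcases le_total |x| N with hx | hx
  · have h1 := H.norm_le_of_abs_le hL1 hε1.2.le (by linarith) hs1 ht1 hx
    rw [← hT, ← hD] at h1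
    have h2 : ε * ‖Phi c z ε (lamEps c z Lam ε) x‖ ^ 2 ≤ D ^ 2 := by
      calc _ ≤ ε * (D / √ε) ^ 2 := by gcongr
        _ = D ^ 2 := by rw [div_pow, Real.sq_sqrt hε.le]; field_simp
    have h3 : x ^ 2 ≤ N ^ 2 := by rw [← sq_abs]; gcongr
    have h4 : 0 ≤ 2 * T ^ 2 := by positivity
    have h5 : ε * ‖Phi c z ε (lamEps c z Lam ε) x‖ ^ 2 * (1 + x ^ 2) ≤ D ^ 2 * (1 + N ^ 2) := by
      gcongr
    linarith
  · have hx1 : 1 ≤ |x| := hL1.trans hx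
    have hx0 : 0 < |x| := by linarith
    have h1 := H.norm_le_of_le_abs hL1 hfar (by linarith [hε1.2]) hx
    rw [← hT] at h1
    have h2 : ε * ‖Phi c z ε (lamEps c z Lam ε) x‖ ^ 2 * (1 + x ^ 2) ≤ 2 * T ^ 2 := by
      calc _ ≤ 1 * (T / |x|) ^ 2 * (|x| ^ 2 + |x| ^ 2) := by
            rw [← sq_abs x]
            gcongr
            · linarith [hε1.2]
            · nlinarith
        _ = _ := by field_simp; ring
    have : 0 ≤ D ^ 2 * (1 + N ^ 2) := by positivity
    linarith

/-- At a fixed distance outside of the turning points `Φ` is bounded independently of `ε`, and the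
factor `ε` does the rest. -/
theorem tendsto_normSq_of_notMem {x : ℝ} (hx : x < xMinus c z Lam ∨ xPlus c z Lam < x) :
    Tendsto (fun ε => ε * ‖Phi c z ε (lamEps c z Lam ε) x‖ ^ 2) (𝓝[>] 0) (𝓝 0) := by
  obtain ⟨C, κ, m, hC, hκ, hm, h⟩ := exists_eventually_Phi hu hLam hsimple
  obtain ⟨hlt, hL1, hst⟩ := L_bounds hu hLam
  obtain ⟨ρ, hρ, hρ1, hρx⟩ : ∃ ρ : ℝ, 0 < ρ ∧ ρ ≤ 1 / 2 ∧
      (x + 2 * ρ ≤ xMinus c z Lam ∨ xPlus c z Lam + 2 * ρ ≤ x) := by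
    rcases hx with hx | hx
    · refine ⟨min (1 / 2) ((xMinus c z Lam - x) / 2), lt_min (by norm_num) (by linarith),
        min_le_left _ _, Or.inl ?_⟩
      linarith [min_le_right (1 / 2) ((xMinus c z Lam - x) / 2)]
    · refine ⟨min (1 / 2) ((x - xPlus c z Lam) / 2), lt_min (by norm_num) (by linarith),
        min_le_left _ _, Or.inr ?_⟩
      linarith [min_le_right (1 / 2) ((x - xPlus c z Lam) / 2)]
  set B := 2 * C / κ +
    (2 * C ^ 2 / (κ / 2) ^ 3 + (2 * C ^ 2 / (κ / 2) ^ 3 + 6 * C ^ 3 / (κ / 2) ^ 4)) +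
    (2 * C / κ + (C / κ + C ^ 2 / κ ^ 2) * (2 * L c z Lam + 4)) / ρ with hB
  have hlim : Tendsto (fun ε : ℝ => ε * B ^ 2) (𝓝[>] 0) (𝓝 0) := by
    have : Tendsto (fun ε : ℝ => ε * B ^ 2) (𝓝 0) (𝓝 (0 * B ^ 2)) := tendsto_id.mul_const _
    rw [zero_mul] at this
    exact this.mono_left nhdsWithin_le_nhds
  refine squeeze_zero' ?_ ?_ hlim
  · filter_upwards [self_mem_nhdsWithin] with ε hε
    replace hε : 0 < ε := hε
    positivity
  · filter_upwards [h (min ρ ((xPlus c z Lam - xMinus c z Lam) / 2)) (lt_min hρ (by linarith)),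
      Ioo_mem_nhdsGT (zero_lt_one' ℝ)] with ε
      ⟨hε, _, _, _, _, _, _, s, t, k, k₁, k₂, S, S₁, S₂, g, hs, ht, H, hS⟩ hε1
    obtain ⟨hs, hs'⟩ := le_min_iff.mp hs
    obtain ⟨ht, ht'⟩ := le_min_iff.mp ht
    obtain ⟨-, -, hfar⟩ := hst s t (hs.trans hρ1) (ht.trans hρ1)
    have hs2 := abs_le.mp hs
    have ht2 := abs_le.mp ht
    have hle : s ≤ t := by linarith [(abs_le.mp hs').2, (abs_le.mp ht').1]
    have h1 := H.norm_le_of_le_sub hL1 hfar hε1.2.le hρ hρ1 hle (x := x) (by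
      rcases hρx with h | h
      · left; linarith
      · right; linarith)
    gcongr

/-- Between the turning points the moduli at `x` and `y` differ by `O(1)`, while each is
`O(ε^(-1/2))`. So `ε` times the difference of the squares is `O(√ε)`. -/
theorem tendsto_normSq_sub {x y : ℝ} (hx : x ∈ Set.Ioo (xMinus c z Lam) (xPlus c z Lam))
    (hy : y ∈ Set.Ioo (xMinus c z Lam) (xPlus c z Lam)) :
    Tendsto (fun ε => ε * ‖Phi c z ε (lamEps c z Lam ε) x‖ ^ 2 -
      ε * ‖Phi c z ε (lamEps c z Lam ε) y‖ ^ 2) (𝓝[>] 0) (𝓝 0) := by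
  wlog hxy : y ≤ x generalizing x y
  · simpa using (this hy hx (le_of_not_ge hxy)).neg
  obtain ⟨C, κ, m, hC, hκ, hm, h⟩ := exists_eventually_Phi hu hLam hsimple
  obtain ⟨K, hK⟩ := exists_eventually_normSq_le hu hLam hsimple
  obtain ⟨ρ, hρ, hρ1, hρy, hρx⟩ : ∃ ρ : ℝ, 0 < ρ ∧ ρ ≤ 1 / 2 ∧
      xMinus c z Lam + 2 * ρ ≤ y ∧ x + 2 * ρ ≤ xPlus c z Lam := by
    have h1 := hy.1
    have h2 := hx.2
    refine ⟨min (1 / 2) (min ((y - xMinus c z Lam) / 2) ((xPlus c z Lam - x) / 2)),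
      lt_min (by norm_num) (lt_min (by linarith) (by linarith)), min_le_left _ _, ?_, ?_⟩
    · linarith [(min_le_right (1 / 2) _).trans
        (min_le_left ((y - xMinus c z Lam) / 2) ((xPlus c z Lam - x) / 2))]
    · linarith [(min_le_right (1 / 2) _).trans
        (min_le_right ((y - xMinus c z Lam) / 2) ((xPlus c z Lam - x) / 2))]
  set B := (2 * C / κ + (C / κ + C ^ 2 / κ ^ 2) * ((x - y) + 4)) / ρ with hB
  have hlim : Tendsto (fun ε : ℝ => √ε * (B * (2 * √K))) (𝓝[>] 0) (𝓝 0) := by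
    have : Tendsto (fun ε : ℝ => √ε * (B * (2 * √K))) (𝓝 0) (𝓝 (√0 * (B * (2 * √K)))) :=
      (Real.continuous_sqrt.tendsto 0).mul_const _
    rw [Real.sqrt_zero, zero_mul] at this
    exact this.mono_left nhdsWithin_le_nhds
  refine squeeze_zero_norm' ?_ hlim
  filter_upwards [h ρ hρ, hK] with ε
    ⟨hε, _, _, _, _, _, _, s, t, k, k₁, k₂, S, S₁, S₂, g, hs, ht, H, hS⟩ hK
  have hs2 := abs_le.mp hs
  have ht2 := abs_le.mp ht
  have h1 := H.abs_norm_sub_le_of_Icc hρ (by linarith) hxy le_rfl fun v hv =>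
    ⟨le_abs.mpr (Or.inl (by linarith [hv.1])), le_abs.mpr (Or.inr (by linarith [hv.2]))⟩
  rw [← hB] at h1
  have hw : √ε * √ε = ε := Real.mul_self_sqrt hε.le
  have hle : ∀ v, √ε * ‖Phi c z ε (lamEps c z Lam ε) v‖ ≤ √K := by
    intro v
    refine Real.le_sqrt_of_sq_le ?_
    rw [mul_pow, Real.sq_sqrt hε.le]
    refine (hK v).trans (mul_le_of_le_one_right ?_ (inv_le_one_of_one_le₀ (by nlinarith)))
    have : 0 ≤ ε * ‖Phi c z ε (lamEps c z Lam ε) 0‖ ^ 2 := by positivity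
    simpa using this.trans (hK 0)
  have e : ε * ‖Phi c z ε (lamEps c z Lam ε) x‖ ^ 2 - ε * ‖Phi c z ε (lamEps c z Lam ε) y‖ ^ 2 =
      √ε * ((‖Phi c z ε (lamEps c z Lam ε) x‖ - ‖Phi c z ε (lamEps c z Lam ε) y‖) *
        (√ε * ‖Phi c z ε (lamEps c z Lam ε) x‖ + √ε * ‖Phi c z ε (lamEps c z Lam ε) y‖)) := by
    linear_combination (‖Phi c z ε (lamEps c z Lam ε) y‖ ^ 2 -
      ‖Phi c z ε (lamEps c z Lam ε) x‖ ^ 2) * hw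
  rw [e, norm_mul, norm_mul, Real.norm_of_nonneg (Real.sqrt_nonneg ε), Real.norm_eq_abs,
    Real.norm_of_nonneg (by positivity : 0 ≤ √ε * ‖Phi c z ε (lamEps c z Lam ε) x‖ +
      √ε * ‖Phi c z ε (lamEps c z Lam ε) y‖)]
  have h2 : √ε * ‖Phi c z ε (lamEps c z Lam ε) x‖ + √ε * ‖Phi c z ε (lamEps c z Lam ε) y‖ ≤
      2 * √K := by linarith [hle x, hle y]
  have hB0 : 0 ≤ B := (abs_nonneg _).trans h1
  gcongr

omit hu hLam hsimple in
theorem IEps_eq (ε x : ℝ) : IEps c z Lam ε x =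
    -((-(2 * Real.pi * lamEps c z Lam ε))⁻¹ * (ε * ‖Phi c z ε (lamEps c z Lam ε) x‖ ^ 2)) := by
  rw [IEps, inv_neg]
  ring

theorem exists_eventually_inv_le : ∃ A : ℝ, 0 < A ∧ ∀ᶠ ε : ℝ in 𝓝[>] 0,
    0 < (-(2 * Real.pi * lamEps c z Lam ε))⁻¹ ∧ (-(2 * Real.pi * lamEps c z Lam ε))⁻¹ ≤ A := by
  obtain ⟨C, κ, m, hC, hκ, hm, h⟩ := exists_eventually_Phi hu hLam hsimple
  have hπ := Real.pi_pos
  refine ⟨(2 * Real.pi * m)⁻¹, by positivity, ?_⟩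
  filter_upwards [h 1 one_pos] with ε ⟨_, _, _, _, h1, _⟩
  have h2 : 2 * Real.pi * m ≤ -(2 * Real.pi * lamEps c z Lam ε) := by nlinarith
  have h3 : 0 < 2 * Real.pi * m := by positivity
  exact ⟨inv_pos.mpr (h3.trans_le h2), inv_anti₀ h3 h2⟩

/-- `-I_ε` has total integral one by Wu's identity and an integrable majorant by the global bound.
Being asymptotically zero outside and constant inside the turning points, it must tend to the
inverse length of the interval. -/
theorem tendsto_IEps {x : ℝ} (hm : x ≠ xMinus c z Lam) (hp : x ≠ xPlus c z Lam) :
    Tendsto (fun ε : ℝ => IEps c z Lam ε x) (𝓝[>] 0) (𝓝 (IZero c z Lam x)) := by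
  obtain ⟨C, κ, m, hC, hκ, hm', h⟩ := exists_eventually_Phi hu hLam hsimple
  obtain ⟨K, hK⟩ := exists_eventually_normSq_le hu hLam hsimple
  obtain ⟨A, hA, hA'⟩ := exists_eventually_inv_le hu hLam hsimple
  obtain ⟨hlt, -, -⟩ := L_bounds hu hLam
  have hmul : ∀ {F : ℝ → ℝ}, Tendsto F (𝓝[>] 0) (𝓝 0) →
      Tendsto (fun ε => (-(2 * Real.pi * lamEps c z Lam ε))⁻¹ * F ε) (𝓝[>] 0) (𝓝 0) := by
    intro F hF
    refine squeeze_zero_norm' (a := fun ε => A * ‖F ε‖) ?_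
      (by simpa using (tendsto_zero_iff_norm_tendsto_zero.mp hF).const_mul A)
    filter_upwards [hA'] with ε hε
    rw [norm_mul, Real.norm_of_nonneg hε.1.le]
    gcongr
    exact hε.2
  have hout : ∀ x, x < xMinus c z Lam ∨ xPlus c z Lam < x →
      Tendsto (fun ε => (-(2 * Real.pi * lamEps c z Lam ε))⁻¹ *
        (ε * ‖Phi c z ε (lamEps c z Lam ε) x‖ ^ 2)) (𝓝[>] 0) (𝓝 0) := fun x hx =>
    hmul (tendsto_normSq_of_notMem hu hLam hsimple hx)
  simp only [IEps_eq]
  by_cases hx : x ∈ Set.Ioo (xMinus c z Lam) (xPlus c z Lam)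
  · rw [IZero, Set.indicator_of_mem hx, neg_div]
    refine Tendsto.neg ?_
    refine tendsto_one_div_of_integral_eq_one (K := A * K)
      (J := fun ε x => (-(2 * Real.pi * lamEps c z Lam ε))⁻¹ *
        (ε * ‖Phi c z ε (lamEps c z Lam ε) x‖ ^ 2)) hlt ?_ ?_ ?_ hout ?_ hx
    · filter_upwards [h 1 one_pos] with ε ⟨_, _, _, _, _, _, h1, _⟩
      exact (h1.const_mul _).const_mul _
    · filter_upwards [h 1 one_pos, hA'] with ε ⟨_, _, _, _, _, h1, _⟩ h2
      rw [integral_const_mul, integral_const_mul, h1]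
      exact inv_mul_cancel₀ (inv_pos.mp h2.1).ne'
    · filter_upwards [hK, hA', self_mem_nhdsWithin] with ε h1 h2 hε y
      replace hε : 0 < ε := hε
      rw [abs_of_nonneg (mul_nonneg h2.1.le (by positivity)), mul_assoc A K]
      exact mul_le_mul h2.2 (h1 y) (by positivity) hA.le
    · intro y hy v hv
      simpa [mul_sub] using hmul (tendsto_normSq_sub hu hLam hsimple hy hv)
  · have hx' : x < xMinus c z Lam ∨ xPlus c z Lam < x := by
      rcases lt_or_gt_of_ne hm with h | h
      · exact Or.inl h
      · exact Or.inr (lt_of_le_of_ne (not_lt.mp fun h2 => hx ⟨h, h2⟩) hp.symm)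
    simpa [IZero, Set.indicator_of_notMem hx] using (hout x hx').neg

end Limit

end BO

/-- The first conjunct says that, for small `ε`, the objects that enter `I_ε` exist: the eigenvalue
nearest to `Λ`, the normalized nullvector and the improper integral that defines `Φ_ε`. -/
theorem mainTheorem11 {P : ℕ} [NeZero P] (c z : Fin P → ℂ) (hu : BO.IsPositiveKlausShaw c z)
    (Λ : ℝ) (hΛ : Λ ∈ BO.bulk c z) (hsimple : BO.SimpleComplexCriticalPoints c z Λ) :
    (∀ᶠ ε : ℝ in 𝓝[>] 0,
      (∃! lam : ℝ, BO.IsNearestEigenvalue c z ε Λ lam) ∧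
      (∃! φ : Fin P → ℂ, BO.IsNormalizedNullvector c z ε (BO.lamEps c z Λ ε) φ) ∧
      ∀ x : ℝ, ∃ l : ℂ,
        Tendsto (BO.truncatedIntegral c z ε (BO.lamEps c z Λ ε) x) atTop (𝓝 l)) ∧
    (∃ K₀ : ℝ, ∀ᶠ ε : ℝ in 𝓝[>] 0, ∀ x : ℝ, BO.L c z Λ ≤ |x| →
      |BO.IEps c z Λ ε x - ε / (2 * Real.pi * BO.lamEps c z Λ ε * x ^ 2)| ≤
        K₀ * ε / |x| ^ 3) ∧
    (∃ K₁ : ℝ, ∀ᶠ ε : ℝ in 𝓝[>] 0, ∀ x : ℝ, |x| ≤ BO.L c z Λ →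
      |BO.IEps c z Λ ε x| ≤ K₁) ∧
    (∀ x : ℝ, x ≠ BO.xMinus c z Λ → x ≠ BO.xPlus c z Λ →
      Tendsto (fun ε : ℝ => BO.IEps c z Λ ε x) (𝓝[>] 0) (𝓝 (BO.IZero c z Λ x))) := by
  obtain ⟨C, κ, m, -, -, -, h⟩ := BO.exists_eventually_Phi hu hΛ hsimple
  obtain ⟨A, hA, hA'⟩ := BO.exists_eventually_inv_le hu hΛ hsimple
  obtain ⟨T, hT⟩ := BO.exists_eventually_abs_normSq_sub_le hu hΛ hsimple
  obtain ⟨K, hK⟩ := BO.exists_eventually_normSq_le hu hΛ hsimple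
  refine ⟨?_, ⟨A * T, ?_⟩, ⟨A * K, ?_⟩, fun x => BO.tendsto_IEps hu hΛ hsimple⟩
  · filter_upwards [h 1 one_pos] with ε ⟨_, h1, h2, h3, _⟩
    exact ⟨h1, h2, h3⟩
  · filter_upwards [hA', hT, self_mem_nhdsWithin] with ε h1 h2 hε x hx
    replace hε : 0 < ε := hε
    have e : BO.IEps c z Λ ε x - ε / (2 * Real.pi * BO.lamEps c z Λ ε * x ^ 2) =
        -((-(2 * Real.pi * BO.lamEps c z Λ ε))⁻¹ * (ε *
          (‖BO.Phi c z ε (BO.lamEps c z Λ ε) x‖ ^ 2 - 1 / x ^ 2))) := by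
      rw [BO.IEps_eq, inv_neg, ← div_div]
      ring
    rw [e, abs_neg, abs_mul, abs_mul, abs_of_pos h1.1, abs_of_pos hε]
    calc _ ≤ A * (ε * (T / |x| ^ 3)) := by
          gcongr
          · exact h1.2
          · exact h2 x hx
      _ = _ := by ring
  · filter_upwards [hA', hK, self_mem_nhdsWithin] with ε h1 h2 hε x _
    replace hε : 0 < ε := hε
    rw [BO.IEps_eq, abs_neg, abs_of_nonneg (mul_nonneg h1.1.le (by positivity))]
    have h3 : 0 ≤ ε * ‖BO.Phi c z ε (BO.lamEps c z Λ ε) x‖ ^ 2 := by positivity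
    have hK0 : 0 ≤ K := by
      have : 0 ≤ ε * ‖BO.Phi c z ε (BO.lamEps c z Λ ε) 0‖ ^ 2 := by positivity
      simpa using this.trans (h2 0)
    refine mul_le_mul h1.2 ((h2 x).trans (mul_le_of_le_one_right hK0
      (inv_le_one_of_one_le₀ ?_))) h3 hA.le
    linarith [sq_nonneg x]
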